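/- All dg-modules are lower $\mathbb Z$-graded over $\mathbb Z$, and operads are symmetric operads in dg-modules. **The operads $\mathcal E_n$ and the objects $\mathcal D_n$.** Let $\mathcal E$ be the Barratt–Eccles operad: $\mathcal E(r)$ is the normalized chain complex spanned by the sequences $\underline w=(w_0,\dots,w_d)$ of permutations in $\Sigma_r$ with $w_k\neq w_{k+1}$ ($r\geq 1$), and its composition is given by the composition of permutations and shuffle products of sequences. For $i\neq j$ let $\sigma|_{ij}$ be the order in which $i,j$ occur in $(\sigma(1),\dots,\sigma(r))$, and let $\mu_{ij}(\underline w)$ be the number of $k$ such that $w_k|_{ij}\neq w_{k+1}|_{ij}$. For $n\geq 1$, the suboperad $\mathcal E_n\subset\mathcal E$ is spanned by the $\underline w$ with $\mu_{ij}(\underline w)<n$ for all pairs. Let $\Lambda$ be the operadic suspension, let $\mathcal D_n=\Lambda^{-n}\mathcal E_n^\vee$ (a cooperad; in arity $r$ an element is a function $c$ on the nondegenerate sequences of $\mathcal E_n(r)$), and let $B^c(\mathcal D_n)=(F(\Sigma^{-1}\bar{\mathcal D}_n),\partial)$ be its cobar construction, where $\bar{\mathcal D}_n$ is the part of $\mathcal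 D_n$ of arity $\geq 2$, $F$ is the free operad, and the differential is the sum of the internal differential of $\mathcal D_n$ and of the derivation determined by the two-vertex part of the cooperad coproduct. The suspension $\sigma^*:\mathcal D_{n}\to\mathcal D_{n+1}$ is the map induced by $(\sigma^*c)(\underline w)=\pm\,\mathrm{sgn}(w_0,\dots,w_{r-1})\,c(w_{r-1},\dots,w_d)$ with a sign that depends only on $n$ and $r$ (it comes from $\Lambda^{n+1}\Lambda^{-1}\cong\Lambda^{n}$), where $\mathrm{sgn}(w_0,\dots,w_{r-1})$ is the signature of $(w_0(1),\dots,w_{r-1}(1))$ if this is a permutation of $(1,\dots,r)$ and $0$ otherwise. **$\mathcal K$-operads.** For $r\geq 1$, $\mathcal K(r)$ is the poset of pairs $\kappa=(\mu,\sigma)$ of a family of weights $\mu_{ij}\in\mathbb N$ indexed by the pairs $\{i,j\}\subset\{1,\dots,r\}$ and of a permutation $\sigma\in\Sigma_r$, where $(\mu,\sigma)\leq(\nu,\tau)$ means that for every pair either $\mu_{ij}<\nu_{ij}$ or $(\mu_{ij},\sigma|_{ij})=(\nu_{ij},\tau|_{ij})$; $\mathcal K(0)=\emptyset$. These posets form an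 operad (composition is substitution of complete graphs in vertices and composition of permutations). For $1\leq m\leq\infty$, $\mathcal K_m(r)\subset\mathcal K(r)$ consists of the $(\mu,\sigma)$ with all $\mu_{ij}<m$; so $\mathcal K_\infty=\mathcal K$. A symmetric $\mathcal K$-diagram $M$ is a family of dg-modules $M(\kappa)$ with compatible morphisms $M(\alpha)\to M(\beta)$ for $\alpha\leq\beta$ and $w_*:M(\alpha)\to M(w\alpha)$ for $w\in\Sigma_r$. A $\mathcal K$-operad is a symmetric $\mathcal K$-diagram $P$ with a unit and natural, equivariant, unital and associative composition products $P(\alpha)\otimes P(\beta)\to P(\alpha\circ_e\beta)$. Every operad is a constant $\mathcal K$-operad. A quasi-free $\mathcal K$-operad $(F(M),\partial)$ is a free $\mathcal K$-operad $F(M)$ whose differential is the sum of the one induced by $M$ and of a derivation $\partial$ with $\partial(M)\subset\bigoplus_{m\geq 2}F_m(M)$. For $\kappa=(\mu,\sigma)\in\mathcal K(r)$ let $\mathcal D_n(\kappa)\subset\mathcal D_n(r)$ be the submodule of the functions $c$ such that $c(\underline w)\neq 0$ implies that for every pair either $n-1-\mu_{ij}<\mu_{ij}(\underline w)$, or $n-1-\mu_{ij}=\mu_{ij}(\underline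 w)$ and $\sigma|_{ij}=w_d|_{ij}$, where $w_d$ is the last permutation of $\underline w$. As above, only the components of arity $\geq 2$ are used as generators. **Statement.** 1. For every $n\geq 1$ the modules $\mathcal D_n(\kappa)$ form a symmetric $\mathcal K$-diagram of dg-modules, and there is a quasi-free $\mathcal K$-operad $B^c(\mathcal D_n)(\kappa)=(F(\Sigma^{-1}\mathcal D_n)(\kappa),\partial)$ such that the morphism of (graded) $\mathcal K$-operads from $B^c(\mathcal D_n)(\kappa)$ to the constant $\mathcal K$-operad $B^c(\mathcal D_n)$ induced by the inclusions $\mathcal D_n(\kappa)\subset\mathcal D_n(r)$ commutes with differentials, and such that for all $r$ and all $n\leq m\leq m'\leq\infty$ the canonical maps $$\operatorname{colim}_{\kappa\in\mathcal K_m(r)}B^c(\mathcal D_n)(\kappa)\to\operatorname{colim}_{\kappa\in\mathcal K_{m'}(r)}B^c(\mathcal D_n)(\kappa)\to B^c(\mathcal D_n)(r)$$ are isomorphisms. In particular this holds for $\operatorname{colim}_{\kappa\in\mathcal K_n(r)}$ and for $\operatorname{colim}_{\kappa\in\mathcal K(r)}$. 2. For every $n\geq 1$ the suspension $\sigma^*:\mathcal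 D_n\to\mathcal D_{n+1}$ is a morphism of dg $\Sigma_*$-objects which restricts to a morphism of symmetric $\mathcal K$-diagrams of dg-modules $\sigma^*:\mathcal D_n(\kappa)\to\mathcal D_{n+1}(\kappa)$. The morphisms induced by $\sigma^*$ on free operads and on free $\mathcal K$-operads commute with the differentials of 1., so that they give a morphism of operads $\sigma^*:B^c(\mathcal D_n)\to B^c(\mathcal D_{n+1})$ and a morphism of quasi-free $\mathcal K$-operads $\phi_{\sigma^*}:(F(\Sigma^{-1}\mathcal D_n)(\kappa),\partial)\to(F(\Sigma^{-1}\mathcal D_{n+1})(\kappa),\partial)$, and $\phi_{\sigma^*}$ realizes $\sigma^*$: it corresponds to it under the canonical morphisms from the quasi-free $\mathcal K$-operads of 1. to the constant ones. -/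

import Mathlib

/-! # Cobar constructions of the duals of the Barratt-Eccles operads as operads shaped on complete graph posets -/

open Equiv (Perm)

namespace KCobar

/-- The data of a quadratic composite `p(i_1, …, i_s) ∘_{i_e} q(j_1, …, j_t)` with values in arity
`r`: the input `e` of the outer operation where the inner one is plugged in, and the input sharing,
which sends each of the `r` inputs of the composite to an input `≠ e` of the outer operation
(`Sum.inl`) or to an input of the inner operation (`Sum.inr`). In particular `r = s + t - 1`. The
standard partial composite `∘_e` is the case where the sharing is the usual index shift. -/
structure Graft (s t r : ℕ) where
  /-- the input of the outer operation where the inner operation is plugged in -/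
  e : Fin s
  /-- the input sharing -/
  f : Fin r → Fin s ⊕ Fin t
  inj : Function.Injective f
  range_iff : ∀ y, (∃ x, f x = y) ↔ y ≠ Sum.inl e

namespace Graft

/-- `g'` is obtained from `g` by relabelling the inputs of the outer operation by `u`, of the inner
operation by `v` and of the composite by `w`. -/
def Rel {s t r : ℕ} (u : Perm (Fin s)) (v : Perm (Fin t)) (w : Perm (Fin r))
    (g g' : Graft s t r) : Prop :=
  g'.e = u g.e ∧ ∀ x, g'.f (w x) = Sum.map u v (g.f x)

/-- `(p ∘_{g₁} q) ∘_{g₂} r` and `p ∘_{h₂} (q ∘_{h₁} r)` are composites over the same tree with three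
vertices on a line, with the same input sharing. -/
def Seq {s t u m m' r : ℕ} (g₁ : Graft s t m) (g₂ : Graft m u r)
    (h₁ : Graft t u m') (h₂ : Graft s m' r) : Prop :=
  g₁.f g₂.e = Sum.inr h₁.e ∧ h₂.e = g₁.e ∧
  ∀ x, Sum.elim (fun y => Sum.map id Sum.inl (g₁.f y)) (fun c => Sum.inr (Sum.inr c)) (g₂.f x)
    = (Sum.map id h₁.f (h₂.f x) : Fin s ⊕ (Fin t ⊕ Fin u))

/-- `(p ∘_{g₁} q) ∘_{g₂} r` and `(p ∘_{h₁} r) ∘_{h₂} q` are composites over the same tree with `q`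
and `r` plugged in two different inputs of `p`, with the same input sharing. -/
def Par {s t u m m' r : ℕ} (g₁ : Graft s t m) (g₂ : Graft m u r)
    (h₁ : Graft s u m') (h₂ : Graft m' t r) : Prop :=
  g₁.f g₂.e = Sum.inl h₁.e ∧ h₁.f h₂.e = Sum.inl g₁.e ∧
  ∀ x, Sum.elim (fun y => Sum.map id Sum.inl (g₁.f y)) (fun c => Sum.inr (Sum.inr c)) (g₂.f x)
    = (Sum.elim (fun z => Sum.map id Sum.inr (h₁.f z)) (fun b => Sum.inr (Sum.inl b)) (h₂.f x) :
        Fin s ⊕ (Fin t ⊕ Fin u))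

/-- Composition with a unit at the root: the input `b` of the inner operation is put at `w b`. -/
def UnitLeft {r : ℕ} (g : Graft 1 r r) (w : Perm (Fin r)) : Prop := ∀ b, g.f (w b) = Sum.inr b

/-- Composition with a unit plugged in the input `e`: the input `a` of the outer operation is
put at `w a`. -/
def UnitRight {s : ℕ} (g : Graft s 1 s) (w : Perm (Fin s)) : Prop :=
  g.f (w g.e) = Sum.inr 0 ∧ ∀ a, a ≠ g.e → g.f (w a) = Sum.inl a

noncomputable instance {s t r : ℕ} : Fintype (Graft s t r) :=
  Fintype.ofInjective (fun g => (g.e, g.f)) (by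
    rintro ⟨e, f, _, _⟩ ⟨e', f', _, _⟩ h
    simp only [Prod.mk.injEq] at h
    obtain ⟨rfl, rfl⟩ := h
    rfl)

/-- The normalized representatives of the isomorphism classes of trees with two vertices: the inner
vertex is plugged in the first input of the outer one and the remaining inputs of both vertices
are put in increasing order. -/
def IsStd {s t r : ℕ} (g : Graft s t r) : Prop :=
  (g.e : ℕ) = 0 ∧ ∀ x y, x < y →
    (∀ a b, g.f x = Sum.inl a → g.f y = Sum.inl b → a < b) ∧
    (∀ a b, g.f x = Sum.inr a → g.f y = Sum.inr b → a < b)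

end Graft

/-- An operad in posets. The composition products are indexed by all input sharings `Graft s t r`,
which amounts to the usual `∘_e` followed by an input permutation. -/
structure PosetOperad where
  obj : ℕ → Type
  order : ∀ r, PartialOrder (obj r)
  act : ∀ {r : ℕ}, Perm (Fin r) → obj r → obj r
  one : obj 1
  comp : ∀ {s t r : ℕ}, Graft s t r → obj s → obj t → obj r
  act_one : ∀ {r : ℕ} (α : obj r), act 1 α = α
  act_mul : ∀ {r : ℕ} (v w : Perm (Fin r)) (α : obj r), act (v * w) α = act v (act w α)
  act_mono : ∀ {r : ℕ} (w : Perm (Fin r)) {α β : obj r}, α ≤ β → act w α ≤ act w β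
  comp_mono : ∀ {s t r : ℕ} (g : Graft s t r) {α α' : obj s} {β β' : obj t},
    α ≤ α' → β ≤ β' → comp g α β ≤ comp g α' β'
  comp_act : ∀ {s t r : ℕ} {u : Perm (Fin s)} {v : Perm (Fin t)} {w : Perm (Fin r)}
    {g g' : Graft s t r}, Graft.Rel u v w g g' → ∀ (α : obj s) (β : obj t),
    comp g' (act u α) (act v β) = act w (comp g α β)
  comp_seq : ∀ {s t u m m' r : ℕ} {g₁ : Graft s t m} {g₂ : Graft m u r}
    {h₁ : Graft t u m'} {h₂ : Graft s m' r}, Graft.Seq g₁ g₂ h₁ h₂ →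
    ∀ (α : obj s) (β : obj t) (γ : obj u),
    comp g₂ (comp g₁ α β) γ = comp h₂ α (comp h₁ β γ)
  comp_par : ∀ {s t u m m' r : ℕ} {g₁ : Graft s t m} {g₂ : Graft m u r}
    {h₁ : Graft s u m'} {h₂ : Graft m' t r}, Graft.Par g₁ g₂ h₁ h₂ →
    ∀ (α : obj s) (β : obj t) (γ : obj u),
    comp g₂ (comp g₁ α β) γ = comp h₂ (comp h₁ α γ) β
  one_comp : ∀ {r : ℕ} {g : Graft 1 r r} {w : Perm (Fin r)}, g.UnitLeft w →
    ∀ β : obj r, comp g one β = act w β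
  comp_one : ∀ {s : ℕ} {g : Graft s 1 s} {w : Perm (Fin s)}, g.UnitRight w →
    ∀ α : obj s, comp g α one = act w α

attribute [instance] PosetOperad.order

/-- The one-point operad in posets. -/
def ptOperad : PosetOperad where
  obj _ := Unit
  order _ := inferInstance
  act _ _ := ()
  one := ()
  comp _ _ _ := ()
  act_one _ := rfl
  act_mul _ _ _ := rfl
  act_mono _ _ _ _ := le_refl _
  comp_mono _ _ _ _ _ _ _ := le_refl _
  comp_act _ _ _ := rfl
  comp_seq _ _ _ _ := rfl
  comp_par _ _ _ _ := rfl
  one_comp _ _ := rfl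
  comp_one _ _ := rfl

/-- The point of `ptOperad` in arity `r`. -/
def pt (r : ℕ) : ptOperad.obj r := ()

/-! ### The complete graph operad -/

/-- `i` occurs before `j` in the sequence `(σ(1), …, σ(r))`; this encodes `σ|_{ij}`. -/
def Precedes {r : ℕ} (σ : Perm (Fin r)) (i j : Fin r) : Prop := σ.symm i < σ.symm j

theorem precedes_mul {r : ℕ} (w σ : Perm (Fin r)) (i j : Fin r) :
    Precedes (w * σ) i j ↔ Precedes σ (w.symm i) (w.symm j) := Iff.rfl

theorem precedes_ext {r : ℕ} {σ τ : Perm (Fin r)}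
    (h : ∀ i j, i ≠ j → (Precedes σ i j ↔ Precedes τ i j)) : σ = τ := by
  have hm : Monotone (τ⁻¹ * σ : Perm (Fin r)) := by
    refine StrictMono.monotone fun a b hab => ?_
    exact (h (σ a) (σ b) (fun h => hab.ne (σ.injective h))).1 (by simpa [Precedes] using hab)
  rw [Equiv.Perm.monotone_iff] at hm
  exact (inv_mul_eq_one.1 hm).symm

/-- The substitution of the sequence `(v(1), …, v(t))` for the value `e` in the sequence
`(u(1), …, u(s))`, with inputs relabelled by the sharing: the composition of the permutation
operad. -/
noncomputable def permComp {s t r : ℕ} (g : Graft s t r) (u : Perm (Fin s)) (v : Perm (Fin t)) :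
    Perm (Fin r) :=
  Tuple.sort fun x => (Sum.elim (fun a => toLex (u.symm a, 0))
    (fun b => toLex (u.symm g.e, (v.symm b : ℕ))) (g.f x) : Fin s ×ₗ ℕ)

/-- The quantity associated to a pair of inputs of a composite by quantities `P` and `Q` associated
to the pairs of inputs of the outer and of the inner operation: inputs of the inner operation sit
at the input `e` of the outer one. -/
def pairVal {X : Type} {s t : ℕ} (e : Fin s) (P : Fin s → Fin s → X) (Q : Fin t → Fin t → X) :
    Fin s ⊕ Fin t → Fin s ⊕ Fin t → X
  | Sum.inl a, Sum.inl b => P a b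
  | Sum.inl a, Sum.inr _ => P a e
  | Sum.inr _, Sum.inl b => P e b
  | Sum.inr a, Sum.inr b => Q a b

theorem precedes_sort {r : ℕ} {A : Type} [LinearOrder A] (f : Fin r → A)
    (hf : Function.Injective f) (x y : Fin r) : Precedes (Tuple.sort f) x y ↔ f x < f y := by
  have h : StrictMono (f ∘ Tuple.sort f) :=
    (Tuple.monotone_sort f).strictMono_of_injective (hf.comp (Tuple.sort f).injective)
  have := h.lt_iff_lt (a := (Tuple.sort f).symm x) (b := (Tuple.sort f).symm y)
  simpa [Precedes] using this.symm

theorem precedes_permComp {s t r : ℕ} (g : Graft s t r) (u : Perm (Fin s)) (v : Perm (Fin t))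
    (x y : Fin r) : Precedes (permComp g u v) x y ↔
      pairVal g.e (Precedes u) (Precedes v) (g.f x) (g.f y) := by
  have hne : ∀ x a, g.f x = Sum.inl a → a ≠ g.e := fun x a h =>
    fun h' => (g.range_iff (Sum.inl a)).1 ⟨x, h⟩ (by rw [h'])
  unfold permComp
  rw [precedes_sort]
  · rcases hx : g.f x with a | a <;> rcases hy : g.f y with b | b <;>
      simp [pairVal, Precedes, Prod.Lex.toLex_lt_toLex]
    · intro h; exact absurd h (hne x a hx)
  · intro x y h
    apply g.inj
    have hx' := hne x
    have hy' := hne y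
    rcases hx : g.f x with a | a <;> rcases hy : g.f y with b | b <;>
      simp only [hx, hy, Sum.elim_inl, Sum.elim_inr, EmbeddingLike.apply_eq_iff_eq,
        Prod.mk.injEq] at h
    · rw [h.1]
    · exact absurd h.1 (hx' a hx)
    · exact absurd h.1.symm (hy' b hy)
    · rw [v.symm.injective (Fin.ext h.2)]

/-- The oriented weight systems `κ = (μ, σ)` on `{1, …, r}`, `r ≥ 1`: weights `μ_{ij} ∈ ℕ` indexed by
the pairs `{i, j}` (the diagonal entries are set to `0`) and a permutation `σ`. -/
@[ext]
structure OWS (r : ℕ) where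
  pos : 0 < r
  wt : Fin r → Fin r → ℕ
  symm : ∀ i j, wt i j = wt j i
  diag : ∀ i, wt i i = 0
  perm : Perm (Fin r)

namespace OWS

theorem ext_of {r : ℕ} {α β : OWS r} (h : ∀ i j, α.wt i j = β.wt i j)
    (h' : ∀ i j, i ≠ j → (Precedes α.perm i j ↔ Precedes β.perm i j)) : α = β :=
  OWS.ext (by ext i j; exact h i j) (precedes_ext h')

/-- `(μ, σ) ≤ (ν, τ)` if `μ_{ij} < ν_{ij}` or `(μ_{ij}, σ|_{ij}) = (ν_{ij}, τ|_{ij})` for all pairs. -/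
instance {r : ℕ} : PartialOrder (OWS r) where
  le α β := ∀ i j, i ≠ j → α.wt i j < β.wt i j ∨
    (α.wt i j = β.wt i j ∧ (Precedes α.perm i j ↔ Precedes β.perm i j))
  le_refl _ _ _ _ := Or.inr ⟨rfl, Iff.rfl⟩
  le_trans α β γ h h' i j hij := by
    have h1 := h i j hij
    have h2 := h' i j hij
    grind
  le_antisymm α β h h' := by
    have key : ∀ i j, i ≠ j →
        α.wt i j = β.wt i j ∧ (Precedes α.perm i j ↔ Precedes β.perm i j) := by
      intro i j hij
      have h1 := h i j hij
      have h2 := h' i j hij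
      grind
    refine ext_of (fun i j => ?_) (fun i j hij => (key i j hij).2)
    by_cases hij : i = j
    · rw [hij, α.diag, β.diag]
    · exact (key i j hij).1

theorem le_def {r : ℕ} {α β : OWS r} : α ≤ β ↔ ∀ i j, i ≠ j → α.wt i j < β.wt i j ∨
    (α.wt i j = β.wt i j ∧ (Precedes α.perm i j ↔ Precedes β.perm i j)) := Iff.rfl

/-- The action of a permutation: `(wμ)_{ij} = μ_{w⁻¹(i) w⁻¹(j)}` and `wσ` is the composite. -/
def act {r : ℕ} (w : Perm (Fin r)) (α : OWS r) : OWS r where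
  pos := α.pos
  wt i j := α.wt (w.symm i) (w.symm j)
  symm _ _ := α.symm _ _
  diag _ := α.diag _
  perm := w * α.perm

/-- Plugging the graph `β` in the vertex `e` of the graph `α`. -/
noncomputable def comp {s t r : ℕ} (g : Graft s t r) (α : OWS s) (β : OWS t) : OWS r where
  pos := ((g.range_iff (Sum.inr ⟨0, β.pos⟩)).2 (by simp)).choose.pos
  wt i j := pairVal g.e α.wt β.wt (g.f i) (g.f j)
  symm i j := by
    rcases g.f i with a | a <;> rcases g.f j with b | b
    exacts [α.symm _ _, α.symm _ _, α.symm _ _, β.symm _ _]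
  diag i := by rcases g.f i with a | a <;> simp [pairVal, α.diag, β.diag]
  perm := permComp g α.perm β.perm

end OWS

theorem pairVal_rel {X : Type} {s t : ℕ} (e : Fin s) (P : Fin s → Fin s → X)
    (Q : Fin t → Fin t → X) (u : Perm (Fin s)) (v : Perm (Fin t)) (y z : Fin s ⊕ Fin t) :
    pairVal (u e) (fun i j => P (u.symm i) (u.symm j)) (fun i j => Q (v.symm i) (v.symm j))
      (Sum.map u v y) (Sum.map u v z) = pairVal e P Q y z := by
  rcases y with a | a <;> rcases z with b | b <;> simp [pairVal]

theorem Graft.Seq.cases {s t u m m' r : ℕ} {g₁ : Graft s t m} {g₂ : Graft m u r}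
    {h₁ : Graft t u m'} {h₂ : Graft s m' r} (h : Graft.Seq g₁ g₂ h₁ h₂) (x : Fin r) :
    (∃ a y, g₂.f x = Sum.inl y ∧ g₁.f y = Sum.inl a ∧ h₂.f x = Sum.inl a) ∨
    (∃ b y z, g₂.f x = Sum.inl y ∧ g₁.f y = Sum.inr b ∧ h₂.f x = Sum.inr z ∧
      h₁.f z = Sum.inl b) ∨
    (∃ c z, g₂.f x = Sum.inr c ∧ h₂.f x = Sum.inr z ∧ h₁.f z = Sum.inr c) := by
  have hx := h.2.2 x
  rcases e1 : g₂.f x with a | a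
  · rcases f1 : g₁.f a with b | b
    · rcases e2 : h₂.f x with c | c
      · simp_all
      · simp [e1, e2, f1] at hx
    · rcases e2 : h₂.f x with c | c
      · simp [e1, e2, f1] at hx
      · simp_all
  · rcases e2 : h₂.f x with c | c
    · simp [e1, e2] at hx
    · simp_all

theorem Graft.Par.cases {s t u m m' r : ℕ} {g₁ : Graft s t m} {g₂ : Graft m u r}
    {h₁ : Graft s u m'} {h₂ : Graft m' t r} (h : Graft.Par g₁ g₂ h₁ h₂) (x : Fin r) :
    (∃ a y z, g₂.f x = Sum.inl y ∧ g₁.f y = Sum.inl a ∧ h₂.f x = Sum.inl z ∧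
      h₁.f z = Sum.inl a) ∨
    (∃ b y, g₂.f x = Sum.inl y ∧ g₁.f y = Sum.inr b ∧ h₂.f x = Sum.inr b) ∨
    (∃ c z, g₂.f x = Sum.inr c ∧ h₂.f x = Sum.inl z ∧ h₁.f z = Sum.inr c) := by
  have hx := h.2.2 x
  rcases e1 : g₂.f x with a | a
  · rcases f1 : g₁.f a with b | b
    · rcases e2 : h₂.f x with c | c
      · rcases f2 : h₁.f c with d | d <;> simp_all
      · simp [e1, e2, f1] at hx
    · rcases e2 : h₂.f x with c | c
      · rcases f2 : h₁.f c with d | d <;> simp [e1, e2, f1, f2] at hx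
      · simp_all
  · rcases e2 : h₂.f x with c | c
    · rcases f2 : h₁.f c with d | d <;> simp_all
    · simp [e1, e2] at hx

theorem pairVal_seq {X : Type} {s t u m m' r : ℕ} {g₁ : Graft s t m} {g₂ : Graft m u r}
    {h₁ : Graft t u m'} {h₂ : Graft s m' r} (h : Graft.Seq g₁ g₂ h₁ h₂)
    (P : Fin s → Fin s → X) (Q : Fin t → Fin t → X) (R : Fin u → Fin u → X) (x y : Fin r) :
    pairVal g₂.e (fun i j => pairVal g₁.e P Q (g₁.f i) (g₁.f j)) R (g₂.f x) (g₂.f y) =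
    pairVal h₂.e P (fun i j => pairVal h₁.e Q R (h₁.f i) (h₁.f j)) (h₂.f x) (h₂.f y) := by
  have h1 := h.1
  have h2 := h.2.1
  rcases h.cases x with ⟨a, i, e1, e2, e3⟩ | ⟨a, i, j, e1, e2, e3, e4⟩ | ⟨a, i, e1, e2, e3⟩ <;>
  rcases h.cases y with ⟨b, k, f1, f2, f3⟩ | ⟨b, k, l, f1, f2, f3, f4⟩ | ⟨b, k, f1, f2, f3⟩ <;>
  simp [pairVal, *]

theorem pairVal_par {X : Type} {s t u m m' r : ℕ} {g₁ : Graft s t m} {g₂ : Graft m u r}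
    {h₁ : Graft s u m'} {h₂ : Graft m' t r} (h : Graft.Par g₁ g₂ h₁ h₂)
    (P : Fin s → Fin s → X) (Q : Fin t → Fin t → X) (R : Fin u → Fin u → X) (x y : Fin r) :
    pairVal g₂.e (fun i j => pairVal g₁.e P Q (g₁.f i) (g₁.f j)) R (g₂.f x) (g₂.f y) =
    pairVal h₂.e (fun i j => pairVal h₁.e P R (h₁.f i) (h₁.f j)) Q (h₂.f x) (h₂.f y) := by
  have h1 := h.1
  have h2 := h.2.1
  rcases h.cases x with ⟨a, i, j, e1, e2, e3, e4⟩ | ⟨a, i, e1, e2, e3⟩ | ⟨a, i, e1, e2, e3⟩ <;>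
  rcases h.cases y with ⟨b, k, l, f1, f2, f3, f4⟩ | ⟨b, k, f1, f2, f3⟩ | ⟨b, k, f1, f2, f3⟩ <;>
  simp [pairVal, *]

theorem pairVal_mono {s t : ℕ} (e : Fin s) {μ μ' : Fin s → Fin s → ℕ} {ν ν' : Fin t → Fin t → ℕ}
    {P P' : Fin s → Fin s → Prop} {Q Q' : Fin t → Fin t → Prop}
    (hα : ∀ i j, i ≠ j → μ i j < μ' i j ∨ (μ i j = μ' i j ∧ (P i j ↔ P' i j)))
    (hβ : ∀ i j, i ≠ j → ν i j < ν' i j ∨ (ν i j = ν' i j ∧ (Q i j ↔ Q' i j)))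
    (y z : Fin s ⊕ Fin t) (hy : y ≠ Sum.inl e) (hz : z ≠ Sum.inl e) (hyz : y ≠ z) :
    pairVal e μ ν y z < pairVal e μ' ν' y z ∨ (pairVal e μ ν y z = pairVal e μ' ν' y z ∧
      (pairVal e P Q y z ↔ pairVal e P' Q' y z)) := by
  rcases y with a | a <;> rcases z with b | b <;> simp only [pairVal]
  · exact hα _ _ (fun h => hyz (by rw [h]))
  · exact hα _ _ (fun h => hy (by rw [h]))
  · exact hα _ _ (fun h => hz (by rw [h]))
  · exact hβ _ _ (fun h => hyz (by rw [h]))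

/-- The complete graph operad `K`. -/
noncomputable def completeGraphOperad : PosetOperad where
  obj r := OWS r
  order _ := inferInstance
  act := OWS.act
  one :=
    { pos := Nat.one_pos
      wt := fun _ _ => 0
      symm := fun _ _ => rfl
      diag := fun _ => rfl
      perm := 1 }
  comp := OWS.comp
  act_one _ := rfl
  act_mul _ _ _ := rfl
  act_mono w α β h i j hij := h _ _ (fun h' => hij (w.symm.injective h'))
  comp_mono g α α' β β' h h' := by
    intro i j hij
    simp only [OWS.comp, precedes_permComp]
    exact pairVal_mono _ h h' _ _ ((g.range_iff _).1 ⟨i, rfl⟩) ((g.range_iff _).1 ⟨j, rfl⟩)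
      (fun h => hij (g.inj h))
  comp_act := by
    intro s t r u v w g g' h α β
    have hf : ∀ x, g'.f x = Sum.map u v (g.f (w.symm x)) := fun x => by rw [← h.2]; simp
    refine OWS.ext_of (fun i j => ?_) (fun i j _ => ?_)
    · simp only [OWS.comp, OWS.act, hf, h.1]
      exact pairVal_rel g.e α.wt β.wt u v _ _
    · simp only [OWS.comp, OWS.act, precedes_mul, precedes_permComp, hf, h.1]
      exact iff_of_eq (pairVal_rel g.e (Precedes α.perm) (Precedes β.perm) u v _ _)
  comp_seq := by
    intro s t u m m' r g₁ g₂ h₁ h₂ h α β γ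
    refine OWS.ext_of (fun i j => pairVal_seq h _ _ _ _ _) (fun i j _ => ?_)
    simp only [OWS.comp, precedes_permComp]
    have e1 : Precedes (permComp g₁ α.perm β.perm) = fun i j =>
      pairVal g₁.e (Precedes α.perm) (Precedes β.perm) (g₁.f i) (g₁.f j) := by
        ext; rw [precedes_permComp]
    have e2 : Precedes (permComp h₁ β.perm γ.perm) = fun i j =>
      pairVal h₁.e (Precedes β.perm) (Precedes γ.perm) (h₁.f i) (h₁.f j) := by
        ext; rw [precedes_permComp]
    rw [e1, e2]
    exact iff_of_eq (pairVal_seq h _ _ _ _ _)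
  comp_par := by
    intro s t u m m' r g₁ g₂ h₁ h₂ h α β γ
    refine OWS.ext_of (fun i j => pairVal_par h _ _ _ _ _) (fun i j _ => ?_)
    simp only [OWS.comp, precedes_permComp]
    have e1 : Precedes (permComp g₁ α.perm β.perm) = fun i j =>
      pairVal g₁.e (Precedes α.perm) (Precedes β.perm) (g₁.f i) (g₁.f j) := by
        ext; rw [precedes_permComp]
    have e2 : Precedes (permComp h₁ α.perm γ.perm) = fun i j =>
      pairVal h₁.e (Precedes α.perm) (Precedes γ.perm) (h₁.f i) (h₁.f j) := by
        ext; rw [precedes_permComp]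
    rw [e1, e2]
    exact iff_of_eq (pairVal_par h _ _ _ _ _)
  one_comp := by
    intro r g w h β
    have hf : ∀ x, g.f x = Sum.inr (w.symm x) := fun x => by rw [← h]; simp
    refine OWS.ext_of (fun i j => ?_) (fun i j _ => ?_)
    · simp [OWS.comp, OWS.act, hf, pairVal]
    · simp [OWS.comp, OWS.act, hf, pairVal, precedes_mul, precedes_permComp]
  comp_one := by
    intro s g w h α
    have hf : ∀ x, w.symm x = g.e ∧ g.f x = Sum.inr 0 ∨ g.f x = Sum.inl (w.symm x) := fun x => by
      by_cases hx : w.symm x = g.e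
      · left
        refine ⟨hx, ?_⟩
        rw [← h.1, ← hx]; simp
      · right
        rw [← h.2 _ hx]; simp
    refine OWS.ext_of (fun i j => ?_) (fun i j hij => ?_)
    · rcases hf i with ⟨hi, hi'⟩ | hi <;> rcases hf j with ⟨hj, hj'⟩ | hj <;>
        simp_all [OWS.comp, OWS.act, pairVal, OWS.diag]
    · have hij' : w.symm i ≠ w.symm j := fun h' => hij (w.symm.injective h')
      rcases hf i with ⟨hi, hi'⟩ | hi <;> rcases hf j with ⟨hj, hj'⟩ | hj <;>
        simp_all [OWS.comp, OWS.act, pairVal, precedes_mul, precedes_permComp]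

/-- The layer `K_m(r) ⊂ K(r)`, `m = 1, 2, …, ∞`, of the oriented weight systems whose weights are all
`< m`; for `m = ∞` this is `K(r)`. -/
def layer (m : ℕ∞) (r : ℕ) : Set (completeGraphOperad.obj r) :=
  {κ | ∀ i j : Fin r, i ≠ j → ((OWS.wt κ i j : ℕ) : ℕ∞) < m}

theorem layer_mono {m m' : ℕ∞} (h : m ≤ m') (r : ℕ) : layer m r ⊆ layer m' r :=
  fun _ hκ i j hij => (hκ i j hij).trans_le h

/-! ### Symmetric diagrams and operads shaped on an operad in posets -/

/-- A graded symmetric `O`-diagram: a collection of graded abelian groups `M(α)`, `α ∈ O(r)`, with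
the morphisms `i_* : M(α) → M(β)` for `α ≤ β` and `w_* : M(α) → M(wα)` for permutations `w`.
The field `map w` is the composite `M(α) → M(wα) → M(β)` for `wα ≤ β`; these composites are the
morphisms of the category whose functors are the symmetric `O`-diagrams. For the one-point operad
these are the graded `Σ_*`-objects, for the complete graph operad the graded symmetric
`K`-diagrams. -/
structure SymDiag (O : PosetOperad) where
  obj : ∀ {r : ℕ}, O.obj r → ℤ → Type
  grp : ∀ {r : ℕ} (α : O.obj r) (k : ℤ), AddCommGroup (obj α k)
  map : ∀ {r : ℕ} {α β : O.obj r} (w : Perm (Fin r)), O.act w α ≤ β → ∀ {k : ℤ}, obj α k →+ obj β k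
  map_id : ∀ {r : ℕ} {α : O.obj r} (h : O.act 1 α ≤ α) {k : ℤ} (x : obj α k), map 1 h x = x
  map_map : ∀ {r : ℕ} {α β γ : O.obj r} (v w : Perm (Fin r)) (h : O.act w α ≤ β)
    (h' : O.act v β ≤ γ) (h'' : O.act (v * w) α ≤ γ) {k : ℤ} (x : obj α k),
    map v h' (map w h x) = map (v * w) h'' x

attribute [instance] SymDiag.grp

namespace SymDiag

variable {O : PosetOperad}

/-- The morphism `i_* : M(α) → M(β)` associated to a relation `α ≤ β`. -/
def incl (M : SymDiag O) {r : ℕ} {α β : O.obj r} (h : α ≤ β) {k : ℤ} : M.obj α k →+ M.obj β k :=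
  M.map 1 (by rw [O.act_one]; exact h)

theorem incl_incl (M : SymDiag O) {r : ℕ} {α β γ : O.obj r} (h : α ≤ β) (h' : β ≤ γ) {k : ℤ}
    (x : M.obj α k) : M.incl h' (M.incl h x) = M.incl (h.trans h') x := by
  unfold incl
  exact M.map_map 1 1 _ _ _ x

/-- Morphisms of graded symmetric `O`-diagrams. -/
structure Hom (M N : SymDiag O) where
  app : ∀ {r : ℕ} {α : O.obj r} {k : ℤ}, M.obj α k →+ N.obj α k
  app_map : ∀ {r : ℕ} {α β : O.obj r} (w : Perm (Fin r)) (h : O.act w α ≤ β) {k : ℤ}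
    (x : M.obj α k), app (M.map w h x) = N.map w h (app x)

/-- A differential on a graded symmetric `O`-diagram, which makes it a diagram of dg-modules. -/
structure Differential (M : SymDiag O) where
  d : ∀ {r : ℕ} {α : O.obj r} {k : ℤ}, M.obj α k →+ M.obj α (k - 1)
  d_d : ∀ {r : ℕ} {α : O.obj r} {k : ℤ} (x : M.obj α k), d (d x) = 0
  d_map : ∀ {r : ℕ} {α β : O.obj r} (w : Perm (Fin r)) (h : O.act w α ≤ β) {k : ℤ}
    (x : M.obj α k), d (M.map w h x) = M.map w h (d x)

end SymDiag

/-- A graded `O`-operad: a graded symmetric `O`-diagram with a unit and with composition products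
`P(α) ⊗ P(β) → P(α ∘_e β)`, given here for all input sharings and followed by the morphism
`P(α ∘ β) → P(γ)` for `α ∘ β ≤ γ`. For the one-point operad these are the usual graded (symmetric)
operads, for the complete graph operad the graded `K`-operads. -/
structure GrOperad (O : PosetOperad) extends SymDiag O where
  one : obj O.one 0
  comp : ∀ {s t r : ℕ} {α : O.obj s} {β : O.obj t} {γ : O.obj r} (g : Graft s t r),
    O.comp g α β ≤ γ → ∀ {i j k : ℤ}, i + j = k → obj α i →+ obj β j →+ obj γ k
  comp_map : ∀ {s t r : ℕ} {α α' : O.obj s} {β β' : O.obj t} {γ γ' : O.obj r}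
    {u : Perm (Fin s)} {v : Perm (Fin t)} {w : Perm (Fin r)} {g g' : Graft s t r},
    Graft.Rel u v w g g' → ∀ (hu : O.act u α ≤ α') (hv : O.act v β ≤ β') (hw : O.act w γ ≤ γ')
    (h : O.comp g α β ≤ γ) (h' : O.comp g' α' β' ≤ γ') {i j k : ℤ} (hk : i + j = k)
    (p : obj α i) (q : obj β j),
    comp g' h' hk (map u hu p) (map v hv q) = map w hw (comp g h hk p q)
  comp_seq : ∀ {s t u m m' r : ℕ} {g₁ : Graft s t m} {g₂ : Graft m u r}
    {g₃ : Graft t u m'} {g₄ : Graft s m' r}, Graft.Seq g₁ g₂ g₃ g₄ →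
    ∀ {α : O.obj s} {β : O.obj t} {γ : O.obj u} {δ : O.obj m} {ε : O.obj m'} {ζ : O.obj r}
    (h₁ : O.comp g₁ α β ≤ δ) (h₂ : O.comp g₂ δ γ ≤ ζ) (h₃ : O.comp g₃ β γ ≤ ε)
    (h₄ : O.comp g₄ α ε ≤ ζ) {i j k a b c : ℤ} (k₁ : i + j = a) (k₂ : a + k = c)
    (k₃ : j + k = b) (k₄ : i + b = c) (p : obj α i) (q : obj β j) (z : obj γ k),
    comp g₂ h₂ k₂ (comp g₁ h₁ k₁ p q) z = comp g₄ h₄ k₄ p (comp g₃ h₃ k₃ q z)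
  comp_par : ∀ {s t u m m' r : ℕ} {g₁ : Graft s t m} {g₂ : Graft m u r}
    {g₃ : Graft s u m'} {g₄ : Graft m' t r}, Graft.Par g₁ g₂ g₃ g₄ →
    ∀ {α : O.obj s} {β : O.obj t} {γ : O.obj u} {δ : O.obj m} {ε : O.obj m'} {ζ : O.obj r}
    (h₁ : O.comp g₁ α β ≤ δ) (h₂ : O.comp g₂ δ γ ≤ ζ) (h₃ : O.comp g₃ α γ ≤ ε)
    (h₄ : O.comp g₄ ε β ≤ ζ) {i j k a b c : ℤ} (k₁ : i + j = a) (k₂ : a + k = c)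
    (k₃ : i + k = b) (k₄ : b + j = c) (p : obj α i) (q : obj β j) (z : obj γ k),
    comp g₂ h₂ k₂ (comp g₁ h₁ k₁ p q) z =
      ((j * k).negOnePow : ℤ) • comp g₄ h₄ k₄ (comp g₃ h₃ k₃ p z) q
  one_comp : ∀ {r : ℕ} {g : Graft 1 r r} {w : Perm (Fin r)}, g.UnitLeft w →
    ∀ {β γ : O.obj r} (h : O.comp g O.one β ≤ γ) (h' : O.act w β ≤ γ) {k : ℤ} (hk : 0 + k = k)
    (q : obj β k), comp g h hk one q = map w h' q
  comp_one : ∀ {s : ℕ} {g : Graft s 1 s} {w : Perm (Fin s)}, g.UnitRight w →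
    ∀ {α γ : O.obj s} (h : O.comp g α O.one ≤ γ) (h' : O.act w α ≤ γ) {k : ℤ} (hk : k + 0 = k)
    (p : obj α k), comp g h hk p one = map w h' p

namespace GrOperad

variable {O : PosetOperad}

/-- Morphisms of graded `O`-operads. -/
structure Hom (P Q : GrOperad O) extends SymDiag.Hom P.toSymDiag Q.toSymDiag where
  app_one : app P.one = Q.one
  app_comp : ∀ {s t r : ℕ} {α : O.obj s} {β : O.obj t} {γ : O.obj r} (g : Graft s t r)
    (h : O.comp g α β ≤ γ) {i j k : ℤ} (hk : i + j = k) (p : P.obj α i) (q : P.obj β j),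
    app (P.comp g h hk p q) = Q.comp g h hk (app p) (app q)

/-- A differential on a graded `O`-operad which satisfies the derivation relation
`d(p ∘ q) = d(p) ∘ q ± p ∘ d(q)`. A graded `O`-operad with such a differential is a dg-operad shaped
on `O`: a usual dg-operad for the one-point operad, a `K`-operad in dg-modules for the complete
graph operad. -/
structure Differential (P : GrOperad O) extends SymDiag.Differential P.toSymDiag where
  leibniz : ∀ {s t r : ℕ} {α : O.obj s} {β : O.obj t} {γ : O.obj r} (g : Graft s t r)
    (h : O.comp g α β ≤ γ) {i j k : ℤ} (hk : i + j = k) (p : P.obj α i) (q : P.obj β j),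
    d (P.comp g h hk p q) = P.comp g h (show (i - 1) + j = k - 1 by omega) (d p) q +
      (i.negOnePow : ℤ) • P.comp g h (show i + (j - 1) = k - 1 by omega) p (d q)

/-- The constant `O`-operad associated to a usual operad. -/
def const (O : PosetOperad) (P : GrOperad ptOperad) : GrOperad O where
  obj {r} _ k := P.obj (pt r) k
  grp _ _ := P.grp _ _
  map w _ := P.map w (le_refl _)
  map_id _ _ _ := P.map_id _ _
  map_map _ _ _ _ _ _ _ := P.map_map _ _ _ _ _ _
  one := P.one
  comp g _ _ _ _ hk := P.comp g (le_refl _) hk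
  comp_map hg _ _ _ _ _ _ _ _ hk := P.comp_map hg _ _ _ _ _ hk
  comp_seq hg _ _ _ _ _ _ _ _ _ _ _ _ _ _ _ _ k₁ k₂ k₃ k₄ := P.comp_seq hg _ _ _ _ k₁ k₂ k₃ k₄
  comp_par hg _ _ _ _ _ _ _ _ _ _ _ _ _ _ _ _ k₁ k₂ k₃ k₄ := P.comp_par hg _ _ _ _ k₁ k₂ k₃ k₄
  one_comp hg _ _ _ _ _ hk := P.one_comp hg _ _ hk
  comp_one hg _ _ _ _ _ hk := P.comp_one hg _ _ hk

end GrOperad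

/-! ### Free operads -/

section Free

variable {O : PosetOperad}

/-- Formal operadic expressions in the elements of a graded symmetric `O`-diagram. -/
inductive FreeTerm (M : SymDiag O) : {r : ℕ} → O.obj r → ℤ → Type
  | gen {r : ℕ} {α : O.obj r} {k : ℤ} (x : M.obj α k) : FreeTerm M α k
  | one : FreeTerm M O.one 0
  | zero {r : ℕ} (α : O.obj r) (k : ℤ) : FreeTerm M α k
  | add {r : ℕ} {α : O.obj r} {k : ℤ} (a b : FreeTerm M α k) : FreeTerm M α k
  | neg {r : ℕ} {α : O.obj r} {k : ℤ} (a : FreeTerm M α k) : FreeTerm M α k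
  | map {r : ℕ} {α β : O.obj r} (w : Perm (Fin r)) (h : O.act w α ≤ β) {k : ℤ}
      (a : FreeTerm M α k) : FreeTerm M β k
  | comp {s t r : ℕ} {α : O.obj s} {β : O.obj t} {γ : O.obj r} (g : Graft s t r)
      (h : O.comp g α β ≤ γ) {i j k : ℤ} (hk : i + j = k) (a : FreeTerm M α i)
      (b : FreeTerm M β j) : FreeTerm M γ k

/-- The Koszul sign `(-1)^n` in front of a formal expression. -/
def FreeTerm.sgn {M : SymDiag O} {r : ℕ} {α : O.obj r} {k : ℤ} (n : ℤ) (a : FreeTerm M α k) :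
    FreeTerm M α k :=
  if Even n then a else a.neg

/-- The smallest congruence on formal operadic expressions for which the axioms of graded
`O`-operads hold and for which the generators `M → FreeTerm M` form a morphism of graded symmetric
`O`-diagrams. -/
inductive FreeRel (M : SymDiag O) : {r : ℕ} → (α : O.obj r) → (k : ℤ) →
    FreeTerm M α k → FreeTerm M α k → Prop
  | refl {r : ℕ} {α : O.obj r} {k : ℤ} (a : FreeTerm M α k) : FreeRel M α k a a
  | symm {r : ℕ} {α : O.obj r} {k : ℤ} {a b : FreeTerm M α k} :
      FreeRel M α k a b → FreeRel M α k b a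
  | trans {r : ℕ} {α : O.obj r} {k : ℤ} {a b c : FreeTerm M α k} :
      FreeRel M α k a b → FreeRel M α k b c → FreeRel M α k a c
  | add_congr {r : ℕ} {α : O.obj r} {k : ℤ} {a a' b b' : FreeTerm M α k} :
      FreeRel M α k a a' → FreeRel M α k b b' → FreeRel M α k (a.add b) (a'.add b')
  | neg_congr {r : ℕ} {α : O.obj r} {k : ℤ} {a a' : FreeTerm M α k} :
      FreeRel M α k a a' → FreeRel M α k a.neg a'.neg
  | map_congr {r : ℕ} {α β : O.obj r} (w : Perm (Fin r)) (h : O.act w α ≤ β) {k : ℤ}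
      {a a' : FreeTerm M α k} : FreeRel M α k a a' → FreeRel M β k (a.map w h) (a'.map w h)
  | comp_congr {s t r : ℕ} {α : O.obj s} {β : O.obj t} {γ : O.obj r} (g : Graft s t r)
      (h : O.comp g α β ≤ γ) {i j k : ℤ} (hk : i + j = k) {a a' : FreeTerm M α i}
      {b b' : FreeTerm M β j} : FreeRel M α i a a' → FreeRel M β j b b' →
      FreeRel M γ k (a.comp g h hk b) (a'.comp g h hk b')
  | add_assoc {r : ℕ} {α : O.obj r} {k : ℤ} (a b c : FreeTerm M α k) :
      FreeRel M α k ((a.add b).add c) (a.add (b.add c))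
  | add_comm {r : ℕ} {α : O.obj r} {k : ℤ} (a b : FreeTerm M α k) :
      FreeRel M α k (a.add b) (b.add a)
  | zero_add {r : ℕ} {α : O.obj r} {k : ℤ} (a : FreeTerm M α k) :
      FreeRel M α k ((FreeTerm.zero α k).add a) a
  | neg_add {r : ℕ} {α : O.obj r} {k : ℤ} (a : FreeTerm M α k) :
      FreeRel M α k (a.neg.add a) (FreeTerm.zero α k)
  | gen_add {r : ℕ} {α : O.obj r} {k : ℤ} (x y : M.obj α k) :
      FreeRel M α k (FreeTerm.gen (x + y)) ((FreeTerm.gen x).add (FreeTerm.gen y))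
  | gen_map {r : ℕ} {α β : O.obj r} (w : Perm (Fin r)) (h : O.act w α ≤ β) {k : ℤ}
      (x : M.obj α k) : FreeRel M β k (FreeTerm.gen (M.map w h x)) ((FreeTerm.gen x).map w h)
  | map_add {r : ℕ} {α β : O.obj r} (w : Perm (Fin r)) (h : O.act w α ≤ β) {k : ℤ}
      (a b : FreeTerm M α k) : FreeRel M β k ((a.add b).map w h) ((a.map w h).add (b.map w h))
  | map_id {r : ℕ} {α : O.obj r} (h : O.act 1 α ≤ α) {k : ℤ} (a : FreeTerm M α k) :
      FreeRel M α k (a.map 1 h) a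
  | map_map {r : ℕ} {α β γ : O.obj r} (v w : Perm (Fin r)) (h : O.act w α ≤ β)
      (h' : O.act v β ≤ γ) (h'' : O.act (v * w) α ≤ γ) {k : ℤ} (a : FreeTerm M α k) :
      FreeRel M γ k ((a.map w h).map v h') (a.map (v * w) h'')
  | comp_add_left {s t r : ℕ} {α : O.obj s} {β : O.obj t} {γ : O.obj r} (g : Graft s t r)
      (h : O.comp g α β ≤ γ) {i j k : ℤ} (hk : i + j = k) (a a' : FreeTerm M α i)
      (b : FreeTerm M β j) :
      FreeRel M γ k ((a.add a').comp g h hk b) ((a.comp g h hk b).add (a'.comp g h hk b))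
  | comp_add_right {s t r : ℕ} {α : O.obj s} {β : O.obj t} {γ : O.obj r} (g : Graft s t r)
      (h : O.comp g α β ≤ γ) {i j k : ℤ} (hk : i + j = k) (a : FreeTerm M α i)
      (b b' : FreeTerm M β j) :
      FreeRel M γ k (a.comp g h hk (b.add b')) ((a.comp g h hk b).add (a.comp g h hk b'))
  | comp_map {s t r : ℕ} {α α' : O.obj s} {β β' : O.obj t} {γ γ' : O.obj r}
      {u : Perm (Fin s)} {v : Perm (Fin t)} {w : Perm (Fin r)} {g g' : Graft s t r}
      (hg : Graft.Rel u v w g g') (hu : O.act u α ≤ α') (hv : O.act v β ≤ β')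
      (hw : O.act w γ ≤ γ') (h : O.comp g α β ≤ γ) (h' : O.comp g' α' β' ≤ γ') {i j k : ℤ}
      (hk : i + j = k) (a : FreeTerm M α i) (b : FreeTerm M β j) :
      FreeRel M γ' k ((a.map u hu).comp g' h' hk (b.map v hv)) ((a.comp g h hk b).map w hw)
  | comp_seq {s t u m m' r : ℕ} {g₁ : Graft s t m} {g₂ : Graft m u r}
      {g₃ : Graft t u m'} {g₄ : Graft s m' r} (hg : Graft.Seq g₁ g₂ g₃ g₄)
      {α : O.obj s} {β : O.obj t} {γ : O.obj u} {δ : O.obj m} {ε : O.obj m'} {ζ : O.obj r}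
      (h₁ : O.comp g₁ α β ≤ δ) (h₂ : O.comp g₂ δ γ ≤ ζ) (h₃ : O.comp g₃ β γ ≤ ε)
      (h₄ : O.comp g₄ α ε ≤ ζ) {i j k a b c : ℤ} (k₁ : i + j = a) (k₂ : a + k = c)
      (k₃ : j + k = b) (k₄ : i + b = c) (x : FreeTerm M α i) (y : FreeTerm M β j)
      (z : FreeTerm M γ k) : FreeRel M ζ c ((x.comp g₁ h₁ k₁ y).comp g₂ h₂ k₂ z)
        (x.comp g₄ h₄ k₄ (y.comp g₃ h₃ k₃ z))
  | comp_par {s t u m m' r : ℕ} {g₁ : Graft s t m} {g₂ : Graft m u r}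
      {g₃ : Graft s u m'} {g₄ : Graft m' t r} (hg : Graft.Par g₁ g₂ g₃ g₄)
      {α : O.obj s} {β : O.obj t} {γ : O.obj u} {δ : O.obj m} {ε : O.obj m'} {ζ : O.obj r}
      (h₁ : O.comp g₁ α β ≤ δ) (h₂ : O.comp g₂ δ γ ≤ ζ) (h₃ : O.comp g₃ α γ ≤ ε)
      (h₄ : O.comp g₄ ε β ≤ ζ) {i j k a b c : ℤ} (k₁ : i + j = a) (k₂ : a + k = c)
      (k₃ : i + k = b) (k₄ : b + j = c) (x : FreeTerm M α i) (y : FreeTerm M β j)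
      (z : FreeTerm M γ k) : FreeRel M ζ c ((x.comp g₁ h₁ k₁ y).comp g₂ h₂ k₂ z)
        (((x.comp g₃ h₃ k₃ z).comp g₄ h₄ k₄ y).sgn (j * k))
  | one_comp {r : ℕ} {g : Graft 1 r r} {w : Perm (Fin r)} (hg : g.UnitLeft w)
      {β γ : O.obj r} (h : O.comp g O.one β ≤ γ) (h' : O.act w β ≤ γ) {k : ℤ} (hk : 0 + k = k)
      (b : FreeTerm M β k) : FreeRel M γ k (FreeTerm.one.comp g h hk b) (b.map w h')
  | comp_one {s : ℕ} {g : Graft s 1 s} {w : Perm (Fin s)} (hg : g.UnitRight w)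
      {α γ : O.obj s} (h : O.comp g α O.one ≤ γ) (h' : O.act w α ≤ γ) {k : ℤ} (hk : k + 0 = k)
      (a : FreeTerm M α k) : FreeRel M γ k (a.comp g h hk FreeTerm.one) (a.map w h')

/-- The component `F(M)(α)` of degree `k` of the free `O`-operad. -/
def FreeObj (M : SymDiag O) {r : ℕ} (α : O.obj r) (k : ℤ) : Type :=
  Quot (FreeRel M α k)

namespace FreeObj

variable {M : SymDiag O} {r : ℕ} {α : O.obj r} {k : ℤ}

instance : Zero (FreeObj M α k) := ⟨Quot.mk _ (FreeTerm.zero α k)⟩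

instance : Add (FreeObj M α k) :=
  ⟨Quot.map₂ FreeTerm.add (fun a _ _ h => .add_congr (.refl a) h)
    (fun _ _ b h => .add_congr h (.refl b))⟩

instance : Neg (FreeObj M α k) := ⟨Quot.map FreeTerm.neg (fun _ _ h => .neg_congr h)⟩

instance : AddCommGroup (FreeObj M α k) where
  add_assoc := by rintro ⟨a⟩ ⟨b⟩ ⟨c⟩; exact Quot.sound (.add_assoc a b c)
  add_comm := by rintro ⟨a⟩ ⟨b⟩; exact Quot.sound (.add_comm a b)
  zero_add := by rintro ⟨a⟩; exact Quot.sound (.zero_add a)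
  add_zero := by rintro ⟨a⟩; exact Quot.sound (.trans (.add_comm _ _) (.zero_add a))
  neg_add_cancel := by rintro ⟨a⟩; exact Quot.sound (.neg_add a)
  nsmul := nsmulRec
  zsmul := zsmulRec

/-- The class of a formal operadic expression. -/
def mk (a : FreeTerm M α k) : FreeObj M α k := Quot.mk _ a

theorem mk_sgn (n : ℤ) (a : FreeTerm M α k) : mk (a.sgn n) = (n.negOnePow : ℤ) • mk a := by
  unfold FreeTerm.sgn
  split_ifs with h
  · simp [Int.negOnePow_even n h]
  · rw [Int.negOnePow_odd n (Int.not_even_iff_odd.1 h)]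
    simp only [Units.val_neg, Units.val_one, neg_smul, one_smul]
    rfl

end FreeObj

/-- The free `O`-operad `F(M)` on a graded symmetric `O`-diagram `M`: formal operadic expressions
modulo the axioms of graded `O`-operads. For the one-point operad this is the usual free operad on
a `Σ_*`-object, for the complete graph operad the free `K`-operad. -/
def Free (M : SymDiag O) : GrOperad O where
  obj := FreeObj M
  grp _ _ := inferInstance
  map w h _ := AddMonoidHom.mk' (Quot.map (FreeTerm.map w h) (fun _ _ e => .map_congr w h e))
    (by rintro ⟨a⟩ ⟨b⟩; exact Quot.sound (.map_add w h a b))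
  map_id := by rintro r α h k ⟨x⟩; exact Quot.sound (.map_id h x)
  map_map := by rintro r α β γ v w h h' h'' k ⟨x⟩; exact Quot.sound (.map_map v w h h' h'' x)
  one := Quot.mk _ FreeTerm.one
  comp g h _ _ _ hk := AddMonoidHom.mk' (fun x => AddMonoidHom.mk' (fun y =>
      Quot.map₂ (fun a b => FreeTerm.comp g h hk a b)
        (fun a _ _ e => .comp_congr g h hk (.refl a) e)
        (fun _ _ b e => .comp_congr g h hk e (.refl b)) x y)
      (by rcases x with ⟨x⟩; rintro ⟨a⟩ ⟨b⟩; exact Quot.sound (.comp_add_right g h hk x a b)))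
    (by rintro ⟨a⟩ ⟨b⟩; ext ⟨x⟩; exact Quot.sound (.comp_add_left g h hk a b x))
  comp_map := by
    rintro s t r α α' β β' γ γ' u v w g g' hg hu hv hw h h' i j k hk ⟨a⟩ ⟨b⟩
    exact Quot.sound (.comp_map hg hu hv hw h h' hk a b)
  comp_seq := by
    rintro s t u m m' r g₁ g₂ g₃ g₄ hg α β γ δ ε ζ h₁ h₂ h₃ h₄ i j k a b c k₁ k₂ k₃ k₄ ⟨x⟩ ⟨y⟩ ⟨z⟩
    exact Quot.sound (.comp_seq hg h₁ h₂ h₃ h₄ k₁ k₂ k₃ k₄ x y z)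
  comp_par := by
    rintro s t u m m' r g₁ g₂ g₃ g₄ hg α β γ δ ε ζ h₁ h₂ h₃ h₄ i j k a b c k₁ k₂ k₃ k₄ ⟨x⟩ ⟨y⟩ ⟨z⟩
    refine Eq.trans (Quot.sound (.comp_par hg h₁ h₂ h₃ h₄ k₁ k₂ k₃ k₄ x y z)) ?_
    exact FreeObj.mk_sgn _ _
  one_comp := by
    rintro r g w hg β γ h h' k hk ⟨b⟩
    exact Quot.sound (.one_comp hg h h' hk b)
  comp_one := by
    rintro s g w hg α γ h h' k hk ⟨a⟩
    exact Quot.sound (.comp_one hg h h' hk a)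

namespace Free

/-- The universal morphism `η : M → F(M)`. -/
def gen (M : SymDiag O) : SymDiag.Hom M (Free M).toSymDiag where
  app := AddMonoidHom.mk' (fun x => Quot.mk _ (FreeTerm.gen x))
    (fun x y => Quot.sound (.gen_add x y))
  app_map w h _ x := Quot.sound (.gen_map w h x)

/-- The evaluation of formal operadic expressions in an `O`-operad. -/
def eval {M : SymDiag O} {Q : GrOperad O} (f : SymDiag.Hom M Q.toSymDiag) {r : ℕ} {α : O.obj r}
    {k : ℤ} : FreeTerm M α k → Q.obj α k
  | .gen x => f.app x
  | .one => Q.one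
  | .zero _ _ => 0
  | .add a b => eval f a + eval f b
  | .neg a => - eval f a
  | .map w h a => Q.map w h (eval f a)
  | .comp g h hk a b => Q.comp g h hk (eval f a) (eval f b)

theorem eval_sgn {M : SymDiag O} {Q : GrOperad O} (f : SymDiag.Hom M Q.toSymDiag) {r : ℕ}
    {α : O.obj r} {k : ℤ} (n : ℤ) (a : FreeTerm M α k) :
    eval f (a.sgn n) = (n.negOnePow : ℤ) • eval f a := by
  unfold FreeTerm.sgn
  split_ifs with h
  · simp [Int.negOnePow_even n h]
  · rw [Int.negOnePow_odd n (Int.not_even_iff_odd.1 h)]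
    simp [eval]

theorem eval_rel {M : SymDiag O} {Q : GrOperad O} (f : SymDiag.Hom M Q.toSymDiag) {r : ℕ}
    {α : O.obj r} {k : ℤ} {a b : FreeTerm M α k} (h : FreeRel M α k a b) :
    eval f a = eval f b := by
  induction h with
  | refl => rfl
  | symm _ ih => exact ih.symm
  | trans _ _ ih ih' => exact ih.trans ih'
  | add_congr _ _ ih ih' => simp [eval, ih, ih']
  | neg_congr _ ih => simp [eval, ih]
  | map_congr _ _ _ ih => simp [eval, ih]
  | comp_congr _ _ _ _ _ ih ih' => simp [eval, ih, ih']
  | add_assoc => simp [eval, add_assoc]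
  | add_comm => simp [eval, add_comm]
  | zero_add => simp [eval]
  | neg_add => simp [eval]
  | gen_add => simp [eval]
  | gen_map => simp [eval, f.app_map]
  | map_add => simp [eval]
  | map_id => simp only [eval]; exact Q.map_id _ _
  | map_map => simp only [eval]; exact Q.map_map _ _ _ _ _ _
  | comp_add_left => simp [eval]
  | comp_add_right => simp [eval]
  | comp_map hg hu hv hw h h' hk a b => simp only [eval]; exact Q.comp_map hg _ _ _ _ _ _ _ _
  | comp_seq hg => simp only [eval]; exact Q.comp_seq hg _ _ _ _ _ _ _ _ _ _ _
  | comp_par hg => rw [eval_sgn]; simp only [eval]; exact Q.comp_par hg _ _ _ _ _ _ _ _ _ _ _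
  | one_comp hg => simp only [eval]; exact Q.one_comp hg _ _ _ _
  | comp_one hg => simp only [eval]; exact Q.comp_one hg _ _ _ _

/-- The morphism of `O`-operads `φ_f : F(M) → Q` which extends a morphism of graded symmetric
`O`-diagrams `f : M → Q`. -/
def lift {M : SymDiag O} {Q : GrOperad O} (f : SymDiag.Hom M Q.toSymDiag) :
    GrOperad.Hom (Free M) Q where
  app := AddMonoidHom.mk' (Quot.lift (eval f) (fun _ _ h => eval_rel f h))
    (by rintro ⟨a⟩ ⟨b⟩; rfl)
  app_map := by rintro r α β w h k ⟨x⟩; rfl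
  app_one := rfl
  app_comp := by rintro s t r α β γ g h i j k hk ⟨p⟩ ⟨q⟩; rfl

theorem lift_gen {M : SymDiag O} {Q : GrOperad O} (f : SymDiag.Hom M Q.toSymDiag) {r : ℕ}
    {α : O.obj r} {k : ℤ} (x : M.obj α k) : (lift f).app ((gen M).app x) = f.app x := rfl

/-- Uniqueness of the extension: together with `lift` this is the universal property of `F(M)`. -/
theorem hom_ext {M : SymDiag O} {Q : GrOperad O} (φ ψ : GrOperad.Hom (Free M) Q)
    (h : ∀ {r : ℕ} {α : O.obj r} {k : ℤ} (x : M.obj α k),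
      φ.app ((gen M).app x) = ψ.app ((gen M).app x))
    {r : ℕ} {α : O.obj r} {k : ℤ} (y : (Free M).obj α k) : φ.app y = ψ.app y := by
  have key : ∀ {r : ℕ} {α : O.obj r} {k : ℤ} (a : FreeTerm M α k),
      φ.app (Quot.mk _ a : FreeObj M α k) = ψ.app (Quot.mk _ a : FreeObj M α k) := by
    intro r α k a
    induction a with
    | gen x => exact h x
    | one => exact φ.app_one.trans ψ.app_one.symm
    | zero α k => exact φ.app.map_zero.trans ψ.app.map_zero.symm
    | add a b iha ihb =>
      exact (φ.app.map_add _ _).trans ((congrArg₂ _ iha ihb).trans (ψ.app.map_add _ _).symm)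
    | neg a iha =>
      exact (φ.app.map_neg _).trans ((congrArg _ iha).trans (ψ.app.map_neg _).symm)
    | map w h a iha =>
      exact (φ.app_map w h _).trans ((congrArg _ iha).trans (ψ.app_map w h _).symm)
    | comp g h hk a b iha ihb =>
      refine (φ.app_comp g h hk (Quot.mk _ a) (Quot.mk _ b)).trans
        (Eq.trans ?_ (ψ.app_comp g h hk (Quot.mk _ a) (Quot.mk _ b)).symm)
      rw [iha, ihb]
  rcases y with ⟨a⟩
  exact key a

/-- The morphism `F(f) : F(M) → F(N)` induced by a morphism `f : M → N`. -/
def mapHom {M N : SymDiag O} (f : SymDiag.Hom M N) : GrOperad.Hom (Free M) (Free N) :=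
  lift
    { app := (gen N).app.comp f.app
      app_map := fun w h _ x => by simp [f.app_map, (gen N).app_map] }

/-- The submodule `⨁_{m ≥ 2} F_m(M)(α)` of a free operad on an `M` with `M(0) = M(1) = 0`: it is
spanned by the composites `p ∘ q` of elements `p`, `q` of arity `≥ 2`. -/
def decomposables (M : SymDiag O) {r : ℕ} (α : O.obj r) (k : ℤ) :
    AddSubgroup ((Free M).obj α k) :=
  AddSubgroup.closure {x | ∃ (s t : ℕ) (_ : 2 ≤ s) (_ : 2 ≤ t) (β : O.obj s) (γ : O.obj t)
    (g : Graft s t r) (h : O.comp g β γ ≤ α) (i j : ℤ) (hk : i + j = k)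
    (p : (Free M).obj β i) (q : (Free M).obj γ j), x = (Free M).comp g h hk p q}

/-- The dg-operad `(F(M), d)` is quasi-free: `d` is the sum of the differential of `F(M)` induced by
the internal differential `δ` of `M` and of a derivation `∂` such that `∂(M) ⊂ ⨁_{m ≥ 2} F_m(M)`.
(The difference `∂` of the derivations `d` and `δ` is automatically a derivation, and a derivation
is determined by its restriction to `M`.) -/
def IsQuasiFree {M : SymDiag O} (δ : M.Differential) (d : (Free M).Differential) : Prop :=
  ∀ {r : ℕ} {α : O.obj r} {k : ℤ} (c : M.obj α k),
    d.d ((gen M).app c) - (gen M).app (δ.d c) ∈ decomposables M α (k - 1)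

end Free

end Free

/-! ### Colimits -/

open Classical in
/-- The component of degree `k` of `colim_{κ ∈ S} P(κ)`, for a subposet `S ⊂ O(r)`. -/
def colim {O : PosetOperad} (P : SymDiag O) {r : ℕ} (S : Set (O.obj r)) (k : ℤ) : Type :=
  AddCommGroup.DirectLimit (fun κ : S => P.obj κ.1 k) (fun _ _ h => P.incl h)

open Classical in
noncomputable instance {O : PosetOperad} (P : SymDiag O) {r : ℕ} (S : Set (O.obj r)) (k : ℤ) :
    AddCommGroup (colim P S k) :=
  AddCommGroup.DirectLimit.addCommGroup (fun κ : S => P.obj κ.1 k) (fun _ _ h => P.incl h)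

namespace colim

variable {O : PosetOperad} (P : SymDiag O) {r : ℕ}

open Classical in
/-- The natural morphism `colim_{κ ∈ S} P(κ) → colim_{κ ∈ T} P(κ)` for `S ⊂ T`. -/
noncomputable def transition {S T : Set (O.obj r)} (h : S ⊆ T) (k : ℤ) :
    colim P S k →+ colim P T k :=
  AddCommGroup.DirectLimit.lift (fun κ : S => P.obj κ.1 k) (fun _ _ h => P.incl h) _
    (fun κ => AddCommGroup.DirectLimit.of (fun κ : T => P.obj κ.1 k) (fun _ _ h => P.incl h)
      ⟨κ.1, h κ.2⟩)
    (fun i j hij x => AddCommGroup.DirectLimit.of_f (G := fun κ : T => P.obj κ.1 k)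
      (f := fun _ _ h => P.incl h) (i := ⟨i.1, h i.2⟩) (j := ⟨j.1, h j.2⟩) hij x)

open Classical in
/-- The morphism `colim_{κ ∈ S} P(κ) → Q(r)` induced by a morphism from `P` to a constant operad. -/
noncomputable def desc {P : SymDiag O} {Q : GrOperad ptOperad}
    (f : SymDiag.Hom P (GrOperad.const O Q).toSymDiag) (S : Set (O.obj r)) (k : ℤ) :
    colim P S k →+ Q.obj (pt r) k :=
  AddCommGroup.DirectLimit.lift (fun κ : S => P.obj κ.1 k) (fun _ _ h => P.incl h)
    (Q.obj (pt r) k) (fun κ => f.app (α := κ.1) (k := k))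
    (fun i j hij x => (f.app_map (α := i.1) (β := j.1) 1 (by rw [O.act_one]; exact hij) x).trans
      (Q.map_id (α := pt r) (le_refl _) _))

end colim

/-! ### The dual of the Barratt-Eccles operad -/

instance {r : ℕ} (σ : Perm (Fin r)) (i j : Fin r) : Decidable (Precedes σ i j) :=
  inferInstanceAs (Decidable (_ < _))

/-- The number of variations of a sequence of permutations `(w_0, …, w_d)` on the pair `{i, j}`: the
number of indices `k` such that `w_k|_{ij} ≠ w_{k+1}|_{ij}`. -/
def variations {r : ℕ} (i j : Fin r) : List (Perm (Fin r)) → ℕ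
  | u :: v :: l => (if Precedes u i j ↔ Precedes v i j then 0 else 1) + variations i j (v :: l)
  | _ => 0

/-- `i` occurs before `j` in the last permutation `w_d` of a sequence `(w_0, …, w_d)`. -/
def LastPrecedes {r : ℕ} (l : List (Perm (Fin r))) (i j : Fin r) : Prop :=
  ∃ u ∈ l.getLast?, Precedes u i j

/-- `Cell n k l`: the sequence `l = (w_0, …, w_d)` is one of the nondegenerate simplices which span
the module `E_n(r)`, `r ≥ 2` (the number of variations is `< n` on every pair), and the dual
generator has degree `k = n (r - 1) - d - 1` in `Σ⁻¹ D_n(r)`, where `D_n = Λ⁻ⁿ E_n^∨`. -/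
structure Cell (n : ℕ) (k : ℤ) {r : ℕ} (l : List (Perm (Fin r))) : Prop where
  two_le : 2 ≤ r
  ne_nil : l ≠ []
  chain : l.IsChain (· ≠ ·)
  var_lt : ∀ i j, i ≠ j → variations i j l < n
  deg : (n : ℤ) * ((r : ℤ) - 1) - l.length = k

/-- The condition which defines the submodule `D_n(κ) ⊂ D_n(r)`, `κ = (μ, σ)`: the oriented weight
system `κ(w)` of a simplex `w = (w_0, …, w_d)`, formed by the numbers of variations and by the last
permutation `w_d`, satisfies `κ(w) ≥ κ^∨`, where `κ^∨ = (n - 1 - μ, σ)`. -/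
def DualLE (n : ℕ) {r : ℕ} (κ : OWS r) (l : List (Perm (Fin r))) : Prop :=
  ∀ i j, i ≠ j → (n : ℤ) - 1 - κ.wt i j < variations i j l ∨
    ((n : ℤ) - 1 - κ.wt i j = variations i j l ∧ (Precedes κ.perm i j ↔ LastPrecedes l i j))

theorem variations_map {r : ℕ} (w : Perm (Fin r)) (i j : Fin r) (l : List (Perm (Fin r))) :
    variations i j (l.map (w * ·)) = variations (w.symm i) (w.symm j) l := by
  induction l with
  | nil => rfl
  | cons u l ih =>
    cases l with
    | nil => rfl
    | cons v l =>
      simp only [List.map_cons] at ih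
      simp only [List.map_cons, variations, ih, precedes_mul]

theorem lastPrecedes_map {r : ℕ} (w : Perm (Fin r)) (i j : Fin r) (l : List (Perm (Fin r))) :
    LastPrecedes (l.map (w * ·)) i j ↔ LastPrecedes l (w.symm i) (w.symm j) := by
  simp [LastPrecedes, List.getLast?_map, precedes_mul]

theorem Cell.map {n : ℕ} {k : ℤ} {r : ℕ} {l : List (Perm (Fin r))} (h : Cell n k l)
    (w : Perm (Fin r)) : Cell n k (l.map (w * ·)) where
  two_le := h.two_le
  ne_nil := by simpa using h.ne_nil
  chain := by
    rw [List.isChain_map]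
    exact h.chain.imp (fun a b hab => by simpa using hab)
  var_lt i j hij := by
    rw [variations_map]
    exact h.var_lt _ _ (fun h' => hij (w.symm.injective h'))
  deg := by simpa using h.deg

theorem map_map_inv {r : ℕ} (w : Perm (Fin r)) (l : List (Perm (Fin r))) :
    (l.map (w⁻¹ * ·)).map (w * ·) = l := by
  simp [List.map_map, Function.comp_def]

theorem Cell.map_iff {n : ℕ} {k : ℤ} {r : ℕ} {l : List (Perm (Fin r))} (w : Perm (Fin r)) :
    Cell n k (l.map (w⁻¹ * ·)) ↔ Cell n k l :=
  ⟨fun h => by simpa only [map_map_inv] using h.map w, fun h => h.map w⁻¹⟩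

theorem DualLE.map {n : ℕ} {r : ℕ} {κ κ' : OWS r} {l : List (Perm (Fin r))} (h : DualLE n κ l)
    (w : Perm (Fin r)) (hw : OWS.act w κ ≤ κ') : DualLE n κ' (l.map (w * ·)) := by
  intro i j hij
  have h1 := h (w.symm i) (w.symm j) (fun h' => hij (w.symm.injective h'))
  have h2 := hw i j hij
  rw [variations_map, lastPrecedes_map]
  simp only [OWS.act, precedes_mul] at h2
  rcases h2 with h2 | ⟨h2, h3⟩
  · left
    rcases h1 with h1 | h1 <;> omega
  · rw [← h2, ← h3]
    exact h1

/-- The signed sum `∑_i (-1)^i c(w_0, …, ŵ_i, …, w_d)`. -/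
def bd {A : Type} : List A → (List A → ℤ) → ℤ
  | [], _ => 0
  | a :: l, c => c l - bd l (fun m => c (a :: m))

theorem bd_eq_sum {A : Type} (l : List A) (c : List A → ℤ) :
    bd l c = ∑ i ∈ Finset.range l.length, (-1) ^ i * c (l.eraseIdx i) := by
  induction l generalizing c with
  | nil => rfl
  | cons a l ih =>
    rw [bd, ih, List.length_cons, Finset.sum_range_succ']
    simp only [List.eraseIdx_cons_succ, List.eraseIdx_cons_zero, pow_succ, pow_zero, one_mul,
      mul_neg, mul_one, neg_mul, Finset.sum_neg_distrib]
    ring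

theorem bd_zero {A : Type} (l : List A) (c : List A → ℤ) (h : ∀ m, c m = 0) : bd l c = 0 := by
  simp [bd_eq_sum, h]

theorem bd_add {A : Type} (l : List A) (c c' : List A → ℤ) :
    bd l (fun m => c m + c' m) = bd l c + bd l c' := by
  simp [bd_eq_sum, mul_add, Finset.sum_add_distrib]

theorem bd_sub {A : Type} (l : List A) (c c' : List A → ℤ) :
    bd l (fun m => c m - c' m) = bd l c - bd l c' := by
  simp [bd_eq_sum, mul_sub, Finset.sum_sub_distrib]

theorem bd_mul {A : Type} (l : List A) (s : ℤ) (c : List A → ℤ) :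
    bd l (fun m => s * c m) = s * bd l c := by
  simp only [bd_eq_sum, Finset.mul_sum]
  exact Finset.sum_congr rfl (fun _ _ => by ring)

theorem bd_map {A B : Type} (f : A → B) (l : List A) (c : List B → ℤ) :
    bd (l.map f) c = bd l (fun m => c (m.map f)) := by
  induction l generalizing c with
  | nil => rfl
  | cons a l ih => simp [bd, ih]

theorem bd_bd {A : Type} (l : List A) (c : List A → ℤ) : bd l (fun m => bd m c) = 0 := by
  induction l generalizing c with
  | nil => rfl
  | cons a l ih => simp [bd, bd_sub, ih]

theorem bd_degenerate {A : Type} (l : List A) (c : List A → ℤ)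
    (hc : ∀ m, ¬ m.IsChain (· ≠ ·) → c m = 0) (hl : ¬ l.IsChain (· ≠ ·)) : bd l c = 0 := by
  induction l generalizing c with
  | nil => rfl
  | cons a l ih =>
    have hc' : ∀ m, ¬ m.IsChain (· ≠ ·) → c (a :: m) = 0 :=
      fun m hm => hc _ (fun h => hm h.tail)
    by_cases h : l.IsChain (· ≠ ·)
    · cases l with
      | nil => simp at hl
      | cons b l =>
        have hab : a = b := by
          by_contra hab
          exact hl (List.isChain_cons_cons.2 ⟨hab, h⟩)
        subst hab
        rw [bd, bd, bd_zero l _ (fun m => hc _ (by simp))]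
        simp
    · rw [bd, hc l h, ih _ hc' h, sub_zero]

theorem variations_eraseIdx {r : ℕ} (i j : Fin r) (l : List (Perm (Fin r))) (k : ℕ)
    (hk : k < l.length) (hl : l.eraseIdx k ≠ []) :
    variations i j (l.eraseIdx k) < variations i j l ∨
      (variations i j (l.eraseIdx k) = variations i j l ∧
        (LastPrecedes (l.eraseIdx k) i j ↔ LastPrecedes l i j)) := by
  induction l generalizing k with
  | nil => simp at hk
  | cons u l ih =>
    cases l with
    | nil => simp_all
    | cons v l =>
      rcases k with _ | k
      · simp only [List.eraseIdx_cons_zero, variations, LastPrecedes, List.getLast?_cons_cons]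
        split_ifs <;> simp
      · rcases k with _ | k
        · cases l with
          | nil =>
            by_cases h : Precedes u i j ↔ Precedes v i j <;>
              simp [variations, LastPrecedes, h]
          | cons w l =>
            simp only [List.eraseIdx_cons_succ, List.eraseIdx_cons_zero, variations, LastPrecedes,
              List.getLast?_cons_cons, iff_self, and_true]
            split_ifs <;> first | omega | tauto
        · have := ih (k + 1) (by simpa using hk) (by simp)
          simp only [List.eraseIdx_cons_succ, variations, LastPrecedes,
            List.getLast?_cons_cons] at this ⊢
          exact this.imp (fun h => by omega) (fun h => ⟨by omega, h.2⟩)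

/-- The integer valued functions on the sequences of permutations which vanish on the sequences
which do not satisfy a condition `S`. -/
def cochains {r : ℕ} (S : List (Perm (Fin r)) → Prop) : AddSubgroup (List (Perm (Fin r)) → ℤ) where
  carrier := {c | ∀ l, c l ≠ 0 → S l}
  zero_mem' l h := absurd rfl h
  add_mem' {a b} ha hb l h := by
    by_cases h' : a l = 0
    · exact hb l (fun h'' => h (by simp [h', h'']))
    · exact ha l h'
  neg_mem' {a} ha l h := ha l (by simpa using h)

/-- A family of conditions on the simplices of the modules `E_n(r)`, indexed by the elements of
`O(r)`, which determines a diagram of submodules of `Σ⁻¹ D_n(r)`. -/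
structure CellSystem (O : PosetOperad) (n : ℕ) where
  mem : ∀ {r : ℕ}, O.obj r → List (Perm (Fin r)) → Prop
  map_mem : ∀ {r : ℕ} {α β : O.obj r} (w : Perm (Fin r)), O.act w α ≤ β →
    ∀ l, mem α l → mem β (l.map (w * ·))
  erase_mem : ∀ {r : ℕ} {α : O.obj r} (l : List (Perm (Fin r))) (i : ℕ), i < l.length →
    l.eraseIdx i ≠ [] → mem α (l.eraseIdx i) → mem α l

namespace CellSystem

variable {O : PosetOperad} {n : ℕ} (S : CellSystem O n)

/-- The cochains of degree `k` on the simplices which satisfy the condition associated to `α`. -/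
abbrev Cochains {r : ℕ} (α : O.obj r) (k : ℤ) : AddSubgroup (List (Perm (Fin r)) → ℤ) :=
  cochains (fun l => Cell n k l ∧ S.mem α l)

/-- The action `(w c)(w_0, …, w_d) = sgn(w)ⁿ c(w⁻¹ w_0, …, w⁻¹ w_d)` of permutations. -/
def act {r : ℕ} {α β : O.obj r} (w : Perm (Fin r)) (h : O.act w α ≤ β) {k : ℤ} :
    S.Cochains α k →+ S.Cochains β k :=
  AddMonoidHom.mk'
    (fun c => ⟨fun l => (Equiv.Perm.sign w : ℤ) ^ n * c.1 (l.map (w⁻¹ * ·)), fun l hl => by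
      have h1 := c.2 _ (right_ne_zero_of_mul hl)
      refine ⟨(Cell.map_iff w).1 h1.1, ?_⟩
      simpa only [map_map_inv] using S.map_mem w h _ h1.2⟩)
    (fun a b => Subtype.ext (by ext l; simp [mul_add]))

theorem act_apply {r : ℕ} {α β : O.obj r} (w : Perm (Fin r)) (h : O.act w α ≤ β) {k : ℤ}
    (c : S.Cochains α k) (l : List (Perm (Fin r))) :
    (S.act w h c).1 l = (Equiv.Perm.sign w : ℤ) ^ n * c.1 (l.map (w⁻¹ * ·)) := rfl

open Classical in
/-- The differential induced by the differential of the Barratt-Eccles operad. -/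
noncomputable def dif {r : ℕ} {α : O.obj r} {k : ℤ} : S.Cochains α k →+ S.Cochains α (k - 1) :=
  AddMonoidHom.mk'
    (fun c => ⟨fun l => if Cell n (k - 1) l then (-1) ^ (l.length + 1) * bd l c.1 else 0,
      fun l hl => by
        simp only [ne_eq, ite_eq_right_iff, not_forall] at hl
        obtain ⟨h, hl⟩ := hl
        refine ⟨h, ?_⟩
        have hl := right_ne_zero_of_mul hl
        rw [bd_eq_sum] at hl
        obtain ⟨i, hi, hl⟩ := Finset.exists_ne_zero_of_sum_ne_zero hl
        have h1 := c.2 _ (right_ne_zero_of_mul hl)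
        exact S.erase_mem l i (Finset.mem_range.1 hi) h1.1.ne_nil h1.2⟩)
    (fun a b => Subtype.ext (by
      ext l
      have h1 := bd_add l a.1 b.1
      have h2 : (a + b).1 = fun m => a.1 m + b.1 m := rfl
      simp only [AddSubgroup.coe_add, Pi.add_apply] at h2 ⊢
      rw [h2, h1]
      split_ifs <;> ring))

open Classical in
theorem dif_apply {r : ℕ} {α : O.obj r} {k : ℤ} (c : S.Cochains α k) (l : List (Perm (Fin r))) :
    (S.dif c).1 l = if Cell n (k - 1) l then (-1) ^ (l.length + 1) * bd l c.1 else 0 := rfl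

theorem dif_dif {r : ℕ} {α : O.obj r} {k : ℤ} (c : S.Cochains α k) : S.dif (S.dif c) = 0 := by
  refine Subtype.ext (funext fun l => ?_)
  rw [dif_apply]
  split_ifs with h
  · suffices bd l (S.dif c).1 = (-1) ^ l.length * bd l (fun m => bd m c.1) by
      rw [this, bd_bd]; simp
    rw [← bd_mul, bd_eq_sum, bd_eq_sum]
    refine Finset.sum_congr rfl (fun i hi => ?_)
    congr 1
    have hi := Finset.mem_range.1 hi
    rw [dif_apply]
    have hlen : (l.eraseIdx i).length + 1 = l.length := by
      rw [List.length_eraseIdx_of_lt hi]; omega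
    split_ifs with h1
    · rw [hlen]
    · by_cases h2 : l.eraseIdx i = []
      · rw [h2]; simp [bd]
      · by_cases h3 : (l.eraseIdx i).IsChain (· ≠ ·)
        · refine absurd ⟨h.two_le, h2, h3, fun a b hab => ?_, ?_⟩ h1
          · have h4 := variations_eraseIdx a b l i hi h2
            have h5 := h.var_lt a b hab
            omega
          · have h4 := h.deg
            have h5 : ((l.eraseIdx i).length : ℤ) + 1 = l.length := by exact_mod_cast hlen
            omega
        · rw [bd_degenerate _ _ (fun m hm => ?_) h3, mul_zero]
          by_contra h4
          exact hm (c.2 _ h4).1.chain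
  · rfl

theorem dif_act {r : ℕ} {α β : O.obj r} (w : Perm (Fin r)) (h : O.act w α ≤ β) {k : ℤ}
    (c : S.Cochains α k) : S.dif (S.act w h c) = S.act w h (S.dif c) := by
  refine Subtype.ext (funext fun l => ?_)
  have h1 : (S.act w h c).1 = fun m => (Equiv.Perm.sign w : ℤ) ^ n * c.1 (m.map (w⁻¹ * ·)) := rfl
  rw [act_apply, dif_apply, dif_apply, h1, bd_mul, bd_map, List.length_map]
  by_cases h2 : Cell n (k - 1) l
  · rw [if_pos h2, if_pos ((Cell.map_iff w).2 h2)]; ring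
  · rw [if_neg h2, if_neg (fun h3 => h2 ((Cell.map_iff w).1 h3)), mul_zero]

/-- The diagram formed by the modules of cochains. -/
def diag : SymDiag O where
  obj α k := S.Cochains α k
  grp _ _ := inferInstance
  map w h := S.act w h
  map_id h k x := Subtype.ext (funext fun l => by simp [act_apply])
  map_map v w h h' h'' k x := Subtype.ext (funext fun l => by
    simp only [act_apply, List.map_map, map_mul, Units.val_mul, mul_pow, mul_inv_rev,
      Function.comp_def, mul_assoc])

/-- The diagram of cochains forms a diagram of dg-modules. -/
noncomputable def differential : S.diag.Differential where
  d := S.dif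
  d_d := S.dif_dif
  d_map := S.dif_act

end CellSystem

/-- The condition satisfied by all simplices. -/
def cellSystem (n : ℕ) : CellSystem ptOperad n where
  mem _ _ := True
  map_mem _ _ _ _ := trivial
  erase_mem _ _ _ _ _ := trivial

/-- The graded `Σ_*`-object `Σ⁻¹ D_n` which generates the cobar construction, where `D_n = Λ⁻ⁿ E_n^∨`
is the `n`-fold operadic desuspension of the dual of the `n`th layer of the Barratt-Eccles operad (reduced
to its augmentation coideal, which is null in arity `0` and `1`). -/
def D (n : ℕ) : SymDiag ptOperad := (cellSystem n).diag

/-- The conditions which define the submodules `D_n(κ) ⊂ D_n(r)`. -/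
noncomputable def cellSystemK (n : ℕ) : CellSystem completeGraphOperad n where
  mem κ l := DualLE n κ l
  map_mem w h l hl := DualLE.map hl w h
  erase_mem l i hi hl h a b hab := by
    have h1 := h a b hab
    have h2 := variations_eraseIdx a b l i hi hl
    rcases h2 with h2 | ⟨h2, h3⟩
    · left
      rcases h1 with h1 | h1 <;> omega
    · rw [← h2, ← h3]
      exact h1

/-- The symmetric `K`-diagram `κ ↦ Σ⁻¹ D_n(κ)`. -/
noncomputable def DK (n : ℕ) : SymDiag completeGraphOperad := (cellSystemK n).diag

/-- The internal differential of `Σ⁻¹ D_n`. -/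
noncomputable def δ (n : ℕ) : (D n).Differential := (cellSystem n).differential

/-- The internal differential of the symmetric `K`-diagram `Σ⁻¹ D_n(κ)`. -/
noncomputable def δK (n : ℕ) : (DK n).Differential := (cellSystemK n).differential

/-- The inclusion `Σ⁻¹ D_n(κ) ⊂ Σ⁻¹ D_n(r)`. -/
noncomputable def inclusion (n : ℕ) {r : ℕ} {κ : completeGraphOperad.obj r} {k : ℤ} :
    (DK n).obj κ k →+ (D n).obj (pt r) k :=
  AddMonoidHom.mk' (fun c : (cellSystemK n).Cochains κ k =>
    (⟨c.1, fun l hl => ⟨(c.2 l hl).1, trivial⟩⟩ : (cellSystem n).Cochains (pt r) k))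
    (fun _ _ => rfl)

/-- The morphism from the free `K`-operad on `Σ⁻¹ D_n(κ)` to the (constant) free operad on `Σ⁻¹ D_n`
which is induced by the inclusions `D_n(κ) ⊂ D_n(r)`. -/
noncomputable def ι (n : ℕ) : GrOperad.Hom (Free (DK n)) (GrOperad.const completeGraphOperad (Free (D n))) :=
  Free.lift
    { app := fun {r _ _} => ((Free.gen (D n)).app (α := pt r)).comp (inclusion n)
      app_map := fun {r _ _} w _ _ x =>
        (Free.gen (D n)).app_map (α := pt r) (β := pt r) w (le_refl _) (inclusion n x) }

/-! ### The twisting derivation of the cobar construction -/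

/-- The terms of the shuffle (Eilenberg-Zilber) product of two simplices `u` and `v`, with their signs:
the sequences `(f(u_{i_0}, v_{j_0}), f(u_{i_1}, v_{j_1}), …)`, where `(i_k, j_k)` ranges over the
paths from `(0, 0)` to `(d, e)` which increase one index by one at each step. -/
def shuffles {A B C : Type} (f : A → B → C) : List A → List B → List (ℤ × List C)
  | [], _ => []
  | _, [] => []
  | a :: u, b :: v =>
    if u = [] ∧ v = [] then [(1, [f a b])]
    else (shuffles f u (b :: v)).map (fun x => (x.1, f a b :: x.2)) ++
      (shuffles f (a :: u) v).map (fun x => ((-1) ^ u.length * x.1, f a b :: x.2))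
termination_by u v => u.length + v.length

/-- The value of a cochain on the composite `u ∘ v` of the Barratt-Eccles operad. -/
noncomputable def evalComp {s t r : ℕ} (g : Graft s t r) (u : List (Perm (Fin s)))
    (v : List (Perm (Fin t))) (c : List (Perm (Fin r)) → ℤ) : ℤ :=
  ((shuffles (permComp g) u v).map (fun x => x.1 * c x.2)).sum

open Classical in
/-- The generator of `Σ⁻¹ D_n(s)` dual to a simplex `l` (zero if the degree of `l` is not `k`). -/
noncomputable def dualBasis (n : ℕ) {s : ℕ} (k : ℤ) (l : List (Perm (Fin s))) :
    (D n).obj (pt s) k :=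
  if h : Cell n k l then
    (⟨Pi.single l 1, fun m hm => by
      obtain rfl : m = l := by
        by_contra h'
        exact hm (Pi.single_eq_of_ne h' _)
      exact ⟨h, trivial⟩⟩ : (cellSystem n).Cochains (pt s) k)
  else 0

/-- The sign of the operadic suspension `Λⁿ` on a composite: `ℓ_s ∘_e ℓ_t = (-1)^{n (s-e) (t-1)} ℓ_r`
for the standard partial composites `∘_e`, `e = 1, …, s`, where `ℓ_r` is the generator of `Λⁿ(r)`,
on which permutations act by `sgnⁿ`. The permutation `permComp g 1 1` compares the input sharing with
the standard one. -/
noncomputable def suspSign (n : ℕ) {s t r : ℕ} (g : Graft s t r) : ℤ :=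
  ((Equiv.Perm.sign (permComp g 1 1) : ℤ) *
    ((((s : ℤ) - 1 - (g.e : ℕ)) * ((t : ℤ) - 1)).negOnePow : ℤ)) ^ n

/-- The coefficient of `u^∨ ∘_g v^∨` in `∂(c)`: up to the sign, which gathers the sign of `Λⁿ` and the
signs produced by the permutations of homogeneous symbols, it is the value of `c` on `u ∘_g v`. -/
noncomputable def twistCoeff (n : ℕ) {s t r : ℕ} (g : Graft s t r) (u : List (Perm (Fin s)))
    (v : List (Perm (Fin t))) (c : List (Perm (Fin r)) → ℤ) : ℤ :=
  -(((((u.length : ℤ) - 1 - n * ((s : ℤ) - 1)) * ((v.length : ℤ) - n * ((t : ℤ) - 1))).negOnePow : ℤ)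
    * suspSign n g * ((((u.length : ℤ) - 1) * n * ((t : ℤ) - 1)).negOnePow : ℤ) * evalComp g u v c)

/-- The value of an element of `Σ⁻¹ D_n(r)` on a sequence of permutations. -/
def value {n r : ℕ} {k : ℤ} (c : (D n).obj (pt r) k) (l : List (Perm (Fin r))) : ℤ :=
  (show (cellSystem n).Cochains (pt r) k from c).1 l

open Classical in
/-- The twisting homomorphism `∂ : Σ⁻¹ D_n → F_2(Σ⁻¹ D_n)` of the cobar construction, which is determined by
the coproducts of the cooperad `D_n`: the sum of the terms `± c(u ∘_g v) u^∨ ∘_g v^∨` over the isomorphism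
classes of trees with two vertices of arities `s, t ≥ 2`, and over the simplices `u` and `v` (of
any lengths `p` and `q`, which are bounded by the length of the simplices on which `c` lives). -/
noncomputable def cobarTwist (n : ℕ) {r : ℕ} {k : ℤ} (c : (D n).obj (pt r) k) :
    (Free (D n)).obj (pt r) (k - 1) :=
  ∑ s ∈ Finset.Icc 2 r, ∑ t ∈ Finset.Icc 2 r, ∑ g : Graft s t r,
    if g.IsStd then
      ∑ p ∈ Finset.range (((n : ℤ) * ((r : ℤ) - 1) - k).toNat + 1),
      ∑ q ∈ Finset.range (((n : ℤ) * ((r : ℤ) - 1) - k).toNat + 1),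
      ∑ u : Fin p → Perm (Fin s), ∑ v : Fin q → Perm (Fin t),
        if h : ((n : ℤ) * ((s : ℤ) - 1) - p) + ((n : ℤ) * ((t : ℤ) - 1) - q) = k - 1 then
          twistCoeff n g (List.ofFn u) (List.ofFn v) (value c) •
            (Free (D n)).comp (α := pt s) (β := pt t) (γ := pt r) g (le_refl _) h
              ((Free.gen (D n)).app (dualBasis n _ (List.ofFn u)))
              ((Free.gen (D n)).app (dualBasis n _ (List.ofFn v)))
        else 0
    else 0

/-- `(F(Σ⁻¹ D_n), d)` is the cobar construction `B^c(D_n)`: the differential `d` is the sum of the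
internal differential and of the derivation which extends the twisting homomorphism. -/
def IsCobar (n : ℕ) (d : (Free (D n)).Differential) : Prop :=
  ∀ {r : ℕ} {k : ℤ} (c : (D n).obj (pt r) k),
    d.d ((Free.gen (D n)).app c) = (Free.gen (D n)).app ((δ n).d c) + cobarTwist n c

/-! ### The suspension morphisms -/

open Classical in
/-- The value of the cochain `sgn` of degree `r - 1` on the front face of a simplex: the signature of
`(w_0(1), …, w_{r-1}(1))` if this sequence is a permutation of `(1, …, r)`, and `0` otherwise. -/
noncomputable def frontSgn {r : ℕ} (l : List (Perm (Fin r))) : ℤ :=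
  if h : ∃ τ : Perm (Fin r), ∀ i : Fin r, ∃ u ∈ l[(i : ℕ)]?, τ i = u ⟨0, i.pos⟩ then
    (Equiv.Perm.sign h.choose : ℤ)
  else 0

open Classical in
/-- The morphism `σ^* : D_n → D_{n+1}` is dual to the suspension morphism `w ↦ sgn ∩ w` of the
Barratt-Eccles operad, where `sgn ∩ (w_0, …, w_d) = sgn(w_0, …, w_{r-1}) (w_{r-1}, …, w_d)`. The sign
`(-1)^{(n+1) (r-1) (r-2) / 2}` is that of the isomorphisms `Λⁿ⁺¹ Λ⁻¹ ≅ Λⁿ`. -/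
def IsSuspension (n : ℕ) (S : SymDiag.Hom (D n) (D (n + 1))) : Prop :=
  ∀ {r : ℕ} {k : ℤ} (c : (D n).obj (pt r) k) (l : List (Perm (Fin r))),
    value (S.app c) l =
      if Cell (n + 1) k l then
        (-1) ^ ((n + 1) * ((r - 1) * (r - 2) / 2)) * frontSgn l * value c (l.drop (r - 1))
      else 0

/-- A morphism of graded diagrams (respectively, of graded operads) which commutes with
differentials. -/
def PreservesDifferentials {O : PosetOperad} {M N : SymDiag O} (f : SymDiag.Hom M N)
    (d : M.Differential) (d' : N.Differential) : Prop :=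
  ∀ {r : ℕ} {α : O.obj r} {k : ℤ} (x : M.obj α k), f.app (d.d x) = d'.d (f.app x)

end KCobar

open KCobar

namespace KCobar

/-! The key fact is that each simplex `w` of `E_n(r)` has a smallest index. Its dual generator lies
in `D_n(κ)` exactly when `κ` is above the oriented weight system `cellOWS` with weights `n - 1 -
μ_ij(w)` and permutation the last vertex of `w` (`dualLE_iff`). These smallest indices are
compatible with permutations, and every term of a composite `u ∘ v` has as smallest index the
composite of those of `u` and `v` (`IsShuffle.cellOWS_eq`).

Two consequences follow for the free operads, before any differential is considered. The direct sums
over all `κ` of the components of `F(D_n(κ))` form an ordinary operad, and `toTotal` maps `F(D_n)`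
to it by placing each dual generator at its smallest index. For `a` in `F(D_n(κ))`, the image of `ι
a` is a decomposition of `a` into pieces of indices `≤ κ` (`adapted_toTotal`). Hence `ι` is
injective on each component (`ι_injective`), and sending the pieces to a colimit gives a left
inverse of the map from the colimit to `F(D_n)(r)` (`desc_injective`). Surjectivity holds because
the smallest indices lie in `K_n`, and `K_m` is a suboperad containing `K_n` when `n ≤ m`
(`mem_layerSpan`).

The differential is constructed on `F(D_n)`. A derivation is a morphism to an operad of dual
numbers, so it is freely determined on generators, and `d² = 0` only has to be checked there. The
internal differential anticommutes with the twist because the shuffle product is a chain map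
(`twistAt_δ`). The square of the twist is a sum over trees with three vertices, each of which occurs
twice with opposite signs (`twistLeft_seq`, `twistLeft_par`); a tree is encoded by the two sets of
inputs above its inner edges, which are nested or disjoint, and this makes the cancellation an
exchange of two subsets (`sum_twistLeft_add_sum_twistRight`). Since smallest indices are
multiplicative, the twist of an element of `D_n(κ)` consists of composites that exist over `κ`
(`cobarTwist_mem`). By injectivity of `ι`, all identities for the `K`-operad are inherited from
`F(D_n)`.

The suspension is dual to the cap product with the cochain `sgn`. This is a cocycle because a
determinant with linearly dependent columns vanishes (`bd_sgnL`). If `sgn` is nonzero on a front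
face, each pair is ordered in both ways along it, so the back face has strictly fewer variations
(`variations_drop_lt`); this gives the passage from `n` to `n + 1`, also for the conditions attached
to `κ`. Compatibility with the twist amounts to `shEval_frontSgn`: labels of a front face must be
distinct and complete, which forces the front part of the lattice path in a shuffle product
(`FrontData.phase_eq`). -/

theorem negOnePow_congr {a b : ℤ} (h : Even (a - b)) :
    (a.negOnePow : ℤ) = (b.negOnePow : ℤ) := by
  rw [(Int.negOnePow_eq_iff a b).2 h]

/-! ### Derivations of free operads -/

namespace Free

variable {O : PosetOperad}

/-- Induction on the elements of a free operad. -/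
theorem induction {M : SymDiag O}
    {motive : ∀ {r : ℕ} {α : O.obj r} {k : ℤ}, (Free M).obj α k → Prop}
    (gen : ∀ {r : ℕ} {α : O.obj r} {k : ℤ} (x : M.obj α k), motive ((gen M).app x))
    (one : motive (Free M).one)
    (zero : ∀ {r : ℕ} (α : O.obj r) (k : ℤ), motive (0 : (Free M).obj α k))
    (add : ∀ {r : ℕ} {α : O.obj r} {k : ℤ} (x y : (Free M).obj α k),
      motive x → motive y → motive (x + y))
    (neg : ∀ {r : ℕ} {α : O.obj r} {k : ℤ} (x : (Free M).obj α k), motive x → motive (-x))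
    (map : ∀ {r : ℕ} {α β : O.obj r} (w : Perm (Fin r)) (h : O.act w α ≤ β) {k : ℤ}
      (x : (Free M).obj α k), motive x → motive ((Free M).map w h x))
    (comp : ∀ {s t r : ℕ} {α : O.obj s} {β : O.obj t} {γ : O.obj r} (g : Graft s t r)
      (h : O.comp g α β ≤ γ) {i j k : ℤ} (hk : i + j = k) (x : (Free M).obj α i)
      (y : (Free M).obj β j), motive x → motive y → motive ((Free M).comp g h hk x y))
    {r : ℕ} {α : O.obj r} {k : ℤ} (x : (Free M).obj α k) : motive x := by
  have key : ∀ {r : ℕ} {α : O.obj r} {k : ℤ} (a : FreeTerm M α k),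
      motive (r := r) (α := α) (k := k) (Quot.mk _ a : FreeObj M α k) := by
    intro r α k a
    induction a with
    | gen x => exact gen x
    | one => exact one
    | zero α k => exact zero α k
    | add a b iha ihb => exact add _ _ iha ihb
    | neg a iha => exact neg _ iha
    | map w h a iha => exact map w h _ iha
    | comp g h hk a b iha ihb => exact comp g h hk _ _ iha ihb
  rcases x with ⟨a⟩
  exact key a

end Free

namespace GrOperad

variable {O : PosetOperad}

/-- The operad of the pairs `(p, p')` thought of as `p + ε p'` with `ε² = 0`, where `ε` has
degree `1`: a derivation `d` corresponds to a morphism `p ↦ (p, d p)`. -/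
def dual (P : GrOperad O) : GrOperad O where
  obj α k := P.obj α k × P.obj α (k - 1)
  grp _ _ := inferInstance
  map w h _ := (P.map w h).prodMap (P.map w h)
  map_id h _ x := Prod.ext (P.map_id h _) (P.map_id h _)
  map_map v w h h' h'' _ x := Prod.ext (P.map_map v w h h' h'' _) (P.map_map v w h h' h'' _)
  one := (P.one, 0)
  comp g h i j k hk := AddMonoidHom.mk' (fun p => AddMonoidHom.mk' (fun q =>
      (P.comp g h hk p.1 q.1, P.comp g h (show (i - 1) + j = k - 1 by omega) p.2 q.1 +
        (i.negOnePow : ℤ) • P.comp g h (show i + (j - 1) = k - 1 by omega) p.1 q.2))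
      (fun q q' => Prod.ext (by simp) (by simp; abel)))
    (fun p p' => by ext q <;> simp; abel)
  comp_map hg hu hv hw h h' i j k hk p q := by
    refine Prod.ext (P.comp_map hg hu hv hw h h' hk _ _) ?_
    simp only [AddMonoidHom.mk'_apply, AddMonoidHom.coe_prodMap, Prod.map_fst, Prod.map_snd,
      map_add, map_zsmul]
    rw [P.comp_map hg hu hv hw h h', P.comp_map hg hu hv hw h h']
  comp_seq hg α β γ δ ε ζ h₁ h₂ h₃ h₄ i j k a b c k₁ k₂ k₃ k₄ p q z := by
    refine Prod.ext (P.comp_seq hg h₁ h₂ h₃ h₄ k₁ k₂ k₃ k₄ _ _ _) ?_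
    simp only [AddMonoidHom.mk'_apply, map_add, map_zsmul, AddMonoidHom.add_apply,
      AddMonoidHom.smul_apply]
    rw [P.comp_seq hg h₁ h₂ h₃ h₄ (show (i - 1) + j = a - 1 by omega) _ k₃ (by omega),
      P.comp_seq hg h₁ h₂ h₃ h₄ (show i + (j - 1) = a - 1 by omega) _
        (show (j - 1) + k = b - 1 by omega) (by omega),
      P.comp_seq hg h₁ h₂ h₃ h₄ k₁ _ (show j + (k - 1) = b - 1 by omega) (by omega)]
    subst k₁
    simp only [Int.negOnePow_add, Units.val_mul, smul_add, smul_smul]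
    abel
  comp_par hg α β γ δ ε ζ h₁ h₂ h₃ h₄ i j k a b c k₁ k₂ k₃ k₄ p q z := by
    refine Prod.ext (P.comp_par hg h₁ h₂ h₃ h₄ k₁ k₂ k₃ k₄ _ _ _) ?_
    simp only [AddMonoidHom.mk'_apply, map_add, map_zsmul, AddMonoidHom.add_apply,
      AddMonoidHom.smul_apply]
    rw [P.comp_par hg h₁ h₂ h₃ h₄ (show (i - 1) + j = a - 1 by omega) _
        (show (i - 1) + k = b - 1 by omega) (by omega),
      P.comp_par hg h₁ h₂ h₃ h₄ (show i + (j - 1) = a - 1 by omega) _ k₃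
        (show b + (j - 1) = c - 1 by omega),
      P.comp_par hg h₁ h₂ h₃ h₄ k₁ _ (show i + (k - 1) = b - 1 by omega)
        (show (b - 1) + j = c - 1 by omega)]
    subst k₁ k₃
    -- Differentiating `z` or `q` lowers one degree in the exchange sign `(-1)^(jk)`; the resulting
    -- change by `j` or `k` is the difference of the Leibniz signs on the two sides.
    have e1 : (((i + j) + j * (k - 1)).negOnePow : ℤ) = ((j * k + i).negOnePow : ℤ) := by
      exact negOnePow_congr ⟨0, by ring⟩
    have e2 : ((i + (j - 1) * k).negOnePow : ℤ) = ((j * k + (i + k)).negOnePow : ℤ) := by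
      exact negOnePow_congr ⟨-k, by ring⟩
    refine Eq.trans ?_ (Prod.smul_snd _ _).symm
    simp only [smul_add, smul_smul, ← Units.val_mul, ← Int.negOnePow_add, e1, e2]
    abel
  one_comp hg β γ h h' k hk q := by
    refine Prod.ext (P.one_comp hg h h' hk _) ?_
    simp only [AddMonoidHom.mk'_apply, map_zero, AddMonoidHom.zero_apply, Int.negOnePow_zero,
      Units.val_one, one_smul, zero_add]
    exact P.one_comp hg h h' _ _
  comp_one hg α γ h h' k hk p := by
    refine Prod.ext (P.comp_one hg h h' hk _) ?_
    simp only [AddMonoidHom.mk'_apply, map_zero, smul_zero, add_zero]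
    exact P.comp_one hg h h' _ _

end GrOperad

namespace Free

variable {O : PosetOperad} {M : SymDiag O}

/-- A homomorphism of degree `-1` from the generators to the free operad. -/
structure DegHom (M : SymDiag O) where
  app : ∀ {r : ℕ} {α : O.obj r} {k : ℤ}, M.obj α k →+ (Free M).obj α (k - 1)
  app_map : ∀ {r : ℕ} {α β : O.obj r} (w : Perm (Fin r)) (h : O.act w α ≤ β) {k : ℤ}
    (x : M.obj α k), app (M.map w h x) = (Free M).map w h (app x)

namespace DegHom

variable (θ : DegHom M)

/-- The morphism `x ↦ (x, d x)` determined by the derivation `d` which extends `θ`. -/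
def toDual : GrOperad.Hom (Free M) (Free M).dual :=
  lift
    { app := ((gen M).app).prod θ.app
      app_map := fun w h _ x => Prod.ext ((gen M).app_map w h x) (θ.app_map w h x) }

/-- The first projection of `dual` is multiplicative and the first component fixes the generators.
This turns the composition formula of `dual` into the Leibniz rule for the second component. -/
theorem toDual_fst {r : ℕ} {α : O.obj r} {k : ℤ} (x : (Free M).obj α k) :
    (θ.toDual.app x).1 = x := by
  induction x using Free.induction with
  | gen x => rfl
  | one => rfl
  | zero => rw [map_zero]; rfl
  | add x y hx hy => rw [map_add]; exact congrArg₂ _ hx hy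
  | neg x hx => rw [map_neg]; exact congrArg _ hx
  | map w h x hx => rw [θ.toDual.app_map]; exact congrArg _ hx
  | comp g h hk x y hx hy =>
    rw [θ.toDual.app_comp]
    change (Free M).comp g h hk (θ.toDual.app x).1 (θ.toDual.app y).1 = _
    rw [hx, hy]

/-- The derivation which extends `θ`. -/
def der {r : ℕ} {α : O.obj r} {k : ℤ} : (Free M).obj α k →+ (Free M).obj α (k - 1) :=
  (AddMonoidHom.snd ((Free M).obj α k) ((Free M).obj α (k - 1))).comp θ.toDual.app

theorem der_one : θ.der (Free M).one = 0 := rfl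

theorem der_map {r : ℕ} {α β : O.obj r} (w : Perm (Fin r)) (h : O.act w α ≤ β) {k : ℤ}
    (x : (Free M).obj α k) : θ.der ((Free M).map w h x) = (Free M).map w h (θ.der x) :=
  congrArg Prod.snd (θ.toDual.app_map w h x)

theorem der_comp {s t r : ℕ} {α : O.obj s} {β : O.obj t} {γ : O.obj r} (g : Graft s t r)
    (h : O.comp g α β ≤ γ) {i j k : ℤ} (hk : i + j = k) (p : (Free M).obj α i)
    (q : (Free M).obj β j) :
    θ.der ((Free M).comp g h hk p q) =
      (Free M).comp g h (show (i - 1) + j = k - 1 by omega) (θ.der p) q +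
      (i.negOnePow : ℤ) • (Free M).comp g h (show i + (j - 1) = k - 1 by omega) p (θ.der q) := by
  have h1 := congrArg Prod.snd (θ.toDual.app_comp g h hk p q)
  have h2 : ((Free M).dual.comp g h hk (θ.toDual.app p) (θ.toDual.app q)).2 =
      (Free M).comp g h (show (i - 1) + j = k - 1 by omega) (θ.toDual.app p).2 (θ.toDual.app q).1 +
      (i.negOnePow : ℤ) • (Free M).comp g h (show i + (j - 1) = k - 1 by omega)
        (θ.toDual.app p).1 (θ.toDual.app q).2 := rfl
  rw [θ.toDual_fst, θ.toDual_fst] at h2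
  exact h1.trans h2

/-- The derivation which extends `θ` is a differential if its square vanishes on generators. -/
def differential
    (hθ : ∀ {r : ℕ} {α : O.obj r} {k : ℤ} (x : M.obj α k), θ.der (θ.app x) = 0) :
    (Free M).Differential where
  d := θ.der
  d_d := by
    intro r α k x
    induction x using Free.induction with
    | gen x => exact hθ x
    | one => rw [θ.der_one, map_zero]
    | zero => simp
    | add x y hx hy => rw [map_add, map_add, hx, hy, add_zero]
    | neg x hx => rw [map_neg, map_neg, hx, neg_zero]
    | map w h x hx => rw [θ.der_map, θ.der_map, hx, map_zero]
    | @comp s t r α β γ g h i j k hk x y hx hy =>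
      -- The terms with `d²` on one factor vanish; the two copies of `d x ∘ d y` carry the signs of
      -- `i - 1` and `i`, hence cancel.
      simp only [θ.der_comp, map_add, map_zsmul, hx, hy, map_zero, AddMonoidHom.zero_apply,
        smul_zero, zero_add, add_zero, Int.negOnePow_sub, Int.negOnePow_one, mul_neg, mul_one,
        Units.val_neg, neg_smul]
      exact neg_add_cancel _
  d_map := θ.der_map
  leibniz := θ.der_comp

end DegHom

end Free

end KCobar

namespace KCobar

/-! ### Shuffle products -/

section Shuffles

variable {A B C : Type}

/-- The value of a function on the shuffle product of two simplices. -/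
def shEval (f : A → B → C) (u : List A) (v : List B) (c : List C → ℤ) : ℤ :=
  ((shuffles f u v).map (fun x => x.1 * c x.2)).sum

/-- `w` is one of the terms of the shuffle product of two simplices. -/
def IsShuffle (f : A → B → C) (u : List A) (v : List B) (w : List C) : Prop :=
  ∃ x ∈ shuffles f u v, x.2 = w

theorem shuffles_nil_left (f : A → B → C) (v : List B) : shuffles f [] v = [] := by
  rw [shuffles]

theorem shuffles_nil_right (f : A → B → C) (u : List A) : shuffles f u [] = [] := by
  cases u <;> rw [shuffles]; simp

@[simp] theorem shEval_nil_left (f : A → B → C) (v : List B) (c : List C → ℤ) :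
    shEval f [] v c = 0 := by
  simp [shEval, shuffles_nil_left]

@[simp] theorem shEval_nil_right (f : A → B → C) (u : List A) (c : List C → ℤ) :
    shEval f u [] c = 0 := by
  simp [shEval, shuffles_nil_right]

/-- Lattice paths are sorted by their first step. The separate vertex term is the path without
steps, for which both recursive terms vanish because a product with an empty list has no terms. -/
theorem shEval_cons_cons (f : A → B → C) (a : A) (u : List A) (b : B) (v : List B)
    (c : List C → ℤ) : shEval f (a :: u) (b :: v) c =
      (if u = [] ∧ v = [] then c [f a b] else 0) + shEval f u (b :: v) (fun m => c (f a b :: m)) +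
        (-1) ^ u.length * shEval f (a :: u) v (fun m => c (f a b :: m)) := by
  by_cases h : u = [] ∧ v = []
  · obtain ⟨rfl, rfl⟩ := h
    simp [shEval, shuffles]
  · rw [shEval, shuffles, if_neg h, if_neg h]
    simp only [List.map_append, List.map_map, List.sum_append, zero_add, shEval]
    congr 1
    rw [← List.sum_map_mul_left]
    congr 1
    refine List.map_congr_left fun x _ => ?_
    simp only [Function.comp_apply]
    ring

theorem isShuffle_nil_left (f : A → B → C) (v : List B) (w : List C) :
    ¬ IsShuffle f [] v w := by
  simp [IsShuffle, shuffles_nil_left]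

theorem isShuffle_nil_right (f : A → B → C) (u : List A) (w : List C) :
    ¬ IsShuffle f u [] w := by
  simp [IsShuffle, shuffles_nil_right]

theorem isShuffle_cons_cons (f : A → B → C) (a : A) (u : List A) (b : B) (v : List B)
    (w : List C) : IsShuffle f (a :: u) (b :: v) w ↔
      (u = [] ∧ v = [] ∧ w = [f a b]) ∨
      ∃ m, w = f a b :: m ∧ (IsShuffle f u (b :: v) m ∨ IsShuffle f (a :: u) v m) := by
  by_cases h : u = [] ∧ v = []
  · obtain ⟨rfl, rfl⟩ := h
    simp only [IsShuffle, shuffles, and_self, if_true, List.mem_singleton]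
    constructor
    · rintro ⟨x, rfl, rfl⟩; simp
    · rintro (⟨-, -, rfl⟩ | ⟨m, -, ⟨x, hx, -⟩ | ⟨x, hx, -⟩⟩)
      · exact ⟨_, rfl, rfl⟩
      · simp at hx
      · simp at hx
  · rw [IsShuffle, shuffles, if_neg h]
    simp only [List.mem_append, List.mem_map]
    constructor
    · rintro ⟨x, ⟨y, hy, rfl⟩ | ⟨y, hy, rfl⟩, rfl⟩
      · exact Or.inr ⟨_, rfl, Or.inl ⟨y, hy, rfl⟩⟩
      · exact Or.inr ⟨_, rfl, Or.inr ⟨y, hy, rfl⟩⟩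
    · rintro (⟨rfl, rfl, -⟩ | ⟨m, rfl, ⟨x, hx, rfl⟩ | ⟨x, hx, rfl⟩⟩)
      · exact absurd ⟨rfl, rfl⟩ h
      · exact ⟨_, Or.inl ⟨x, hx, rfl⟩, rfl⟩
      · exact ⟨_, Or.inr ⟨x, hx, rfl⟩, rfl⟩

theorem shEval_congr {f : A → B → C} {u : List A} {v : List B} {c c' : List C → ℤ}
    (h : ∀ w, IsShuffle f u v w → c w = c' w) : shEval f u v c = shEval f u v c' := by
  unfold shEval
  congr 1
  exact List.map_congr_left fun x hx => by rw [h _ ⟨x, hx, rfl⟩]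

theorem shEval_zero (f : A → B → C) (u : List A) (v : List B) :
    shEval f u v (fun _ => 0) = 0 := by
  simp [shEval]

theorem shEval_eq_zero {f : A → B → C} {u : List A} {v : List B} {c : List C → ℤ}
    (h : ∀ w, IsShuffle f u v w → c w = 0) : shEval f u v c = 0 :=
  (shEval_congr h).trans (shEval_zero f u v)

theorem shEval_add (f : A → B → C) (u : List A) (v : List B) (c c' : List C → ℤ) :
    shEval f u v (fun m => c m + c' m) = shEval f u v c + shEval f u v c' := by
  simp [shEval, mul_add, List.sum_map_add]

theorem shEval_mul (f : A → B → C) (u : List A) (v : List B) (a : ℤ) (c : List C → ℤ) :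
    shEval f u v (fun m => a * c m) = a * shEval f u v c := by
  simp only [shEval, ← List.sum_map_mul_left]
  congr 1
  exact List.map_congr_left fun x _ => by ring

theorem shEval_sub (f : A → B → C) (u : List A) (v : List B) (c c' : List C → ℤ) :
    shEval f u v (fun m => c m - c' m) = shEval f u v c - shEval f u v c' := by
  have h := shEval_add f u v c (fun m => -1 * c' m)
  rw [shEval_mul] at h
  simpa [sub_eq_add_neg] using h

theorem shEval_sum {ι : Type} (f : A → B → C) (u : List A) (v : List B) (s : Finset ι)
    (c : ι → List C → ℤ) :
    shEval f u v (fun m => ∑ i ∈ s, c i m) = ∑ i ∈ s, shEval f u v (c i) := by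
  classical
  induction s using Finset.induction_on with
  | empty => simp [shEval]
  | insert i s hi ih =>
    simp only [Finset.sum_insert hi, shEval_add, ih]

theorem shEval_map {A' B' C' : Type} (f : A' → B' → C') (p : A → A') (q : B → B') (u : List A)
    (v : List B) (c : List C' → ℤ) :
    shEval f (u.map p) (v.map q) c = shEval (fun a b => f (p a) (q b)) u v c := by
  induction u generalizing v c with
  | nil => simp
  | cons a u ih =>
    induction v generalizing c with
    | nil => simp
    | cons b v ih' =>
      have h1 := ih (b :: v)
      simp only [List.map_cons] at h1 ih' ⊢
      rw [shEval_cons_cons, shEval_cons_cons, ih', h1]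
      simp

theorem shEval_map_right {C' : Type} (f : A → B → C) (p : C → C') (u : List A)
    (v : List B) (c : List C' → ℤ) :
    shEval (fun a b => p (f a b)) u v c = shEval f u v (fun m => c (m.map p)) := by
  induction u generalizing v c with
  | nil => simp
  | cons a u ih =>
    induction v generalizing c with
    | nil => simp
    | cons b v ih' => simp [shEval_cons_cons, ih', ih]

theorem IsShuffle.length {f : A → B → C} {u : List A} {v : List B} {w : List C}
    (h : IsShuffle f u v w) : w.length + 1 = u.length + v.length := by
  induction u generalizing v w with
  | nil => exact absurd h (isShuffle_nil_left _ _ _)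
  | cons a u ih =>
    induction v generalizing w with
    | nil => exact absurd h (isShuffle_nil_right _ _ _)
    | cons b v ih' =>
      rw [isShuffle_cons_cons] at h
      rcases h with ⟨rfl, rfl, rfl⟩ | ⟨m, rfl, h | h⟩
      · rfl
      · have := ih h
        simp only [List.length_cons] at this ⊢
        omega
      · have := ih' h
        simp only [List.length_cons] at this ⊢
        omega

theorem IsShuffle.left_ne_nil {f : A → B → C} {u : List A} {v : List B} {w : List C}
    (h : IsShuffle f u v w) : u ≠ [] := by
  rintro rfl; exact isShuffle_nil_left _ _ _ h

theorem IsShuffle.right_ne_nil {f : A → B → C} {u : List A} {v : List B} {w : List C}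
    (h : IsShuffle f u v w) : v ≠ [] := by
  rintro rfl; exact isShuffle_nil_right _ _ _ h

theorem IsShuffle.ne_nil {f : A → B → C} {u : List A} {v : List B} {w : List C}
    (h : IsShuffle f u v w) : w ≠ [] := by
  rintro rfl
  have h1 := h.length
  have h2 := List.length_pos_of_ne_nil h.left_ne_nil
  have h3 := List.length_pos_of_ne_nil h.right_ne_nil
  simp only [List.length_nil] at h1
  omega

theorem IsShuffle.head {f : A → B → C} {a : A} {u : List A} {b : B} {v : List B} {w : List C}
    (h : IsShuffle f (a :: u) (b :: v) w) : ∃ m, w = f a b :: m := by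
  rw [isShuffle_cons_cons] at h
  rcases h with ⟨-, -, rfl⟩ | ⟨m, rfl, -⟩
  exacts [⟨_, rfl⟩, ⟨_, rfl⟩]

/-- An induction principle for the terms of shuffle products. -/
@[elab_as_elim]
theorem IsShuffle.rec' {f : A → B → C}
    {motive : ∀ (u : List A) (v : List B) (w : List C), IsShuffle f u v w → Prop}
    (single : ∀ a b h, motive [a] [b] [f a b] h)
    (left : ∀ a a' u b v m h (h' : IsShuffle f (a' :: u) (b :: v) (f a' b :: m)),
      motive (a' :: u) (b :: v) (f a' b :: m) h' →
      motive (a :: a' :: u) (b :: v) (f a b :: f a' b :: m) h)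
    (right : ∀ a u b b' v m h (h' : IsShuffle f (a :: u) (b' :: v) (f a b' :: m)),
      motive (a :: u) (b' :: v) (f a b' :: m) h' →
      motive (a :: u) (b :: b' :: v) (f a b :: f a b' :: m) h)
    {u : List A} {v : List B} {w : List C} (h : IsShuffle f u v w) : motive u v w h := by
  induction u generalizing v w with
  | nil => exact absurd h (isShuffle_nil_left _ _ _)
  | cons a u ih =>
    induction v generalizing w with
    | nil => exact absurd h (isShuffle_nil_right _ _ _)
    | cons b v ih' =>
      have h0 := h
      rw [isShuffle_cons_cons] at h0
      rcases h0 with ⟨rfl, rfl, rfl⟩ | ⟨m, rfl, h0 | h0⟩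
      · exact single a b h
      · have h1 := ih h0
        cases u with
        | nil => exact absurd h0 (isShuffle_nil_left _ _ _)
        | cons a' u =>
          obtain ⟨m, rfl⟩ := h0.head
          exact left _ _ _ _ _ _ h h0 h1
      · have h1 := ih' h0
        cases v with
        | nil => exact absurd h0 (isShuffle_nil_right _ _ _)
        | cons b' v =>
          obtain ⟨m, rfl⟩ := h0.head
          exact right _ _ _ _ _ _ h h0 h1

/-- Every lattice path ends at the pair of last vertices. This computes the permutation in the
oriented weight system of a composite. -/
theorem IsShuffle.getLast? {f : A → B → C} {u : List A} {v : List B} {w : List C}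
    (h : IsShuffle f u v w) :
    ∃ a b, u.getLast? = some a ∧ v.getLast? = some b ∧ w.getLast? = some (f a b) := by
  induction h using IsShuffle.rec' with
  | single a b _ => exact ⟨a, b, rfl, rfl, rfl⟩
  | left a a' u b v m _ _ ih => simpa only [List.getLast?_cons_cons] using ih
  | right a u b b' v m _ _ ih => simpa only [List.getLast?_cons_cons] using ih

/-- A step along one factor keeps the entry of the other one fixed, so a repetition in a factor
reappears in every term. -/
theorem IsShuffle.isChain_of {f : A → B → C} {u : List A} {v : List B} {w : List C}
    (h : IsShuffle f u v w) (hw : w.IsChain (· ≠ ·)) :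
    u.IsChain (· ≠ ·) ∧ v.IsChain (· ≠ ·) := by
  induction h using IsShuffle.rec' with
  | single a b _ => simp
  | left a a' u b v m _ _ ih =>
    rw [List.isChain_cons_cons] at hw ⊢
    have := ih hw.2
    exact ⟨⟨fun h => hw.1 (by rw [h]), this.1⟩, this.2⟩
  | right a u b b' v m _ _ ih =>
    rw [List.isChain_cons_cons] at hw ⊢
    have := ih hw.2
    exact ⟨this.1, ⟨fun h => hw.1 (by rw [h]), this.2⟩⟩

/-- Consecutive entries of a term differ in one argument of `f` only, so injectivity in each
variable excludes repetitions. -/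
theorem IsShuffle.isChain {f : A → B → C} (hf : ∀ a a' b, f a b = f a' b → a = a')
    (hf' : ∀ a b b', f a b = f a b' → b = b') {u : List A} {v : List B} {w : List C}
    (h : IsShuffle f u v w) (hu : u.IsChain (· ≠ ·)) (hv : v.IsChain (· ≠ ·)) :
    w.IsChain (· ≠ ·) := by
  induction h using IsShuffle.rec' with
  | single a b _ => simp
  | left a a' u b v m _ _ ih =>
    rw [List.isChain_cons_cons] at hu ⊢
    exact ⟨fun h => hu.1 (hf _ _ _ h), ih hu.2 hv⟩
  | right a u b b' v m _ _ ih =>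
    rw [List.isChain_cons_cons] at hv ⊢
    exact ⟨fun h => hv.1 (hf' _ _ _ h), ih hu hv.2⟩

open Classical in
/-- The number of changes of the truth value of a predicate along a sequence. -/
noncomputable def changes (P : A → Prop) : List A → ℕ
  | a :: b :: l => (if P a ↔ P b then 0 else 1) + changes P (b :: l)
  | _ => 0

/-- Steps along `v` do not affect a predicate that only sees the first argument, and the steps along
`u` run through `u` in order. With `changes_right` this computes the variations of composites. -/
theorem IsShuffle.changes_left {f : A → B → C} {P : A → Prop} {Q : C → Prop}
    (hf : ∀ a b, Q (f a b) ↔ P a) {u : List A} {v : List B} {w : List C}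
    (h : IsShuffle f u v w) : changes Q w = changes P u := by
  induction h using IsShuffle.rec' with
  | single a b _ => rfl
  | left a a' u b v m _ _ ih =>
    have h1 := hf a b
    have h2 := hf a' b
    by_cases h3 : P a <;> by_cases h4 : P a' <;> simp [changes, ih, h1, h2, h3, h4]
  | right a u b b' v m _ _ ih => simp only [changes, hf, ih, if_true, zero_add]

theorem IsShuffle.changes_right {f : A → B → C} {P : B → Prop} {Q : C → Prop}
    (hf : ∀ a b, Q (f a b) ↔ P b) {u : List A} {v : List B} {w : List C}
    (h : IsShuffle f u v w) : changes Q w = changes P v := by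
  induction h using IsShuffle.rec' with
  | single a b _ => rfl
  | left a a' u b v m _ _ ih => simp only [changes, hf, ih, if_true, zero_add]
  | right a u b b' v m _ _ ih =>
    have h1 := hf a b
    have h2 := hf a b'
    by_cases h3 : P b <;> by_cases h4 : P b' <;> simp [changes, ih, h1, h2, h3, h4]

/-- The recursion for lattice paths in a three-dimensional box: the first step goes along `u`, `v`
or `z`. `shEval_assoc_right_rec` yields the same recursion for the other bracketing, so that
associativity is an induction on the three lists. -/
theorem shEval_assoc_left_rec {D E : Type} (p : A → B → D) (q : D → C → E) (a : A) (u : List A)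
    (b : B) (v : List B) (d : C) (z : List C) (c : List E → ℤ) :
    shEval p (a :: u) (b :: v) (fun m => shEval q m (d :: z) c) =
      (if u = [] ∧ v = [] ∧ z = [] then c [q (p a b) d] else 0) +
      shEval p u (b :: v) (fun m => shEval q m (d :: z) (fun m => c (q (p a b) d :: m))) +
      (-1) ^ u.length *
        shEval p (a :: u) v (fun m => shEval q m (d :: z) (fun m => c (q (p a b) d :: m))) +
      (-1) ^ (u.length + v.length) *
        shEval p (a :: u) (b :: v) (fun m => shEval q m z (fun m => c (q (p a b) d :: m))) := by
  set c' := fun m => c (q (p a b) d :: m) with hc'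
  -- All terms of the first product have the same length `N`, so the sign of a first step along `z`
  -- is constant and comes out of the sum.
  have key : ∀ (u : List A) (v : List B) (N : ℕ), u.length + v.length = N + 1 →
      shEval p u v (fun m => shEval q (p a b :: m) (d :: z) c) =
        shEval p u v (fun m => shEval q m (d :: z) c') +
        (-1) ^ N * shEval p u v (fun m => shEval q (p a b :: m) z c') := by
    intro u v N hN
    rw [← shEval_mul, ← shEval_add]
    refine shEval_congr fun w hw => ?_
    rw [shEval_cons_cons, if_neg (fun h => hw.ne_nil h.1), zero_add]
    have := hw.length
    obtain rfl : w.length = N := by omega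
    rfl
  rw [shEval_cons_cons, key u (b :: v) (u.length + v.length) (by simp; omega),
    key (a :: u) v (u.length + v.length) (by simp; omega),
    shEval_cons_cons p a u b v (fun m => shEval q m z c')]
  by_cases h : u = [] ∧ v = []
  · obtain ⟨rfl, rfl⟩ := h
    simp [shEval_cons_cons, hc']
  · rw [if_neg h, if_neg h, if_neg (fun h' => h ⟨h'.1, h'.2.1⟩)]
    ring

theorem shEval_assoc_right_rec {D E : Type} (p : B → C → D) (q : A → D → E) (a : A) (u : List A)
    (b : B) (v : List B) (d : C) (z : List C) (c : List E → ℤ) :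
    shEval p (b :: v) (d :: z) (fun m => shEval q (a :: u) m c) =
      (if u = [] ∧ v = [] ∧ z = [] then c [q a (p b d)] else 0) +
      shEval p (b :: v) (d :: z) (fun m => shEval q u m (fun m => c (q a (p b d) :: m))) +
      (-1) ^ u.length *
        shEval p v (d :: z) (fun m => shEval q (a :: u) m (fun m => c (q a (p b d) :: m))) +
      (-1) ^ (u.length + v.length) *
        shEval p (b :: v) z (fun m => shEval q (a :: u) m (fun m => c (q a (p b d) :: m))) := by
  set c' := fun m => c (q a (p b d) :: m) with hc'
  have key : ∀ (v : List B) (z : List C),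
      shEval p v z (fun m => shEval q (a :: u) (p b d :: m) c) =
        shEval p v z (fun m => shEval q u (p b d :: m) c') +
        (-1) ^ u.length * shEval p v z (fun m => shEval q (a :: u) m c') := by
    intro v z
    rw [← shEval_mul, ← shEval_add]
    refine shEval_congr fun w hw => ?_
    rw [shEval_cons_cons, if_neg (fun h => hw.ne_nil h.2), zero_add]
  rw [shEval_cons_cons, key, key, shEval_cons_cons p b v d z (fun m => shEval q u m c')]
  by_cases h : v = [] ∧ z = []
  · obtain ⟨rfl, rfl⟩ := h
    simp [shEval_cons_cons, hc']
  · rw [if_neg h, if_neg h, if_neg (fun h' => h h'.2)]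
    ring

/-- The associativity of shuffle products. -/
theorem shEval_assoc {D D' E : Type} {p : A → B → D} {q : D → C → E} {p' : B → C → D'}
    {q' : A → D' → E} (h : ∀ a b d, q (p a b) d = q' a (p' b d)) (u : List A) (v : List B)
    (z : List C) (c : List E → ℤ) :
    shEval p u v (fun m => shEval q m z c) = shEval p' v z (fun m => shEval q' u m c) := by
  induction u generalizing v z c with
  | nil => simp [shEval_zero]
  | cons a u ih =>
    induction v generalizing z c with
    | nil => simp
    | cons b v ih' =>
      induction z generalizing c with
      | nil => simp [shEval_zero]
      | cons d z ih'' =>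
        rw [shEval_assoc_left_rec, shEval_assoc_right_rec, ih, ih', ih'']
        simp only [h]

/-- The commutativity of shuffle products. -/
theorem shEval_comm (f : A → B → C) (u : List A) (v : List B) (c : List C → ℤ) :
    shEval f u v c =
      (-1) ^ ((u.length + 1) * (v.length + 1)) * shEval (fun b a => f a b) v u c := by
  induction u generalizing v c with
  | nil => simp
  | cons a u ih =>
    induction v generalizing c with
    | nil => simp
    | cons b v ih' =>
      rw [shEval_cons_cons, shEval_cons_cons, ih, ih']
      by_cases h : u = [] ∧ v = []
      · obtain ⟨rfl, rfl⟩ := h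
        simp
      · rw [if_neg h, if_neg (fun h' => h h'.symm)]
        -- The recursion is symmetric up to signs, and these depend only on the parities of the two
        -- lengths.
        simp only [List.length_cons, pow_add, pow_mul, add_mul, mul_add, one_mul, mul_one]
        rcases neg_one_pow_eq_or ℤ u.length with h1 | h1 <;>
        rcases neg_one_pow_eq_or ℤ v.length with h2 | h2 <;>
        simp [h1, h2, add_comm]

theorem bd_congr {l : List A} {c c' : List A → ℤ}
    (h : ∀ m, m.length + 1 = l.length → c m = c' m) : bd l c = bd l c' := by
  rw [bd_eq_sum, bd_eq_sum]
  refine Finset.sum_congr rfl fun i hi => ?_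
  have hi := Finset.mem_range.1 hi
  rw [h _ (by rw [List.length_eraseIdx_of_lt hi]; omega)]

/-- Only a sequence of length one has the empty sequence as a face. This evaluates the boundary of
the vertex term in `shEval_cons_cons`. -/
theorem bd_of_nil (l : List A) (a : ℤ) (P : Prop) [Decidable P] :
    bd l (fun m => if m = [] ∧ P then a else 0) = if l.length = 1 ∧ P then a else 0 := by
  match l with
  | [] => simp [bd]
  | [x] => simp [bd]
  | x :: y :: l =>
    rw [bd_eq_sum]
    simp only [List.length_cons]
    rw [Finset.sum_eq_zero, if_neg (by omega)]
    intro i hi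
    have hi := Finset.mem_range.1 hi
    rw [if_neg, mul_zero]
    rintro ⟨h, -⟩
    have := congrArg List.length h
    rw [List.length_eraseIdx_of_lt (by simpa using hi)] at this
    simp at this

theorem bd_of_nil' (l : List A) (a : ℤ) (P : Prop) [Decidable P] :
    bd l (fun m => if P ∧ m = [] then a else 0) = if P ∧ l.length = 1 then a else 0 := by
  simp only [and_comm (a := P), bd_of_nil]

/-- The boundary of a shuffle product, up to the term `c []` which occurs for vertices. -/
theorem shEval_bd_aux (f : A → B → C) (u : List A) (v : List B) (c : List C → ℤ) :
    shEval f u v (fun m => bd m c) =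
      bd u (fun m => shEval f m v c) + (-1) ^ (u.length + 1) * bd v (fun m => shEval f u m c) +
        if u.length = 1 ∧ v.length = 1 then c [] else 0 := by
  induction u generalizing v c with
  | nil => simp [bd, bd_zero]
  | cons a u ih =>
    induction v generalizing c with
    | nil => simp [bd, bd_zero]
    | cons b v ih' =>
      set c' := fun m => c (f a b :: m) with hc'
      -- `e1` and `e2` treat the faces that keep the first vertex; `e4` to `e7` split off the face
      -- that deletes it. The split terms of `e4` and `e5` match those of `e3`, and those of `e6`
      -- and `e7` cancel.
      have e1 : bd u (fun m => shEval f (a :: m) (b :: v) c) =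
          (if u.length = 1 ∧ v = [] then c [f a b] else 0) + bd u (fun m => shEval f m (b :: v) c')
          + (-1) ^ (u.length + 1) * bd u (fun m => shEval f (a :: m) v c') := by
        rw [← bd_of_nil, ← bd_mul, ← bd_add, ← bd_add]
        refine bd_congr fun m hm => ?_
        rw [shEval_cons_cons, ← hm, pow_add, pow_add]
        ring
      have e2 : bd v (fun m => shEval f (a :: u) (b :: m) c) =
          (if u = [] ∧ v.length = 1 then c [f a b] else 0) + bd v (fun m => shEval f u (b :: m) c')
          + (-1) ^ u.length * bd v (fun m => shEval f (a :: u) m c') := by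
        rw [← bd_of_nil', ← bd_mul, ← bd_add, ← bd_add]
        refine bd_congr fun m hm => ?_
        rw [shEval_cons_cons]
      have e3 : ∀ (u : List A) (v : List B),
          shEval f u v (fun m => bd (f a b :: m) c) =
            shEval f u v c - shEval f u v (fun m => bd m c') := by
        intro u v
        simp only [bd, shEval_sub]
        rfl
      have e4 : bd (a :: u) (fun m => shEval f m (b :: v) c) =
          shEval f u (b :: v) c - bd u (fun m => shEval f (a :: m) (b :: v) c) := rfl
      have e5 : bd (b :: v) (fun m => shEval f (a :: u) m c) =
          shEval f (a :: u) v c - bd v (fun m => shEval f (a :: u) (b :: m) c) := rfl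
      have e6 : bd (b :: v) (fun m => shEval f u m c') =
          shEval f u v c' - bd v (fun m => shEval f u (b :: m) c') := rfl
      have e7 : bd (a :: u) (fun m => shEval f m v c') =
          shEval f u v c' - bd u (fun m => shEval f (a :: m) v c') := rfl
      rw [shEval_cons_cons, e3, e3, ih, ih', e4, e5, e6, e7, e1, e2]
      have e9 : c [f a b] = c' [] := rfl
      simp only [List.length_cons, Nat.add_eq_right, List.length_eq_zero_iff, bd, sub_zero,
        pow_add, pow_one, e9]
      rcases neg_one_pow_eq_or ℤ u.length with h2 | h2 <;> rw [h2] <;> ring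

/-- The shuffle product is a chain map. -/
theorem shEval_bd (f : A → B → C) (u : List A) (v : List B) (c : List C → ℤ) (hc : c [] = 0) :
    shEval f u v (fun m => bd m c) =
      bd u (fun m => shEval f m v c) +
        (-1) ^ (u.length + 1) * bd v (fun m => shEval f u m c) := by
  rw [shEval_bd_aux, hc, ite_self, add_zero]

end Shuffles

end KCobar

namespace KCobar

/-! ### Composites of permutations and signs -/

/-- Sign identities become polynomial identities over `ZMod 2`, which are settled by checking
finitely many cases or by normalization in characteristic two. -/
theorem negOnePow_congr_zmod {a b : ℤ} (h : (a : ZMod 2) = (b : ZMod 2)) :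
    (a.negOnePow : ℤ) = (b.negOnePow : ℤ) := by
  refine negOnePow_congr (even_iff_two_dvd.2 ?_)
  have := (ZMod.intCast_eq_intCast_iff_dvd_sub b a 2).1 h.symm
  exact_mod_cast this

/-- A permutation is determined by the relative orders of pairs, and for these associativity is
`pairVal_seq`. -/
theorem permComp_seq {s t u m m' r : ℕ} {g₁ : Graft s t m} {g₂ : Graft m u r}
    {h₁ : Graft t u m'} {h₂ : Graft s m' r} (h : Graft.Seq g₁ g₂ h₁ h₂) (a : Perm (Fin s))
    (b : Perm (Fin t)) (c : Perm (Fin u)) :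
    permComp g₂ (permComp g₁ a b) c = permComp h₂ a (permComp h₁ b c) := by
  refine precedes_ext fun i j _ => ?_
  have e1 : Precedes (permComp g₁ a b) = fun i j =>
    pairVal g₁.e (Precedes a) (Precedes b) (g₁.f i) (g₁.f j) := by ext; rw [precedes_permComp]
  have e2 : Precedes (permComp h₁ b c) = fun i j =>
    pairVal h₁.e (Precedes b) (Precedes c) (h₁.f i) (h₁.f j) := by ext; rw [precedes_permComp]
  rw [precedes_permComp, precedes_permComp, e1, e2]
  exact iff_of_eq (pairVal_seq h _ _ _ _ _)

theorem permComp_par {s t u m m' r : ℕ} {g₁ : Graft s t m} {g₂ : Graft m u r}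
    {h₁ : Graft s u m'} {h₂ : Graft m' t r} (h : Graft.Par g₁ g₂ h₁ h₂) (a : Perm (Fin s))
    (b : Perm (Fin t)) (c : Perm (Fin u)) :
    permComp g₂ (permComp g₁ a b) c = permComp h₂ (permComp h₁ a c) b := by
  refine precedes_ext fun i j _ => ?_
  have e1 : Precedes (permComp g₁ a b) = fun i j =>
    pairVal g₁.e (Precedes a) (Precedes b) (g₁.f i) (g₁.f j) := by ext; rw [precedes_permComp]
  have e2 : Precedes (permComp h₁ a c) = fun i j =>
    pairVal h₁.e (Precedes a) (Precedes c) (h₁.f i) (h₁.f j) := by ext; rw [precedes_permComp]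
  rw [precedes_permComp, precedes_permComp, e1, e2]
  exact iff_of_eq (pairVal_par h _ _ _ _ _)

theorem permComp_rel {s t r : ℕ} {u : Perm (Fin s)} {v : Perm (Fin t)} {w : Perm (Fin r)}
    {g g' : Graft s t r} (h : Graft.Rel u v w g g') (a : Perm (Fin s)) (b : Perm (Fin t)) :
    permComp g' (u * a) (v * b) = w * permComp g a b := by
  have hf : ∀ x, g'.f x = Sum.map u v (g.f (w.symm x)) := fun x => by rw [← h.2]; simp
  refine precedes_ext fun i j _ => ?_
  rw [precedes_mul, precedes_permComp, precedes_permComp, hf, hf, h.1]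
  exact iff_of_eq (pairVal_rel g.e (Precedes a) (Precedes b) u v _ _)

section PairVal

variable {X : Type} {s t : ℕ} (e : Fin s) (P : Fin s → Fin s → X) (Q : Fin t → Fin t → X)

theorem pairVal_inl_inl (a b : Fin s) : pairVal e P Q (Sum.inl a) (Sum.inl b) = P a b := rfl

theorem pairVal_inl_inr (a : Fin s) (b : Fin t) :
    pairVal e P Q (Sum.inl a) (Sum.inr b) = P a e := rfl

theorem pairVal_inr_inl (a : Fin t) (b : Fin s) :
    pairVal e P Q (Sum.inr a) (Sum.inl b) = P e b := rfl

theorem pairVal_inr_inr (a b : Fin t) : pairVal e P Q (Sum.inr a) (Sum.inr b) = Q a b := rfl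

end PairVal

namespace Graft

variable {s t r : ℕ} (g : Graft s t r)

/-- The inputs of a composite correspond to the inputs of the factors other than `e`. -/
noncomputable def equiv : Fin r ≃ {y : Fin s ⊕ Fin t // y ≠ Sum.inl g.e} :=
  Equiv.ofBijective (fun x => ⟨g.f x, (g.range_iff _).1 ⟨x, rfl⟩⟩)
    ⟨fun _ _ h => g.inj (congrArg Subtype.val h),
      fun y => by obtain ⟨x, hx⟩ := (g.range_iff y.1).2 y.2; exact ⟨x, Subtype.ext hx⟩⟩

/-- The inputs of a composite are those of both factors except `e`. The factor at `e` is kept on the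
left to avoid division; this identity yields the arities, positions and signs of composites. -/
theorem prod_comp {A : Type} [CommMonoid A] (F : Fin s ⊕ Fin t → A) :
    (∏ x, F (g.f x)) * F (Sum.inl g.e) = (∏ a, F (Sum.inl a)) * ∏ b, F (Sum.inr b) := by
  rw [← Fintype.prod_sumElim (fun a => F (Sum.inl a)) (fun b => F (Sum.inr b))]
  have h1 : (∏ x, F (g.f x)) = ∏ y : {y : Fin s ⊕ Fin t // y ≠ Sum.inl g.e}, F y.1 :=
    Fintype.prod_equiv g.equiv _ _ (fun _ => rfl)
  rw [h1, mul_comm, ← Fintype.prod_eq_mul_prod_subtype_ne (fun y => F y) (Sum.inl g.e)]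
  refine Finset.prod_congr rfl fun y _ => ?_
  rcases y with y | y <;> rfl

theorem sum_comp {A : Type} [AddCommMonoid A] (F : Fin s ⊕ Fin t → A) :
    (∑ x, F (g.f x)) + F (Sum.inl g.e) = (∑ a, F (Sum.inl a)) + ∑ b, F (Sum.inr b) :=
  g.prod_comp (A := Multiplicative A) F

theorem arity {s t r : ℕ} (g : Graft s t r) : r + 1 = s + t := by
  simpa using g.sum_comp (A := ℕ) (fun _ => 1)

theorem e_ne {x : Fin r} {a : Fin s} (h : g.f x = Sum.inl a) : a ≠ g.e := fun h' =>
  (g.range_iff (Sum.inl a)).1 ⟨x, h⟩ (by rw [h'])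

end Graft

/-- In comparisons with `e`, an input of the inner operation stands for `e`, which is why `0 < t` is
needed. -/
theorem permComp_injective_left {s t r : ℕ} (g : Graft s t r) (a a' : Perm (Fin s))
    (b : Perm (Fin t)) (h : permComp g a b = permComp g a' b) (ht : 0 < t) : a = a' := by
  have hx : ∀ i, ∃ x, g.f x = Sum.inl i ∨ (i = g.e ∧ g.f x = Sum.inr ⟨0, ht⟩) := fun i => by
    by_cases hi : i = g.e
    · obtain ⟨x, hx⟩ := (g.range_iff (Sum.inr ⟨0, ht⟩)).2 (by simp)
      exact ⟨x, Or.inr ⟨hi, hx⟩⟩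
    · obtain ⟨x, hx⟩ := (g.range_iff (Sum.inl i)).2 (by simpa using hi)
      exact ⟨x, Or.inl hx⟩
  refine precedes_ext fun i j hij => ?_
  obtain ⟨y, hy⟩ := hx j
  obtain ⟨x, hx⟩ := hx i
  have h1 := precedes_permComp g a b x y
  have h2 := precedes_permComp g a' b x y
  rw [h] at h1
  have h3 := h1.symm.trans h2
  rcases hx with hx | ⟨rfl, hx⟩ <;> rcases hy with hy | ⟨rfl, hy⟩ <;>
    simp_all [pairVal]

theorem permComp_injective_right {s t r : ℕ} (g : Graft s t r) (a : Perm (Fin s))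
    (b b' : Perm (Fin t)) (h : permComp g a b = permComp g a b') : b = b' := by
  refine precedes_ext fun i j hij => ?_
  obtain ⟨x, hx⟩ := (g.range_iff (Sum.inr i)).2 (by simp)
  obtain ⟨y, hy⟩ := (g.range_iff (Sum.inr j)).2 (by simp)
  have h1 := precedes_permComp g a b x y
  have h2 := precedes_permComp g a b' x y
  rw [h] at h1
  have h3 := h1.symm.trans h2
  simpa [hx, hy, pairVal] using h3

open Classical in
/-- The conditional with an arbitrary proposition as condition. -/
noncomputable def cite {A : Type} (P : Prop) (x y : A) : A := if P then x else y

theorem cite_pos {A : Type} {P : Prop} (h : P) (x y : A) : cite P x y = x := if_pos h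

theorem cite_neg {A : Type} {P : Prop} (h : ¬ P) (x y : A) : cite P x y = y := if_neg h

/-- The number of elements which precede a given one is its position. -/
theorem sum_precedes {r : ℕ} (σ : Perm (Fin r)) (x : Fin r) :
    (∑ y, cite (Precedes σ y x) 1 0) = (σ.symm x : ℕ) := by
  have h : ∀ y, cite (Precedes σ y x) 1 0 = if σ.symm y < σ.symm x then 1 else 0 := fun y => by
    by_cases h : Precedes σ y x
    · rw [cite_pos h]; exact (if_pos h).symm
    · rw [cite_neg h]; exact (if_neg h).symm
  simp only [h]
  rw [← Finset.card_filter]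
  rw [← Fin.card_Iio (σ.symm x)]
  refine Finset.card_equiv σ.symm fun y => ?_
  rw [Finset.mem_filter, Finset.mem_Iio]
  exact and_iff_right (Finset.mem_univ _)

theorem not_precedes_self {r : ℕ} (σ : Perm (Fin r)) (x : Fin r) : ¬ Precedes σ x x :=
  lt_irrefl _

theorem precedes_asymm {r : ℕ} {σ : Perm (Fin r)} {x y : Fin r} (h : x ≠ y) :
    Precedes σ y x ↔ ¬ Precedes σ x y := by
  unfold Precedes
  have := fun h' => h (σ.symm.injective h')
  rw [not_lt]
  exact ⟨le_of_lt, fun h1 => lt_of_le_of_ne h1 (fun h2 => this h2.symm)⟩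

/-- The position of an input of the inner operation. -/
theorem permComp_symm_inr {s t r : ℕ} (g : Graft s t r) (a : Perm (Fin s)) (b : Perm (Fin t))
    {x : Fin r} {j : Fin t} (hx : g.f x = Sum.inr j) :
    ((permComp g a b).symm x : ℕ) = (a.symm g.e : ℕ) + (b.symm j : ℕ) := by
  simp only [← sum_precedes, precedes_permComp, hx]
  have h := g.sum_comp (fun z => cite (pairVal g.e (Precedes a) (Precedes b) z (Sum.inr j)) 1 0)
  simpa only [pairVal_inl_inr, pairVal_inr_inr, cite_neg (not_precedes_self _ _), add_zero] using h

/-- The position of an input of the outer operation. -/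
theorem permComp_symm_inl {s t r : ℕ} (g : Graft s t r) (a : Perm (Fin s)) (b : Perm (Fin t))
    {x : Fin r} {i : Fin s} (hx : g.f x = Sum.inl i) :
    ((permComp g a b).symm x : ℕ) + cite (Precedes a g.e i) 1 0 =
      (a.symm i : ℕ) + cite (Precedes a g.e i) t 0 := by
  simp only [← sum_precedes, precedes_permComp, hx]
  -- In the count of predecessors, the single input `e` is replaced by the `t` inputs of the inner
  -- operation.
  have h := g.sum_comp (fun z => cite (pairVal g.e (Precedes a) (Precedes b) z (Sum.inl i)) 1 0)
  simp only [pairVal_inl_inl, pairVal_inr_inl] at h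
  rw [h, Finset.sum_const, Finset.card_univ, Fintype.card_fin]
  by_cases h1 : Precedes a g.e i
  · simp [cite_pos h1]
  · simp [cite_neg h1]

/-- The discordance of two permutations on a pair. -/
noncomputable def discord {r : ℕ} (σ τ : Perm (Fin r)) (x y : Fin r) : ℤˣ :=
  cite (Precedes σ x y ∧ Precedes τ y x) (-1) 1

theorem discord_self {r : ℕ} (σ τ : Perm (Fin r)) (x : Fin r) : discord σ τ x x = 1 :=
  cite_neg (fun h => not_precedes_self _ _ h.1) _ _

/-- Groups the two orientations of each pair, for comparison with the formula for the signature as a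
product over pairs `x < y`. -/
theorem prod_prod_eq {r : ℕ} {A : Type} [CommMonoid A] (d : Fin r → Fin r → A)
    (hd : ∀ x, d x x = 1) : ∏ x, ∏ y, d x y = ∏ y, ∏ x ∈ Finset.Iio y, d x y * d y x := by
  have h1 : ∀ x, ∏ y, d x y = (∏ y ∈ Finset.Ioi x, d x y) * ∏ y ∈ Finset.Iio x, d x y := by
    intro x
    rw [← Finset.prod_union]
    · refine (Finset.prod_subset (Finset.subset_univ _) fun y _ hy => ?_).symm
      have : y = x := by
        by_contra h
        rcases lt_or_gt_of_ne h with h | h <;> simp [h] at hy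
      rw [this, hd]
    · rw [Finset.disjoint_left]
      intro y hy hy'
      simp only [Finset.mem_Ioi, Finset.mem_Iio] at hy hy'
      exact lt_asymm hy hy'
  simp only [h1, Finset.prod_mul_distrib]
  congr 1
  exact Finset.prod_comm' (by simp)

/-- Each pair that `σ` and `τ` order differently contributes exactly one factor `-1` to the double
product, and both sides count these pairs modulo 2. -/
theorem sign_mul_sign {r : ℕ} (σ τ : Perm (Fin r)) :
    Perm.sign σ * Perm.sign τ = ∏ x, ∏ y, discord σ τ x y := by
  rw [prod_prod_eq _ (discord_self σ τ), ← Perm.sign_symm σ, ← Perm.sign_symm τ,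
    Equiv.Perm.sign_eq_prod_prod_Iio, Equiv.Perm.sign_eq_prod_prod_Iio]
  simp only [← Finset.prod_mul_distrib]
  refine Finset.prod_congr rfl fun y _ => Finset.prod_congr rfl fun x hx => ?_
  have hxy : x ≠ y := (Finset.mem_Iio.1 hx).ne
  have h1 := precedes_asymm (σ := σ) hxy
  have h2 := precedes_asymm (σ := τ) hxy
  have e1 : (σ.symm x < σ.symm y) ↔ Precedes σ x y := Iff.rfl
  have e2 : (τ.symm x < τ.symm y) ↔ Precedes τ x y := Iff.rfl
  simp only [discord, h1, h2, e1, e2]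
  by_cases h3 : Precedes σ x y <;> by_cases h4 : Precedes τ x y <;> simp [cite, h3, h4]

/-- A position counts predecessors. Elements that precede `e` in both orders count twice, so modulo
2 only those that precede it in exactly one order remain, and these are the discordant ones. -/
theorem prod_discord {r : ℕ} (σ τ : Perm (Fin r)) (e : Fin r) :
    (∏ x, discord σ τ x e) * (∏ x, discord σ τ e x) =
      (-1) ^ ((σ.symm e : ℕ) + (τ.symm e : ℕ)) := by
  rw [← sum_precedes, ← sum_precedes, ← Finset.prod_mul_distrib, ← Finset.sum_add_distrib,
    ← Finset.prod_pow_eq_pow_sum]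
  refine Finset.prod_congr rfl fun x _ => ?_
  by_cases hx : x = e
  · simp [hx, discord, cite, not_precedes_self]
  · have h1 := precedes_asymm (σ := σ) hx
    have h2 := precedes_asymm (σ := τ) hx
    simp only [discord, h1, h2]
    by_cases h3 : Precedes σ x e <;> by_cases h4 : Precedes τ x e <;> simp [cite, h3, h4]

theorem units_mul_self (x : ℤˣ) : x * x = 1 := Int.units_mul_self x

/-- A discordant pair of inputs of the composite comes from one of the factors. A discordant pair of
outer inputs that involves `e` is repeated for each of the `t` inner inputs, that is `t - 1` extra
times, and `t + 1` has the same parity. -/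
theorem sign_permComp_mul {s t r : ℕ} (g : Graft s t r) (a a' : Perm (Fin s))
    (b b' : Perm (Fin t)) :
    Perm.sign (permComp g a b) * Perm.sign (permComp g a' b') =
      (Perm.sign a * Perm.sign a') * (Perm.sign b * Perm.sign b') *
        ((-1) ^ ((a.symm g.e : ℕ) + (a'.symm g.e : ℕ))) ^ (t + 1) := by
  rw [sign_mul_sign, sign_mul_sign, sign_mul_sign, ← prod_discord]
  set d := discord a a' with hd
  set d' := discord b b' with hd'
  set D : Fin s ⊕ Fin t → Fin s ⊕ Fin t → ℤˣ := pairVal g.e d d' with hD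
  have h1 : ∀ x y, discord (permComp g a b) (permComp g a' b') x y = D (g.f x) (g.f y) := by
    intro x y
    simp only [discord, precedes_permComp, hD, hd, hd']
    rcases g.f x with i | i <;> rcases g.f y with j | j <;> rfl
  -- Units of `ℤ` are their own inverses, so the factor at `e` in `prod_comp` can be moved to the
  -- other side.
  have h2 : ∀ z, ∏ y, D z (g.f y) =
      (∏ i, D z (Sum.inl i)) * (∏ j, D z (Sum.inr j)) * D z (Sum.inl g.e) := by
    intro z
    rw [← g.prod_comp, mul_assoc, units_mul_self, mul_one]
  have h3 : ∏ x, ∏ y, D (g.f x) (g.f y) =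
      (∏ i, ∏ y, D (Sum.inl i) (g.f y)) * (∏ j, ∏ y, D (Sum.inr j) (g.f y)) *
        ∏ y, D (Sum.inl g.e) (g.f y) := by
    rw [← g.prod_comp (fun z => ∏ y, D z (g.f y)), mul_assoc, units_mul_self, mul_one]
  simp only [h1]
  rw [h3]
  simp only [h2]
  simp only [hD, pairVal_inl_inl, pairVal_inl_inr, pairVal_inr_inl, pairVal_inr_inr,
    Finset.prod_mul_distrib, Finset.prod_const, Finset.card_univ,
    Fintype.card_fin, Finset.prod_pow]
  have h4 : d g.e g.e = 1 := discord_self _ _ _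
  simp only [h4, one_pow, mul_one]
  rw [mul_pow, pow_succ, pow_succ]
  ac_rfl

end KCobar

/-! ### Signs of the operadic suspension -/

namespace KCobar

/-- The sign of the operadic suspension on a composite. -/
noncomputable def graftSign {s t r : ℕ} (g : Graft s t r) : ℤ :=
  (Equiv.Perm.sign (permComp g 1 1) : ℤ) *
    ((((s : ℤ) - 1 - (g.e : ℕ)) * ((t : ℤ) - 1)).negOnePow : ℤ)

theorem suspSign_eq (n : ℕ) {s t r : ℕ} (g : Graft s t r) : suspSign n g = graftSign g ^ n := rfl

theorem one_symm_apply {r : ℕ} (x : Fin r) : (1 : Perm (Fin r)).symm x = x := rfl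

/-- Compared with the signature of `a`, a block of `t` inputs is moved instead of the single input
`e`; this costs the displacement of `e` times `t - 1`. -/
theorem sign_permComp {s t r : ℕ} (g : Graft s t r) (a : Perm (Fin s)) (b : Perm (Fin t)) :
    (Perm.sign (permComp g a b) : ℤ) = Perm.sign (permComp g 1 1) * Perm.sign a * Perm.sign b *
      (((((a.symm g.e : ℕ) : ℤ) - (g.e : ℕ)) * ((t : ℤ) - 1)).negOnePow : ℤ) := by
  have h := sign_permComp_mul g a 1 b 1
  have h1 : Perm.sign (permComp g a b) = (Perm.sign (permComp g a b) *
      Perm.sign (permComp g 1 1)) * Perm.sign (permComp g 1 1) := by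
    rw [mul_assoc, units_mul_self, mul_one]
  rw [h1, h]
  have h2 : ((((((a.symm g.e : ℕ) : ℤ) - (g.e : ℕ)) * ((t : ℤ) - 1)).negOnePow : ℤ)) =
      ((-1) ^ ((a.symm g.e : ℕ) + (g.e : ℕ))) ^ (t + 1) := by
    rw [← pow_mul]
    have h3 : ((-1 : ℤ)) ^ (((a.symm g.e : ℕ) + (g.e : ℕ)) * (t + 1)) =
        (((((a.symm g.e : ℕ) + (g.e : ℕ)) * (t + 1) : ℕ) : ℤ).negOnePow : ℤ) := by
      rw [Int.coe_negOnePow_natCast]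
    rw [h3]
    refine negOnePow_congr_zmod ?_
    push_cast
    generalize (((a.symm g.e : ℕ) : ZMod 2)) = x
    generalize (((g.e : ℕ) : ZMod 2)) = y
    generalize ((t : ZMod 2)) = z
    revert x y z
    decide
  rw [h2]
  simp only [Units.val_mul, Perm.sign_one, mul_one, Units.val_pow_eq_pow_val, Units.val_neg,
    Units.val_one, one_symm_apply]
  ring

theorem sign_mul_self {r : ℕ} (σ : Perm (Fin r)) : (Perm.sign σ : ℤ) * Perm.sign σ = 1 := by
  rw [← Units.val_mul, units_mul_self, Units.val_one]

theorem negOnePow_mul_self (a : ℤ) : (a.negOnePow : ℤ) * a.negOnePow = 1 := by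
  rw [← Units.val_mul, units_mul_self, Units.val_one]

/-- By `permComp_rel`, the reference permutation of `g'` is `w * permComp g u⁻¹ v⁻¹`. The
displacement of `e` in `sign_permComp` compensates the change of `e` in the block sign. -/
theorem graftSign_rel {s t r : ℕ} {u : Perm (Fin s)} {v : Perm (Fin t)} {w : Perm (Fin r)}
    {g g' : Graft s t r} (h : Graft.Rel u v w g g') :
    graftSign g' = Perm.sign u * Perm.sign v * Perm.sign w * graftSign g := by
  have h1 := permComp_rel h u⁻¹ v⁻¹
  rw [mul_inv_cancel, mul_inv_cancel] at h1
  rw [graftSign, h1, Perm.sign_mul, Units.val_mul, sign_permComp g, Perm.sign_inv, Perm.sign_inv,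
    graftSign, h.1]
  have h2 : ((((((u⁻¹).symm g.e : ℕ) : ℤ) - (g.e : ℕ)) * ((t : ℤ) - 1)).negOnePow : ℤ) *
      (((s : ℤ) - 1 - (u g.e : ℕ)) * ((t : ℤ) - 1)).negOnePow =
      ((((s : ℤ) - 1 - (g.e : ℕ)) * ((t : ℤ) - 1)).negOnePow : ℤ) := by
    have h3 : (u⁻¹).symm = u := rfl
    rw [h3, ← Units.val_mul, ← Int.negOnePow_add]
    exact congrArg _ (congrArg _ (by ring))
  linear_combination (Perm.sign u * Perm.sign v * Perm.sign w * Perm.sign (permComp g 1 1) : ℤ) * h2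

/-- Signatures are taken in `permComp_seq` at the identities. The input `g₂.e` stands at position
`g₁.e + h₁.e` of the first composite, and the remaining block signs agree modulo 2. -/
theorem graftSign_seq {s t u m m' r : ℕ} {g₁ : Graft s t m} {g₂ : Graft m u r}
    {h₁ : Graft t u m'} {h₂ : Graft s m' r} (h : Graft.Seq g₁ g₂ h₁ h₂) :
    graftSign g₁ * graftSign g₂ = graftSign h₁ * graftSign h₂ := by
  have e1 := congrArg (fun σ => (Perm.sign σ : ℤ)) (permComp_seq h 1 1 1)
  rw [sign_permComp g₂, sign_permComp h₂] at e1
  have e2 := permComp_symm_inr g₁ 1 1 h.1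
  rw [e2] at e1
  simp only [Perm.sign_one, Units.val_one, mul_one, one_symm_apply, sub_self,
    zero_mul, Int.negOnePow_zero] at e1
  have a1 := g₁.arity
  have a2 := h₁.arity
  have e3 : (((((g₁.e : ℕ) + (h₁.e : ℕ) : ℕ) : ℤ) - (g₂.e : ℕ)) * ((u : ℤ) - 1)).negOnePow *
      ((((s : ℤ) - 1 - (g₁.e : ℕ)) * ((t : ℤ) - 1)).negOnePow : ℤ) *
      (((m : ℤ) - 1 - (g₂.e : ℕ)) * ((u : ℤ) - 1)).negOnePow =
      ((((t : ℤ) - 1 - (h₁.e : ℕ)) * ((u : ℤ) - 1)).negOnePow : ℤ) *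
      (((s : ℤ) - 1 - (g₁.e : ℕ)) * ((m' : ℤ) - 1)).negOnePow := by
    simp only [← Units.val_mul, ← Int.negOnePow_add]
    refine negOnePow_congr ⟨((g₁.e : ℕ) + (h₁.e : ℕ) - (g₂.e : ℕ)) * ((u : ℤ) - 1), ?_⟩
    have hm : (m : ℤ) = s + t - 1 := by omega
    have hm' : (m' : ℤ) = t + u - 1 := by omega
    rw [hm, hm']
    push_cast
    ring
  have e4 := negOnePow_mul_self
    (((((g₁.e : ℕ) + (h₁.e : ℕ) : ℕ) : ℤ) - (g₂.e : ℕ)) * ((u : ℤ) - 1))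
  rw [graftSign, graftSign, graftSign, graftSign, h.2.1]
  generalize ((((((g₁.e : ℕ) + (h₁.e : ℕ) : ℕ) : ℤ) - (g₂.e : ℕ)) *
    ((u : ℤ) - 1)).negOnePow : ℤ) = N at *
  generalize ((((s : ℤ) - 1 - (g₁.e : ℕ)) * ((t : ℤ) - 1)).negOnePow : ℤ) = n₁ at *
  generalize ((((m : ℤ) - 1 - (g₂.e : ℕ)) * ((u : ℤ) - 1)).negOnePow : ℤ) = n₂ at *
  generalize ((((t : ℤ) - 1 - (h₁.e : ℕ)) * ((u : ℤ) - 1)).negOnePow : ℤ) = n₃ at *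
  generalize ((((s : ℤ) - 1 - (g₁.e : ℕ)) * ((m' : ℤ) - 1)).negOnePow : ℤ) = n₄ at *
  linear_combination e1 * n₃ * n₄ + (Perm.sign (permComp g₁ 1 1) : ℤ) *
    Perm.sign (permComp g₂ 1 1) * (N * e3 - n₁ * n₂ * e4)

/-- As in the sequential case, but the displacements depend on which of the two inputs of the root
comes first: the later one is shifted by the block plugged in before it. The defect `(t - 1)(u - 1)`
is the sign of the exchange of two generators of the suspension. -/
theorem graftSign_par {s t u m m' r : ℕ} {g₁ : Graft s t m} {g₂ : Graft m u r}
    {h₁ : Graft s u m'} {h₂ : Graft m' t r} (h : Graft.Par g₁ g₂ h₁ h₂) :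
    graftSign g₁ * graftSign g₂ =
      ((((t : ℤ) - 1) * ((u : ℤ) - 1)).negOnePow : ℤ) * (graftSign h₁ * graftSign h₂) := by
  have e1 := congrArg (fun σ => (Perm.sign σ : ℤ)) (permComp_par h 1 1 1)
  rw [sign_permComp g₂, sign_permComp h₂] at e1
  simp only [Perm.sign_one, Units.val_one, mul_one] at e1
  have e2 := permComp_symm_inl g₁ 1 1 h.1
  have e2' := permComp_symm_inl h₁ 1 1 h.2.1
  have a1 := g₁.arity
  have a2 := h₁.arity
  have ne := g₁.e_ne h.1
  generalize ((permComp g₁ 1 1).symm g₂.e : ℕ) = p at *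
  generalize ((permComp h₁ 1 1).symm h₂.e : ℕ) = q at *
  have e3 : (((p : ℤ) - (g₂.e : ℕ)) * ((u : ℤ) - 1)).negOnePow *
      ((((s : ℤ) - 1 - (g₁.e : ℕ)) * ((t : ℤ) - 1)).negOnePow : ℤ) *
      (((m : ℤ) - 1 - (g₂.e : ℕ)) * ((u : ℤ) - 1)).negOnePow =
      ((((t : ℤ) - 1) * ((u : ℤ) - 1)).negOnePow : ℤ) *
      (((q : ℤ) - (h₂.e : ℕ)) * ((t : ℤ) - 1)).negOnePow *
      ((((s : ℤ) - 1 - (h₁.e : ℕ)) * ((u : ℤ) - 1)).negOnePow : ℤ) *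
      (((m' : ℤ) - 1 - (h₂.e : ℕ)) * ((t : ℤ) - 1)).negOnePow := by
    simp only [← Units.val_mul, ← Int.negOnePow_add]
    have hm : (m : ℤ) = s + t - 1 := by omega
    have hm' : (m' : ℤ) = s + u - 1 := by omega
    rw [hm, hm']
    refine negOnePow_congr_zmod ?_
    rcases lt_or_gt_of_ne ne with hlt | hlt
    · have h1 : Precedes (1 : Perm (Fin s)) h₁.e g₁.e := hlt
      have h2 : ¬ Precedes (1 : Perm (Fin s)) g₁.e h₁.e := lt_asymm hlt
      rw [cite_neg h2, cite_neg h2] at e2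
      rw [cite_pos h1, cite_pos h1] at e2'
      simp only [one_symm_apply, add_zero] at e2 e2'
      have hq : (q : ℤ) = (g₁.e : ℕ) + u - 1 := by omega
      rw [hq, e2]
      push_cast
      generalize ((s : ZMod 2)) = s'
      generalize ((t : ZMod 2)) = t'
      generalize ((u : ZMod 2)) = u'
      generalize (((g₁.e : ℕ) : ZMod 2)) = a
      generalize (((g₂.e : ℕ) : ZMod 2)) = b
      generalize (((h₁.e : ℕ) : ZMod 2)) = c
      generalize (((h₂.e : ℕ) : ZMod 2)) = d
      ring_nf
      reduce_mod_char
    · have h1 : Precedes (1 : Perm (Fin s)) g₁.e h₁.e := hlt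
      have h2 : ¬ Precedes (1 : Perm (Fin s)) h₁.e g₁.e := lt_asymm hlt
      rw [cite_pos h1, cite_pos h1] at e2
      rw [cite_neg h2, cite_neg h2] at e2'
      simp only [one_symm_apply, add_zero] at e2 e2'
      have hp : (p : ℤ) = (h₁.e : ℕ) + t - 1 := by omega
      rw [hp, e2']
      push_cast
      generalize ((s : ZMod 2)) = s'
      generalize ((t : ZMod 2)) = t'
      generalize ((u : ZMod 2)) = u'
      generalize (((g₁.e : ℕ) : ZMod 2)) = a
      generalize (((g₂.e : ℕ) : ZMod 2)) = b
      generalize (((h₁.e : ℕ) : ZMod 2)) = c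
      generalize (((h₂.e : ℕ) : ZMod 2)) = d
      ring_nf
      reduce_mod_char
  have e4 := negOnePow_mul_self (((p : ℤ) - (g₂.e : ℕ)) * ((u : ℤ) - 1))
  have e5 := negOnePow_mul_self (((q : ℤ) - (h₂.e : ℕ)) * ((t : ℤ) - 1))
  rw [graftSign, graftSign, graftSign, graftSign]
  generalize ((((p : ℤ) - (g₂.e : ℕ)) * ((u : ℤ) - 1)).negOnePow : ℤ) = N at *
  generalize ((((q : ℤ) - (h₂.e : ℕ)) * ((t : ℤ) - 1)).negOnePow : ℤ) = M at *
  generalize ((((s : ℤ) - 1 - (g₁.e : ℕ)) * ((t : ℤ) - 1)).negOnePow : ℤ) = n₁ at *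
  generalize ((((m : ℤ) - 1 - (g₂.e : ℕ)) * ((u : ℤ) - 1)).negOnePow : ℤ) = n₂ at *
  generalize ((((s : ℤ) - 1 - (h₁.e : ℕ)) * ((u : ℤ) - 1)).negOnePow : ℤ) = n₃ at *
  generalize ((((m' : ℤ) - 1 - (h₂.e : ℕ)) * ((t : ℤ) - 1)).negOnePow : ℤ) = n₄ at *
  generalize ((((t : ℤ) - 1) * ((u : ℤ) - 1)).negOnePow : ℤ) = K at *
  linear_combination e1 * (N * n₁ * n₂) + (Perm.sign (permComp h₁ 1 1) : ℤ) *
    Perm.sign (permComp h₂ 1 1) * (M * e3 + K * n₃ * n₄ * e5) -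
    (Perm.sign (permComp g₁ 1 1) : ℤ) * Perm.sign (permComp g₂ 1 1) * n₁ * n₂ * e4

end KCobar

namespace KCobar

namespace Graft

/-! ### Input sharings up to relabelling -/

theorem Rel.refl {s t r : ℕ} (g : Graft s t r) : Rel 1 1 1 g g :=
  ⟨rfl, fun x => by simp⟩

/-- The set of the inputs of a composite which belong to the inner operation. -/
def inner {s t r : ℕ} (g : Graft s t r) : Finset (Fin r) :=
  Finset.univ.filter fun x => (g.f x).isRight = true

theorem mem_inner {s t r : ℕ} {g : Graft s t r} {x : Fin r} :
    x ∈ g.inner ↔ ∃ b, g.f x = Sum.inr b := by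
  simp [inner, Sum.isRight_iff]

theorem notMem_inner {s t r : ℕ} {g : Graft s t r} {x : Fin r} :
    x ∉ g.inner ↔ ∃ a, g.f x = Sum.inl a := by
  rw [mem_inner]
  rcases g.f x with a | b <;> simp

theorem card_inner {s t r : ℕ} (g : Graft s t r) : g.inner.card = t := by
  have h := g.sum_comp (A := ℕ) (fun y => if y.isRight = true then 1 else 0)
  simp only [Sum.isRight_inl, Sum.isRight_inr, if_true, Bool.false_eq_true, if_false] at h
  rw [inner, Finset.card_filter]
  simpa using h

/-- Composites with the same set of inner inputs only differ by relabellings. -/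
theorem exists_rel {s t r : ℕ} {g g' : Graft s t r} (h : g.inner = g'.inner) :
    ∃ σ τ, Rel σ τ 1 g g' := by
  have key : ∀ x, (∃ a, g.f x = Sum.inl a) ↔ ∃ a, g'.f x = Sum.inl a := fun x => by
    rw [← notMem_inner, ← notMem_inner, h]
  have key' : ∀ x, (∃ a, g.f x = Sum.inr a) ↔ ∃ a, g'.f x = Sum.inr a := fun x => by
    rw [← mem_inner, ← mem_inner, h]
  -- No input of the composite lies over `e`, so its image has to be prescribed separately.
  have h1 : ∀ a, ∃ a', (a = g.e → a' = g'.e) ∧ ∀ x, g.f x = Sum.inl a → g'.f x = Sum.inl a' := by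
    intro a
    by_cases ha : a = g.e
    · exact ⟨g'.e, fun _ => rfl, fun x hx => absurd ha (g.e_ne hx)⟩
    · obtain ⟨x, hx⟩ := (g.range_iff (Sum.inl a)).2 (by simpa using ha)
      obtain ⟨a', ha'⟩ := (key x).1 ⟨a, hx⟩
      exact ⟨a', fun h => absurd h ha, fun y hy => by rw [g.inj (hy.trans hx.symm), ha']⟩
  have h2 : ∀ b, ∃ b', ∀ x, g.f x = Sum.inr b → g'.f x = Sum.inr b' := by
    intro b
    obtain ⟨x, hx⟩ := (g.range_iff (Sum.inr b)).2 (by simp)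
    obtain ⟨b', hb'⟩ := (key' x).1 ⟨b, hx⟩
    exact ⟨b', fun y hy => by rw [g.inj (hy.trans hx.symm), hb']⟩
  choose σ hσ hσ' using h1
  choose τ hτ using h2
  have iσ : Function.Injective σ := by
    intro a a' haa
    by_cases ha : a = g.e <;> by_cases ha' : a' = g.e
    · rw [ha, ha']
    · obtain ⟨x, hx⟩ := (g.range_iff (Sum.inl a')).2 (by simpa using ha')
      exact absurd (by rw [← haa, hσ _ ha]) (g'.e_ne (hσ' _ _ hx))
    · obtain ⟨x, hx⟩ := (g.range_iff (Sum.inl a)).2 (by simpa using ha)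
      exact absurd (by rw [haa, hσ _ ha']) (g'.e_ne (hσ' _ _ hx))
    · obtain ⟨x, hx⟩ := (g.range_iff (Sum.inl a)).2 (by simpa using ha)
      obtain ⟨y, hy⟩ := (g.range_iff (Sum.inl a')).2 (by simpa using ha')
      have h3 := hσ' _ _ hx
      rw [haa, ← hσ' _ _ hy] at h3
      have h4 := hx.symm.trans ((congrArg g.f (g'.inj h3)).trans hy)
      exact Sum.inl.inj h4
  have iτ : Function.Injective τ := by
    intro b b' hbb
    obtain ⟨x, hx⟩ := (g.range_iff (Sum.inr b)).2 (by simp)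
    obtain ⟨y, hy⟩ := (g.range_iff (Sum.inr b')).2 (by simp)
    have h3 := hτ _ _ hx
    rw [hbb, ← hτ _ _ hy] at h3
    exact Sum.inr.inj (hx.symm.trans ((congrArg g.f (g'.inj h3)).trans hy))
  refine ⟨Equiv.ofBijective σ (Finite.injective_iff_bijective.1 iσ),
    Equiv.ofBijective τ (Finite.injective_iff_bijective.1 iτ), (hσ _ rfl).symm, fun x => ?_⟩
  rcases hx : g.f x with a | b
  · exact hσ' _ _ hx
  · exact hτ _ _ hx

theorem ext_of {s t r : ℕ} {g g' : Graft s t r} (he : g.e = g'.e) (hf : g.f = g'.f) :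
    g = g' := by
  cases g; cases g'; simp_all

/-- The cardinality of the set is `t`, and `s` follows from `r + 1 = s + t`. -/
theorem sigma_eq_of_inner_eq {s t s' t' r : ℕ} {g : Graft s t r} {g' : Graft s' t' r}
    (h : g.inner = g'.inner) : s = s' ∧ t = t' := by
  have h1 := g.card_inner
  rw [h, g'.card_inner] at h1
  have h2 := g.arity
  have h3 := g'.arity
  omega

/-- The relabellings between two normalized composites are increasing, hence trivial; the input `e`
is the smallest one on both sides. -/
theorem eq_of_isStd {s t r : ℕ} {g g' : Graft s t r} (hg : g.IsStd) (hg' : g'.IsStd)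
    (h : g.inner = g'.inner) : g = g' := by
  obtain ⟨σ, τ, h1, h2⟩ := exists_rel h
  have he : g.e = g'.e := Fin.ext (hg.1.trans hg'.1.symm)
  have hσ : σ = 1 := by
    rw [← Equiv.Perm.monotone_iff]
    intro a b hab
    rcases hab.eq_or_lt with rfl | hab
    · exact le_rfl
    by_cases ha : a = g.e
    · rw [ha, ← h1]
      exact Fin.le_def.2 (by rw [hg'.1]; exact Nat.zero_le _)
    · have hb : b ≠ g.e := by
        rintro rfl
        have := Fin.lt_def.1 hab
        rw [hg.1] at this
        omega
      obtain ⟨x, hx⟩ := (g.range_iff (Sum.inl a)).2 (by simpa using ha)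
      obtain ⟨y, hy⟩ := (g.range_iff (Sum.inl b)).2 (by simpa using hb)
      have hxy : x < y := by
        rcases lt_trichotomy x y with h | h | h
        · exact h
        · rw [h, hy] at hx; exact absurd (Sum.inl.inj hx) hab.ne'
        · exact absurd ((hg.2 y x h).1 _ _ hy hx) (lt_asymm hab)
      have hx' := h2 x
      have hy' := h2 y
      rw [hx] at hx'
      rw [hy] at hy'
      exact ((hg'.2 x y hxy).1 _ _ hx' hy').le
  have hτ : τ = 1 := by
    rw [← Equiv.Perm.monotone_iff]
    intro a b hab
    rcases hab.eq_or_lt with rfl | hab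
    · exact le_rfl
    obtain ⟨x, hx⟩ := (g.range_iff (Sum.inr a)).2 (by simp)
    obtain ⟨y, hy⟩ := (g.range_iff (Sum.inr b)).2 (by simp)
    have hxy : x < y := by
      rcases lt_trichotomy x y with h | h | h
      · exact h
      · rw [h, hy] at hx; exact absurd (Sum.inr.inj hx) hab.ne'
      · exact absurd ((hg.2 y x h).2 _ _ hy hx) (lt_asymm hab)
    have hx' := h2 x
    have hy' := h2 y
    rw [hx] at hx'
    rw [hy] at hy'
    exact ((hg'.2 x y hxy).2 _ _ hx' hy').le
  refine ext_of he (funext fun x => ?_)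
  have := h2 x
  rw [hσ, hτ] at this
  simpa using this.symm

/-- The normalized composite with a given set of inner inputs. -/
noncomputable def std {r : ℕ} (A : Finset (Fin r)) : Graft (Aᶜ.card + 1) A.card r where
  e := 0
  f x := if h : x ∈ A then Sum.inr ((A.orderIsoOfFin rfl).symm ⟨x, h⟩)
    else Sum.inl (((Aᶜ.orderIsoOfFin rfl).symm ⟨x, Finset.mem_compl.2 h⟩).succ)
  inj x y h := by
    by_cases hx : x ∈ A <;> by_cases hy : y ∈ A <;> simp [hx, hy] at h
    · exact h
    · exact h
  range_iff y := by
    constructor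
    · rintro ⟨x, rfl⟩
      by_cases hx : x ∈ A <;> simp [hx, Fin.succ_ne_zero]
    · intro hy
      rcases y with a | b
      · obtain ⟨a', rfl⟩ : ∃ a', Fin.succ a' = a :=
          Fin.exists_succ_eq.2 (fun h => hy (by rw [h]))
        have h1 := (Aᶜ.orderIsoOfFin rfl a').2
        refine ⟨Aᶜ.orderIsoOfFin rfl a', ?_⟩
        rw [dif_neg (Finset.mem_compl.1 h1)]
        exact congrArg (fun z => Sum.inl (Fin.succ z)) ((Aᶜ.orderIsoOfFin rfl).symm_apply_apply a')
      · refine ⟨A.orderIsoOfFin rfl b, ?_⟩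
        rw [dif_pos (A.orderIsoOfFin rfl b).2]
        exact congrArg Sum.inr ((A.orderIsoOfFin rfl).symm_apply_apply b)

theorem inner_std {r : ℕ} (A : Finset (Fin r)) : (std A).inner = A := by
  ext x
  rw [mem_inner]
  by_cases hx : x ∈ A <;> simp [std, hx]

theorem isStd_std {r : ℕ} (A : Finset (Fin r)) : (std A).IsStd := by
  refine ⟨rfl, fun x y hxy => ⟨fun a b ha hb => ?_, fun a b ha hb => ?_⟩⟩
  · by_cases hx : x ∈ A
    · simp [std, hx] at ha
    by_cases hy : y ∈ A
    · simp [std, hy] at hb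
    simp only [std, hx, hy, dif_neg, not_false_eq_true, Sum.inl.injEq] at ha hb
    rw [← ha, ← hb, Fin.succ_lt_succ_iff, OrderIso.lt_iff_lt]
    exact hxy
  · by_cases hx : x ∈ A
    · by_cases hy : y ∈ A
      · simp only [std, hx, hy, dif_pos, Sum.inr.injEq] at ha hb
        rw [← ha, ← hb, OrderIso.lt_iff_lt]
        exact hxy
      · simp [std, hy] at hb
    · simp [std, hx] at ha

/-- A quantity which does not depend on labellings depends only on the set of inner inputs. -/
theorem eq_of_inner_eq {r : ℕ} {X : Type} (F : ∀ {s t : ℕ}, Graft s t r → X)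
    (hF : ∀ {s t : ℕ} {g g' : Graft s t r} {σ : Perm (Fin s)} {τ : Perm (Fin t)},
      Rel σ τ 1 g g' → F g = F g')
    {s t s' t' : ℕ} {g : Graft s t r} {g' : Graft s' t' r} (h : g.inner = g'.inner) :
    F g = F g' := by
  obtain ⟨rfl, rfl⟩ := sigma_eq_of_inner_eq h
  obtain ⟨σ, τ, h⟩ := exists_rel h
  exact hF h

open Classical in
/-- Sums over the normalized composites are sums over the sets of inner inputs. -/
theorem sum_isStd {r : ℕ} {X : Type} [AddCommMonoid X] (F : ∀ {s t : ℕ}, Graft s t r → X)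
    (hF : ∀ {s t : ℕ} (g : Graft s t r), s < 2 ∨ t < 2 → F g = 0) :
    (∑ s ∈ Finset.Icc 2 r, ∑ t ∈ Finset.Icc 2 r, ∑ g : Graft s t r, if g.IsStd then F g else 0) =
      ∑ A ∈ Finset.univ.filter (fun A : Finset (Fin r) => A.Nonempty), F (std A) := by
  have h1 : ∀ s t, (∑ g : Graft s t r, if g.IsStd then F g else 0) =
      ∑ g ∈ Finset.univ.filter (fun g : Graft s t r => g.IsStd), F g := fun s t => by
    rw [Finset.sum_filter]
  simp only [h1]
  rw [Finset.sum_congr rfl (fun s _ => Finset.sum_sigma' _ _ _), Finset.sum_sigma']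
  -- One-element sets and the full set give a factor of arity one. They are negligible by `hF`, so
  -- only nonzero terms are matched.
  refine Finset.sum_bij_ne_zero (fun x _ _ => x.2.2.inner) ?_ ?_ ?_ ?_
  · rintro ⟨s, t, g⟩ hx -
    simp only [Finset.mem_sigma, Finset.mem_Icc, Finset.mem_filter] at hx
    rw [Finset.mem_filter, ← Finset.card_pos, g.card_inner]
    exact ⟨Finset.mem_univ _, by omega⟩
  · rintro ⟨s, t, g⟩ hx - ⟨s', t', g'⟩ hx' - h
    simp only [Finset.mem_sigma, Finset.mem_Icc, Finset.mem_filter] at hx hx'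
    obtain ⟨rfl, rfl⟩ := sigma_eq_of_inner_eq h
    rw [eq_of_isStd hx.2.2.2 hx'.2.2.2 h]
  · intro A hA hA'
    have h2 : 2 ≤ Aᶜ.card + 1 ∧ 2 ≤ A.card := by
      by_contra h
      exact hA' (hF _ (by omega))
    have h3 := (std A).arity
    refine ⟨⟨_, _, std A⟩, ?_, hA', inner_std A⟩
    simp only [Finset.mem_sigma, Finset.mem_Icc, Finset.mem_filter, Finset.mem_univ, true_and]
    refine ⟨⟨h2.1, by omega⟩, ⟨h2.2, by omega⟩, isStd_std A⟩
  · rintro ⟨s, t, g⟩ hx -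
    simp only [Finset.mem_sigma, Finset.mem_Icc, Finset.mem_filter] at hx
    have key : ∀ {s' t' : ℕ} (g' : Graft s' t' r), g'.IsStd → g.inner = g'.inner →
        F g = F g' := by
      intro s' t' g' hg' h
      obtain ⟨rfl, rfl⟩ := sigma_eq_of_inner_eq h
      rw [eq_of_isStd hx.2.2.2 hg' h]
    exact key _ (isStd_std _) (inner_std _).symm

/-! ### Composites over trees with three vertices -/

/-- Any enumeration of the inputs does, since intermediate composites are only needed up to
relabelling. -/
theorem exists_graft {s t r : ℕ} (e : Fin s) (h : r + 1 = s + t) :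
    ∃ g : Graft s t r, g.e = e := by
  have h1 : Fintype.card {y : Fin s ⊕ Fin t // y ≠ Sum.inl e} = r := by
    rw [Fintype.card_subtype_compl, Fintype.card_sum, Fintype.card_subtype_eq,
      Fintype.card_fin, Fintype.card_fin]
    omega
  let φ := (Fintype.equivFinOfCardEq h1).symm
  exact ⟨⟨e, fun x => (φ x).1, fun x y hxy => φ.injective (Subtype.ext hxy),
    fun y => ⟨by rintro ⟨x, rfl⟩; exact (φ x).2, fun hy => ⟨φ.symm ⟨y, hy⟩, by simp⟩⟩⟩, rfl⟩

/-- The input sharing of a composite `(p ∘_{g₁} q) ∘_{g₂} r`. -/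
def tri {s t u m r : ℕ} (g₁ : Graft s t m) (g₂ : Graft m u r) (x : Fin r) :
    Fin s ⊕ (Fin t ⊕ Fin u) :=
  Sum.elim (fun y => Sum.map id Sum.inl (g₁.f y)) (fun c => Sum.inr (Sum.inr c)) (g₂.f x)

theorem tri_aux_injective {s t u m : ℕ} (g₁ : Graft s t m) : Function.Injective
    (Sum.elim (fun y => Sum.map id Sum.inl (g₁.f y)) (fun c => Sum.inr (Sum.inr c)) :
      Fin m ⊕ Fin u → Fin s ⊕ (Fin t ⊕ Fin u)) := by
  rintro (y | c) (y' | c') h <;> simp only [Sum.elim_inl, Sum.elim_inr] at h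
  · rw [g₁.inj (Function.Injective.sumMap Function.injective_id Sum.inl_injective h)]
  · rcases hy : g₁.f y with a | b <;> simp [hy] at h
  · rcases hy : g₁.f y' with a | b <;> simp [hy] at h
  · simp at h; rw [h]

theorem tri_injective {s t u m r : ℕ} (g₁ : Graft s t m) (g₂ : Graft m u r) :
    Function.Injective (tri g₁ g₂) := (tri_aux_injective g₁).comp g₂.inj

/-- The two missing values are the inner edges of the tree: the inputs in which the second and the
third operation are plugged. -/
theorem exists_tri_eq {s t u m r : ℕ} (g₁ : Graft s t m) (g₂ : Graft m u r)
    (y : Fin s ⊕ (Fin t ⊕ Fin u)) :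
    (∃ x, tri g₁ g₂ x = y) ↔ y ≠ Sum.inl g₁.e ∧ y ≠ Sum.map id Sum.inl (g₁.f g₂.e) := by
  constructor
  · rintro ⟨x, rfl⟩
    have h2 : tri g₁ g₂ x ≠ Sum.map id Sum.inl (g₁.f g₂.e) := fun h =>
      (g₂.range_iff _).1 ⟨x, rfl⟩ (tri_aux_injective g₁ (a₁ := g₂.f x) (a₂ := Sum.inl g₂.e) h)
    refine ⟨fun h => ?_, h2⟩
    rw [tri] at h
    rcases hx : g₂.f x with y | c
    · rcases hy : g₁.f y with a | b
      · simp only [hx, Sum.elim_inl, hy, Sum.map_inl, id, Sum.inl.injEq] at h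
        exact g₁.e_ne hy h
      · simp [hx, hy] at h
    · simp [hx] at h
  · rintro ⟨h1, h2⟩
    have key : ∀ z, g₁.f z ≠ g₁.f g₂.e → ∃ x, g₂.f x = Sum.inl z := fun z hz =>
      (g₂.range_iff _).2 (fun h => hz (by rw [Sum.inl.inj h]))
    rcases y with a | b | c
    · obtain ⟨z, hz⟩ := (g₁.range_iff (Sum.inl a)).2 (by simpa using h1)
      obtain ⟨x, hx⟩ := key z (fun h => h2 (by rw [← h, hz]; rfl))
      exact ⟨x, by simp [tri, hx, hz]⟩
    · obtain ⟨z, hz⟩ := (g₁.range_iff (Sum.inr b)).2 (by simp)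
      obtain ⟨x, hx⟩ := key z (fun h => h2 (by rw [← h, hz]; rfl))
      exact ⟨x, by simp [tri, hx, hz]⟩
    · obtain ⟨x, hx⟩ := (g₂.range_iff (Sum.inr c)).2 (by simp)
      exact ⟨x, by simp [tri, hx]⟩

/-- The intermediate composite is chosen with `h₁.e = b`. Then `tri g₁ g₂` avoids the value omitted
by `h₁`, so it factors through `h₁`, and the factorization is `h₂`. -/
theorem exists_seq {s t u m r : ℕ} (g₁ : Graft s t m) (g₂ : Graft m u r) {b : Fin t}
    (hb : g₁.f g₂.e = Sum.inr b) :
    ∃ (m' : ℕ) (h₁ : Graft t u m') (h₂ : Graft s m' r), Seq g₁ g₂ h₁ h₂ := by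
  obtain ⟨h₁, he⟩ := exists_graft (r := t + u - 1) (t := u) b (by have := b.pos; omega)
  have iψ : Function.Injective (Sum.map id h₁.f : Fin s ⊕ _ → _) :=
    Function.injective_id.sumMap h₁.inj
  have h : ∀ x, ∃ y, (Sum.map id h₁.f y : Fin s ⊕ (Fin t ⊕ Fin u)) = tri g₁ g₂ x := by
    intro x
    have h2 := ((exists_tri_eq g₁ g₂ _).1 ⟨x, rfl⟩).2
    rcases hx : tri g₁ g₂ x with a | w
    · exact ⟨Sum.inl a, rfl⟩
    · obtain ⟨z, hz⟩ := (h₁.range_iff w).2 (fun h => h2 (by rw [hx, h, he, hb]; rfl))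
      exact ⟨Sum.inr z, by simp [hz]⟩
  choose f hf using h
  refine ⟨_, h₁, ⟨g₁.e, f, fun x y hxy => ?_, fun y => ?_⟩, by rw [he, hb], rfl,
    fun x => (hf x).symm⟩
  · exact tri_injective g₁ g₂ (by rw [← hf, ← hf, hxy])
  · have h3 : (∃ x, f x = y) ↔ ∃ x, tri g₁ g₂ x = Sum.map id h₁.f y := by
      simp only [← hf, iψ.eq_iff]
    rw [h3, exists_tri_eq, hb]
    rcases y with a | z
    · simp
    · simp only [Sum.map_inr, ne_eq, reduceCtorEq, not_false_eq_true, true_and, Sum.inr.injEq,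
        iff_true]
      exact fun h => (h₁.range_iff _).1 ⟨z, rfl⟩ (by rw [h, he])

/-- The same factorization when both operations are plugged in distinct inputs of the root; `z₀` is
the input of the new intermediate composite that corresponds to `g₁.e`. -/
theorem exists_par {s t u m r : ℕ} (g₁ : Graft s t m) (g₂ : Graft m u r) {a : Fin s}
    (ha : g₁.f g₂.e = Sum.inl a) :
    ∃ (m' : ℕ) (h₁ : Graft s u m') (h₂ : Graft m' t r), Par g₁ g₂ h₁ h₂ := by
  obtain ⟨h₁, he⟩ := exists_graft (r := s + u - 1) (t := u) a (by have := a.pos; omega)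
  obtain ⟨z₀, hz₀⟩ := (h₁.range_iff (Sum.inl g₁.e)).2 (by
    rw [he]; simpa using (g₁.e_ne ha).symm)
  set ψ : Fin (s + u - 1) ⊕ Fin t → Fin s ⊕ (Fin t ⊕ Fin u) :=
    Sum.elim (fun z => Sum.map id Sum.inr (h₁.f z)) (fun b => Sum.inr (Sum.inl b)) with hψ
  have iψ : Function.Injective ψ := by
    rintro (y | c) (y' | c') h <;> simp only [hψ, Sum.elim_inl, Sum.elim_inr] at h
    · rw [h₁.inj (Function.Injective.sumMap Function.injective_id Sum.inr_injective h)]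
    · rcases hy : h₁.f y with a | b <;> simp [hy] at h
    · rcases hy : h₁.f y' with a | b <;> simp [hy] at h
    · simp at h; rw [h]
  have h : ∀ x, ∃ y, ψ y = tri g₁ g₂ x := by
    intro x
    have h2 := ((exists_tri_eq g₁ g₂ _).1 ⟨x, rfl⟩).2
    rcases hx : tri g₁ g₂ x with a' | b | c
    · obtain ⟨z, hz⟩ := (h₁.range_iff (Sum.inl a')).2 (fun h => h2 (by
        rw [hx, ha, Sum.inl.inj h, he]; rfl))
      exact ⟨Sum.inl z, by simp [hψ, hz]⟩
    · exact ⟨Sum.inr b, rfl⟩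
    · obtain ⟨z, hz⟩ := (h₁.range_iff (Sum.inr c)).2 (by simp)
      exact ⟨Sum.inl z, by simp [hψ, hz]⟩
  choose f hf using h
  refine ⟨_, h₁, ⟨z₀, f, fun x y hxy => ?_, fun y => ?_⟩, by rw [he, ha], hz₀,
    fun x => (hf x).symm⟩
  · exact tri_injective g₁ g₂ (by rw [← hf, ← hf, hxy])
  · have h3 : (∃ x, f x = y) ↔ ∃ x, tri g₁ g₂ x = ψ y := by
      simp only [← hf, iψ.eq_iff]
    have h4 : Sum.inl g₁.e = ψ (Sum.inl z₀) := by simp [hψ, hz₀]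
    rw [h3, exists_tri_eq, h4, iψ.ne_iff, and_iff_left_iff_imp]
    rintro - h
    rcases y with z | b
    · rcases hz : h₁.f z with a' | c
      · simp only [hψ, Sum.elim_inl, hz, ha, Sum.map_inl, id, Sum.inl.injEq] at h
        exact h₁.e_ne hz (by rw [h, he])
      · simp [hψ, hz, ha] at h
    · simp [hψ, ha] at h

/-- The set of the inputs of `(p ∘_{g₁} q) ∘_{g₂} r` above the vertex `q`. -/
def outer {s t u m r : ℕ} (g₁ : Graft s t m) (g₂ : Graft m u r) : Finset (Fin r) :=
  Finset.univ.filter fun x =>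
    Sum.elim (fun y => (g₁.f y).isRight) (fun _ => (g₁.f g₂.e).isRight) (g₂.f x) = true

/-- The set of the inputs of `p ∘_{h₂} (q ∘_{h₁} r)` above the vertex `r`. -/
def innermost {s t u m r : ℕ} (h₁ : Graft t u m) (h₂ : Graft s m r) : Finset (Fin r) :=
  Finset.univ.filter fun x => Sum.elim (fun _ => false) (fun z => (h₁.f z).isRight) (h₂.f x) = true

section

variable {s t u m m' r : ℕ}

/-- An inner edge of a tree is recorded by the set of inputs above it. The four identities here say
that the rebracketed composite has the same two sets, so that trees can be handled as pairs of
subsets. -/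
theorem Seq.inner_eq {g₁ : Graft s t m} {g₂ : Graft m u r} {h₁ : Graft t u m'}
    {h₂ : Graft s m' r} (h : Seq g₁ g₂ h₁ h₂) : h₂.inner = outer g₁ g₂ := by
  ext x
  simp only [inner, outer, Finset.mem_filter, Finset.mem_univ, true_and]
  rcases h.cases x with ⟨a, y, e1, e2, e3⟩ | ⟨b, y, z, e1, e2, e3, e4⟩ | ⟨c, z, e1, e2, e3⟩ <;>
    simp [*, h.1]

theorem Seq.innermost_eq {g₁ : Graft s t m} {g₂ : Graft m u r} {h₁ : Graft t u m'}
    {h₂ : Graft s m' r} (h : Seq g₁ g₂ h₁ h₂) : innermost h₁ h₂ = g₂.inner := by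
  ext x
  simp only [inner, innermost, Finset.mem_filter, Finset.mem_univ, true_and]
  rcases h.cases x with ⟨a, y, e1, e2, e3⟩ | ⟨b, y, z, e1, e2, e3, e4⟩ | ⟨c, z, e1, e2, e3⟩ <;>
    simp [*]

theorem Par.inner_eq {g₁ : Graft s t m} {g₂ : Graft m u r} {h₁ : Graft s u m'}
    {h₂ : Graft m' t r} (h : Par g₁ g₂ h₁ h₂) : h₂.inner = outer g₁ g₂ := by
  ext x
  simp only [inner, outer, Finset.mem_filter, Finset.mem_univ, true_and]
  rcases h.cases x with ⟨a, y, z, e1, e2, e3, e4⟩ | ⟨b, y, e1, e2, e3⟩ | ⟨c, z, e1, e2, e3⟩ <;>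
    simp [*, h.1]

theorem Par.outer_eq {g₁ : Graft s t m} {g₂ : Graft m u r} {h₁ : Graft s u m'}
    {h₂ : Graft m' t r} (h : Par g₁ g₂ h₁ h₂) : outer h₁ h₂ = g₂.inner := by
  ext x
  simp only [inner, outer, Finset.mem_filter, Finset.mem_univ, true_and]
  rcases h.cases x with ⟨a, y, z, e1, e2, e3, e4⟩ | ⟨b, y, e1, e2, e3⟩ | ⟨c, z, e1, e2, e3⟩ <;>
    simp [*, h.2.1]

end

end Graft

end KCobar

namespace KCobar

/-! ### Composites without degree constraints -/

namespace GrOperad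

variable {s t u m m' r : ℕ}

open Classical in
/-- The composite of two elements in a given degree (zero if this is not the sum of the degrees). -/
noncomputable def pcomp (P : GrOperad ptOperad) (g : Graft s t r) {i j : ℤ} (k : ℤ) :
    P.obj (pt s) i →+ P.obj (pt t) j →+ P.obj (pt r) k :=
  if h : i + j = k then P.comp (α := pt s) (β := pt t) (γ := pt r) g (le_refl _) h else 0

variable (P : GrOperad ptOperad)

theorem pcomp_pos (g : Graft s t r) {i j k : ℤ} (h : i + j = k) (p : P.obj (pt s) i)
    (q : P.obj (pt t) j) : P.pcomp g k p q = P.comp (γ := pt r) g (le_refl _) h p q := by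
  have e : P.pcomp g k = P.comp (α := pt s) (β := pt t) (γ := pt r) g (le_refl _) h := dif_pos h
  rw [e]

theorem pcomp_neg (g : Graft s t r) {i j k : ℤ} (h : i + j ≠ k) (p : P.obj (pt s) i)
    (q : P.obj (pt t) j) : P.pcomp g k p q = 0 := by
  have e : P.pcomp g k = (0 : P.obj (pt s) i →+ P.obj (pt t) j →+ P.obj (pt r) k) := dif_neg h
  rw [e]; rfl

theorem pcomp_map {σ : Perm (Fin s)} {τ : Perm (Fin t)} {ρ : Perm (Fin r)} {g g' : Graft s t r}
    (hg : Graft.Rel σ τ ρ g g') {i j k : ℤ} (p : P.obj (pt s) i) (q : P.obj (pt t) j) :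
    P.pcomp g' k (P.map (β := pt s) σ (le_refl _) p) (P.map (β := pt t) τ (le_refl _) q) =
      P.map (β := pt r) ρ (le_refl _) (P.pcomp g k p q) := by
  by_cases h : i + j = k
  · rw [P.pcomp_pos g' h, P.pcomp_pos g h]
    exact P.comp_map hg _ _ _ _ _ _ _ _
  · rw [P.pcomp_neg g' h, P.pcomp_neg g h, map_zero]

theorem pcomp_map_one {σ : Perm (Fin s)} {τ : Perm (Fin t)} {g g' : Graft s t r}
    (hg : Graft.Rel σ τ 1 g g') {i j k : ℤ} (p : P.obj (pt s) i) (q : P.obj (pt t) j) :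
    P.pcomp g' k (P.map (β := pt s) σ (le_refl _) p) (P.map (β := pt t) τ (le_refl _) q) =
      P.pcomp g k p q :=
  (P.pcomp_map hg p q).trans (P.map_id (α := pt r) (le_refl _) _)

theorem pcomp_seq {g₁ : Graft s t m} {g₂ : Graft m u r} {h₁ : Graft t u m'} {h₂ : Graft s m' r}
    (hg : Graft.Seq g₁ g₂ h₁ h₂) {i j k c : ℤ} (p : P.obj (pt s) i) (q : P.obj (pt t) j)
    (z : P.obj (pt u) k) :
    P.pcomp g₂ c (P.pcomp g₁ (i + j) p q) z = P.pcomp h₂ c p (P.pcomp h₁ (j + k) q z) := by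
  by_cases h : i + j + k = c
  · rw [P.pcomp_pos g₂ h, P.pcomp_pos g₁ rfl, P.pcomp_pos h₂ (by omega), P.pcomp_pos h₁ rfl]
    exact P.comp_seq hg _ _ _ _ _ _ _ _ _ _ _
  · rw [P.pcomp_neg g₂ h, P.pcomp_neg h₂ (by omega)]

theorem pcomp_par {g₁ : Graft s t m} {g₂ : Graft m u r} {h₁ : Graft s u m'} {h₂ : Graft m' t r}
    (hg : Graft.Par g₁ g₂ h₁ h₂) {i j k c : ℤ} (p : P.obj (pt s) i) (q : P.obj (pt t) j)
    (z : P.obj (pt u) k) :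
    P.pcomp g₂ c (P.pcomp g₁ (i + j) p q) z =
      ((j * k).negOnePow : ℤ) • P.pcomp h₂ c (P.pcomp h₁ (i + k) p z) q := by
  by_cases h : i + j + k = c
  · rw [P.pcomp_pos g₂ h, P.pcomp_pos g₁ rfl, P.pcomp_pos h₂ (by omega), P.pcomp_pos h₁ rfl]
    exact P.comp_par hg _ _ _ _ _ _ _ _ _ _ _
  · rw [P.pcomp_neg g₂ h, P.pcomp_neg h₂ (by omega), smul_zero]

end GrOperad

theorem Free.DegHom.der_pcomp {M : SymDiag ptOperad} (θ : Free.DegHom M) {s t r : ℕ}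
    (g : Graft s t r) {i j k : ℤ} (p : (Free M).obj (pt s) i) (q : (Free M).obj (pt t) j) :
    θ.der ((Free M).pcomp g k p q) = (Free M).pcomp g (k - 1) (θ.der p) q +
      (i.negOnePow : ℤ) • (Free M).pcomp g (k - 1) p (θ.der q) := by
  by_cases h : i + j = k
  · rw [(Free M).pcomp_pos g h, (Free M).pcomp_pos g (by omega), (Free M).pcomp_pos g (by omega)]
    exact θ.der_comp g _ h p q
  · rw [(Free M).pcomp_neg g h, (Free M).pcomp_neg g (by omega), (Free M).pcomp_neg g (by omega),
      map_zero, smul_zero, add_zero]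

/-! ### The cells of the shuffles -/

/-- The degree of the generator dual to a simplex. -/
def deg (n : ℕ) {r : ℕ} (l : List (Perm (Fin r))) : ℤ := (n : ℤ) * ((r : ℤ) - 1) - l.length

theorem Cell.deg_eq {n r : ℕ} {k : ℤ} {l : List (Perm (Fin r))} (h : Cell n k l) :
    KCobar.deg n l = k := h.deg

theorem variations_eq_changes {r : ℕ} (i j : Fin r) (l : List (Perm (Fin r))) :
    variations i j l = changes (fun σ => Precedes σ i j) l := by
  induction l with
  | nil => rfl
  | cons a l ih =>
    cases l with
    | nil => rfl
    | cons b l =>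
      rw [variations, changes, ih]
      congr 1
      by_cases h : Precedes a i j ↔ Precedes b i j
      · rw [if_pos h, if_pos h]
      · rw [if_neg h, if_neg h]

section

variable {n s t r : ℕ} {g : Graft s t r} {u : List (Perm (Fin s))} {v : List (Perm (Fin t))}
  {w : List (Perm (Fin r))}

/-- By `precedes_permComp`, the relative order of two inputs depends on a single factor, so it
changes only along the steps in that factor. -/
theorem IsShuffle.variations_eq (h : IsShuffle (permComp g) u v w) (x y : Fin r) :
    variations x y w =
      pairVal g.e (fun a b => variations a b u) (fun a b => variations a b v) (g.f x) (g.f y) := by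
  rw [variations_eq_changes]
  rcases hx : g.f x with a | a <;> rcases hy : g.f y with b | b <;>
    simp only [pairVal, variations_eq_changes]
  · exact h.changes_left (fun σ τ => by rw [precedes_permComp, hx, hy]; rfl)
  · exact h.changes_left (fun σ τ => by rw [precedes_permComp, hx, hy]; rfl)
  · exact h.changes_left (fun σ τ => by rw [precedes_permComp, hx, hy]; rfl)
  · exact h.changes_right (fun σ τ => by rw [precedes_permComp, hx, hy]; rfl)

/-- The length of `w` is one less than the sum of the lengths, while `r - 1 = (s - 1) + (t - 1)`.
This is why the twisting homomorphism has degree `-1`. -/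
theorem IsShuffle.deg_eq (h : IsShuffle (permComp g) u v w) : deg n w = deg n u + deg n v + 1 := by
  have h1 := h.length
  have h2 := g.arity
  unfold deg
  have h3 : (w.length : ℤ) = u.length + v.length - 1 := by omega
  have h4 : (r : ℤ) = s + t - 1 := by omega
  rw [h3, h4]
  ring

theorem IsShuffle.cell_left (h : IsShuffle (permComp g) u v w) {k : ℤ} (hw : Cell n k w)
    (hs : 2 ≤ s) (ht : 2 ≤ t) : Cell n (deg n u) u where
  two_le := hs
  ne_nil := h.left_ne_nil
  chain := (h.isChain_of hw.chain).1
  deg := rfl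
  var_lt := by
    -- Each outer input is represented by an input of the composite, with an inner input standing
    -- for `e`.
    have key : ∀ a, ∃ x, g.f x = Sum.inl a ∨ (a = g.e ∧ g.f x = Sum.inr ⟨0, by omega⟩) := by
      intro a
      by_cases ha : a = g.e
      · obtain ⟨x, hx⟩ := (g.range_iff (Sum.inr ⟨0, by omega⟩)).2 (by simp)
        exact ⟨x, Or.inr ⟨ha, hx⟩⟩
      · obtain ⟨x, hx⟩ := (g.range_iff (Sum.inl a)).2 (by simpa using ha)
        exact ⟨x, Or.inl hx⟩
    intro a b hab
    obtain ⟨x, hx⟩ := key a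
    obtain ⟨y, hy⟩ := key b
    have h1 : x ≠ y := by
      rintro rfl
      rcases hx with hx | ⟨hx, hx'⟩ <;> rcases hy with hy | ⟨hy, hy'⟩
      · exact hab (Sum.inl.inj (hx.symm.trans hy))
      · rw [hx] at hy'; simp at hy'
      · rw [hx'] at hy; simp at hy
      · exact hab (hx.trans hy.symm)
    have h2 := hw.var_lt x y h1
    rw [h.variations_eq] at h2
    rcases hx with hx | ⟨hx, hx'⟩ <;> rcases hy with hy | ⟨hy, hy'⟩
    · rwa [hx, hy] at h2
    · rwa [hx, hy', pairVal_inl_inr, ← hy] at h2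
    · rwa [hx', hy, pairVal_inr_inl, ← hx] at h2
    · exact absurd (hx.trans hy.symm) hab

theorem IsShuffle.cell_right (h : IsShuffle (permComp g) u v w) {k : ℤ} (hw : Cell n k w)
    (ht : 2 ≤ t) : Cell n (deg n v) v where
  two_le := ht
  ne_nil := h.right_ne_nil
  chain := (h.isChain_of hw.chain).2
  deg := rfl
  var_lt a b hab := by
    obtain ⟨x, hx⟩ := (g.range_iff (Sum.inr a)).2 (by simp)
    obtain ⟨y, hy⟩ := (g.range_iff (Sum.inr b)).2 (by simp)
    have h1 : x ≠ y := by
      rintro rfl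
      exact hab (Sum.inr.inj (hx.symm.trans hy))
    have h2 := hw.var_lt x y h1
    rwa [h.variations_eq, hx, hy, pairVal_inr_inr] at h2

/-- Each pair of inputs of the composite inherits its bound on variations from one of the factors:
`E_n` is closed under composition. -/
theorem IsShuffle.cell (h : IsShuffle (permComp g) u v w) {i j : ℤ} (hu : Cell n i u)
    (hv : Cell n j v) : Cell n (i + j + 1) w where
  two_le := by
    have h1 := g.arity
    have h2 := hu.two_le
    have h3 := hv.two_le
    omega
  ne_nil := h.ne_nil
  chain := h.isChain (fun a a' b hab => permComp_injective_left g a a' b hab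
    (by have := hv.two_le; omega)) (permComp_injective_right g) hu.chain hv.chain
  deg := by
    have h1 := h.deg_eq (n := n)
    rw [hu.deg_eq, hv.deg_eq] at h1
    exact h1
  var_lt x y hxy := by
    rw [h.variations_eq]
    rcases hx : g.f x with a | a <;> rcases hy : g.f y with b | b
    · exact hu.var_lt a b (fun hab => hxy (g.inj (by rw [hx, hy, hab])))
    · exact hu.var_lt a _ (g.e_ne hx)
    · exact hu.var_lt _ b (g.e_ne hy).symm
    · exact hv.var_lt a b (fun hab => hxy (g.inj (by rw [hx, hy, hab])))

end

/-! ### The coefficients of the twisting homomorphism -/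

/-- The sign gathered by the permutations of homogeneous symbols in the coproducts. -/
def koszul (n s t x y : ℕ) : ℤ :=
  -(((((x : ℤ) - 1 - n * ((s : ℤ) - 1)) * ((y : ℤ) - n * ((t : ℤ) - 1))).negOnePow : ℤ)
    * ((((x : ℤ) - 1) * n * ((t : ℤ) - 1)).negOnePow : ℤ))

section

variable {n s t r : ℕ} (g : Graft s t r) (u : List (Perm (Fin s))) (v : List (Perm (Fin t)))

theorem twistCoeff_eq (c : List (Perm (Fin r)) → ℤ) : twistCoeff n g u v c =
    koszul n s t u.length v.length * graftSign g ^ n * shEval (permComp g) u v c := by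
  unfold twistCoeff koszul
  rw [suspSign_eq, show evalComp g u v c = shEval (permComp g) u v c from rfl]
  ring

theorem twistCoeff_congr {c c' : List (Perm (Fin r)) → ℤ}
    (h : ∀ w, IsShuffle (permComp g) u v w → c w = c' w) :
    twistCoeff n g u v c = twistCoeff n g u v c' := by
  rw [twistCoeff_eq, twistCoeff_eq, shEval_congr h]

theorem exists_isShuffle {c : List (Perm (Fin r)) → ℤ} (h : twistCoeff n g u v c ≠ 0) :
    ∃ w, IsShuffle (permComp g) u v w ∧ c w ≠ 0 := by
  by_contra h'
  push Not at h'
  exact h (by rw [twistCoeff_eq, shEval_eq_zero h', mul_zero])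

theorem twistCoeff_add (c c' : List (Perm (Fin r)) → ℤ) :
    twistCoeff n g u v (fun m => c m + c' m) = twistCoeff n g u v c + twistCoeff n g u v c' := by
  simp only [twistCoeff_eq, shEval_add]; ring

theorem twistCoeff_mul (a : ℤ) (c : List (Perm (Fin r)) → ℤ) :
    twistCoeff n g u v (fun m => a * c m) = a * twistCoeff n g u v c := by
  simp only [twistCoeff_eq, shEval_mul]; ring

theorem twistCoeff_sum {ι : Type} (s : Finset ι) (c : ι → List (Perm (Fin r)) → ℤ) :
    twistCoeff n g u v (fun m => ∑ i ∈ s, c i m) = ∑ i ∈ s, twistCoeff n g u v (c i) := by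
  simp only [twistCoeff_eq, shEval_sum, Finset.mul_sum]

/-- The relabelling sign of `graftSign`, to the power `n`, absorbs the sign of the action of `ρ` on
`D_n` and leaves the signs by which `σ` and `τ` act on dual generators. -/
theorem twistCoeff_rel {σ : Perm (Fin s)} {τ : Perm (Fin t)} {ρ : Perm (Fin r)}
    {g' : Graft s t r} (h : Graft.Rel σ τ ρ g g') (c : List (Perm (Fin r)) → ℤ) :
    twistCoeff n g' (u.map (σ * ·)) (v.map (τ * ·))
        (fun l => (Perm.sign ρ : ℤ) ^ n * c (l.map (ρ⁻¹ * ·))) =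
      (Perm.sign σ * Perm.sign τ : ℤ) ^ n * twistCoeff n g u v c := by
  rw [twistCoeff_mul, twistCoeff_eq, twistCoeff_eq, List.length_map, List.length_map, shEval_map,
    graftSign_rel h]
  have h1 : (fun a b => permComp g' (σ * a) (τ * b)) = fun a b => ρ * permComp g a b := by
    ext a b : 2
    exact permComp_rel h a b
  rw [h1, shEval_map_right]
  have h2 : (fun m : List (Perm (Fin r)) => c ((m.map (ρ * ·)).map (ρ⁻¹ * ·))) = c := by
    funext m
    congr 1
    simp
  rw [h2]
  have h3 : (Perm.sign ρ : ℤ) ^ n * (Perm.sign ρ : ℤ) ^ n = 1 := by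
    rw [← mul_pow, sign_mul_self, one_pow]
  simp only [mul_pow]
  linear_combination ((Perm.sign σ : ℤ) ^ n * (Perm.sign τ : ℤ) ^ n * graftSign g ^ n *
    koszul n s t u.length v.length * shEval (permComp g) u v c) * h3

end

/-! ### Dual basis elements -/

theorem value_add {n r : ℕ} {k : ℤ} (c c' : (D n).obj (pt r) k) (l : List (Perm (Fin r))) :
    value (c + c') l = value c l + value c' l := rfl

theorem value_zero {n r : ℕ} {k : ℤ} (l : List (Perm (Fin r))) :
    value (0 : (D n).obj (pt r) k) l = 0 := rfl

/-- The value of cochains on a simplex as a homomorphism. -/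
def valueHom (n : ℕ) {r : ℕ} (k : ℤ) (l : List (Perm (Fin r))) : (D n).obj (pt r) k →+ ℤ :=
  AddMonoidHom.mk' (fun c => value c l) (fun c c' => value_add c c' l)

theorem D_ext {n r : ℕ} {k : ℤ} {c c' : (D n).obj (pt r) k}
    (h : ∀ l, value c l = value c' l) : c = c' := Subtype.ext (funext h)

theorem cell_of_value {n r : ℕ} {k : ℤ} {c : (D n).obj (pt r) k} {l : List (Perm (Fin r))}
    (h : value c l ≠ 0) : Cell n k l :=
  ((show (cellSystem n).Cochains (pt r) k from c).2 l h).1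

theorem dualBasis_eq_zero {n r : ℕ} {k : ℤ} {l : List (Perm (Fin r))} (h : ¬ Cell n k l) :
    dualBasis n k l = 0 := dif_neg h

theorem value_dualBasis {n r : ℕ} {k : ℤ} {l : List (Perm (Fin r))} (h : Cell n k l) :
    value (dualBasis n k l) = Pi.single l 1 := by
  have e : dualBasis n k l = (⟨Pi.single l 1, fun m hm => by
      obtain rfl : m = l := by
        by_contra h'
        exact hm (Pi.single_eq_of_ne h' _)
      exact ⟨h, trivial⟩⟩ : (cellSystem n).Cochains (pt r) k) := dif_pos h
  rw [e]
  rfl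

theorem value_dualBasis_self {n r : ℕ} {k : ℤ} {l : List (Perm (Fin r))} (h : Cell n k l) :
    value (dualBasis n k l) l = 1 := by
  rw [value_dualBasis h, Pi.single_eq_same]

theorem value_dualBasis_ne {n r : ℕ} {k : ℤ} {l m : List (Perm (Fin r))} (h : m ≠ l) :
    value (dualBasis n k l) m = 0 := by
  by_cases h' : Cell n k l
  · rw [value_dualBasis h', Pi.single_eq_of_ne h]
  · rw [dualBasis_eq_zero h']
    exact value_zero m

theorem value_map {n r : ℕ} {k : ℤ} (w : Perm (Fin r)) (c : (D n).obj (pt r) k)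
    (l : List (Perm (Fin r))) :
    value ((D n).map (β := pt r) w (le_refl _) c) l =
      (Perm.sign w : ℤ) ^ n * value c (l.map (w⁻¹ * ·)) := rfl

open Classical in
theorem value_δ {n r : ℕ} {k : ℤ} (c : (D n).obj (pt r) k) (l : List (Perm (Fin r))) :
    value ((δ n).d c) l =
      if Cell n (k - 1) l then (-1) ^ (l.length + 1) * bd l (value c) else 0 := rfl

theorem value_zsmul {n r : ℕ} {k : ℤ} (a : ℤ) (c : (D n).obj (pt r) k)
    (l : List (Perm (Fin r))) : value (a • c) l = a * value c l := by
  have := map_zsmul (valueHom n k l) a c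
  rwa [smul_eq_mul] at this

/-- The action precomposes with `w⁻¹`, so it carries the indicator function of `l` to that of the
translate, up to `sgn(w)ⁿ`, which is its own inverse. -/
theorem dualBasis_map {n r : ℕ} {k : ℤ} (w : Perm (Fin r)) (l : List (Perm (Fin r))) :
    dualBasis n k (l.map (w * ·)) =
      (Perm.sign w : ℤ) ^ n • (D n).map (β := pt r) w (le_refl _) (dualBasis n k l) := by
  have h0 : (Perm.sign w : ℤ) ^ n * (Perm.sign w : ℤ) ^ n = 1 := by
    rw [← mul_pow, sign_mul_self, one_pow]
  refine D_ext fun m => ?_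
  rw [value_zsmul, value_map, ← mul_assoc, h0, one_mul]
  have h1 : ∀ m : List (Perm (Fin r)), m = l.map (w * ·) ↔ m.map (w⁻¹ * ·) = l := fun m => by
    constructor
    · rintro rfl
      simp
    · rintro rfl
      exact (map_map_inv w m).symm
  by_cases h2 : m = l.map (w * ·)
  · have h3 := (h1 m).1 h2
    by_cases h4 : Cell n k m
    · rw [h3, value_dualBasis_self (by rw [← h3]; exact (Cell.map_iff w).2 h4), h2,
        value_dualBasis_self (by rwa [← h2])]
    · rw [dualBasis_eq_zero (by rwa [← h2]), dualBasis_eq_zero (l := l)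
        (by rw [← h3]; exact fun h => h4 ((Cell.map_iff w).1 h))]
      rfl
  · rw [value_dualBasis_ne h2, value_dualBasis_ne (fun h => h2 ((h1 m).2 h))]

/-- The sequences of bounded length. -/
noncomputable def lists (r N : ℕ) : Finset (List (Perm (Fin r))) :=
  (List.finite_length_le (Perm (Fin r)) N).toFinset

theorem mem_lists {r N : ℕ} {l : List (Perm (Fin r))} : l ∈ lists r N ↔ l.length ≤ N := by
  simp [lists]

theorem lists_subset {r N N' : ℕ} (h : N ≤ N') : lists r N ⊆ lists r N' := fun _ hl =>
  mem_lists.2 ((mem_lists.1 hl).trans h)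

/-- The length of the simplices in a given degree. -/
def len (n r : ℕ) (k : ℤ) : ℕ := ((n : ℤ) * ((r : ℤ) - 1) - k).toNat

theorem Cell.length_eq {n r : ℕ} {k : ℤ} {l : List (Perm (Fin r))} (h : Cell n k l) :
    l.length = len n r k := by
  have := h.deg
  unfold len
  omega

theorem len_deg {n r : ℕ} (l : List (Perm (Fin r))) : len n r (deg n l) = l.length := by
  unfold len deg
  omega

theorem len_sub_one {n r : ℕ} (k : ℤ) : len n r (k - 1) ≤ len n r k + 1 := by
  unfold len
  omega

/-- Only a lower bound on `N` is required, so that terms of several degrees can be expanded over the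
same index set. -/
theorem eq_sum_dualBasis {n r : ℕ} {k : ℤ} (c : (D n).obj (pt r) k) {N : ℕ}
    (hN : len n r k ≤ N) : c = ∑ l ∈ lists r N, value c l • dualBasis n k l := by
  refine D_ext fun m => ?_
  have h1 : value (∑ l ∈ lists r N, value c l • dualBasis n k l) m =
      ∑ l ∈ lists r N, value c l * value (dualBasis n k l) m := by
    have := map_sum (valueHom n k m) (fun l => value c l • dualBasis n k l) (lists r N)
    refine this.trans (Finset.sum_congr rfl fun l _ => value_zsmul _ _ _)
  rw [h1]
  by_cases h : value c m = 0
  · rw [h, Finset.sum_eq_zero]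
    intro l _
    by_cases hl : m = l
    · rw [← hl, h, zero_mul]
    · rw [value_dualBasis_ne hl, mul_zero]
  · have hm := cell_of_value h
    rw [Finset.sum_eq_single m]
    · rw [value_dualBasis_self hm, mul_one]
    · intro l _ hl
      rw [value_dualBasis_ne hl.symm, mul_zero]
    · intro h'
      exact absurd (mem_lists.2 (by rw [hm.length_eq]; exact hN)) h'

/-- Evaluation against the dual basis. -/
theorem sum_mul_value {n r N : ℕ} (F : List (Perm (Fin r)) → ℤ)
    (hF : ∀ m, F m ≠ 0 → Cell n (deg n m) m ∧ m.length ≤ N) (m : List (Perm (Fin r))) :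
    ∑ l ∈ lists r N, F l * value (dualBasis n (deg n l) l) m = F m := by
  by_cases h : F m = 0
  · rw [h, Finset.sum_eq_zero]
    intro l _
    by_cases hl : m = l
    · rw [← hl, h, zero_mul]
    · rw [value_dualBasis_ne hl, mul_zero]
  · obtain ⟨h1, h2⟩ := hF m h
    rw [Finset.sum_eq_single m]
    · rw [value_dualBasis_self h1, mul_one]
    · intro l _ hl
      rw [value_dualBasis_ne hl.symm, mul_zero]
    · intro h'
      exact absurd (mem_lists.2 h2) h'

/-- The generator of the cobar construction dual to a simplex (zero for other sequences). -/
noncomputable def basis (n : ℕ) {r : ℕ} (l : List (Perm (Fin r))) :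
    (Free (D n)).obj (pt r) (deg n l) :=
  (Free.gen (D n)).app (dualBasis n (deg n l) l)

theorem basis_eq_zero {n r : ℕ} {l : List (Perm (Fin r))} (h : ¬ Cell n (deg n l) l) :
    basis n l = 0 := by
  rw [basis, dualBasis_eq_zero h, map_zero]

section

variable {n s t r : ℕ} {g : Graft s t r} {k m : ℤ}

theorem pcomp_gen_left (c : (D n).obj (pt s) k) {N : ℕ} (hN : len n s k ≤ N) {j : ℤ}
    (q : (Free (D n)).obj (pt t) j) :
    (Free (D n)).pcomp g m ((Free.gen (D n)).app c) q =
      ∑ l ∈ lists s N, value c l • (Free (D n)).pcomp g m (basis n l) q := by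
  conv_lhs => rw [eq_sum_dualBasis c hN]
  simp only [map_sum, map_zsmul, AddMonoidHom.finsetSum_apply, AddMonoidHom.smul_apply]
  refine Finset.sum_congr rfl fun l _ => ?_
  -- A nonzero coefficient forces the degree of `l` to be `k`; only then do the two dual generators
  -- live in the same group.
  by_cases h : value c l = 0
  · rw [h, zero_smul, zero_smul]
  · have h1 := (cell_of_value h).deg_eq
    subst h1
    rfl

theorem pcomp_gen_right (c : (D n).obj (pt t) k) {N : ℕ} (hN : len n t k ≤ N) {i : ℤ}
    (p : (Free (D n)).obj (pt s) i) :
    (Free (D n)).pcomp g m p ((Free.gen (D n)).app c) =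
      ∑ l ∈ lists t N, value c l • (Free (D n)).pcomp g m p (basis n l) := by
  conv_lhs => rw [eq_sum_dualBasis c hN]
  simp only [map_sum, map_zsmul]
  refine Finset.sum_congr rfl fun l _ => ?_
  by_cases h : value c l = 0
  · rw [h, zero_smul, zero_smul]
  · have h1 := (cell_of_value h).deg_eq
    subst h1
    rfl

theorem basis_map (σ : Perm (Fin s)) (u : List (Perm (Fin s))) (p : ℤ) :
    (Free.gen (D n)).app (dualBasis n p (u.map (σ * ·))) = (Perm.sign σ : ℤ) ^ n •
      (Free (D n)).map (β := pt s) σ (le_refl _) ((Free.gen (D n)).app (dualBasis n p u)) := by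
  rw [dualBasis_map, map_zsmul]
  congr 1
  exact (Free.gen (D n)).app_map σ _ _

theorem deg_map (σ : Perm (Fin s)) (u : List (Perm (Fin s))) :
    deg n (u.map (σ * ·)) = deg n u := by
  simp [deg]

end

end KCobar

/-! ### Sums over pairs and triples of simplices -/

namespace KCobar

/-- Written as a single power of `-1`, so that products of signs become sums of exponents. -/
theorem koszul_eq (n s t x y : ℕ) : koszul n s t x y =
    ((1 + ((x : ℤ) - 1 - n * ((s : ℤ) - 1)) * ((y : ℤ) - n * ((t : ℤ) - 1)) +
      ((x : ℤ) - 1) * n * ((t : ℤ) - 1)).negOnePow : ℤ) := by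
  rw [koszul, Int.negOnePow_add, Int.negOnePow_add, Int.negOnePow_one]
  simp only [Units.val_mul, Units.val_neg, Units.val_one]
  ring

section

variable {n s t u m m' r : ℕ}

theorem twistCoeff_length {g : Graft s t r} {x : List (Perm (Fin s))} {y : List (Perm (Fin t))}
    {c : List (Perm (Fin r)) → ℤ} {N : ℕ} (hc : ∀ w, c w ≠ 0 → w.length ≤ N)
    (h : twistCoeff n g x y c ≠ 0) : x.length ≤ N ∧ y.length ≤ N := by
  obtain ⟨w, h1, h2⟩ := exists_isShuffle g x y h
  have h3 := h1.length
  have h4 := hc w h2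
  have h5 := List.length_pos_of_ne_nil h1.left_ne_nil
  have h6 := List.length_pos_of_ne_nil h1.right_ne_nil
  omega

/-- A sum over the pairs of simplices is preserved by the relabellings of composites. -/
theorem sum_twist_rel {σ : Perm (Fin s)} {τ : Perm (Fin t)} {ρ : Perm (Fin r)}
    {g g' : Graft s t r} (hg : Graft.Rel σ τ ρ g g') {c c' : List (Perm (Fin r)) → ℤ}
    (hc : ∀ l, c' l = (Perm.sign ρ : ℤ) ^ n * c (l.map (ρ⁻¹ * ·))) (N : ℕ) {A : Type}
    {B : Type} [AddCommGroup A] [AddCommGroup B] (φ : A →+ B)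
    (G : List (Perm (Fin s)) → List (Perm (Fin t)) → A)
    (G' : List (Perm (Fin s)) → List (Perm (Fin t)) → B)
    (hG : ∀ x y, G' (x.map (σ * ·)) (y.map (τ * ·)) =
      (Perm.sign σ * Perm.sign τ : ℤ) ^ n • φ (G x y)) :
    ∑ p ∈ lists s N ×ˢ lists t N, twistCoeff n g' p.1 p.2 c' • G' p.1 p.2 =
      φ (∑ p ∈ lists s N ×ˢ lists t N, twistCoeff n g p.1 p.2 c • G p.1 p.2) := by
  rw [map_sum]
  symm
  refine Finset.sum_nbij' (fun p => (p.1.map (σ * ·), p.2.map (τ * ·)))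
    (fun p => (p.1.map (σ⁻¹ * ·), p.2.map (τ⁻¹ * ·))) ?_ ?_ ?_ ?_ ?_
  · rintro ⟨x, y⟩ h
    simpa only [Finset.mem_product, mem_lists, List.length_map] using h
  · rintro ⟨x, y⟩ h
    simpa only [Finset.mem_product, mem_lists, List.length_map] using h
  · rintro ⟨x, y⟩ _
    simp
  · rintro ⟨x, y⟩ _
    simp
  · rintro ⟨x, y⟩ _
    have h1 : c' = fun l => (Perm.sign ρ : ℤ) ^ n * c (l.map (ρ⁻¹ * ·)) := funext hc
    have h2 : ((Perm.sign σ * Perm.sign τ : ℤ) ^ n) * (Perm.sign σ * Perm.sign τ : ℤ) ^ n = 1 := by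
      rw [← mul_pow]
      have h3 : (Perm.sign σ * Perm.sign τ * (Perm.sign σ * Perm.sign τ) : ℤ) = 1 := by
        linear_combination (Perm.sign τ * Perm.sign τ : ℤ) * sign_mul_self σ + sign_mul_self τ
      rw [h3, one_pow]
    dsimp only
    rw [h1, twistCoeff_rel g x y hg, hG, smul_smul, mul_right_comm, h2, one_mul, map_zsmul]

/-- The component of the twisting homomorphism on composites of a given shape. -/
noncomputable def twistAt (n N : ℕ) (k : ℤ) (g : Graft s t r) (c : List (Perm (Fin r)) → ℤ) :
    (Free (D n)).obj (pt r) k :=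
  ∑ p ∈ lists s N ×ˢ lists t N, twistCoeff n g p.1 p.2 c •
    (Free (D n)).pcomp g k (basis n p.1) (basis n p.2)

theorem twistAt_eq {N N' : ℕ} (hN : N ≤ N') (k : ℤ) (g : Graft s t r)
    {c : List (Perm (Fin r)) → ℤ} (hc : ∀ w, c w ≠ 0 → w.length ≤ N) :
    twistAt n N k g c = twistAt n N' k g c := by
  refine Finset.sum_subset (Finset.product_subset_product (lists_subset hN) (lists_subset hN)) ?_
  intro p _ hp
  by_cases h : twistCoeff n g p.1 p.2 c = 0
  · rw [h, zero_smul]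
  · have h1 := twistCoeff_length hc h
    exact absurd (Finset.mem_product.2 ⟨mem_lists.2 h1.1, mem_lists.2 h1.2⟩) hp

theorem twistAt_add (N : ℕ) (k : ℤ) (g : Graft s t r) (c c' : List (Perm (Fin r)) → ℤ) :
    twistAt n N k g (fun l => c l + c' l) = twistAt n N k g c + twistAt n N k g c' := by
  simp only [twistAt, twistCoeff_add, add_smul, Finset.sum_add_distrib]

theorem twistAt_mul (N : ℕ) (k : ℤ) (g : Graft s t r) (a : ℤ) (c : List (Perm (Fin r)) → ℤ) :
    twistAt n N k g (fun l => a * c l) = a • twistAt n N k g c := by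
  simp only [twistAt, twistCoeff_mul, Finset.smul_sum, smul_smul]

theorem basis_map_pcomp {g g' : Graft s t r} {σ : Perm (Fin s)} {τ : Perm (Fin t)}
    {ρ : Perm (Fin r)} (hg : Graft.Rel σ τ ρ g g') (k : ℤ) (x : List (Perm (Fin s)))
    (y : List (Perm (Fin t))) :
    (Free (D n)).pcomp g' k (basis n (x.map (σ * ·))) (basis n (y.map (τ * ·))) =
      (Perm.sign σ * Perm.sign τ : ℤ) ^ n •
      (Free (D n)).map (β := pt r) ρ (le_refl _)
        ((Free (D n)).pcomp g k (basis n x) (basis n y)) := by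
  unfold basis
  rw [deg_map, deg_map, basis_map, basis_map]
  simp only [map_zsmul, AddMonoidHom.smul_apply, smul_smul]
  rw [GrOperad.pcomp_map _ hg, mul_pow, mul_comm]

/-- For `ρ = 1` this is independence of the labelling of the vertices, for general `ρ` it is
equivariance. The signs of `σ` and `τ` on coefficients and on dual generators cancel. -/
theorem twistAt_rel {σ : Perm (Fin s)} {τ : Perm (Fin t)} {ρ : Perm (Fin r)}
    {g g' : Graft s t r} (hg : Graft.Rel σ τ ρ g g') {c c' : List (Perm (Fin r)) → ℤ}
    (hc : ∀ l, c' l = (Perm.sign ρ : ℤ) ^ n * c (l.map (ρ⁻¹ * ·))) (N : ℕ) (k : ℤ) :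
    twistAt n N k g' c' = (Free (D n)).map (β := pt r) ρ (le_refl _) (twistAt n N k g c) :=
  sum_twist_rel (n := n) hg hc N ((Free (D n)).map (β := pt r) ρ (le_refl _))
    (fun x y => (Free (D n)).pcomp g k (basis n x) (basis n y))
    (fun x y => (Free (D n)).pcomp g' k (basis n x) (basis n y))
    (fun x y => basis_map_pcomp hg k x y)

/-- The characteristic function of a simplex. -/
noncomputable def char (n : ℕ) (l : List (Perm (Fin r))) : List (Perm (Fin r)) → ℤ :=
  value (dualBasis n (deg n l) l)

theorem char_map (σ : Perm (Fin r)) (l m : List (Perm (Fin r))) :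
    char n (l.map (σ * ·)) m = char n l (m.map (σ⁻¹ * ·)) := by
  unfold char
  rw [deg_map, dualBasis_map, value_zsmul, value_map, ← mul_assoc, ← mul_pow, sign_mul_self,
    one_pow, one_mul]

theorem char_length {l w : List (Perm (Fin r))} (h : char n l w ≠ 0) : w.length = l.length := by
  rw [(cell_of_value h).length_eq, len_deg]

theorem twistAt_char_rel {σ : Perm (Fin s)} {τ : Perm (Fin t)} {ρ : Perm (Fin r)}
    {g g' : Graft s t r} (hg : Graft.Rel σ τ ρ g g') (N : ℕ) (k : ℤ) (l : List (Perm (Fin r))) :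
    twistAt n N k g' (char n (l.map (ρ * ·))) = (Perm.sign ρ : ℤ) ^ n •
      (Free (D n)).map (β := pt r) ρ (le_refl _) (twistAt n N k g (char n l)) := by
  rw [← map_zsmul, ← twistAt_mul]
  refine twistAt_rel hg (fun m => ?_) N k
  rw [char_map, ← mul_assoc, ← mul_pow, sign_mul_self, one_pow, one_mul]

/-- The terms of the square of the twisting derivation where it is applied to the outer vertex. -/
noncomputable def twistLeft (n N : ℕ) (k : ℤ) (g₁ : Graft s t m) (g₂ : Graft m u r)
    (c : List (Perm (Fin r)) → ℤ) : (Free (D n)).obj (pt r) k :=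
  ∑ p ∈ lists m N ×ˢ lists u N, twistCoeff n g₂ p.1 p.2 c •
    (Free (D n)).pcomp g₂ k (twistAt n N (deg n p.1 - 1) g₁ (char n p.1)) (basis n p.2)

/-- The terms of the square of the twisting derivation where it is applied to the inner vertex. -/
noncomputable def twistRight (n N : ℕ) (k : ℤ) (h₁ : Graft t u m') (h₂ : Graft s m' r)
    (c : List (Perm (Fin r)) → ℤ) : (Free (D n)).obj (pt r) k :=
  ∑ p ∈ lists s N ×ˢ lists m' N, twistCoeff n h₂ p.1 p.2 c • ((deg n p.1).negOnePow : ℤ) •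
    (Free (D n)).pcomp h₂ k (basis n p.1) (twistAt n N (deg n p.2 - 1) h₁ (char n p.2))

theorem basis_map' (σ : Perm (Fin s)) (x : List (Perm (Fin s))) {k : ℤ} (g : Graft s t r)
    {j : ℤ} (q : (Free (D n)).obj (pt t) j) :
    (Free (D n)).pcomp g k (basis n (x.map (σ * ·))) q =
      (Perm.sign σ : ℤ) ^ n • (Free (D n)).pcomp g k
        ((Free (D n)).map (β := pt s) σ (le_refl _) (basis n x)) q := by
  unfold basis
  rw [deg_map, basis_map, map_zsmul, AddMonoidHom.smul_apply]

theorem basis_map'' (τ : Perm (Fin t)) (y : List (Perm (Fin t))) {k : ℤ} (g : Graft s t r)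
    {i : ℤ} (p : (Free (D n)).obj (pt s) i) :
    (Free (D n)).pcomp g k p (basis n (y.map (τ * ·))) =
      (Perm.sign τ : ℤ) ^ n • (Free (D n)).pcomp g k p
        ((Free (D n)).map (β := pt t) τ (le_refl _) (basis n y)) := by
  unfold basis
  rw [deg_map, basis_map, map_zsmul]

/-- The relabelling `ρ` of the intermediate composite occurs once at the output of `g₁` and once at
the outer factor of `g₂`, and its signs cancel. -/
theorem twistLeft_rel {σ : Perm (Fin s)} {τ : Perm (Fin t)} {ρ : Perm (Fin m)}
    {τ' : Perm (Fin u)} {g₁ g₁' : Graft s t m} {g₂ g₂' : Graft m u r}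
    (hg : Graft.Rel σ τ ρ g₁ g₁') (hg' : Graft.Rel ρ τ' 1 g₂ g₂') (N : ℕ) (k : ℤ)
    (c : List (Perm (Fin r)) → ℤ) :
    twistLeft n N k g₁' g₂' c = twistLeft n N k g₁ g₂ c := by
  refine sum_twist_rel (n := n) hg' (c := c) (c' := c) (fun l => by simp) N (AddMonoidHom.id _)
    (fun x y => (Free (D n)).pcomp g₂ k (twistAt n N (deg n x - 1) g₁ (char n x)) (basis n y))
    (fun x y => (Free (D n)).pcomp g₂' k (twistAt n N (deg n x - 1) g₁' (char n x)) (basis n y))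
    fun x y => ?_
  rw [basis_map'', deg_map, twistAt_char_rel hg, map_zsmul, AddMonoidHom.smul_apply,
    GrOperad.pcomp_map_one _ hg', smul_smul, mul_pow, mul_comm]
  rfl

theorem twistRight_rel {σ : Perm (Fin t)} {τ : Perm (Fin u)} {ρ : Perm (Fin m')}
    {σ' : Perm (Fin s)} {h₁ h₁' : Graft t u m'} {h₂ h₂' : Graft s m' r}
    (hg : Graft.Rel σ τ ρ h₁ h₁') (hg' : Graft.Rel σ' ρ 1 h₂ h₂') (N : ℕ) (k : ℤ)
    (c : List (Perm (Fin r)) → ℤ) :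
    twistRight n N k h₁' h₂' c = twistRight n N k h₁ h₂ c := by
  refine sum_twist_rel (n := n) hg' (c := c) (c' := c) (fun l => by simp) N (AddMonoidHom.id _)
    (fun x y => ((deg n x).negOnePow : ℤ) •
      (Free (D n)).pcomp h₂ k (basis n x) (twistAt n N (deg n y - 1) h₁ (char n y)))
    (fun x y => ((deg n x).negOnePow : ℤ) •
      (Free (D n)).pcomp h₂' k (basis n x) (twistAt n N (deg n y - 1) h₁' (char n y)))
    fun x y => ?_
  rw [basis_map', deg_map, deg_map, twistAt_char_rel hg, map_zsmul,
    GrOperad.pcomp_map_one _ hg', smul_smul, smul_smul, mul_pow]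
  refine Eq.trans ?_ (smul_smul _ _ _).symm
  congr 1
  ring

/-! ### Expansions over the triples of simplices -/

theorem cell_of_basis {l : List (Perm (Fin r))} (h : basis n l ≠ 0) : Cell n (deg n l) l := by
  by_contra h'
  exact h (basis_eq_zero h')

theorem cell_left_of_twistCoeff {g : Graft s t r} {x : List (Perm (Fin s))}
    {y : List (Perm (Fin t))} {c : List (Perm (Fin r)) → ℤ} {k : ℤ}
    (hc : ∀ w, c w ≠ 0 → Cell n k w) (hs : 2 ≤ s) (ht : 2 ≤ t)
    (h : twistCoeff n g x y c ≠ 0) : Cell n (deg n x) x := by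
  obtain ⟨w, h1, h2⟩ := exists_isShuffle g x y h
  exact h1.cell_left (hc w h2) hs ht

theorem cell_right_of_twistCoeff {g : Graft s t r} {x : List (Perm (Fin s))}
    {y : List (Perm (Fin t))} {c : List (Perm (Fin r)) → ℤ} {k : ℤ}
    (hc : ∀ w, c w ≠ 0 → Cell n k w) (ht : 2 ≤ t)
    (h : twistCoeff n g x y c ≠ 0) : Cell n (deg n y) y := by
  obtain ⟨w, h1, h2⟩ := exists_isShuffle g x y h
  exact h1.cell_right (hc w h2) ht

theorem twistCoeff_char_deg {g : Graft s t r} {x : List (Perm (Fin s))}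
    {y : List (Perm (Fin t))} {l : List (Perm (Fin r))}
    (h : twistCoeff n g x y (char n l) ≠ 0) : deg n l - 1 = deg n x + deg n y := by
  obtain ⟨w, h1, h2⟩ := exists_isShuffle g x y h
  have h3 := h1.deg_eq (n := n)
  have h4 := char_length h2
  unfold deg at h3 ⊢
  rw [h4] at h3
  omega

/-- Expanding the inner `twistAt` leaves a sum over an intermediate simplex `w`, which duality
collapses: the coefficient of a triple is the iterated evaluation of `c` on `(x ∘ y) ∘ z`. -/
theorem twistLeft_eq (N : ℕ) (k K : ℤ) (g₁ : Graft s t m) (g₂ : Graft m u r)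
    (c : List (Perm (Fin r)) → ℤ) (hc : ∀ w, c w ≠ 0 → Cell n k w) (hN : len n r k ≤ N) :
    twistLeft n N K g₁ g₂ c = ∑ x ∈ lists s N, ∑ y ∈ lists t N, ∑ z ∈ lists u N,
      twistCoeff n g₁ x y (fun w => twistCoeff n g₂ w z c) •
        (Free (D n)).pcomp g₂ K ((Free (D n)).pcomp g₁ (deg n x + deg n y) (basis n x) (basis n y))
          (basis n z) := by
  have e1 : twistLeft n N K g₁ g₂ c = ∑ w ∈ lists m N, ∑ z ∈ lists u N, ∑ x ∈ lists s N,
      ∑ y ∈ lists t N, (twistCoeff n g₂ w z c * twistCoeff n g₁ x y (char n w)) •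
        (Free (D n)).pcomp g₂ K ((Free (D n)).pcomp g₁ (deg n x + deg n y) (basis n x) (basis n y))
          (basis n z) := by
    rw [twistLeft, Finset.sum_product]
    refine Finset.sum_congr rfl fun w _ => Finset.sum_congr rfl fun z _ => ?_
    rw [twistAt, Finset.sum_product]
    simp only [map_sum, map_zsmul, AddMonoidHom.finsetSum_apply, AddMonoidHom.smul_apply,
      Finset.smul_sum, smul_smul]
    refine Finset.sum_congr rfl fun x _ => Finset.sum_congr rfl fun y _ => ?_
    by_cases h : twistCoeff n g₁ x y (char n w) = 0
    · rw [h, mul_zero, zero_smul, zero_smul]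
    · rw [twistCoeff_char_deg h]
  rw [e1, Finset.sum_comm]
  have e2 : ∀ z, ∑ w ∈ lists m N, ∑ x ∈ lists s N, ∑ y ∈ lists t N,
      (twistCoeff n g₂ w z c * twistCoeff n g₁ x y (char n w)) •
        (Free (D n)).pcomp g₂ K ((Free (D n)).pcomp g₁ (deg n x + deg n y) (basis n x) (basis n y))
          (basis n z) = ∑ x ∈ lists s N, ∑ y ∈ lists t N,
      twistCoeff n g₁ x y (fun w => twistCoeff n g₂ w z c) •
        (Free (D n)).pcomp g₂ K ((Free (D n)).pcomp g₁ (deg n x + deg n y) (basis n x) (basis n y))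
          (basis n z) := by
    intro z
    rw [Finset.sum_comm]
    refine Finset.sum_congr rfl fun x _ => ?_
    rw [Finset.sum_comm]
    refine Finset.sum_congr rfl fun y _ => ?_
    rw [← Finset.sum_smul]
    -- Zero generators are discarded first. The remaining ones have arity at least 2, which is
    -- needed to see that the coefficient, as a function of `w`, is supported on cells.
    by_cases hx : basis n x = 0
    · rw [hx]; simp only [map_zero, AddMonoidHom.zero_apply, smul_zero]
    by_cases hy : basis n y = 0
    · rw [hy]; simp only [map_zero, AddMonoidHom.zero_apply, smul_zero]
    by_cases hz : basis n z = 0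
    · rw [hz]; simp only [map_zero, smul_zero]
    have hs := (cell_of_basis hx).two_le
    have ht := (cell_of_basis hy).two_le
    have hu := (cell_of_basis hz).two_le
    have ha := g₁.arity
    congr 1
    simp only [← twistCoeff_mul, ← twistCoeff_sum]
    refine twistCoeff_congr _ _ _ fun w _ => ?_
    refine sum_mul_value (fun w => twistCoeff n g₂ w z c) (fun w hw => ⟨?_, ?_⟩) w
    · exact cell_left_of_twistCoeff hc (by omega) hu hw
    · exact (twistCoeff_length (fun w' hw' => ((hc w' hw').length_eq.trans_le hN)) hw).1
  simp only [e2]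
  rw [Finset.sum_comm]
  refine Finset.sum_congr rfl fun x _ => Finset.sum_comm

/-- The mirror image of `twistLeft_eq`. The extra sign comes from the Leibniz rule, when the
derivation passes the outer generator. -/
theorem twistRight_eq (N : ℕ) (k K : ℤ) (h₁ : Graft t u m') (h₂ : Graft s m' r)
    (c : List (Perm (Fin r)) → ℤ) (hc : ∀ w, c w ≠ 0 → Cell n k w) (hN : len n r k ≤ N) :
    twistRight n N K h₁ h₂ c = ∑ x ∈ lists s N, ∑ y ∈ lists t N, ∑ z ∈ lists u N,
      (twistCoeff n h₁ y z (fun w => twistCoeff n h₂ x w c) * ((deg n x).negOnePow : ℤ)) •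
        (Free (D n)).pcomp h₂ K (basis n x)
          ((Free (D n)).pcomp h₁ (deg n y + deg n z) (basis n y) (basis n z)) := by
  rw [twistRight, Finset.sum_product]
  refine Finset.sum_congr rfl fun x _ => ?_
  have e1 : ∀ w, twistCoeff n h₂ x w c • ((deg n x).negOnePow : ℤ) •
      (Free (D n)).pcomp h₂ K (basis n x) (twistAt n N (deg n w - 1) h₁ (char n w)) =
      ∑ y ∈ lists t N, ∑ z ∈ lists u N,
      ((twistCoeff n h₂ x w c * twistCoeff n h₁ y z (char n w)) * ((deg n x).negOnePow : ℤ)) •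
        (Free (D n)).pcomp h₂ K (basis n x)
          ((Free (D n)).pcomp h₁ (deg n y + deg n z) (basis n y) (basis n z)) := by
    intro w
    rw [twistAt, Finset.sum_product]
    simp only [map_sum, map_zsmul, Finset.smul_sum, smul_smul]
    refine Finset.sum_congr rfl fun y _ => Finset.sum_congr rfl fun z _ => ?_
    by_cases h : twistCoeff n h₁ y z (char n w) = 0
    · rw [h]; simp only [mul_zero, zero_mul, zero_smul]
    · rw [twistCoeff_char_deg h]
      congr 1
      ring
  simp only [e1]
  rw [Finset.sum_comm]
  refine Finset.sum_congr rfl fun y _ => ?_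
  rw [Finset.sum_comm]
  refine Finset.sum_congr rfl fun z _ => ?_
  rw [← Finset.sum_smul, ← Finset.sum_mul]
  by_cases hx : basis n x = 0
  · rw [hx]; simp only [map_zero, AddMonoidHom.zero_apply, smul_zero]
  by_cases hy : basis n y = 0
  · rw [hy]; simp only [map_zero, AddMonoidHom.zero_apply, smul_zero]
  by_cases hz : basis n z = 0
  · rw [hz]; simp only [map_zero, smul_zero]
  have hs := (cell_of_basis hx).two_le
  have ht := (cell_of_basis hy).two_le
  have hu := (cell_of_basis hz).two_le
  have ha := h₁.arity
  congr 2
  simp only [← twistCoeff_mul, ← twistCoeff_sum]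
  refine twistCoeff_congr _ _ _ fun w _ => ?_
  refine sum_mul_value (fun w => twistCoeff n h₂ x w c) (fun w hw => ⟨?_, ?_⟩) w
  · exact cell_right_of_twistCoeff hc (by omega) hw
  · exact (twistCoeff_length (fun w' hw' => ((hc w' hw').length_eq.trans_le hN)) hw).2

/-- All terms of `x ∘ y` have the same length `N`, so the Koszul sign of the second composite is
constant on them. -/
theorem twistCoeff_twistCoeff_left (g₁ : Graft s t m) (g₂ : Graft m u r)
    (x : List (Perm (Fin s))) (y : List (Perm (Fin t))) (z : List (Perm (Fin u)))
    (c : List (Perm (Fin r)) → ℤ) {N : ℕ} (hN : N + 1 = x.length + y.length) :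
    twistCoeff n g₁ x y (fun w => twistCoeff n g₂ w z c) =
      koszul n s t x.length y.length * koszul n m u N z.length *
        (graftSign g₁ * graftSign g₂) ^ n *
        shEval (permComp g₁) x y (fun w => shEval (permComp g₂) w z c) := by
  rw [twistCoeff_eq, shEval_congr (c' := fun w => koszul n m u N z.length * graftSign g₂ ^ n *
    shEval (permComp g₂) w z c), shEval_mul, mul_pow]
  · ring
  · intro w hw
    have h1 := hw.length
    have h2 : w.length = N := by omega
    rw [twistCoeff_eq, h2]

theorem twistCoeff_twistCoeff_right (h₁ : Graft t u m') (h₂ : Graft s m' r)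
    (x : List (Perm (Fin s))) (y : List (Perm (Fin t))) (z : List (Perm (Fin u)))
    (c : List (Perm (Fin r)) → ℤ) {N : ℕ} (hN : N + 1 = y.length + z.length) :
    twistCoeff n h₁ y z (fun w => twistCoeff n h₂ x w c) =
      koszul n t u y.length z.length * koszul n s m' x.length N *
        (graftSign h₁ * graftSign h₂) ^ n *
        shEval (permComp h₁) y z (fun w => shEval (permComp h₂) x w c) := by
  rw [twistCoeff_eq, shEval_congr (c' := fun w => koszul n s m' x.length N * graftSign h₂ ^ n *
    shEval (permComp h₂) x w c), shEval_mul, mul_pow]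
  · ring
  · intro w hw
    have h1 := hw.length
    have h2 : w.length = N := by omega
    rw [twistCoeff_eq, h2]

/-- Associativity of the shuffle product and of the suspension sign reduces the comparison to Koszul
signs. On desuspended generators these differ by exactly `-1`, so the two ways to produce a linear
tree with three vertices cancel. -/
theorem twistLeft_seq {g₁ : Graft s t m} {g₂ : Graft m u r} {h₁ : Graft t u m'}
    {h₂ : Graft s m' r} (hg : Graft.Seq g₁ g₂ h₁ h₂) (N : ℕ) (k K : ℤ)
    (c : List (Perm (Fin r)) → ℤ) (hc : ∀ w, c w ≠ 0 → Cell n k w) (hN : len n r k ≤ N) :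
    twistLeft n N K g₁ g₂ c = - twistRight n N K h₁ h₂ c := by
  rw [twistLeft_eq N k K g₁ g₂ c hc hN, twistRight_eq N k K h₁ h₂ c hc hN]
  simp only [← Finset.sum_neg_distrib]
  refine Finset.sum_congr rfl fun x _ => Finset.sum_congr rfl fun y _ =>
    Finset.sum_congr rfl fun z _ => ?_
  by_cases hx : basis n x = 0
  · rw [hx]; simp only [map_zero, AddMonoidHom.zero_apply, smul_zero, neg_zero]
  by_cases hy : basis n y = 0
  · rw [hy]; simp only [map_zero, AddMonoidHom.zero_apply, smul_zero, neg_zero]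
  rw [GrOperad.pcomp_seq _ hg, ← neg_smul]
  congr 1
  have hx' := List.length_pos_of_ne_nil (cell_of_basis hx).ne_nil
  have hy' := List.length_pos_of_ne_nil (cell_of_basis hy).ne_nil
  obtain ⟨M, hM⟩ : ∃ M, M + 1 = x.length + y.length := ⟨x.length + y.length - 1, by omega⟩
  obtain ⟨M', hM'⟩ : ∃ M, M + 1 = y.length + z.length := ⟨y.length + z.length - 1, by omega⟩
  rw [twistCoeff_twistCoeff_left g₁ g₂ x y z c hM, twistCoeff_twistCoeff_right h₁ h₂ x y z c hM',
    shEval_assoc (permComp_seq hg), graftSign_seq hg]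
  have key : koszul n s t x.length y.length * koszul n m u M z.length =
      - (koszul n t u y.length z.length * koszul n s m' x.length M' *
        ((deg n x).negOnePow : ℤ)) := by
    simp only [koszul_eq, deg]
    rw [← neg_one_mul, show (-1 : ℤ) = ((1 : ℤ).negOnePow : ℤ) by simp]
    simp only [← Units.val_mul, ← Int.negOnePow_add]
    have a1 : (m : ℤ) = s + t - 1 := by have := g₁.arity; omega
    have a2 : (m' : ℤ) = t + u - 1 := by have := h₁.arity; omega
    have a3 : (M : ℤ) = x.length + y.length - 1 := by omega
    have a4 : (M' : ℤ) = y.length + z.length - 1 := by omega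
    rw [a1, a2, a3, a4]
    refine negOnePow_congr_zmod ?_
    push_cast
    generalize (n : ZMod 2) = n'
    generalize (s : ZMod 2) = s'
    generalize (t : ZMod 2) = t'
    generalize (u : ZMod 2) = u'
    generalize (x.length : ZMod 2) = x'
    generalize (y.length : ZMod 2) = y'
    generalize (z.length : ZMod 2) = z'
    revert n' s' t' u' x' y' z'
    decide
  rw [key]
  ring

/-- Exchanging two operations plugged in the same root costs a shuffle sign, a suspension sign and
the sign of parallel composition. Together with the Koszul signs of the coefficients they give `-1`.
-/
theorem twistLeft_par {g₁ : Graft s t m} {g₂ : Graft m u r} {h₁ : Graft s u m'}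
    {h₂ : Graft m' t r} (hg : Graft.Par g₁ g₂ h₁ h₂) (N : ℕ) (k K : ℤ)
    (c : List (Perm (Fin r)) → ℤ) (hc : ∀ w, c w ≠ 0 → Cell n k w) (hN : len n r k ≤ N) :
    twistLeft n N K g₁ g₂ c = - twistLeft n N K h₁ h₂ c := by
  rw [twistLeft_eq N k K g₁ g₂ c hc hN, twistLeft_eq N k K h₁ h₂ c hc hN]
  simp only [← Finset.sum_neg_distrib]
  refine Finset.sum_congr rfl fun x _ => ?_
  rw [Finset.sum_comm]
  refine Finset.sum_congr rfl fun z _ => Finset.sum_congr rfl fun y _ => ?_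
  by_cases hx : basis n x = 0
  · rw [hx]; simp only [map_zero, AddMonoidHom.zero_apply, smul_zero, neg_zero]
  rw [GrOperad.pcomp_par _ hg, smul_smul, ← neg_smul]
  congr 1
  have hx' := List.length_pos_of_ne_nil (cell_of_basis hx).ne_nil
  obtain ⟨M, hM⟩ : ∃ M, M + 1 = x.length + y.length := ⟨x.length + y.length - 1, by omega⟩
  obtain ⟨M', hM'⟩ : ∃ M, M + 1 = x.length + z.length := ⟨x.length + z.length - 1, by omega⟩
  rw [twistCoeff_twistCoeff_left g₁ g₂ x y z c hM, twistCoeff_twistCoeff_left h₁ h₂ x z y c hM',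
    graftSign_par hg]
  have e1 : shEval (permComp g₁) x y (fun w => shEval (permComp g₂) w z c) =
      (-1) ^ ((y.length + 1) * (z.length + 1)) *
        shEval (permComp h₁) x z (fun w => shEval (permComp h₂) w y c) := by
    -- Both iterated products are shuffles of `x` with the shuffle of `y` and `z`, taken with values
    -- in pairs; commutativity is applied to this inner product.
    rw [shEval_assoc (p' := Prod.mk) (q' := fun a b => permComp h₂ (permComp h₁ a b.2) b.1)
      (fun a b d => permComp_par hg a b d), shEval_comm,
      ← shEval_assoc (p := permComp h₁) (q := permComp h₂) (fun a b d => rfl)]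
  rw [e1]
  have e2 : ((-1 : ℤ) ^ ((y.length + 1) * (z.length + 1))) =
      (((((y.length + 1) * (z.length + 1) : ℕ)) : ℤ).negOnePow : ℤ) := by
    rw [Int.coe_negOnePow_natCast]
  have e3 : (((((t : ℤ) - 1) * ((u : ℤ) - 1)).negOnePow : ℤ)) ^ n =
      (((n : ℤ) * (((t : ℤ) - 1) * ((u : ℤ) - 1))).negOnePow : ℤ) := by
    generalize ((t : ℤ) - 1) * ((u : ℤ) - 1) = a
    rcases Int.even_or_odd a with h | h
    · rw [Int.negOnePow_even _ h, Int.negOnePow_even _ (h.mul_left _)]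
      simp
    · rw [Int.negOnePow_odd _ h]
      rcases Nat.even_or_odd n with h' | h'
      · rw [Int.negOnePow_even _ (Even.mul_right (by exact_mod_cast h') _)]
        simp [h'.neg_one_pow]
      · rw [Int.negOnePow_odd _ (Odd.mul (by exact_mod_cast h') h)]
        simp [h'.neg_one_pow]
  have key : koszul n s t x.length y.length * koszul n m u M z.length *
      (((t : ℤ) - 1) * ((u : ℤ) - 1)).negOnePow ^ n *
      (-1) ^ ((y.length + 1) * (z.length + 1)) * ((deg n y * deg n z).negOnePow : ℤ) =
      - (koszul n s u x.length z.length * koszul n m' t M' y.length) := by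
    rw [e2, e3]
    simp only [koszul_eq, deg]
    rw [← neg_one_mul, show (-1 : ℤ) = ((1 : ℤ).negOnePow : ℤ) by simp]
    simp only [← Units.val_mul, ← Int.negOnePow_add]
    have a1 : (m : ℤ) = s + t - 1 := by have := g₁.arity; omega
    have a2 : (m' : ℤ) = s + u - 1 := by have := h₁.arity; omega
    have a3 : (M : ℤ) = x.length + y.length - 1 := by omega
    have a4 : (M' : ℤ) = x.length + z.length - 1 := by omega
    rw [a1, a2, a3, a4]
    refine negOnePow_congr_zmod ?_
    push_cast
    generalize (n : ZMod 2) = n'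
    generalize (s : ZMod 2) = s'
    generalize (t : ZMod 2) = t'
    generalize (u : ZMod 2) = u'
    generalize (x.length : ZMod 2) = x'
    generalize (y.length : ZMod 2) = y'
    generalize (z.length : ZMod 2) = z'
    revert n' s' t' u' x' y' z'
    decide
  simp only [mul_pow]
  linear_combination (graftSign h₁ ^ n * graftSign h₂ ^ n *
    shEval (permComp h₁) x z (fun w => shEval (permComp h₂) w y c)) * key

/-! ### Compatibility with the internal differential -/

/-- The degree test in `δ` is redundant here: a nonzero boundary value forces the lengths of `l` and
`x` to differ by one. -/
theorem value_δ_dualBasis {x l : List (Perm (Fin r))} (hl : Cell n (deg n l) l) :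
    value ((δ n).d (dualBasis n (deg n x) x)) l =
      (-1) ^ (l.length + 1) * bd l (char n x) := by
  rw [value_δ]
  split_ifs with h
  · rfl
  · rw [bd_congr (c' := fun _ => 0), bd_zero _ _ (fun _ => rfl), mul_zero]
    intro m hm
    by_contra h1
    have h2 := char_length h1
    refine h ?_
    have h3 : deg n x - 1 = deg n l := by
      unfold deg
      have : (l.length : ℤ) = x.length + 1 := by omega
      omega
    rw [h3]
    exact hl

theorem bd_sum {A : Type} {ι : Type} (l : List A) (s : Finset ι) (c : ι → List A → ℤ) :
    bd l (fun m => ∑ i ∈ s, c i m) = ∑ i ∈ s, bd l (c i) := by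
  simp only [bd_eq_sum, Finset.mul_sum]
  exact Finset.sum_comm

/-- The twisting homomorphism anticommutes with the internal differential. -/
theorem twistAt_δ (N : ℕ) (k K : ℤ) (hK : K = k - 1 - 1) (g : Graft s t r) (c : (D n).obj (pt r) k)
    (hN : len n r k + 1 ≤ N) :
    twistAt n N K g (value ((δ n).d c)) +
      ∑ p ∈ lists s N ×ˢ lists t N, twistCoeff n g p.1 p.2 (value c) •
        ((Free (D n)).pcomp g K
          ((Free.gen (D n)).app ((δ n).d (dualBasis n (deg n p.1) p.1))) (basis n p.2) +
        ((deg n p.1).negOnePow : ℤ) • (Free (D n)).pcomp g K (basis n p.1)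
          ((Free.gen (D n)).app ((δ n).d (dualBasis n (deg n p.2) p.2)))) = 0 := by
  have hc : ∀ w, value c w ≠ 0 → Cell n k w := fun w hw => cell_of_value hw
  have hlen : ∀ {x : List (Perm (Fin s))} {y : List (Perm (Fin t))},
      twistCoeff n g x y (value c) ≠ 0 → x.length + 1 ≤ N ∧ y.length + 1 ≤ N := fun h => by
    have := twistCoeff_length (fun w' hw' => ((hc w' hw').length_eq.le)) h
    omega
  have e1 : ∀ x y, twistCoeff n g x y (value c) •
      ((Free (D n)).pcomp g K
          ((Free.gen (D n)).app ((δ n).d (dualBasis n (deg n x) x))) (basis n y) +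
        ((deg n x).negOnePow : ℤ) • (Free (D n)).pcomp g K (basis n x)
          ((Free.gen (D n)).app ((δ n).d (dualBasis n (deg n y) y)))) =
      ∑ x' ∈ lists s N, (twistCoeff n g x y (value c) *
        value ((δ n).d (dualBasis n (deg n x) x)) x') •
          (Free (D n)).pcomp g K (basis n x') (basis n y) +
      ∑ y' ∈ lists t N, (twistCoeff n g x y (value c) * ((deg n x).negOnePow : ℤ) *
        value ((δ n).d (dualBasis n (deg n y) y)) y') •
          (Free (D n)).pcomp g K (basis n x) (basis n y') := by
    intro x y
    by_cases h : twistCoeff n g x y (value c) = 0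
    · simp only [h, zero_mul, zero_smul, Finset.sum_const_zero, add_zero]
    · have h1 := hlen h
      have h2 := len_sub_one (n := n) (r := s) (deg n x)
      have h3 := len_sub_one (n := n) (r := t) (deg n y)
      rw [len_deg] at h2 h3
      rw [pcomp_gen_left _ (h2.trans h1.1), pcomp_gen_right _ (h3.trans h1.2)]
      simp only [smul_add, Finset.smul_sum, smul_smul]
      simp only [mul_assoc]
  -- The simplices in the result become the outer summation indices, so that the claim can be
  -- checked separately on each coefficient of `x^∨ ∘ y^∨`.
  have e2 : ∑ p ∈ lists s N ×ˢ lists t N, twistCoeff n g p.1 p.2 (value c) •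
        ((Free (D n)).pcomp g K
          ((Free.gen (D n)).app ((δ n).d (dualBasis n (deg n p.1) p.1))) (basis n p.2) +
        ((deg n p.1).negOnePow : ℤ) • (Free (D n)).pcomp g K (basis n p.1)
          ((Free.gen (D n)).app ((δ n).d (dualBasis n (deg n p.2) p.2)))) =
      ∑ x ∈ lists s N, ∑ y ∈ lists t N,
        (∑ x' ∈ lists s N, twistCoeff n g x' y (value c) *
          value ((δ n).d (dualBasis n (deg n x') x')) x +
        ∑ y' ∈ lists t N, twistCoeff n g x y' (value c) * ((deg n x).negOnePow : ℤ) *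
          value ((δ n).d (dualBasis n (deg n y') y')) y) •
        (Free (D n)).pcomp g K (basis n x) (basis n y) := by
    rw [Finset.sum_product]
    simp only [e1, Finset.sum_add_distrib, add_smul, Finset.sum_smul]
    congr 1
    · rw [Finset.sum_comm]
      refine Eq.trans (Finset.sum_congr rfl fun y _ => Finset.sum_comm) Finset.sum_comm
    · refine Finset.sum_congr rfl fun x _ => Finset.sum_comm
  rw [e2, twistAt, Finset.sum_product, ← Finset.sum_add_distrib]
  refine Finset.sum_eq_zero fun x hx => ?_
  rw [← Finset.sum_add_distrib]
  refine Finset.sum_eq_zero fun y hy => ?_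
  rw [← add_smul]
  by_cases bx : basis n x = 0
  · rw [bx]; simp only [map_zero, AddMonoidHom.zero_apply, smul_zero]
  by_cases by' : basis n y = 0
  · rw [by']; simp only [map_zero, smul_zero]
  by_cases hd : deg n x + deg n y = K
  swap
  · rw [GrOperad.pcomp_neg _ _ hd, smul_zero]
  have cx := cell_of_basis bx
  have cy := cell_of_basis by'
  have hx' := List.length_pos_of_ne_nil cx.ne_nil
  have hy' := List.length_pos_of_ne_nil cy.ne_nil
  obtain ⟨a, ha⟩ : ∃ a, a + 1 = x.length := ⟨x.length - 1, by omega⟩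
  obtain ⟨b, hb⟩ : ∃ b, b + 1 = y.length := ⟨y.length - 1, by omega⟩
  -- Duality turns the sum over `x'` into the boundary of `x`, whose faces all have length `a`, so
  -- that the Koszul sign is constant.
  have f1 : ∑ x' ∈ lists s N, twistCoeff n g x' y (value c) *
      value ((δ n).d (dualBasis n (deg n x') x')) x = (-1) ^ (x.length + 1) *
        (koszul n s t a y.length * graftSign g ^ n *
          bd x (fun l => shEval (permComp g) l y (value c))) := by
    have h1 : ∀ x', twistCoeff n g x' y (value c) *
        value ((δ n).d (dualBasis n (deg n x') x')) x = (-1) ^ (x.length + 1) *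
        bd x (fun l => twistCoeff n g x' y (value c) * char n x' l) := by
      intro x'
      rw [value_δ_dualBasis cx, bd_mul]
      ring
    simp only [h1]
    rw [← Finset.mul_sum, ← bd_sum, ← bd_mul x (koszul n s t a y.length * graftSign g ^ n)]
    congr 1
    refine bd_congr fun l hl => ?_
    have h2 : l.length = a := by omega
    have h3 := sum_mul_value (n := n) (N := N) (fun l => twistCoeff n g l y (value c))
      (fun l hl => ⟨cell_left_of_twistCoeff hc cx.two_le cy.two_le hl, by
        have := (hlen hl).1; omega⟩) l
    exact h3.trans (by rw [twistCoeff_eq, h2])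
  have f2 : ∑ y' ∈ lists t N, twistCoeff n g x y' (value c) * ((deg n x).negOnePow : ℤ) *
      value ((δ n).d (dualBasis n (deg n y') y')) y = (-1) ^ (y.length + 1) *
        ((deg n x).negOnePow : ℤ) * (koszul n s t x.length b * graftSign g ^ n *
          bd y (fun l => shEval (permComp g) x l (value c))) := by
    have h1 : ∀ y', twistCoeff n g x y' (value c) * ((deg n x).negOnePow : ℤ) *
        value ((δ n).d (dualBasis n (deg n y') y')) y = (-1) ^ (y.length + 1) *
        ((deg n x).negOnePow : ℤ) *
        bd y (fun l => twistCoeff n g x y' (value c) * char n y' l) := by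
      intro y'
      rw [value_δ_dualBasis cy, bd_mul]
      ring
    simp only [h1]
    rw [← Finset.mul_sum, ← bd_sum, ← bd_mul y (koszul n s t x.length b * graftSign g ^ n)]
    congr 1
    refine bd_congr fun l hl => ?_
    have h2 : l.length = b := by omega
    have h3 := sum_mul_value (n := n) (N := N) (fun l => twistCoeff n g x l (value c))
      (fun l hl => ⟨cell_right_of_twistCoeff hc cy.two_le hl, by
        have := (hlen hl).2; omega⟩) l
    exact h3.trans (by rw [twistCoeff_eq, h2])
  -- The shuffle product is a chain map, which splits the boundary in `δ c` between the two factors.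
  have f3 : twistCoeff n g x y (value ((δ n).d c)) =
      koszul n s t x.length y.length * graftSign g ^ n * ((-1) ^ (x.length + y.length) *
        (bd x (fun l => shEval (permComp g) l y (value c)) +
          (-1) ^ (x.length + 1) * bd y (fun l => shEval (permComp g) x l (value c)))) := by
    rw [twistCoeff_eq, ← shEval_bd, ← shEval_mul _ _ _ ((-1) ^ (x.length + y.length))]
    · congr 1
      refine shEval_congr fun w hw => ?_
      have h1 := hw.cell cx cy
      rw [hd] at h1
      rw [value_δ, if_pos (by rwa [show k - 1 = K + 1 by omega]), hw.length]
    · by_contra h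
      exact (hc _ h).ne_nil rfl
  rw [f1, f2, f3]
  have h1 : ∀ e : ℕ, (((1 : ℤ).negOnePow : ℤ)) ^ e = ((e : ℤ).negOnePow : ℤ) := fun e => by
    rw [Int.coe_negOnePow_natCast]; simp
  have h2 : (-1 : ℤ) = ((1 : ℤ).negOnePow : ℤ) := by simp
  -- The signs of the two occurrences of the boundary of `x` are opposite; `k2` is the same for `y`.
  have k1 : koszul n s t x.length y.length * (-1) ^ (x.length + y.length) +
      (-1) ^ (x.length + 1) * koszul n s t a y.length = 0 := by
    refine eq_neg_iff_add_eq_zero.1 (Eq.trans ?_ (neg_one_mul _))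
    rw [h2]
    simp only [koszul_eq, h1]
    simp only [← Units.val_mul, ← Int.negOnePow_add]
    have a3 : (a : ℤ) = x.length - 1 := by omega
    rw [a3]
    refine negOnePow_congr_zmod ?_
    push_cast
    generalize (n : ZMod 2) = n'
    generalize (s : ZMod 2) = s'
    generalize (t : ZMod 2) = t'
    generalize (x.length : ZMod 2) = x'
    generalize (y.length : ZMod 2) = y'
    revert n' s' t' x' y'
    decide
  have k2 : koszul n s t x.length y.length * (-1) ^ (x.length + y.length) * (-1) ^ (x.length + 1) +
      (-1) ^ (y.length + 1) * ((deg n x).negOnePow : ℤ) * koszul n s t x.length b = 0 := by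
    refine eq_neg_iff_add_eq_zero.1 (Eq.trans ?_ (neg_one_mul _))
    rw [h2]
    simp only [koszul_eq, deg, h1]
    simp only [← Units.val_mul, ← Int.negOnePow_add]
    have a3 : (b : ℤ) = y.length - 1 := by omega
    rw [a3]
    refine negOnePow_congr_zmod ?_
    push_cast
    generalize (n : ZMod 2) = n'
    generalize (s : ZMod 2) = s'
    generalize (t : ZMod 2) = t'
    generalize (x.length : ZMod 2) = x'
    generalize (y.length : ZMod 2) = y'
    revert n' s' t' x' y'
    decide
  convert zero_smul ℤ _ using 2
  linear_combination (graftSign g ^ n *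
    bd x (fun l => shEval (permComp g) l y (value c))) * k1 + (graftSign g ^ n *
    bd y (fun l => shEval (permComp g) x l (value c))) * k2

end

end KCobar

/-! ### Transport of sets of inputs to the factors of a composite -/

namespace KCobar

namespace Graft

section

variable {s t u m r : ℕ}

theorem outer_std {g₁ : Graft s t m} {g₂ : Graft m u r} {x : Fin r} : x ∈ outer g₁ g₂ ↔
    (∃ y, g₂.f x = Sum.inl y ∧ y ∈ g₁.inner) ∨ (x ∈ g₂.inner ∧ g₂.e ∈ g₁.inner) := by
  rw [mem_inner (g := g₂)]
  rcases h : g₂.f x with y | c <;> simp [outer, inner, h]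

theorem mem_innermost {h₁ : Graft t u m} {h₂ : Graft s m r} {x : Fin r} :
    x ∈ innermost h₁ h₂ ↔ ∃ y, h₂.f x = Sum.inr y ∧ y ∈ h₁.inner := by
  rcases h : h₂.f x with y | c <;> simp [innermost, inner, h]

open Classical in
/-- The set of the inputs of the outer operation which correspond to a set of inputs of a
composite. -/
noncomputable def push (g : Graft s t r) (B : Finset (Fin r)) : Finset (Fin s) :=
  Finset.univ.filter fun y => (∃ x ∈ B, g.f x = Sum.inl y) ∨ (y = g.e ∧ g.inner ⊆ B)

open Classical in
/-- The set of the inputs of the inner operation which correspond to a set of inputs of a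
composite. -/
noncomputable def pushInner (g : Graft s t r) (B : Finset (Fin r)) : Finset (Fin t) :=
  Finset.univ.filter fun y => ∃ x ∈ B, g.f x = Sum.inr y

theorem mem_push {g : Graft s t r} {B : Finset (Fin r)} {y : Fin s} :
    y ∈ g.push B ↔ (∃ x ∈ B, g.f x = Sum.inl y) ∨ (y = g.e ∧ g.inner ⊆ B) := by
  simp [push]

theorem mem_pushInner {g : Graft s t r} {B : Finset (Fin r)} {y : Fin t} :
    y ∈ g.pushInner B ↔ ∃ x ∈ B, g.f x = Sum.inr y := by
  simp [pushInner]

theorem inner_nonempty {g : Graft s t r} (ht : 0 < t) : g.inner.Nonempty := by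
  rw [← Finset.card_pos, card_inner]; exact ht

/-- With `outer_push`, this makes subsets of the inputs of the outer operation correspond to the
subsets of the inputs of the composite that contain or avoid the inner block. The block must be
nonempty to detect `g₂.e`. -/
theorem push_outer {g₁ : Graft s t m} {g₂ : Graft m u r} (hu : 0 < u) :
    g₂.push (outer g₁ g₂) = g₁.inner := by
  ext y
  rw [mem_push]
  constructor
  · rintro (⟨x, hx, h⟩ | ⟨rfl, h⟩)
    · rw [outer_std] at hx
      rcases hx with ⟨y', h', hy'⟩ | ⟨h', -⟩
      · rw [h] at h'
        rwa [Sum.inl.inj h']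
      · obtain ⟨b, hb⟩ := mem_inner.1 h'
        rw [h] at hb; simp at hb
    · obtain ⟨x, hx⟩ := inner_nonempty (g := g₂) hu
      rcases outer_std.1 (h hx) with ⟨y', h', -⟩ | ⟨-, h'⟩
      · exact absurd hx (notMem_inner.2 ⟨y', h'⟩)
      · exact h'
  · intro hy
    by_cases he : y = g₂.e
    · exact Or.inr ⟨he, fun x hx => outer_std.2 (Or.inr ⟨hx, he ▸ hy⟩)⟩
    · obtain ⟨x, hx⟩ := (g₂.range_iff (Sum.inl y)).2 (by simpa using he)
      exact Or.inl ⟨x, outer_std.2 (Or.inl ⟨y, hx, hy⟩), hx⟩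

theorem pushInner_innermost {h₁ : Graft t u m} {h₂ : Graft s m r} :
    h₂.pushInner (innermost h₁ h₂) = h₁.inner := by
  ext y
  rw [mem_pushInner]
  constructor
  · rintro ⟨x, hx, h⟩
    obtain ⟨y', h', hy'⟩ := mem_innermost.1 hx
    rw [h] at h'
    rwa [Sum.inr.inj h']
  · intro hy
    obtain ⟨x, hx⟩ := (h₂.range_iff (Sum.inr y)).2 (by simp)
    exact ⟨x, mem_innermost.2 ⟨y, hx, hy⟩, hx⟩

/-- The hypothesis `hB` says that `B` treats the block of inner inputs as the single input `g₂.e`.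
-/
theorem outer_push {g₁ : Graft s t m} {g₂ : Graft m u r} {B : Finset (Fin r)}
    (hB : g₂.inner ⊆ B ∨ Disjoint g₂.inner B) (h : g₁.inner = g₂.push B) : outer g₁ g₂ = B := by
  ext x
  rw [outer_std, h, mem_push (y := g₂.e)]
  constructor
  · rintro (⟨y, hy, hy'⟩ | ⟨h1, h2⟩)
    · rcases mem_push.1 hy' with ⟨x', hx', h3⟩ | ⟨h3, -⟩
      · rwa [g₂.inj (hy.trans h3.symm)]
      · exact absurd h3 (g₂.e_ne hy)
    · rcases h2 with ⟨x', hx', h3⟩ | ⟨-, h3⟩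
      · exact absurd rfl (g₂.e_ne h3)
      · exact h3 h1
  · intro hx
    by_cases h1 : x ∈ g₂.inner
    · right
      refine ⟨h1, Or.inr ⟨rfl, ?_⟩⟩
      rcases hB with hB | hB
      · exact hB
      · exact absurd hx (Finset.disjoint_left.1 hB h1)
    · obtain ⟨a, ha⟩ := notMem_inner.1 h1
      exact Or.inl ⟨a, ha, mem_push.2 (Or.inl ⟨x, hx, ha⟩)⟩

theorem innermost_push {h₁ : Graft t u m} {h₂ : Graft s m r} {B : Finset (Fin r)}
    (hB : B ⊆ h₂.inner) (h : h₁.inner = h₂.pushInner B) : innermost h₁ h₂ = B := by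
  ext x
  rw [mem_innermost, h]
  constructor
  · rintro ⟨y, hy, hy'⟩
    obtain ⟨x', hx', h3⟩ := mem_pushInner.1 hy'
    rwa [h₂.inj (hy.trans h3.symm)]
  · intro hx
    obtain ⟨b, hb⟩ := mem_inner.1 (hB hx)
    exact ⟨b, hb, mem_pushInner.2 ⟨x, hx, hb⟩⟩

/-- The two cases correspond to the vertex in which the last operation is plugged: the previous one
or the root. -/
theorem outer_subset_or {g₁ : Graft s t m} {g₂ : Graft m u r} :
    g₂.inner ⊆ outer g₁ g₂ ∨ Disjoint g₂.inner (outer g₁ g₂) := by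
  by_cases h : g₂.e ∈ g₁.inner
  · exact Or.inl fun x hx => outer_std.2 (Or.inr ⟨hx, h⟩)
  · right
    rw [Finset.disjoint_left]
    intro x hx hx'
    rcases outer_std.1 hx' with ⟨y, hy, -⟩ | ⟨-, h'⟩
    · exact notMem_inner.2 ⟨y, hy⟩ hx
    · exact h h'

theorem innermost_subset {h₁ : Graft t u m} {h₂ : Graft s m r} :
    innermost h₁ h₂ ⊆ h₂.inner := fun x hx => by
  obtain ⟨y, hy, -⟩ := mem_innermost.1 hx
  exact mem_inner.2 ⟨y, hy⟩

theorem push_nonempty {g : Graft s t r} {B : Finset (Fin r)} (hB : B.Nonempty)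
    (h : g.inner ⊆ B ∨ Disjoint g.inner B) : (g.push B).Nonempty := by
  obtain ⟨x, hx⟩ := hB
  rcases h with h | h
  · exact ⟨g.e, mem_push.2 (Or.inr ⟨rfl, h⟩)⟩
  · obtain ⟨a, ha⟩ := notMem_inner.1 (Finset.disjoint_right.1 h hx)
    exact ⟨a, mem_push.2 (Or.inl ⟨x, hx, ha⟩)⟩

theorem pushInner_nonempty {g : Graft s t r} {B : Finset (Fin r)} (hB : B.Nonempty)
    (h : B ⊆ g.inner) : (g.pushInner B).Nonempty := by
  obtain ⟨x, hx⟩ := hB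
  obtain ⟨b, hb⟩ := mem_inner.1 (h hx)
  exact ⟨b, mem_pushInner.2 ⟨x, hx, hb⟩⟩

theorem outer_nonempty {g₁ : Graft s t m} {g₂ : Graft m u r} (hu : 0 < u)
    (h : g₁.inner.Nonempty) : (outer g₁ g₂).Nonempty := by
  obtain ⟨y, hy⟩ := h
  by_cases he : y = g₂.e
  · obtain ⟨x, hx⟩ := inner_nonempty (g := g₂) hu
    exact ⟨x, outer_std.2 (Or.inr ⟨hx, he ▸ hy⟩)⟩
  · obtain ⟨x, hx⟩ := (g₂.range_iff (Sum.inl y)).2 (by simpa using he)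
    exact ⟨x, outer_std.2 (Or.inl ⟨y, hx, hy⟩)⟩

theorem innermost_nonempty {h₁ : Graft t u m} {h₂ : Graft s m r}
    (h : h₁.inner.Nonempty) : (innermost h₁ h₂).Nonempty := by
  obtain ⟨y, hy⟩ := h
  obtain ⟨x, hx⟩ := (h₂.range_iff (Sum.inr y)).2 (by simp)
  exact ⟨x, mem_innermost.2 ⟨y, hx, hy⟩⟩

-- Replaces subsets of the inputs of a factor, a type that depends on the composite, by subsets of
-- the fixed set of `r` inputs. The two stages of a decomposition can then be exchanged.
open Classical in
theorem sum_push {X : Type} [AddCommMonoid X] (g : Graft s t r) (ht : 0 < t)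
    (F : Finset (Fin s) → X) :
    ∑ B ∈ Finset.univ.filter (fun B : Finset (Fin s) => B.Nonempty), F B =
      ∑ B ∈ Finset.univ.filter (fun B : Finset (Fin r) => B.Nonempty ∧
        (g.inner ⊆ B ∨ Disjoint g.inner B)), F (g.push B) := by
  refine Finset.sum_nbij' (fun B => outer (std B) g) g.push ?_ ?_ ?_ ?_ ?_
  · intro B hB
    simp only [Finset.mem_filter, Finset.mem_univ, true_and] at hB ⊢
    exact ⟨outer_nonempty ht (by rwa [inner_std]), outer_subset_or⟩
  · intro B hB
    simp only [Finset.mem_filter, Finset.mem_univ, true_and] at hB ⊢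
    exact push_nonempty hB.1 hB.2
  · intro B _
    rw [push_outer ht, inner_std]
  · intro B hB
    simp only [Finset.mem_filter, Finset.mem_univ, true_and] at hB
    exact outer_push hB.2 (inner_std _)
  · intro B _
    rw [push_outer ht, inner_std]

open Classical in
theorem sum_pushInner {X : Type} [AddCommMonoid X] (g : Graft s t r)
    (F : Finset (Fin t) → X) :
    ∑ B ∈ Finset.univ.filter (fun B : Finset (Fin t) => B.Nonempty), F B =
      ∑ B ∈ Finset.univ.filter (fun B : Finset (Fin r) => B.Nonempty ∧ B ⊆ g.inner),
        F (g.pushInner B) := by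
  refine Finset.sum_nbij' (fun B => innermost (std B) g) g.pushInner ?_ ?_ ?_ ?_ ?_
  · intro B hB
    simp only [Finset.mem_filter, Finset.mem_univ, true_and] at hB ⊢
    exact ⟨innermost_nonempty (by rwa [inner_std]), innermost_subset⟩
  · intro B hB
    simp only [Finset.mem_filter, Finset.mem_univ, true_and] at hB ⊢
    exact pushInner_nonempty hB.1 hB.2
  · intro B _
    rw [pushInner_innermost, inner_std]
  · intro B hB
    simp only [Finset.mem_filter, Finset.mem_univ, true_and] at hB
    exact innermost_push hB.2 (inner_std _)
  · intro B _
    rw [pushInner_innermost, inner_std]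

/-- The composite obtained by a relabelling of the inputs. -/
def relabel (g : Graft s t r) (w : Perm (Fin r)) : Graft s t r where
  e := g.e
  f x := g.f (w.symm x)
  inj := g.inj.comp w.symm.injective
  range_iff y := by
    rw [← g.range_iff]
    exact ⟨fun ⟨x, hx⟩ => ⟨_, hx⟩, fun ⟨x, hx⟩ => ⟨w x, by simpa using hx⟩⟩

theorem rel_relabel (g : Graft s t r) (w : Perm (Fin r)) : Rel 1 1 w g (g.relabel w) :=
  ⟨rfl, fun x => by simp [relabel]⟩

theorem mem_inner_relabel {g : Graft s t r} {w : Perm (Fin r)} {x : Fin r} :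
    w x ∈ (g.relabel w).inner ↔ x ∈ g.inner := by
  simp [mem_inner, relabel]

theorem outer_rel {g₁ : Graft s t m} {g₂ g₂' : Graft m u r} {σ : Perm (Fin m)}
    {τ : Perm (Fin u)} (h : Rel σ τ 1 g₂ g₂') :
    outer (g₁.relabel σ) g₂' = outer g₁ g₂ := by
  ext x
  have hx := h.2 x
  rw [Equiv.Perm.one_apply] at hx
  rw [outer_std, outer_std, mem_inner, mem_inner (g := g₂), hx, h.1, mem_inner_relabel]
  rcases g₂.f x with a | b <;> simp [mem_inner_relabel]

theorem innermost_rel {h₁ : Graft t u m} {h₂ h₂' : Graft s m r} {σ : Perm (Fin s)}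
    {τ : Perm (Fin m)} (h : Rel σ τ 1 h₂ h₂') :
    innermost (h₁.relabel τ) h₂' = innermost h₁ h₂ := by
  ext x
  have hx := h.2 x
  rw [Equiv.Perm.one_apply] at hx
  rw [mem_innermost, mem_innermost, hx]
  rcases h₂.f x with a | b <;> simp [mem_inner_relabel]

end

end Graft

/-! ### The square of the twisting derivation -/

section

variable {n s t u m s' t' u' m' r : ℕ}

theorem twistAt_congr {g : Graft s t r} {g' : Graft s' t' r} (h : g.inner = g'.inner) (N : ℕ)
    (k : ℤ) (c : List (Perm (Fin r)) → ℤ) : twistAt n N k g c = twistAt n N k g' c := by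
  refine Graft.eq_of_inner_eq (fun g => twistAt n N k g c) (fun hg => ?_) h
  refine (Eq.trans (twistAt_rel hg (c := c) (c' := c) (fun l => by simp) N k) ?_).symm
  exact (Free (D n)).map_id (α := pt r) (le_refl _) _

/-- The second composites are first identified by relabelling their vertices. Then `push` recovers
the inner set of the first composite, so that only a relabelling of its vertices remains. -/
theorem twistLeft_congr {g₁ : Graft s t m} {g₂ : Graft m u r} {g₁' : Graft s' t' m'}
    {g₂' : Graft m' u' r} (hu : 0 < u) (h : g₂.inner = g₂'.inner)
    (h' : Graft.outer g₁ g₂ = Graft.outer g₁' g₂') (N : ℕ) (k : ℤ)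
    (c : List (Perm (Fin r)) → ℤ) : twistLeft n N k g₁ g₂ c = twistLeft n N k g₁' g₂' c := by
  obtain ⟨rfl, rfl⟩ := Graft.sigma_eq_of_inner_eq h
  obtain ⟨σ, τ, hg⟩ := Graft.exists_rel h
  have h1 := congrArg g₂'.push ((Graft.outer_rel (g₁ := g₁) hg).trans h')
  rw [Graft.push_outer hu, Graft.push_outer hu] at h1
  obtain ⟨rfl, rfl⟩ := Graft.sigma_eq_of_inner_eq h1
  obtain ⟨σ', τ', hg'⟩ := Graft.exists_rel h1
  rw [← twistLeft_rel (g₁.rel_relabel σ) hg, ← twistLeft_rel hg' (Graft.Rel.refl g₂')]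

theorem twistRight_congr {h₁ : Graft t u m} {h₂ : Graft s m r} {h₁' : Graft t' u' m'}
    {h₂' : Graft s' m' r} (h : h₂.inner = h₂'.inner)
    (h' : Graft.innermost h₁ h₂ = Graft.innermost h₁' h₂') (N : ℕ) (k : ℤ)
    (c : List (Perm (Fin r)) → ℤ) : twistRight n N k h₁ h₂ c = twistRight n N k h₁' h₂' c := by
  obtain ⟨rfl, rfl⟩ := Graft.sigma_eq_of_inner_eq h
  obtain ⟨σ, τ, hg⟩ := Graft.exists_rel h
  have h1 := congrArg h₂'.pushInner ((Graft.innermost_rel (h₁ := h₁) hg).trans h')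
  rw [Graft.pushInner_innermost, Graft.pushInner_innermost] at h1
  obtain ⟨rfl, rfl⟩ := Graft.sigma_eq_of_inner_eq h1
  obtain ⟨σ', τ', hg'⟩ := Graft.exists_rel h1
  rw [← twistRight_rel (h₁.rel_relabel τ) hg, ← twistRight_rel hg' (Graft.Rel.refl h₂')]

open Classical in
/-- The square of the twisting derivation vanishes on the generators. -/
theorem sum_twistLeft_add_sum_twistRight (N : ℕ) (k K : ℤ) (c : List (Perm (Fin r)) → ℤ)
    (hc : ∀ w, c w ≠ 0 → Cell n k w) (hN : len n r k ≤ N) :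
    (∑ A ∈ Finset.univ.filter (fun A : Finset (Fin r) => A.Nonempty),
      ∑ B ∈ Finset.univ.filter (fun B : Finset (Fin (Aᶜ.card + 1)) => B.Nonempty),
        twistLeft n N K (Graft.std B) (Graft.std A) c) +
    ∑ A ∈ Finset.univ.filter (fun A : Finset (Fin r) => A.Nonempty),
      ∑ B ∈ Finset.univ.filter (fun B : Finset (Fin A.card) => B.Nonempty),
        twistRight n N K (Graft.std B) (Graft.std A) c = 0 := by
  -- Trees with three vertices are indexed by pairs of subsets of the `r` inputs. In `X A B`, the
  -- operation plugged in last has the inputs `A` above it and the previous one the inputs `B`; in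
  -- `Y A B`, the set `B ⊆ A` lies above the topmost vertex.
  set X : Finset (Fin r) → Finset (Fin r) → (Free (D n)).obj (pt r) K := fun A B =>
    twistLeft n N K (Graft.std ((Graft.std A).push B)) (Graft.std A) c with hX
  set Y : Finset (Fin r) → Finset (Fin r) → (Free (D n)).obj (pt r) K := fun A B =>
    twistRight n N K (Graft.std ((Graft.std A).pushInner B)) (Graft.std A) c with hY
  have e1 : ∀ A ∈ Finset.univ.filter (fun A : Finset (Fin r) => A.Nonempty),
      ∑ B ∈ Finset.univ.filter (fun B : Finset (Fin (Aᶜ.card + 1)) => B.Nonempty),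
        twistLeft n N K (Graft.std B) (Graft.std A) c =
      ∑ B ∈ Finset.univ.filter (fun B : Finset (Fin r) => B.Nonempty ∧ (A ⊆ B ∨ Disjoint A B)),
        X A B := by
    intro A hA
    have h := (Graft.std A).sum_push (Finset.card_pos.2 (Finset.mem_filter.1 hA).2)
      (fun B => twistLeft n N K (Graft.std B) (Graft.std A) c)
    rwa [Graft.inner_std] at h
  have e2 : ∀ A ∈ Finset.univ.filter (fun A : Finset (Fin r) => A.Nonempty),
      ∑ B ∈ Finset.univ.filter (fun B : Finset (Fin A.card) => B.Nonempty),
        twistRight n N K (Graft.std B) (Graft.std A) c =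
      ∑ B ∈ Finset.univ.filter (fun B : Finset (Fin r) => B.Nonempty ∧ B ⊆ A), Y A B := by
    intro A hA
    have h := (Graft.std A).sum_pushInner
      (fun B => twistRight n N K (Graft.std B) (Graft.std A) c)
    rwa [Graft.inner_std] at h
  rw [Finset.sum_congr rfl e1, Finset.sum_congr rfl e2]
  have e3 : ∀ A ∈ Finset.univ.filter (fun A : Finset (Fin r) => A.Nonempty),
      ∑ B ∈ Finset.univ.filter (fun B : Finset (Fin r) => B.Nonempty ∧ (A ⊆ B ∨ Disjoint A B)),
        X A B =
      ∑ B ∈ Finset.univ.filter (fun B : Finset (Fin r) => B.Nonempty ∧ A ⊆ B), X A B +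
      ∑ B ∈ Finset.univ.filter (fun B : Finset (Fin r) => B.Nonempty ∧ Disjoint A B), X A B := by
    intro A hA
    simp only [and_or_left]
    rw [Finset.filter_or, Finset.sum_union]
    rw [Finset.disjoint_left]
    intro B hB hB'
    simp only [Finset.mem_filter, Finset.mem_univ, true_and] at hA hB hB'
    obtain ⟨x, hx⟩ := hA
    exact Finset.disjoint_left.1 hB'.2 hx (hB.2 hx)
  rw [Finset.sum_congr rfl e3, Finset.sum_add_distrib]
  -- If `A ⊆ B`, the tree is linear, and it also arises by decomposing the inner vertex of the tree
  -- given by `B`.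
  have e4 : ∀ (A B : Finset (Fin r)), A.Nonempty → A ⊆ B → X A B = - Y B A := by
    intro A B hA hAB
    have hA' : (Graft.std A).inner ⊆ B := by rwa [Graft.inner_std]
    have h1 : (Graft.std A).e ∈ (Graft.std ((Graft.std A).push B)).inner := by
      rw [Graft.inner_std, Graft.mem_push]
      exact Or.inr ⟨rfl, hA'⟩
    obtain ⟨b, hb⟩ := Graft.mem_inner.1 h1
    obtain ⟨m', h₁, h₂, hs⟩ := Graft.exists_seq _ _ hb
    have h2 : h₂.inner = B := hs.inner_eq.trans
      (Graft.outer_push (Or.inl hA') (Graft.inner_std _))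
    have h3 : Graft.innermost h₁ h₂ = A := hs.innermost_eq.trans (Graft.inner_std A)
    simp only [hX, hY]
    rw [twistLeft_seq hs N k K c hc hN]
    congr 1
    refine twistRight_congr (h2.trans (Graft.inner_std B).symm) (h3.trans ?_) N K c
    exact (Graft.innermost_push (by rwa [Graft.inner_std]) (Graft.inner_std _)).symm
  -- If `A` and `B` are disjoint, both vertices sit on the root and can be plugged in the other
  -- order.
  have e5 : ∀ (A B : Finset (Fin r)), A.Nonempty → B.Nonempty → Disjoint A B →
      X A B = - X B A := by
    intro A B hA hB hAB
    have hA' : Disjoint (Graft.std A).inner B := by rwa [Graft.inner_std]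
    have hB' : Disjoint (Graft.std B).inner A := by rw [Graft.inner_std]; exact hAB.symm
    have h1 : (Graft.std A).e ∉ (Graft.std ((Graft.std A).push B)).inner := by
      rw [Graft.inner_std, Graft.mem_push]
      rintro (⟨x, -, hx⟩ | ⟨-, h⟩)
      · exact Graft.e_ne _ hx rfl
      · obtain ⟨x, hx⟩ := hA
        rw [Graft.inner_std] at h
        exact Finset.disjoint_left.1 hAB hx (h hx)
    obtain ⟨b, hb⟩ := Graft.notMem_inner.1 h1
    obtain ⟨m', h₁, h₂, hs⟩ := Graft.exists_par _ _ hb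
    have h2 : h₂.inner = B := hs.inner_eq.trans
      (Graft.outer_push (Or.inr hA') (Graft.inner_std _))
    have h3 : Graft.outer h₁ h₂ = A := hs.outer_eq.trans (Graft.inner_std A)
    simp only [hX]
    rw [twistLeft_par hs N k K c hc hN]
    congr 1
    refine twistLeft_congr ?_ (h2.trans (Graft.inner_std B).symm) (h3.trans ?_) N K c
    · rw [← h₂.card_inner, h2]
      exact Finset.card_pos.2 hB
    · exact (Graft.outer_push (Or.inr hB') (Graft.inner_std _)).symm
  have e6 : ∑ A ∈ Finset.univ.filter (fun A : Finset (Fin r) => A.Nonempty),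
      ∑ B ∈ Finset.univ.filter (fun B : Finset (Fin r) => B.Nonempty ∧ Disjoint A B), X A B = 0 := by
    rw [← Finset.sum_finset_product (Finset.univ.filter
      (fun p : Finset (Fin r) × Finset (Fin r) => p.1.Nonempty ∧ p.2.Nonempty ∧ Disjoint p.1 p.2))
      _ _ (fun p => by simp) (f := fun p => X p.1 p.2)]
    -- The exchange of `A` and `B` has no fixed point because disjoint nonempty sets are distinct.
    refine Finset.sum_involution (fun p _ => p.swap) ?_ ?_ ?_ ?_
    · rintro ⟨A, B⟩ h
      simp only [Finset.mem_filter, Finset.mem_univ, true_and] at h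
      rw [Prod.swap_prod_mk, e5 A B h.1 h.2.1 h.2.2, neg_add_cancel]
    · rintro ⟨A, B⟩ h _ h'
      simp only [Finset.mem_filter, Finset.mem_univ, true_and] at h
      obtain rfl : B = A := congrArg Prod.fst h'
      obtain ⟨x, hx⟩ := h.1
      exact Finset.disjoint_left.1 h.2.2 hx hx
    · rintro ⟨A, B⟩ h
      simp only [Finset.mem_filter, Finset.mem_univ, true_and, Prod.swap_prod_mk] at h ⊢
      exact ⟨h.2.1, h.1, h.2.2.symm⟩
    · rintro ⟨A, B⟩ _
      rfl
  have e7 : ∑ A ∈ Finset.univ.filter (fun A : Finset (Fin r) => A.Nonempty),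
      ∑ B ∈ Finset.univ.filter (fun B : Finset (Fin r) => B.Nonempty ∧ A ⊆ B), X A B =
      - ∑ A ∈ Finset.univ.filter (fun A : Finset (Fin r) => A.Nonempty),
      ∑ B ∈ Finset.univ.filter (fun B : Finset (Fin r) => B.Nonempty ∧ B ⊆ A), Y A B := by
    rw [← Finset.sum_finset_product (Finset.univ.filter
      (fun p : Finset (Fin r) × Finset (Fin r) => p.1.Nonempty ∧ p.2.Nonempty ∧ p.1 ⊆ p.2))
      _ _ (fun p => by simp) (f := fun p => X p.1 p.2),
      ← Finset.sum_finset_product (Finset.univ.filter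
      (fun p : Finset (Fin r) × Finset (Fin r) => p.1.Nonempty ∧ p.2.Nonempty ∧ p.2 ⊆ p.1))
      _ _ (fun p => by simp) (f := fun p => Y p.1 p.2), ← Finset.sum_neg_distrib]
    refine Finset.sum_nbij' Prod.swap Prod.swap ?_ ?_ ?_ ?_ ?_
    · rintro ⟨A, B⟩ h
      simp only [Finset.mem_filter, Finset.mem_univ, true_and, Prod.swap_prod_mk] at h ⊢
      exact ⟨h.2.1, h.1, h.2.2⟩
    · rintro ⟨A, B⟩ h
      simp only [Finset.mem_filter, Finset.mem_univ, true_and, Prod.swap_prod_mk] at h ⊢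
      exact ⟨h.2.1, h.1, h.2.2⟩
    · rintro ⟨A, B⟩ _
      rfl
    · rintro ⟨A, B⟩ _
      rfl
    · rintro ⟨A, B⟩ h
      simp only [Finset.mem_filter, Finset.mem_univ, true_and] at h
      exact e4 A B h.1 h.2.2
  rw [e6, e7, add_zero, neg_add_cancel]

/-! ### The cobar construction -/

/-- The twisting homomorphism as a sum over the sets of inputs of the inner operations. -/
noncomputable def twist (n : ℕ) {r : ℕ} {k : ℤ} (c : (D n).obj (pt r) k) :
    (Free (D n)).obj (pt r) (k - 1) :=
  ∑ A ∈ Finset.univ.filter (fun A : Finset (Fin r) => A.Nonempty),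
    twistAt n (len n r k) (k - 1) (Graft.std A) (value c)

theorem twist_eq {k : ℤ} (c : (D n).obj (pt r) k) {N : ℕ} (hN : len n r k ≤ N) :
    twist n c = ∑ A ∈ Finset.univ.filter (fun A : Finset (Fin r) => A.Nonempty),
      twistAt n N (k - 1) (Graft.std A) (value c) :=
  Finset.sum_congr rfl fun _ _ =>
    twistAt_eq hN _ _ fun _ hw => (cell_of_value hw).length_eq.le

theorem sum_lists {X : Type} [AddCommMonoid X] (N : ℕ) (F : List (Perm (Fin r)) → X) :
    ∑ l ∈ lists r N, F l =
      ∑ p ∈ Finset.range (N + 1), ∑ u : Fin p → Perm (Fin r), F (List.ofFn u) := by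
  rw [Finset.sum_sigma']
  refine Finset.sum_nbij' (fun l => ⟨l.length, l.get⟩) (fun x => List.ofFn x.2) ?_ ?_ ?_ ?_ ?_
  · intro l hl
    have := mem_lists.1 hl
    simp only [Finset.mem_sigma, Finset.mem_range, Finset.mem_univ, and_true]
    omega
  · rintro ⟨p, x⟩ h
    simp only [Finset.mem_sigma, Finset.mem_range, Finset.mem_univ, and_true] at h
    rw [mem_lists, List.length_ofFn]
    exact Nat.lt_succ_iff.1 h
  · intro l _
    exact List.ofFn_get l
  · rintro ⟨p, x⟩ _
    exact List.equivSigmaTuple.apply_symm_apply (⟨p, x⟩ : Σ n, Fin n → Perm (Fin r))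
  · intro l _
    exact congrArg F (List.ofFn_get l).symm

open Classical in
theorem cobarTwist_term {k i j : ℤ} (g : Graft s t r) (x : List (Perm (Fin s)))
    (y : List (Perm (Fin t))) (a : ℤ) (hi : i = deg n x) (hj : j = deg n y) :
    (if h : i + j = k then
      a • (Free (D n)).comp (α := pt s) (β := pt t) (γ := pt r) g (le_refl _) h
        ((Free.gen (D n)).app (dualBasis n i x)) ((Free.gen (D n)).app (dualBasis n j y))
      else 0) = a • (Free (D n)).pcomp g k (basis n x) (basis n y) := by
  subst hi hj
  by_cases h : deg n x + deg n y = k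
  · rw [GrOperad.pcomp_pos _ _ h]
    exact dif_pos h
  · rw [GrOperad.pcomp_neg _ _ h, smul_zero]
    exact dif_neg h

theorem twistAt_eq_zero {k : ℤ} (g : Graft s t r) (h : s < 2 ∨ t < 2) (N : ℕ)
    (c : List (Perm (Fin r)) → ℤ) : twistAt n N k g c = 0 := by
  refine Finset.sum_eq_zero fun p _ => ?_
  rcases h with h | h
  · rw [basis_eq_zero (l := p.1) (fun h' => by have := h'.two_le; omega)]
    simp only [map_zero, AddMonoidHom.zero_apply, smul_zero]
  · rw [basis_eq_zero (l := p.2) (fun h' => by have := h'.two_le; omega)]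
    simp only [map_zero, smul_zero]

/-- A normalized tree is determined by its set of inner inputs, and the subsets that give a factor
of arity less than 2 contribute zero. Sums over subsets are better suited to permutations than sums
over normalized trees. -/
theorem cobarTwist_eq {k : ℤ} (c : (D n).obj (pt r) k) : cobarTwist n c = twist n c := by
  unfold twist
  rw [← Graft.sum_isStd (fun g => twistAt n (len n r k) (k - 1) g (value c))
    (fun g h => twistAt_eq_zero g h _ _)]
  refine Finset.sum_congr rfl fun s _ => Finset.sum_congr rfl fun t _ =>
    Finset.sum_congr rfl fun g _ => ?_
  congr 1
  rw [twistAt, Finset.sum_product, sum_lists]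
  refine Finset.sum_congr rfl fun p _ => ?_
  simp only [sum_lists]
  rw [Finset.sum_comm]
  refine Finset.sum_congr rfl fun q _ => ?_
  refine Finset.sum_congr rfl fun x _ => Finset.sum_congr rfl fun y _ => ?_
  exact cobarTwist_term g _ _ _ (by simp [deg]) (by simp [deg])

/-- The image under `w` of the normalized composite with inner set `A` has inner set `w A` but need
not be normalized; `twistAt_congr` makes this irrelevant. -/
theorem twist_map {k : ℤ} (w : Perm (Fin r)) (c : (D n).obj (pt r) k) :
    twist n ((D n).map (β := pt r) w (le_refl _) c) =
      (Free (D n)).map (β := pt r) w (le_refl _) (twist n c) := by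
  unfold twist
  rw [map_sum]
  symm
  refine Finset.sum_nbij' (fun A => A.map w.toEmbedding) (fun A => A.map w.symm.toEmbedding)
    ?_ ?_ ?_ ?_ ?_
  · intro A hA
    simpa using hA
  · intro A hA
    simpa using hA
  · intro A _
    ext x
    simp
  · intro A _
    ext x
    simp
  · intro A _
    rw [← twistAt_rel ((Graft.std A).rel_relabel w) (fun l => value_map w c l)]
    refine twistAt_congr ?_ _ _ _
    ext x
    obtain ⟨x, rfl⟩ := w.surjective x
    rw [Graft.mem_inner_relabel, Graft.inner_std, Graft.inner_std]
    simp

theorem twist_add {k : ℤ} (c c' : (D n).obj (pt r) k) :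
    twist n (c + c') = twist n c + twist n c' := by
  unfold twist
  rw [← Finset.sum_add_distrib]
  exact Finset.sum_congr rfl fun A _ => twistAt_add _ _ _ (value c) (value c')

theorem cobarHom_add {k : ℤ} (c c' : (D n).obj (pt r) k) :
    (Free.gen (D n)).app ((δ n).d (c + c')) + twist n (c + c') =
      ((Free.gen (D n)).app ((δ n).d c) + twist n c) +
        ((Free.gen (D n)).app ((δ n).d c') + twist n c') := by
  rw [map_add, map_add, twist_add]
  abel

theorem cobarHom_map {k : ℤ} (w : Perm (Fin r)) (c : (D n).obj (pt r) k) :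
    (Free.gen (D n)).app ((δ n).d ((D n).map (β := pt r) w (le_refl _) c)) +
        twist n ((D n).map (β := pt r) w (le_refl _) c) =
      (Free (D n)).map (β := pt r) w (le_refl _)
        ((Free.gen (D n)).app ((δ n).d c) + twist n c) := by
  rw [twist_map, map_add]
  congr 1
  refine (congrArg _ ((δ n).d_map (α := pt r) (β := pt r) w (le_refl _) c)).trans ?_
  exact (Free.gen (D n)).app_map (α := pt r) (β := pt r) w (le_refl _) _

/-- The homomorphism which determines the differential of the cobar construction. -/
noncomputable def cobarHom (n : ℕ) : Free.DegHom (D n) where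
  app {r _ k} := AddMonoidHom.mk'
    (fun c : (D n).obj (pt r) k => (Free.gen (D n)).app (α := pt r) ((δ n).d c) + twist n c)
    (fun c c' => cobarHom_add (r := r) c c')
  app_map {r _ _} w _ _ x := cobarHom_map (r := r) w x

theorem cobarHom_app {k : ℤ} (c : (D n).obj (pt r) k) :
    (cobarHom n).app c = (Free.gen (D n)).app ((δ n).d c) + twist n c := rfl

/-- The square consists of `δ² = 0`, of the anticommutator of `δ` and `∂` (`twistAt_δ`), and of `∂²`
(`sum_twistLeft_add_sum_twistRight`). -/
theorem der_cobarHom {k : ℤ} (c : (D n).obj (pt r) k) :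
    (cobarHom n).der ((cobarHom n).app c) = 0 := by
  -- One more than the length of the simplices that support `c`, because `δ c` lives on simplices
  -- with one more vertex.
  set N := len n r k + 1 with hN
  have e1 : ∀ {s : ℕ} (l : List (Perm (Fin s))), l ∈ lists s N → (cobarHom n).der (basis n l) =
      (Free.gen (D n)).app ((δ n).d (dualBasis n (deg n l) l)) +
      ∑ A ∈ Finset.univ.filter (fun A : Finset (Fin s) => A.Nonempty),
        twistAt n N (deg n l - 1) (Graft.std A) (char n l) := by
    intro s l hl
    have h := twist_eq (dualBasis n (deg n l) l) (N := N) (by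
      rw [len_deg]; exact mem_lists.1 hl)
    exact congrArg (fun z => (Free.gen (D n)).app ((δ n).d (dualBasis n (deg n l) l)) + z) h
  have e2 : ∀ A : Finset (Fin r), (cobarHom n).der (twistAt n N (k - 1) (Graft.std A) (value c)) =
      ∑ p ∈ lists (Aᶜ.card + 1) N ×ˢ lists A.card N, twistCoeff n (Graft.std A) p.1 p.2 (value c) •
        ((Free (D n)).pcomp (Graft.std A) (k - 1 - 1)
          ((Free.gen (D n)).app ((δ n).d (dualBasis n (deg n p.1) p.1))) (basis n p.2) +
        ((deg n p.1).negOnePow : ℤ) • (Free (D n)).pcomp (Graft.std A) (k - 1 - 1) (basis n p.1)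
          ((Free.gen (D n)).app ((δ n).d (dualBasis n (deg n p.2) p.2)))) +
      (∑ B ∈ Finset.univ.filter (fun B : Finset (Fin (Aᶜ.card + 1)) => B.Nonempty),
        twistLeft n N (k - 1 - 1) (Graft.std B) (Graft.std A) (value c) +
      ∑ B ∈ Finset.univ.filter (fun B : Finset (Fin A.card) => B.Nonempty),
        twistRight n N (k - 1 - 1) (Graft.std B) (Graft.std A) (value c)) := by
    intro A
    unfold twistLeft twistRight
    rw [Finset.sum_comm, Finset.sum_comm (t := lists (Aᶜ.card + 1) N ×ˢ lists A.card N),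
      ← Finset.sum_add_distrib, ← Finset.sum_add_distrib, twistAt, map_sum]
    refine Finset.sum_congr rfl fun p hp => ?_
    rw [Finset.mem_product] at hp
    rw [map_zsmul, Free.DegHom.der_pcomp, e1 _ hp.1, e1 _ hp.2]
    simp only [map_add, AddMonoidHom.add_apply, map_sum, AddMonoidHom.finsetSum_apply, smul_add,
      Finset.smul_sum]
    abel
  have e3 : (cobarHom n).der ((Free.gen (D n)).app ((δ n).d c)) =
      ∑ A ∈ Finset.univ.filter (fun A : Finset (Fin r) => A.Nonempty),
        twistAt n N (k - 1 - 1) (Graft.std A) (value ((δ n).d c)) := by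
    rw [← twist_eq _ (len_sub_one k)]
    have h := cobarHom_app ((δ n).d c)
    rw [(δ n).d_d, map_zero, zero_add] at h
    exact h
  rw [cobarHom_app, map_add, e3, twist_eq c (Nat.le_succ _), map_sum, Finset.sum_congr rfl
    (fun A _ => e2 A), Finset.sum_add_distrib, Finset.sum_add_distrib,
    sum_twistLeft_add_sum_twistRight N k _ _ (fun w hw => cell_of_value hw) (Nat.le_succ _),
    add_zero, ← Finset.sum_add_distrib]
  exact Finset.sum_eq_zero fun A _ => twistAt_δ N k _ rfl (Graft.std A) c le_rfl

/-- The differential of the cobar construction. -/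
noncomputable def cobarDifferential (n : ℕ) : (Free (D n)).Differential :=
  (cobarHom n).differential (fun {r _ _} c => der_cobarHom (r := r) c)

theorem isCobar (n : ℕ) : IsCobar n (cobarDifferential n) := fun c => by
  rw [cobarTwist_eq]; rfl

end

end KCobar

namespace KCobar

/-! ### The total operad of an operad shaped on an operad in posets -/

section

variable {O : PosetOperad}

theorem SymDiag.map_congr (M : SymDiag O) {r : ℕ} {α β : O.obj r} {w w' : Perm (Fin r)}
    (hw : w = w') (h : O.act w α ≤ β) (h' : O.act w' α ≤ β) {k : ℤ} (x : M.obj α k) :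
    M.map w h x = M.map w' h' x := by
  subst hw; rfl

theorem SymDiag.incl_map (M : SymDiag O) {r : ℕ} {α β γ : O.obj r} {w : Perm (Fin r)}
    (h : O.act w α ≤ β) (h' : β ≤ γ) {k : ℤ} (x : M.obj α k) :
    M.incl h' (M.map w h x) = M.map w (h.trans h') x :=
  (M.map_map 1 w _ _ (by rw [one_mul]; exact h.trans h') x).trans
    (M.map_congr (one_mul w) _ _ x)

theorem SymDiag.map_incl (M : SymDiag O) {r : ℕ} {α β γ : O.obj r} {w : Perm (Fin r)}
    (h : α ≤ β) (h' : O.act w β ≤ γ) {k : ℤ} (x : M.obj α k) :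
    M.map w h' (M.incl h x) = M.map w ((O.act_mono w h).trans h') x :=
  (M.map_map w 1 _ _ (by rw [mul_one]; exact (O.act_mono w h).trans h') x).trans
    (M.map_congr (mul_one w) _ _ x)

theorem SymDiag.incl_self (M : SymDiag O) {r : ℕ} {α : O.obj r} (h : α ≤ α) {k : ℤ}
    (x : M.obj α k) : M.incl h x = x := M.map_id _ x

theorem GrOperad.comp_incl (P : GrOperad O) {s t r : ℕ} {α α' : O.obj s} {β β' : O.obj t}
    {γ γ' : O.obj r} (g : Graft s t r) (hα : α ≤ α') (hβ : β ≤ β') (hγ : γ ≤ γ')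
    (h : O.comp g α β ≤ γ) (h' : O.comp g α' β' ≤ γ') {i j k : ℤ} (hk : i + j = k)
    (p : P.obj α i) (q : P.obj β j) :
    P.comp g h' hk (P.incl hα p) (P.incl hβ q) = P.incl hγ (P.comp g h hk p q) :=
  P.comp_map (Graft.Rel.refl g) _ _ _ _ _ _ _ _

theorem GrOperad.incl_comp (P : GrOperad O) {s t r : ℕ} {α : O.obj s} {β : O.obj t}
    {γ γ' : O.obj r} (g : Graft s t r) (h : O.comp g α β ≤ γ) (hγ : γ ≤ γ') {i j k : ℤ}
    (hk : i + j = k) (p : P.obj α i) (q : P.obj β j) :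
    P.incl hγ (P.comp g h hk p q) = P.comp g (h.trans hγ) hk p q := by
  rw [← P.comp_incl g le_rfl le_rfl hγ h (h.trans hγ) hk p q, P.incl_self, P.incl_self]

/-- The direct sum of the components of a diagram in a given arity and degree. -/
def Total (M : SymDiag O) (r : ℕ) (k : ℤ) : Type := DirectSum (O.obj r) fun κ => M.obj κ k

noncomputable instance (M : SymDiag O) (r : ℕ) (k : ℤ) : AddCommGroup (Total M r k) :=
  inferInstanceAs (AddCommGroup (DirectSum (O.obj r) fun κ => M.obj κ k))

namespace Total

variable (M : SymDiag O) {r : ℕ} {k : ℤ}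

open Classical in
/-- The inclusion of a summand. -/
noncomputable def of (κ : O.obj r) : M.obj κ k →+ Total M r k :=
  DirectSum.of (fun κ => M.obj κ k) κ

variable {M} {A : Type} [AddCommGroup A]

open Classical in
/-- The homomorphism determined by homomorphisms on the summands. -/
noncomputable def lift (f : ∀ κ : O.obj r, M.obj κ k →+ A) : Total M r k →+ A :=
  DirectSum.toAddMonoid f

theorem lift_of (f : ∀ κ : O.obj r, M.obj κ k →+ A) (κ : O.obj r) (x : M.obj κ k) :
    lift f (of M κ x) = f κ x := by
  classical exact DirectSum.toAddMonoid_of f κ x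

theorem hom_ext {f f' : Total M r k →+ A} (h : ∀ κ x, f (of M κ x) = f' (of M κ x)) : f = f' := by
  classical exact DirectSum.addHom_ext h

/-- The axioms of the total operad compare summands whose indices are only propositionally equal;
the inclusion morphism plays the role of a cast. -/
theorem of_eq {α β : O.obj r} (h : α = β) {x : M.obj α k} {y : M.obj β k}
    (hxy : M.incl h.le x = y) : of M α x = of M β y := by
  subst h
  rw [← hxy, M.incl_self]

theorem induction {motive : Total M r k → Prop} (zero : motive 0)
    (of : ∀ κ x, motive (of M κ x)) (add : ∀ x y, motive x → motive y → motive (x + y))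
    (x : Total M r k) : motive x := by
  classical exact DirectSum.induction_on x zero of add

end Total

namespace GrOperad

variable (P : GrOperad O)

/-- The composition products of the total operad. -/
noncomputable def totalComp {s t r : ℕ} (g : Graft s t r) {i j k : ℤ} (hk : i + j = k) :
    Total P.toSymDiag s i →+ Total P.toSymDiag t j →+ Total P.toSymDiag r k :=
  Total.lift fun α => AddMonoidHom.mk' (fun x => Total.lift fun β =>
      (Total.of P.toSymDiag (O.comp g α β)).comp (P.comp g le_rfl hk x))
    (fun x x' => Total.hom_ext fun β y => by
      rw [AddMonoidHom.add_apply, Total.lift_of, Total.lift_of, Total.lift_of]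
      simp only [map_add, AddMonoidHom.coe_comp, Function.comp_apply, AddMonoidHom.add_apply])

theorem totalComp_of {s t r : ℕ} (g : Graft s t r) {i j k : ℤ} (hk : i + j = k) {α : O.obj s}
    {β : O.obj t} (x : P.obj α i) (y : P.obj β j) :
    P.totalComp g hk (Total.of _ α x) (Total.of _ β y) =
      Total.of P.toSymDiag (O.comp g α β) (P.comp g le_rfl hk x y) := by
  rw [totalComp, Total.lift_of, AddMonoidHom.mk'_apply, Total.lift_of]
  rfl

/-- The action of permutations on the total operad. -/
noncomputable def totalMap {r : ℕ} (w : Perm (Fin r)) {k : ℤ} :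
    Total P.toSymDiag r k →+ Total P.toSymDiag r k :=
  Total.lift fun α => (Total.of P.toSymDiag (O.act w α)).comp (P.map w le_rfl)

theorem totalMap_of {r : ℕ} (w : Perm (Fin r)) {k : ℤ} {α : O.obj r} (x : P.obj α k) :
    P.totalMap w (Total.of _ α x) = Total.of P.toSymDiag (O.act w α) (P.map w le_rfl x) := by
  rw [totalMap, Total.lift_of]
  rfl

/-- The total operad: the direct sums of the components in each arity. -/
noncomputable def total : GrOperad ptOperad where
  obj {r} _ k := Total P.toSymDiag r k
  grp _ _ := inferInstance
  map w _ := P.totalMap w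
  map_id {r} _ _ k x := by
    induction x using Total.induction with
    | zero => rw [map_zero]
    | add x y hx hy => rw [map_add, hx, hy]
    | of α x =>
      rw [totalMap_of]
      refine Total.of_eq (O.act_one α) ?_
      rw [P.incl_map]
      exact P.map_id _ x
  map_map {r} _ _ _ v w _ _ _ k x := by
    induction x using Total.induction with
    | zero => simp only [map_zero]
    | add x y hx hy => simp only [map_add, hx, hy]
    | of α x =>
      rw [totalMap_of, totalMap_of, totalMap_of]
      refine Total.of_eq (O.act_mul v w α).symm ?_
      rw [P.incl_map]
      exact P.map_map v w _ _ _ x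
  one := Total.of P.toSymDiag O.one P.one
  comp g _ _ _ _ hk := P.totalComp g hk
  comp_map {s t r _ _ _ _ _ _ u v w g g'} hg _ _ _ _ _ i j k hk p q := by
    induction p using Total.induction with
    | zero => simp only [map_zero, AddMonoidHom.zero_apply]
    | add x y hx hy => simp only [map_add, AddMonoidHom.add_apply, hx, hy]
    | of α x =>
      induction q using Total.induction with
      | zero => simp only [map_zero]
      | add x y hx hy => simp only [map_add, hx, hy]
      | of β y =>
        simp only [totalMap_of, totalComp_of]
        have h := O.comp_act hg α β
        refine Total.of_eq h ?_
        rw [P.incl_comp]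
        exact P.comp_map hg _ _ _ _ _ _ _ _
  comp_seq {s t u m m' r g₁ g₂ g₃ g₄} hg _ _ _ _ _ _ _ _ _ _ i j k a b c k₁ k₂ k₃ k₄ p q z := by
    induction p using Total.induction with
    | zero => simp only [map_zero, AddMonoidHom.zero_apply]
    | add x y hx hy => simp only [map_add, AddMonoidHom.add_apply, hx, hy]
    | of α x =>
      induction q using Total.induction with
      | zero => simp only [map_zero, AddMonoidHom.zero_apply]
      | add x y hx hy => simp only [map_add, AddMonoidHom.add_apply, hx, hy]
      | of β y =>
        induction z using Total.induction with
        | zero => simp only [map_zero]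
        | add x y hx hy => simp only [map_add, hx, hy]
        | of γ z =>
          simp only [totalComp_of]
          refine Total.of_eq (O.comp_seq hg α β γ) ?_
          rw [P.incl_comp]
          exact P.comp_seq hg _ _ _ _ _ _ _ _ _ _ _
  comp_par {s t u m m' r g₁ g₂ g₃ g₄} hg _ _ _ _ _ _ _ _ _ _ i j k a b c k₁ k₂ k₃ k₄ p q z := by
    induction p using Total.induction with
    | zero => simp only [map_zero, AddMonoidHom.zero_apply, smul_zero]
    | add x y hx hy => simp only [map_add, AddMonoidHom.add_apply, hx, hy, smul_add]
    | of α x =>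
      induction q using Total.induction with
      | zero => simp only [map_zero, AddMonoidHom.zero_apply, smul_zero]
      | add x y hx hy => simp only [map_add, AddMonoidHom.add_apply, hx, hy, smul_add]
      | of β y =>
        induction z using Total.induction with
        | zero => simp only [map_zero, AddMonoidHom.zero_apply, smul_zero]
        | add x y hx hy => simp only [map_add, AddMonoidHom.add_apply, hx, hy, smul_add]
        | of γ z =>
          simp only [totalComp_of, ← map_zsmul]
          refine Total.of_eq (O.comp_par hg α β γ) ?_
          rw [P.incl_comp]
          refine (P.comp_par hg _ _ le_rfl le_rfl _ _ k₃ k₄ _ _ _).trans ?_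
          rw [map_zsmul]
  one_comp {r g w} hg _ _ _ _ k hk q := by
    induction q using Total.induction with
    | zero => simp only [map_zero]
    | add x y hx hy => simp only [map_add, hx, hy]
    | of β y =>
      rw [totalMap_of, totalComp_of]
      refine Total.of_eq (O.one_comp hg β) ?_
      rw [P.incl_comp]
      exact P.one_comp hg _ _ _ _
  comp_one {r g w} hg _ _ _ _ k hk p := by
    induction p using Total.induction with
    | zero => simp only [map_zero, AddMonoidHom.zero_apply]
    | add x y hx hy => simp only [map_add, AddMonoidHom.add_apply, hx, hy]
    | of β y =>
      rw [totalMap_of, totalComp_of]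
      refine Total.of_eq (O.comp_one hg β) ?_
      rw [P.incl_comp]
      exact P.comp_one hg _ _ _ _

end GrOperad

/-- An element of the total operad is adapted to an element of `P(α)` if it decomposes the latter
into elements which come from the components of indices `≤ α`. -/
inductive Adapted (P : GrOperad O) {r : ℕ} (α : O.obj r) {k : ℤ} :
    Total P.toSymDiag r k → P.obj α k → Prop
  | zero : Adapted P α 0 0
  | of {κ : O.obj r} (h : κ ≤ α) (x : P.obj κ k) :
      Adapted P α (Total.of P.toSymDiag κ x) (P.incl h x)
  | add {x y : Total P.toSymDiag r k} {p q : P.obj α k} :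
      Adapted P α x p → Adapted P α y q → Adapted P α (x + y) (p + q)

namespace Adapted

variable {P : GrOperad O} {r : ℕ} {α : O.obj r} {k : ℤ}

theorem neg {x : Total P.toSymDiag r k} {p : P.obj α k} (h : Adapted P α x p) :
    Adapted P α (-x) (-p) := by
  induction h with
  | zero => rw [neg_zero, neg_zero]; exact zero
  | of h x => rw [← map_neg, ← map_neg]; exact of h _
  | add _ _ h h' => rw [neg_add, neg_add]; exact add h h'

theorem zsmul {x : Total P.toSymDiag r k} {p : P.obj α k} (h : Adapted P α x p) (a : ℤ) :
    Adapted P α (a • x) (a • p) := by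
  induction h with
  | zero => rw [smul_zero, smul_zero]; exact zero
  | of h x => rw [← map_zsmul, ← map_zsmul]; exact of h _
  | add _ _ h h' => rw [smul_add, smul_add]; exact add h h'

theorem sum {ι : Type} (s : Finset ι) {x : ι → Total P.toSymDiag r k} {p : ι → P.obj α k}
    (h : ∀ i ∈ s, Adapted P α (x i) (p i)) : Adapted P α (∑ i ∈ s, x i) (∑ i ∈ s, p i) := by
  classical
  induction s using Finset.induction_on with
  | empty => exact zero
  | insert i s hi ih =>
    rw [Finset.sum_insert hi, Finset.sum_insert hi]
    exact add (h i (Finset.mem_insert_self i s))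
      (ih fun j hj => h j (Finset.mem_insert_of_mem hj))

/-- Adapted elements are stable under the operations because these are monotone in `O`; the same
holds for `comp`. -/
theorem map {β : O.obj r} (w : Perm (Fin r)) (hw : O.act w α ≤ β) {x : Total P.toSymDiag r k}
    {p : P.obj α k} (h : Adapted P α x p) : Adapted P β (P.totalMap w x) (P.map w hw p) := by
  induction h with
  | zero => rw [map_zero, map_zero]; exact zero
  | of h x =>
    rw [P.totalMap_of, P.map_incl]
    have := of (P := P) (α := β) ((O.act_mono w h).trans hw) (P.map w le_rfl x)
    rwa [P.incl_map] at this
  | add _ _ h h' => rw [map_add, map_add]; exact add h h'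

theorem comp {s t : ℕ} {α : O.obj s} {β : O.obj t} {γ : O.obj r} (g : Graft s t r)
    (hg : O.comp g α β ≤ γ) {i j : ℤ} (hk : i + j = k) {x : Total P.toSymDiag s i}
    {y : Total P.toSymDiag t j} {p : P.obj α i} {q : P.obj β j} (h : Adapted P α x p)
    (h' : Adapted P β y q) : Adapted P γ (P.totalComp g hk x y) (P.comp g hg hk p q) := by
  induction h with
  | zero => simp only [map_zero, AddMonoidHom.zero_apply]; exact zero
  | add _ _ h1 h2 => simp only [map_add, AddMonoidHom.add_apply]; exact add h1 h2
  | of h x =>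
    induction h' with
    | zero => simp only [map_zero]; exact zero
    | add _ _ h1 h2 => simp only [map_add]; exact add h1 h2
    | of h' y =>
      have h1 := (O.comp_mono g h h').trans hg
      rw [P.totalComp_of, P.comp_incl g h h' h1 le_rfl hg]
      exact of h1 _

/-- Homomorphisms which are compatible with the inclusions of the components of indices `≤ α` take
the same value on adapted elements. -/
theorem lift_eq {A : Type} [AddCommGroup A] (f : ∀ κ : O.obj r, P.obj κ k →+ A)
    (hf : ∀ κ (h : κ ≤ α) x, f κ x = f α (P.incl h x)) {x : Total P.toSymDiag r k} {p : P.obj α k}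
    (h : Adapted P α x p) : Total.lift f x = f α p := by
  induction h with
  | zero => rw [map_zero, map_zero]
  | of h x => rw [Total.lift_of, hf _ h]
  | add _ _ h1 h2 => rw [map_add, map_add, h1, h2]

open Classical in
/-- An element of `P(α)` is determined by an adapted element. -/
theorem eq_zero {p : P.obj α k} (h : Adapted P α 0 p) : p = 0 := by
  -- The test family is the inclusion on components of index `≤ α` and zero on all others.
  have h1 := lift_eq (P := P) (α := α)
    (fun κ => if h : κ ≤ α then P.incl h else 0) (fun κ h x => by
      rw [dif_pos h, dif_pos le_rfl, P.incl_self]) h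
  rw [map_zero, dif_pos le_rfl, P.incl_self] at h1
  exact h1.symm

end Adapted

end

end KCobar

namespace KCobar

/-! ### The oriented weight systems of the cells -/

theorem variations_comm {r : ℕ} (i j : Fin r) (l : List (Perm (Fin r))) :
    variations i j l = variations j i l := by
  by_cases hij : i = j
  · rw [hij]
  induction l with
  | nil => rfl
  | cons a l ih =>
    cases l with
    | nil => rfl
    | cons b l =>
      have h : (Precedes a i j ↔ Precedes b i j) ↔ (Precedes a j i ↔ Precedes b j i) := by
        rw [precedes_asymm hij, precedes_asymm hij]
        tauto
      rw [variations, variations, ih]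
      simp only [h]

/-- The oriented weight system dual to a simplex. -/
def cellOWS (n : ℕ) {r : ℕ} (hr : 0 < r) (l : List (Perm (Fin r))) : OWS r where
  pos := hr
  wt i j := if i = j then 0 else n - 1 - variations i j l
  symm i j := by simp only [variations_comm i j, eq_comm (a := i)]
  diag i := if_pos rfl
  perm := l.getLast?.getD 1

section

variable {n s t r : ℕ} {k : ℤ}

theorem lastPrecedes_iff {l : List (Perm (Fin r))} (h : l ≠ []) (i j : Fin r) :
    LastPrecedes l i j ↔ Precedes (l.getLast?.getD 1) i j := by
  obtain ⟨a, ha⟩ : ∃ a, l.getLast? = some a := by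
    rw [List.getLast?_eq_some_getLast h]; exact ⟨_, rfl⟩
  simp [LastPrecedes, ha]

/-- The indices `κ` for which the dual of a simplex lies in `D_n(κ)` thus have a smallest element.
Truncated subtraction in `cellOWS` is exact because a cell has fewer than `n` variations on each
pair. -/
theorem dualLE_iff {l : List (Perm (Fin r))} (h : Cell n k l) (hr : 0 < r) (κ : OWS r) :
    DualLE n κ l ↔ cellOWS n hr l ≤ κ := by
  rw [OWS.le_def]
  refine forall_congr' fun i => forall_congr' fun j => forall_congr' fun hij => ?_
  have h1 := h.var_lt i j hij
  have h2 : (cellOWS n hr l).wt i j = n - 1 - variations i j l := if_neg hij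
  rw [h2, lastPrecedes_iff h.ne_nil]
  have h3 : (cellOWS n hr l).perm = l.getLast?.getD 1 := rfl
  rw [h3]
  refine or_congr (by omega) (and_congr (by omega) ?_)
  exact ⟨Iff.symm, Iff.symm⟩

theorem cellOWS_map (w : Perm (Fin r)) {l : List (Perm (Fin r))} (hl : l ≠ []) (hr : 0 < r) :
    cellOWS n hr (l.map (w * ·)) = OWS.act w (cellOWS n hr l) := by
  refine OWS.ext_of (fun i j => ?_) (fun i j _ => ?_)
  · simp only [cellOWS, OWS.act, variations_map, EmbeddingLike.apply_eq_iff_eq]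
  · obtain ⟨a, ha⟩ : ∃ a, l.getLast? = some a := by
      rw [List.getLast?_eq_some_getLast hl]; exact ⟨_, rfl⟩
    simp only [cellOWS, OWS.act, List.getLast?_map, ha, Option.map_some, Option.getD_some]

/-- Variations and last permutations of a term of a shuffle are computed by `pairVal` from those of
the factors, exactly as the weights and orders of a composite graph. Smallest indices are therefore
multiplicative. -/
theorem IsShuffle.cellOWS_eq {g : Graft s t r} {u : List (Perm (Fin s))} {v : List (Perm (Fin t))}
    {w : List (Perm (Fin r))} (h : IsShuffle (permComp g) u v w) (hs : 0 < s) (ht : 0 < t)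
    (hr : 0 < r) : cellOWS n hr w =
      completeGraphOperad.comp g (cellOWS n hs u) (cellOWS n ht v) := by
  refine OWS.ext_of (fun i j => ?_) (fun i j _ => ?_)
  · change (if i = j then 0 else n - 1 - variations i j w) =
      pairVal g.e (cellOWS n hs u).wt (cellOWS n ht v).wt (g.f i) (g.f j)
    by_cases hij : i = j
    · rw [if_pos hij, hij]
      rcases g.f j with a | a <;> simp [pairVal, OWS.diag]
    · rw [if_neg hij, h.variations_eq]
      rcases hi : g.f i with a | a <;> rcases hj : g.f j with b | b <;>
        simp only [pairVal, cellOWS]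
      · rw [if_neg (fun hab => hij (g.inj (by rw [hi, hj, hab])))]
      · rw [if_neg (g.e_ne hi)]
      · rw [if_neg (g.e_ne hj).symm]
      · rw [if_neg (fun hab => hij (g.inj (by rw [hi, hj, hab])))]
  · obtain ⟨a, b, ha, hb, hw⟩ := h.getLast?
    have e1 : (cellOWS n hr w).perm = permComp g a b := by simp [cellOWS, hw]
    have e2 : (cellOWS n hs u).perm = a := by simp [cellOWS, ha]
    have e3 : (cellOWS n ht v).perm = b := by simp [cellOWS, hb]
    rw [e1]
    change _ ↔ Precedes (permComp g (cellOWS n hs u).perm (cellOWS n ht v).perm) i j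
    rw [e2, e3]

/-! ### The generators of the operads shaped on complete graphs -/

/-- The oriented weight system dual to a simplex, as an element of the complete graph operad. -/
def cellIdx (n : ℕ) {r : ℕ} (hr : 0 < r) (l : List (Perm (Fin r))) : completeGraphOperad.obj r :=
  cellOWS n hr l

theorem cellIdx_le {l : List (Perm (Fin r))} (h : Cell n k l) {hr : 0 < r}
    {κ : completeGraphOperad.obj r} (h' : DualLE n κ l) : cellIdx n hr l ≤ κ :=
  (dualLE_iff h hr κ).1 h'

theorem cellIdx_map (w : Perm (Fin r)) {l : List (Perm (Fin r))} (hl : l ≠ []) (hr : 0 < r) :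
    cellIdx n hr (l.map (w * ·)) = completeGraphOperad.act w (cellIdx n hr l) :=
  cellOWS_map w hl hr


theorem inclusion_injective (κ : completeGraphOperad.obj r) :
    Function.Injective (inclusion n (κ := κ) (k := k)) := fun _ _ h =>
  Subtype.ext (congrArg (value (n := n) (r := r) (k := k)) h)

/-- The element dual to a simplex in a component of the diagram of generators. -/
noncomputable def basisK {κ : completeGraphOperad.obj r} {l : List (Perm (Fin r))} (h : Cell n k l)
    (h' : DualLE n κ l) : (DK n).obj κ k :=
  (⟨Pi.single l 1, fun m hm => by
      obtain rfl : m = l := by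
        by_contra h'
        exact hm (Pi.single_eq_of_ne h' _)
      exact ⟨h, h'⟩⟩ : (cellSystemK n).Cochains κ k)

theorem inclusion_basisK {κ : completeGraphOperad.obj r} {l : List (Perm (Fin r))} (h : Cell n k l)
    (h' : DualLE n κ l) : inclusion n (basisK h h') = dualBasis n k l :=
  D_ext fun m => by rw [value_dualBasis h]; rfl

theorem inclusion_map {κ κ' : completeGraphOperad.obj r} (w : Perm (Fin r))
    (h : completeGraphOperad.act w κ ≤ κ') (x : (DK n).obj κ k) :
    inclusion n ((DK n).map w h x) = (D n).map (β := pt r) w (le_refl _) (inclusion n x) := rfl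

theorem incl_basisK {κ κ' : completeGraphOperad.obj r} {l : List (Perm (Fin r))} (h : Cell n k l)
    (h' : DualLE n κ l) (h'' : DualLE n κ' l) (hκ : κ ≤ κ') :
    (DK n).incl hκ (basisK h h') = basisK h h'' := by
  refine inclusion_injective κ' ?_
  refine (inclusion_map 1 _ _).trans ?_
  rw [inclusion_basisK, inclusion_basisK]
  exact (D n).map_id (α := pt r) (le_refl _) _

theorem map_basisK {κ κ' : completeGraphOperad.obj r} {l : List (Perm (Fin r))} (h : Cell n k l)
    (h' : DualLE n κ l) (w : Perm (Fin r)) (h'' : DualLE n κ' (l.map (w * ·)))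
    (hκ : completeGraphOperad.act w κ ≤ κ') :
    (DK n).map w hκ (basisK h h') = (Perm.sign w : ℤ) ^ n • basisK (h.map w) h'' := by
  refine inclusion_injective κ' ?_
  rw [map_zsmul]
  refine (inclusion_map w _ _).trans ?_
  rw [inclusion_basisK, inclusion_basisK, dualBasis_map, smul_smul, ← mul_pow, sign_mul_self,
    one_pow, one_smul]

theorem dualLE_cellIdx {l : List (Perm (Fin r))} (h : Cell n k l) (hr : 0 < r) :
    DualLE n (cellIdx n hr l) l := (dualLE_iff h hr _).2 le_rfl

open Classical in
/-- The generator dual to a simplex in the total operad. -/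
noncomputable def totalBasis (n : ℕ) {r : ℕ} (k : ℤ) (l : List (Perm (Fin r))) :
    Total (Free (DK n)).toSymDiag r k :=
  if h : Cell n k l then
    Total.of (Free (DK n)).toSymDiag (cellIdx n (by have := h.two_le; omega) l)
      ((Free.gen (DK n)).app (basisK h (dualLE_cellIdx h _)))
  else 0

theorem totalBasis_pos {l : List (Perm (Fin r))} (h : Cell n k l) (hr : 0 < r) :
    totalBasis n k l = Total.of (Free (DK n)).toSymDiag (cellIdx n hr l)
      ((Free.gen (DK n)).app (basisK h (dualLE_cellIdx h hr))) := dif_pos h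

theorem totalBasis_map (w : Perm (Fin r)) (l : List (Perm (Fin r))) :
    (Free (DK n)).totalMap w (totalBasis n k l) =
      (Perm.sign w : ℤ) ^ n • totalBasis n k (l.map (w * ·)) := by
  by_cases h : Cell n k l
  · have hr : 0 < r := by have := h.two_le; omega
    rw [totalBasis_pos h hr, totalBasis_pos (h.map w) hr, GrOperad.totalMap_of, ← map_zsmul,
      ← map_zsmul]
    have h1 : completeGraphOperad.act w (cellIdx n hr l) = cellIdx n hr (l.map (w * ·)) :=
      (cellIdx_map w h.ne_nil hr).symm
    refine Total.of_eq h1 ?_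
    rw [SymDiag.incl_map, ← map_basisK h (dualLE_cellIdx h hr) w _ h1.le]
    exact ((Free.gen (DK n)).app_map _ _ _).symm
  · have h1 : totalBasis n k l = 0 := dif_neg h
    have h2 : totalBasis n k (l.map (w * ·)) = 0 := dif_neg (fun h' => h (by
      have := h'.map w⁻¹
      simpa using this))
    rw [h1, h2, map_zero, smul_zero]

/-- The value on cochains of the morphism to the total operad. -/
noncomputable def toTotalApp (n : ℕ) {r : ℕ} (k : ℤ) :
    (D n).obj (pt r) k →+ Total (Free (DK n)).toSymDiag r k :=
  AddMonoidHom.mk' (fun c => ∑ l ∈ lists r (len n r k), value c l • totalBasis n k l)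
    (fun c c' => by
      rw [← Finset.sum_add_distrib]
      exact Finset.sum_congr rfl fun l _ => by rw [value_add, add_smul])

theorem toTotalApp_apply (c : (D n).obj (pt r) k) :
    toTotalApp n k c = ∑ l ∈ lists r (len n r k), value c l • totalBasis n k l := rfl

theorem toTotalApp_map (w : Perm (Fin r)) (c : (D n).obj (pt r) k) :
    toTotalApp n k ((D n).map (β := pt r) w (le_refl _) c) =
      (Free (DK n)).totalMap w (toTotalApp n k c) := by
  rw [toTotalApp_apply, toTotalApp_apply, map_sum]
  symm
  refine Finset.sum_nbij' (fun l => l.map (w * ·)) (fun l => l.map (w⁻¹ * ·)) ?_ ?_ ?_ ?_ ?_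
  · intro l hl
    simpa only [mem_lists, List.length_map] using hl
  · intro l hl
    simpa only [mem_lists, List.length_map] using hl
  · intro l _
    simp
  · intro l _
    exact map_map_inv w l
  · intro l _
    rw [map_zsmul, totalBasis_map, value_map, smul_smul]
    congr 1
    rw [mul_comm]
    congr 2
    simp

/-- The morphism from the cobar construction to the total operad. -/
noncomputable def toTotal (n : ℕ) : GrOperad.Hom (Free (D n)) (Free (DK n)).total :=
  Free.lift
    { app := fun {r _ k} => toTotalApp n (r := r) k
      app_map := fun {r _ _} w _ _ x => toTotalApp_map (r := r) w x }

theorem toTotal_gen (c : (D n).obj (pt r) k) :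
    (toTotal n).app ((Free.gen (D n)).app c) = toTotalApp n k c := rfl

theorem ι_gen {κ : completeGraphOperad.obj r} (c : (DK n).obj κ k) :
    (ι n).app ((Free.gen (DK n)).app c) = (Free.gen (D n)).app (α := pt r) (inclusion n c) := rfl

open Classical in
theorem eq_sum_basisK {κ : completeGraphOperad.obj r} (c : (DK n).obj κ k) :
    c = ∑ l ∈ lists r (len n r k), value (inclusion n c) l •
      if h : Cell n k l ∧ DualLE n κ l then basisK h.1 h.2 else 0 := by
  refine inclusion_injective κ ?_
  rw [map_sum]
  refine (eq_sum_dualBasis (inclusion n c) le_rfl).trans (Finset.sum_congr rfl fun l _ => ?_)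
  rw [map_zsmul]
  by_cases h : value (inclusion n c) l = 0
  · rw [h, zero_smul, zero_smul]
  · have h1 : Cell n k l ∧ DualLE n κ l :=
      (show (cellSystemK n).Cochains κ k from c).2 l h
    rw [dif_pos h1, inclusion_basisK]

/-- `toTotal` cuts an element of `F(D_n)` into pieces placed at their smallest indices. For an
element coming from `κ` these indices are `≤ κ`, and the pieces, pushed to `κ`, add up to it. For
generators this is `cellIdx_le`, and the operations preserve it. -/
theorem adapted_toTotal {κ : completeGraphOperad.obj r} (a : (Free (DK n)).obj κ k) :
    Adapted (Free (DK n)) κ ((toTotal n).app (α := pt r) ((ι n).app a)) a := by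
  classical
  induction a using Free.induction with
  | @gen r κ k c =>
    rw [ι_gen, toTotal_gen, toTotalApp_apply]
    have h1 := congrArg (Free.gen (DK n)).app (eq_sum_basisK c)
    rw [map_sum] at h1
    have h2 : Adapted (Free (DK n)) κ
        (∑ l ∈ lists r (len n r k), value (inclusion n c) l • totalBasis n k l)
        (∑ l ∈ lists r (len n r k), (Free.gen (DK n)).app (value (inclusion n c) l •
          if h : Cell n k l ∧ DualLE n κ l then basisK h.1 h.2 else 0)) := by
      refine Adapted.sum _ fun l _ => ?_
      rw [map_zsmul]
      by_cases h : value (inclusion n c) l = 0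
      · rw [h, zero_smul, zero_smul]
        exact Adapted.zero
      · have h2 : Cell n k l ∧ DualLE n κ l :=
          (show (cellSystemK n).Cochains κ k from c).2 l h
        rw [dif_pos h2]
        refine Adapted.zsmul ?_ _
        have hr : 0 < r := OWS.pos κ
        have hκ := cellIdx_le h2.1 (hr := hr) h2.2
        rw [totalBasis_pos h2.1 hr]
        have h3 := Adapted.of (P := Free (DK n)) (α := κ) hκ
          ((Free.gen (DK n)).app (basisK h2.1 (dualLE_cellIdx h2.1 hr)))
        have h4 : (Free (DK n)).incl hκ
            ((Free.gen (DK n)).app (basisK h2.1 (dualLE_cellIdx h2.1 hr))) =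
            (Free.gen (DK n)).app (basisK h2.1 h2.2) := by
          rw [← incl_basisK h2.1 (dualLE_cellIdx h2.1 hr) h2.2 hκ]
          exact ((Free.gen (DK n)).app_map _ _ _).symm
        rwa [h4] at h3
    rwa [← h1] at h2
  | one =>
    have h1 := Adapted.of (P := Free (DK n)) (α := completeGraphOperad.one) le_rfl
      (Free (DK n)).one
    rwa [SymDiag.incl_self] at h1
  | zero κ k =>
    rw [map_zero]
    refine Eq.subst (motive := fun z => Adapted (Free (DK n)) _ z _) ?_ Adapted.zero
    exact (map_zero ((toTotal n).app (α := pt _))).symm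
  | add x y hx hy =>
    rw [map_add]
    refine Eq.subst (motive := fun z => Adapted (Free (DK n)) _ z _) ?_ (Adapted.add hx hy)
    exact (map_add ((toTotal n).app (α := pt _)) _ _).symm
  | neg x hx =>
    rw [map_neg]
    refine Eq.subst (motive := fun z => Adapted (Free (DK n)) _ z _) ?_ (Adapted.neg hx)
    exact (map_neg ((toTotal n).app (α := pt _)) _).symm
  | map w h x hx =>
    rw [(ι n).app_map]
    refine Eq.subst (motive := fun z => Adapted (Free (DK n)) _ z _) ?_ (Adapted.map w h hx)
    exact ((toTotal n).app_map (α := pt _) (β := pt _) w (le_refl _) _).symm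
  | comp g h hk x y hx hy =>
    rw [(ι n).app_comp]
    refine Eq.subst (motive := fun z => Adapted (Free (DK n)) _ z _) ?_ (Adapted.comp g h hk hx hy)
    exact ((toTotal n).app_comp (α := pt _) (β := pt _) (γ := pt _) g (le_refl _) hk _ _).symm

/-- The components of the free operad on the diagram of generators embed in the cobar construction. -/
theorem ι_injective (κ : completeGraphOperad.obj r) : Function.Injective ((ι n).app (α := κ) (k := k)) := by
  refine (injective_iff_map_eq_zero _).2 fun a ha => ?_
  have h := adapted_toTotal a
  have h1 : (toTotal n).app (α := pt r) (0 : (Free (D n)).obj (pt r) k) = 0 := map_zero _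
  have h2 : (toTotal n).app (α := pt r) ((ι n).app a) = 0 :=
    (congrArg ((toTotal n).app (α := pt r)) ha).trans h1
  rw [h2] at h
  exact h.eq_zero

end

end KCobar

namespace KCobar

/-! ### Colimits over the layers -/

namespace colim

variable {O : PosetOperad} {P : SymDiag O} {r : ℕ} {k : ℤ}

open Classical in
/-- The canonical homomorphisms to a colimit. -/
noncomputable def of {S : Set (O.obj r)} {κ : O.obj r} (h : κ ∈ S) : P.obj κ k →+ colim P S k :=
  AddCommGroup.DirectLimit.of (fun κ : S => P.obj κ.1 k) (fun _ _ h => P.incl h) ⟨κ, h⟩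

theorem of_incl {S : Set (O.obj r)} {κ κ' : O.obj r} (h : κ ∈ S) (h' : κ' ∈ S) (hκ : κ ≤ κ')
    (x : P.obj κ k) : of h' (P.incl hκ x) = of h x := by
  classical
  exact AddCommGroup.DirectLimit.of_f (G := fun κ : S => P.obj κ.1 k)
    (f := fun _ _ h => P.incl h) (i := ⟨κ, h⟩) (j := ⟨κ', h'⟩) hκ x

theorem hom_ext {S : Set (O.obj r)} {A : Type} [AddCommGroup A] {f f' : colim P S k →+ A}
    (h : ∀ κ (hκ : κ ∈ S) (x : P.obj κ k), f (of hκ x) = f' (of hκ x)) : f = f' := by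
  classical
  exact AddCommGroup.DirectLimit.hom_ext (G := fun κ : S => P.obj κ.1 k)
    (f := fun _ _ h => P.incl h) (P := A) (fun κ => AddMonoidHom.ext fun x => h κ.1 κ.2 x)

theorem transition_of {S T : Set (O.obj r)} (hST : S ⊆ T) {κ : O.obj r} (h : κ ∈ S)
    (x : P.obj κ k) : transition P hST k (of h x) = of (hST h) x := by
  classical
  exact AddCommGroup.DirectLimit.lift_of (G := fun κ : S => P.obj κ.1 k)
    (f := fun _ _ h => P.incl h) _ _ _ (⟨κ, h⟩ : S) x

variable {Q : GrOperad ptOperad} (f : SymDiag.Hom P (GrOperad.const O Q).toSymDiag)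

theorem desc_of {S : Set (O.obj r)} {κ : O.obj r} (h : κ ∈ S) (x : P.obj κ k) :
    desc f S k (of h x) = f.app x := by
  classical
  exact AddCommGroup.DirectLimit.lift_of (G := fun κ : S => P.obj κ.1 k)
    (f := fun _ _ h => P.incl h) _ _ _ (⟨κ, h⟩ : S) x

theorem desc_transition {S T : Set (O.obj r)} (hST : S ⊆ T) (x : colim P S k) :
    desc f T k (transition P hST k x) = desc f S k x := by
  have h : (desc f T k).comp (transition P hST k) = desc f S k := hom_ext fun κ hκ x => by
    rw [AddMonoidHom.comp_apply, transition_of, desc_of, desc_of]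
  exact DFunLike.congr_fun h x

/-- Two out of three, for the maps from both colimits to the constant object. -/
theorem transition_bijective {S T : Set (O.obj r)} (hST : S ⊆ T)
    (hS : Function.Bijective (desc f S k)) (hT : Function.Bijective (desc f T k)) :
    Function.Bijective (transition P hST k) := by
  refine (Function.Bijective.of_comp_iff' hT _).1 ?_
  convert hS using 1
  exact funext fun x => desc_transition f hST x

end colim

/-- Layers are closed downwards, so the pieces of a decomposition of an element over the layer stay
in it. -/
theorem layer_of_le {m : ℕ∞} {r : ℕ} {α β : completeGraphOperad.obj r} (h : α ≤ β)
    (hβ : β ∈ layer m r) : α ∈ layer m r := fun i j hij => by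
  have h1 : OWS.wt α i j ≤ OWS.wt β i j := by
    rcases OWS.le_def.1 h i j hij with h1 | h1
    · exact h1.le
    · exact h1.1.le
  exact (Nat.cast_le.2 h1).trans_lt (hβ i j hij)

theorem layer_act {m : ℕ∞} {r : ℕ} {α : completeGraphOperad.obj r} (w : Perm (Fin r))
    (hα : α ∈ layer m r) : completeGraphOperad.act w α ∈ layer m r :=
  fun i j hij => hα (w.symm i) (w.symm j) (fun h => hij (w.symm.injective h))

theorem layer_one (m : ℕ∞) : completeGraphOperad.one ∈ layer m 1 :=
  fun i j hij => absurd (Subsingleton.elim i j) hij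

theorem layer_comp {m : ℕ∞} {s t r : ℕ} (g : Graft s t r) {α : completeGraphOperad.obj s}
    {β : completeGraphOperad.obj t} (hα : α ∈ layer m s) (hβ : β ∈ layer m t) :
    completeGraphOperad.comp g α β ∈ layer m r := fun i j hij => by
  change ((pairVal g.e (OWS.wt α) (OWS.wt β) (g.f i) (g.f j) : ℕ) : ℕ∞) < m
  rcases hi : g.f i with a | a <;> rcases hj : g.f j with b | b
  · exact hα a b (fun h => hij (g.inj (by rw [hi, hj, h])))
  · exact hα a g.e (g.e_ne hi)
  · exact hα g.e b (g.e_ne hj).symm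
  · exact hβ a b (fun h => hij (g.inj (by rw [hi, hj, h])))

section

variable {n r : ℕ} {k : ℤ}

/-- The weights `n - 1 - μ` are less than `n`, so the smallest index of a cell lies in `K_n`. This
is where `n ≤ m` enters. -/
theorem layer_cellIdx {m : ℕ∞} {l : List (Perm (Fin r))} (h : Cell n k l) (hr : 0 < r)
    (hm : (n : ℕ∞) ≤ m) : cellIdx n hr l ∈ layer m r := fun i j hij => by
  refine lt_of_lt_of_le (Nat.cast_lt.2 ?_) hm
  change (if i = j then 0 else n - 1 - variations i j l) < n
  have h1 := h.var_lt i j hij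
  rw [if_neg hij]
  omega

/-- Sending the pieces produced by `toTotal` to the colimit gives a left inverse: in the colimit,
the pieces of an element over `κ` have the same sum as the element itself. -/
theorem desc_injective (m : ℕ∞) :
    Function.Injective (colim.desc (ι n).toHom (layer m r) k) := by
  classical
  -- Summands outside the layer are sent to zero; they play no role for elements indexed by the
  -- layer.
  let f : ∀ κ : completeGraphOperad.obj r, (Free (DK n)).obj κ k →+
      colim (Free (DK n)).toSymDiag (layer m r) k :=
    fun κ => if h : κ ∈ layer m r then colim.of h else 0
  have hf : ∀ {κ : completeGraphOperad.obj r} (h : κ ∈ layer m r), f κ = colim.of h :=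
    fun h => dif_pos h
  let Ξ : (Free (D n)).obj (pt r) k →+ colim (Free (DK n)).toSymDiag (layer m r) k :=
    (Total.lift (M := (Free (DK n)).toSymDiag) f).comp ((toTotal n).app (α := pt r))
  have h : Ξ.comp (colim.desc (ι n).toHom (layer m r) k) = AddMonoidHom.id _ := by
    refine colim.hom_ext fun κ hκ x => ?_
    rw [AddMonoidHom.comp_apply, colim.desc_of]
    refine (Adapted.lift_eq f (fun κ' h' y => ?_) (adapted_toTotal x)).trans ?_
    · rw [hf hκ, hf (layer_of_le h' hκ), colim.of_incl]
    · rw [hf hκ]; rfl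
  exact Function.LeftInverse.injective (g := Ξ) fun x => DFunLike.congr_fun h x

/-- The elements of the cobar construction which come from the layer `K_m`. -/
def layerSpan (n : ℕ) (m : ℕ∞) (r : ℕ) (k : ℤ) : AddSubgroup ((Free (D n)).obj (pt r) k) :=
  AddSubgroup.closure {x | ∃ κ ∈ layer m r, ∃ a : (Free (DK n)).obj κ k, x = (ι n).app a}

theorem ι_mem_layerSpan {m : ℕ∞} {κ : completeGraphOperad.obj r} (hκ : κ ∈ layer m r)
    (a : (Free (DK n)).obj κ k) : (ι n).app a ∈ layerSpan n m r k :=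
  AddSubgroup.subset_closure ⟨κ, hκ, a, rfl⟩

theorem map_mem_layerSpan {m : ℕ∞} (w : Perm (Fin r)) {x : (Free (D n)).obj (pt r) k}
    (hx : x ∈ layerSpan n m r k) :
    (Free (D n)).map (β := pt r) w (le_refl _) x ∈ layerSpan n m r k := by
  induction hx using AddSubgroup.closure_induction with
  | mem x hx =>
    obtain ⟨κ, hκ, a, rfl⟩ := hx
    have h := (ι n).app_map (β := completeGraphOperad.act w κ) w le_rfl a
    exact h ▸ ι_mem_layerSpan (layer_act w hκ) _
  | zero => rw [map_zero]; exact zero_mem _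
  | add x y _ _ hx hy => rw [map_add]; exact add_mem hx hy
  | neg x _ hx => rw [map_neg]; exact neg_mem hx

theorem comp_mem_layerSpan {m : ℕ∞} {s t : ℕ} (g : Graft s t r) {i j : ℤ} (hk : i + j = k)
    {x : (Free (D n)).obj (pt s) i} {y : (Free (D n)).obj (pt t) j}
    (hx : x ∈ layerSpan n m s i) (hy : y ∈ layerSpan n m t j) :
    (Free (D n)).comp (γ := pt r) g (le_refl _) hk x y ∈ layerSpan n m r k := by
  induction hx using AddSubgroup.closure_induction with
  | zero => rw [map_zero]; exact zero_mem _
  | add x y _ _ hx hy => rw [map_add]; exact add_mem hx hy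
  | neg x _ hx => rw [map_neg]; exact neg_mem hx
  | mem x hx =>
    obtain ⟨κ, hκ, a, rfl⟩ := hx
    induction hy using AddSubgroup.closure_induction with
    | zero => rw [map_zero]; exact zero_mem _
    | add x y _ _ hx hy => rw [map_add]; exact add_mem hx hy
    | neg x _ hx => rw [map_neg]; exact neg_mem hx
    | mem y hy =>
      obtain ⟨κ', hκ', b, rfl⟩ := hy
      have h := (ι n).app_comp (γ := completeGraphOperad.comp g κ κ') g le_rfl hk a b
      exact h ▸ ι_mem_layerSpan (layer_comp g hκ hκ') _

theorem gen_dualBasis_mem_layerSpan {m : ℕ∞} (hm : (n : ℕ∞) ≤ m) (l : List (Perm (Fin r))) :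
    (Free.gen (D n)).app (dualBasis n k l) ∈ layerSpan n m r k := by
  by_cases h : Cell n k l
  · have hr : 0 < r := by have := h.two_le; omega
    have h1 := ι_mem_layerSpan (m := m) (layer_cellIdx h hr hm)
      ((Free.gen (DK n)).app (basisK h (dualLE_cellIdx h hr)))
    rwa [ι_gen, inclusion_basisK] at h1
  · rw [dualBasis_eq_zero h, map_zero]
    exact zero_mem _

/-- Generators come from their smallest indices, which lie in the layer, and the layer is closed
under the operad operations. -/
theorem mem_layerSpan {m : ℕ∞} (hm : (n : ℕ∞) ≤ m) {α : ptOperad.obj r}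
    (x : (Free (D n)).obj α k) : x ∈ layerSpan n m r k := by
  induction x using Free.induction with
  | @gen r α k c =>
    have h : (Free.gen (D n)).app (α := pt r) c ∈ layerSpan n m r k := by
      rw [eq_sum_dualBasis (r := r) c le_rfl, map_sum]
      refine sum_mem fun l _ => ?_
      rw [map_zsmul]
      exact zsmul_mem (gen_dualBasis_mem_layerSpan hm l) _
    exact h
  | one =>
    have h := ι_mem_layerSpan (n := n) (layer_one m) (Free (DK n)).one
    rw [(ι n).app_one] at h
    exact h
  | zero α k => exact zero_mem _
  | add x y hx hy => exact add_mem hx hy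
  | neg x hx => exact neg_mem hx
  | map w h x hx => exact map_mem_layerSpan w hx
  | comp g h hk x y hx hy => exact comp_mem_layerSpan g hk hx hy

theorem desc_surjective {m : ℕ∞} (hm : (n : ℕ∞) ≤ m) :
    Function.Surjective (colim.desc (ι n).toHom (layer m r) k) := by
  have h : layerSpan n m r k ≤ (colim.desc (ι n).toHom (layer m r) k).range := by
    refine (AddSubgroup.closure_le _).2 ?_
    rintro x ⟨κ, hκ, a, rfl⟩
    exact ⟨colim.of hκ a, colim.desc_of _ hκ a⟩
  exact fun x => h (mem_layerSpan hm x)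

theorem desc_bijective {m : ℕ∞} (hm : (n : ℕ∞) ≤ m) :
    Function.Bijective (colim.desc (ι n).toHom (layer m r) k) :=
  ⟨desc_injective m, desc_surjective hm⟩

end

end KCobar

namespace KCobar

/-! ### The differential of the quasi-free operad shaped on complete graphs -/

section

variable {n s t r : ℕ} {k : ℤ} {κ : completeGraphOperad.obj r}

/-- A nonzero coefficient yields a term `w` of `x ∘ y` in the support of `c`. Its smallest index is
the composite of those of `x` and `y` and is `≤ κ`, so the product of the dual generators already
exists over `κ`. -/
theorem comp_dualBasis_mem (g : Graft s t r) (hs : 2 ≤ s) (ht : 2 ≤ t)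
    {c : (DK n).obj κ k} {x : List (Perm (Fin s))} {y : List (Perm (Fin t))}
    (hc : twistCoeff n g x y (value (inclusion n c)) ≠ 0) {i j : ℤ} (hi : deg n x = i)
    (hj : deg n y = j) (h : i + j = k - 1) :
    (Free (D n)).comp (α := pt s) (β := pt t) (γ := pt r) g (le_refl _) h
      ((Free.gen (D n)).app (dualBasis n i x)) ((Free.gen (D n)).app (dualBasis n j y)) ∈
      (Free.decomposables (DK n) κ (k - 1)).map (ι n).app := by
  subst hi hj
  obtain ⟨w, hw, hcw⟩ := exists_isShuffle g x y hc
  have h1 : Cell n k w ∧ DualLE n κ w := (show (cellSystemK n).Cochains κ k from c).2 w hcw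
  have hx := hw.cell_left h1.1 hs ht
  have hy := hw.cell_right h1.1 ht
  have hs' : 0 < s := by omega
  have ht' : 0 < t := by omega
  have hκ : completeGraphOperad.comp g (cellIdx n hs' x) (cellIdx n ht' y) ≤ κ :=
    (hw.cellOWS_eq hs' ht' (OWS.pos κ)).symm.le.trans (cellIdx_le h1.1 (hr := OWS.pos κ) h1.2)
  refine ⟨(Free (DK n)).comp g hκ h
    ((Free.gen (DK n)).app (basisK hx (dualLE_cellIdx hx hs')))
    ((Free.gen (DK n)).app (basisK hy (dualLE_cellIdx hy ht'))), ?_, ?_⟩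
  · exact AddSubgroup.subset_closure ⟨s, t, hs, ht, _, _, g, hκ, _, _, h, _, _, rfl⟩
  · refine ((ι n).app_comp g hκ h _ _).trans ?_
    rw [ι_gen, ι_gen, inclusion_basisK, inclusion_basisK]
    rfl

theorem cobarTwist_mem (c : (DK n).obj κ k) :
    cobarTwist n (inclusion n c) ∈ (Free.decomposables (DK n) κ (k - 1)).map (ι n).app := by
  unfold cobarTwist
  refine sum_mem fun s hs => sum_mem fun t ht => sum_mem fun g _ => ?_
  split_ifs
  · refine sum_mem fun p _ => sum_mem fun q _ => sum_mem fun u _ => sum_mem fun v _ => ?_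
    split_ifs with h
    · by_cases hc : twistCoeff n g (List.ofFn u) (List.ofFn v) (value (inclusion n c)) = 0
      · rw [hc, zero_smul]
        exact zero_mem _
      · refine zsmul_mem (comp_dualBasis_mem g (Finset.mem_Icc.1 hs).1 (Finset.mem_Icc.1 ht).1 hc
          ?_ ?_ h) _
        · rw [deg, List.length_ofFn]
        · rw [deg, List.length_ofFn]
    · exact zero_mem _
  · exact zero_mem _

/-- The twisting homomorphism of the diagram of generators. -/
noncomputable def twistK (c : (DK n).obj κ k) : (Free (DK n)).obj κ (k - 1) :=
  (cobarTwist_mem c).choose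

theorem twistK_mem (c : (DK n).obj κ k) : twistK c ∈ Free.decomposables (DK n) κ (k - 1) :=
  (cobarTwist_mem c).choose_spec.1

theorem ι_twistK (c : (DK n).obj κ k) : (ι n).app (twistK c) = cobarTwist n (inclusion n c) :=
  (cobarTwist_mem c).choose_spec.2

theorem ι_cobarHom (c : (DK n).obj κ k) :
    (ι n).app ((Free.gen (DK n)).app ((δK n).d c) + twistK c) =
      (cobarHom n).app (α := pt r) (inclusion n c) := by
  rw [map_add, ι_twistK, cobarTwist_eq]
  rfl

/-- The homomorphism on generators which determines the differential of the quasi-free operad. -/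
noncomputable def cobarHomK (n : ℕ) : Free.DegHom (DK n) where
  app := AddMonoidHom.mk' (fun c => (Free.gen (DK n)).app ((δK n).d c) + twistK c) (fun c c' => by
    -- The choice of preimages is harmless: by injectivity of `ι`, additivity and equivariance are
    -- inherited from `cobarHom`.
    refine ι_injective _ ?_
    rw [ι_cobarHom, map_add (ι n).app, ι_cobarHom, ι_cobarHom, map_add (inclusion n)]
    exact map_add ((cobarHom n).app (α := pt _)) _ _)
  app_map {r α β} w h k x := by
    refine ι_injective _ ?_
    refine (ι_cobarHom _).trans ?_
    refine ((cobarHom n).app_map (α := pt r) (β := pt r) w (le_refl _) (inclusion n x)).trans ?_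
    refine Eq.trans ?_ ((ι n).app_map w h _).symm
    exact congrArg ((Free (D n)).map (α := pt r) (β := pt r) w (le_refl _)) (ι_cobarHom x).symm

theorem ι_cobarHomK (c : (DK n).obj κ k) :
    (ι n).app ((cobarHomK n).app c) = (cobarHom n).app (α := pt r) (inclusion n c) :=
  ι_cobarHom c

/-- `ι` intertwines the homomorphisms on generators, hence the derivations that extend them. With
injectivity, `d² = 0` transfers to all components. -/
theorem ι_der (x : (Free (DK n)).obj κ k) :
    (ι n).app ((cobarHomK n).der x) = (cobarHom n).der (α := pt r) ((ι n).app x) := by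
  induction x using Free.induction with
  | gen c => exact ι_cobarHomK c
  | one =>
    rw [Free.DegHom.der_one, map_zero, (ι n).app_one]
    rfl
  | zero κ k =>
    rw [map_zero, map_zero, map_zero]
    exact (map_zero ((cobarHom n).der (α := pt _))).symm
  | add x y hx hy =>
    rw [map_add, map_add, hx, hy, map_add]
    exact (map_add ((cobarHom n).der (α := pt _)) _ _).symm
  | neg x hx =>
    rw [map_neg, map_neg, hx, map_neg]
    exact (map_neg ((cobarHom n).der (α := pt _)) _).symm
  | map w h x hx =>
    rw [Free.DegHom.der_map, (ι n).app_map, (ι n).app_map, hx]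
    exact ((cobarHom n).der_map (α := pt _) (β := pt _) w (le_refl _) _).symm
  | comp g h hk x y hx hy =>
    rw [Free.DegHom.der_comp, map_add, map_zsmul, (ι n).app_comp, (ι n).app_comp, (ι n).app_comp,
      hx, hy]
    exact ((cobarHom n).der_comp (α := pt _) (β := pt _) (γ := pt _) g (le_refl _) hk _ _).symm

theorem der_cobarHomK (c : (DK n).obj κ k) : (cobarHomK n).der ((cobarHomK n).app c) = 0 := by
  refine ι_injective _ ?_
  rw [ι_der, ι_cobarHomK, map_zero]
  exact der_cobarHom (r := r) _

/-- The differential of the quasi-free operad shaped on complete graphs. -/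
noncomputable def cobarDifferentialK (n : ℕ) : (Free (DK n)).Differential :=
  (cobarHomK n).differential der_cobarHomK

theorem isQuasiFree (n : ℕ) : Free.IsQuasiFree (δK n) (cobarDifferentialK n) := fun c => by
  have h : (cobarDifferentialK n).d ((Free.gen (DK n)).app c) =
    (Free.gen (DK n)).app ((δK n).d c) + twistK c := rfl
  rw [h, add_sub_cancel_left]
  exact twistK_mem c

end

end KCobar

namespace KCobar

/-! ### The signature of a sequence of labels -/

section

variable {r : ℕ}

open Classical in
/-- The signature of a sequence of labels which enumerates a permutation, zero otherwise. -/
noncomputable def sgnL (L : List (Fin r)) : ℤ :=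
  if h : ∃ τ : Perm (Fin r), L = List.ofFn τ then (Perm.sign h.choose : ℤ) else 0

theorem sgnL_ofFn (τ : Perm (Fin r)) : sgnL (List.ofFn τ) = Perm.sign τ := by
  have h : ∃ τ' : Perm (Fin r), List.ofFn τ = List.ofFn τ' := ⟨τ, rfl⟩
  have h1 : h.choose = τ := DFunLike.coe_injective (List.ofFn_injective h.choose_spec.symm)
  have h2 : sgnL (List.ofFn τ) = (Perm.sign h.choose : ℤ) := dif_pos h
  rw [h2, h1]

theorem exists_of_sgnL {L : List (Fin r)} (h : sgnL L ≠ 0) : ∃ τ : Perm (Fin r), L = List.ofFn τ := by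
  by_contra h'
  exact h (dif_neg h')

theorem nodup_of_sgnL {L : List (Fin r)} (h : sgnL L ≠ 0) : L.Nodup := by
  obtain ⟨τ, rfl⟩ := exists_of_sgnL h
  exact List.nodup_ofFn.2 τ.injective

theorem mem_of_sgnL {L : List (Fin r)} (h : sgnL L ≠ 0) (i : Fin r) : i ∈ L := by
  obtain ⟨τ, rfl⟩ := exists_of_sgnL h
  exact List.mem_ofFn.2 ⟨τ.symm i, by simp⟩

theorem length_of_sgnL {L : List (Fin r)} (h : sgnL L ≠ 0) : L.length = r := by
  obtain ⟨τ, rfl⟩ := exists_of_sgnL h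
  exact List.length_ofFn

theorem sgnL_map (w : Perm (Fin r)) (L : List (Fin r)) :
    sgnL (L.map w) = Perm.sign w * sgnL L := by
  by_cases h : ∃ τ : Perm (Fin r), L = List.ofFn τ
  · obtain ⟨τ, rfl⟩ := h
    have h1 : (List.ofFn τ).map w = List.ofFn (w * τ : Perm (Fin r)) := by
      rw [List.map_ofFn]; rfl
    rw [h1, sgnL_ofFn, sgnL_ofFn, map_mul, Units.val_mul]
  · have h1 : sgnL L = 0 := dif_neg h
    rw [h1, mul_zero]
    by_contra h2
    obtain ⟨τ, hτ⟩ := exists_of_sgnL h2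
    refine h ⟨w⁻¹ * τ, ?_⟩
    have h3 := congrArg (List.map (w⁻¹ : Perm (Fin r))) hτ
    rw [List.map_map, List.map_ofFn] at h3
    refine Eq.trans ?_ h3
    rw [← Equiv.Perm.coe_mul, inv_mul_cancel]
    simp

/-- The matrix of a sequence of labels. -/
def labelMatrix {m : ℕ} (a : Fin m → Fin r) : Matrix (Fin m) (Fin r) ℤ :=
  Matrix.of fun i j => if a i = j then 1 else 0

/-- The rows are the basis vectors given by the labels, so the matrix is a permutation matrix or has
two equal rows. -/
theorem sgnL_eq_det (a : Fin r → Fin r) : sgnL (List.ofFn a) = (labelMatrix a).det := by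
  by_cases h : Function.Injective a
  · obtain ⟨τ, rfl⟩ : ∃ τ : Perm (Fin r), τ = a :=
      ⟨Equiv.ofBijective a (Finite.injective_iff_bijective.1 h), rfl⟩
    have h1 : labelMatrix τ = τ.toPEquiv.toMatrix := by
      ext i j
      simp [labelMatrix, PEquiv.toMatrix_apply, Equiv.toPEquiv_apply]
    have h2 : sgnL (List.ofFn fun i => τ i) = Perm.sign τ := sgnL_ofFn τ
    rw [h2, h1, Matrix.det_permutation]
    simp
  · rw [Function.not_injective_iff] at h
    obtain ⟨i, j, hij, hne⟩ := h
    rw [Matrix.det_zero_of_row_eq hne (by ext k; simp [labelMatrix, hij])]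
    by_contra h1
    exact hne (List.nodup_ofFn.1 (nodup_of_sgnL h1) hij)

theorem eraseIdx_ofFn {A : Type} {m : ℕ} (b : Fin (m + 1) → A) (i : Fin (m + 1)) :
    (List.ofFn b).eraseIdx i = List.ofFn (b ∘ i.succAbove) := by
  have hlen : ((List.ofFn b).eraseIdx i).length = m := by
    rw [List.length_eraseIdx_of_lt (by rw [List.length_ofFn]; exact i.2), List.length_ofFn]
    rfl
  refine List.ext_getElem (by rw [hlen, List.length_ofFn]) fun j h1 h2 => ?_
  rw [List.getElem_eraseIdx, List.getElem_ofFn]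
  split_ifs with h
  · rw [List.getElem_ofFn, Function.comp_apply, Fin.succAbove_of_castSucc_lt _ _ h]
    rfl
  · rw [List.getElem_ofFn, List.getElem_ofFn, Function.comp_apply,
      Fin.succAbove_of_le_castSucc i ⟨j, by rwa [List.length_ofFn] at h2⟩
        (Fin.le_def.2 (not_lt.1 h))]
    rfl

/-- The signature is a cocycle. -/
theorem bd_sgnL {L : List (Fin r)} (hL : L.length = r + 1) : bd L sgnL = 0 := by
  obtain ⟨b, rfl⟩ : ∃ b : Fin (r + 1) → Fin r, L = List.ofFn b := by
    refine ⟨fun i => L.get (i.cast hL.symm), ?_⟩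
    exact List.ext_getElem (by rw [List.length_ofFn, hL]) fun i h1 h2 => by
      rw [List.getElem_ofFn]; rfl
  -- The matrix of labels is bordered by a column of ones. This column is the sum of the others, so
  -- the determinant vanishes, and expansion along it gives the signed sum over faces.
  let A : Matrix (Fin (r + 1)) (Fin (r + 1)) ℤ :=
    Matrix.of fun i j => Fin.cases 1 (fun j => if b i = j then 1 else 0) j
  have h0 : A.det = 0 := by
    rw [← Matrix.exists_mulVec_eq_zero_iff]
    refine ⟨Fin.cons 1 fun _ => -1, fun h => ?_, ?_⟩
    · have := congrFun h 0
      simp at this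
    · ext i
      simp [Matrix.mulVec, dotProduct, Fin.sum_univ_succ, A]
  rw [Matrix.det_succ_column_zero] at h0
  rw [bd_eq_sum, List.length_ofFn, Finset.sum_range, ← h0]
  refine Finset.sum_congr rfl fun i _ => ?_
  have h1 : A.submatrix i.succAbove Fin.succ = labelMatrix (b ∘ i.succAbove) := by
    ext j k; simp [A, labelMatrix]
  have h2 : A i 0 = 1 := by simp [A]
  rw [h1, h2, mul_one, ← sgnL_eq_det, eraseIdx_ofFn]

/-- The Leibniz rule for cup products. -/
theorem bd_cup {A : Type} (p : ℕ) (l : List A) (F c : List A → ℤ) (hc : c [] = 0) :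
    bd l (fun m => F (m.take (p + 1)) * c (m.drop p)) =
      bd (l.take (p + 2)) F * c (l.drop (p + 1)) +
        (-1) ^ p * (F (l.take (p + 1)) * bd (l.drop p) c) := by
  induction p generalizing l F with
  | zero =>
    cases l with
    | nil => simp [bd]
    | cons a l =>
      cases l with
      -- Deleting the only vertex leaves the empty back face, so `c [] = 0` is required.
      | nil => simp [bd, hc]
      | cons b l =>
        simp only [bd, List.take_succ_cons, List.take_zero, List.drop_zero, List.drop_succ_cons,
          bd_mul, pow_zero, zero_add, one_mul]
        ring
  | succ p ih =>
    cases l with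
    | nil => simp [bd]
    | cons a l =>
      have h1 := ih l (fun m => F (a :: m))
      simp only [bd, List.take_succ_cons, List.drop_succ_cons] at h1 ⊢
      rw [h1]
      ring

/-! ### The front faces of simplices -/

/-- The first value of a permutation. -/
def lab (hr : 0 < r) (w : Perm (Fin r)) : Fin r := w ⟨0, hr⟩

theorem frontSgn_eq (hr : 0 < r) (l : List (Perm (Fin r))) :
    frontSgn l = sgnL ((l.take r).map (lab hr)) := by
  have key : ∀ τ : Perm (Fin r), (∀ i : Fin r, ∃ u ∈ l[(i : ℕ)]?, τ i = u ⟨0, i.pos⟩) ↔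
      (l.take r).map (lab hr) = List.ofFn τ := by
    intro τ
    constructor
    · intro h
      refine List.ext_getElem? fun i => ?_
      by_cases hi : i < r
      · obtain ⟨u, hu, hτ⟩ := h ⟨i, hi⟩
        have hu' : l[i]? = some u := hu
        rw [List.getElem?_map, List.getElem?_take_of_lt hi, hu', List.getElem?_ofFn, dif_pos hi,
          hτ]
        rfl
      · rw [List.getElem?_eq_none (by simp; omega), List.getElem?_eq_none (by simp; omega)]
    · intro h i
      have h1 := congrArg (fun L => L[(i : ℕ)]?) h
      simp only [List.getElem?_map, List.getElem?_take_of_lt i.2, List.getElem?_ofFn, dif_pos i.2,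
        Option.map_eq_some_iff] at h1
      obtain ⟨u, hu, hτ⟩ := h1
      exact ⟨u, hu, hτ.symm⟩
  by_cases h : ∃ τ : Perm (Fin r), ∀ i : Fin r, ∃ u ∈ l[(i : ℕ)]?, τ i = u ⟨0, i.pos⟩
  · have h1 : frontSgn l = (Perm.sign h.choose : ℤ) := dif_pos h
    rw [h1, (key _).1 h.choose_spec, sgnL_ofFn]
  · have h1 : frontSgn l = 0 := dif_neg h
    have h2 : sgnL ((l.take r).map (lab hr)) = 0 :=
      dif_neg fun ⟨τ, hτ⟩ => h ⟨τ, (key τ).2 hτ⟩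
    rw [h1, h2]

theorem frontSgn_map (hr : 0 < r) (w : Perm (Fin r)) (l : List (Perm (Fin r))) :
    frontSgn (l.map (w * ·)) = Perm.sign w * frontSgn l := by
  rw [frontSgn_eq hr, frontSgn_eq hr, ← sgnL_map, ← List.map_take, List.map_map, List.map_map]
  rfl

theorem length_of_frontSgn (hr : 0 < r) {l : List (Perm (Fin r))} (h : frontSgn l ≠ 0) :
    r ≤ l.length := by
  rw [frontSgn_eq hr] at h
  have := length_of_sgnL h
  simp at this
  omega

/-- The cap product with a cocycle commutes with boundaries up to sign: the first term of the
Leibniz rule vanishes by `bd_sgnL`, or because the back face is empty when `l` is too short. -/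
theorem bd_frontSgn_mul (hr : 0 < r) (l : List (Perm (Fin r))) (c : List (Perm (Fin r)) → ℤ)
    (hc : c [] = 0) : bd l (fun m => frontSgn m * c (m.drop (r - 1))) =
      (-1) ^ (r - 1) * (frontSgn l * bd (l.drop (r - 1)) c) := by
  obtain ⟨p, rfl⟩ : ∃ p, r = p + 1 := ⟨r - 1, by omega⟩
  simp only [frontSgn_eq hr, Nat.add_sub_cancel]
  rw [bd_cup p l (fun m => sgnL (m.map (lab hr))) c hc]
  have h : bd (l.take (p + 2)) (fun m => sgnL (m.map (lab hr))) * c (l.drop (p + 1)) = 0 := by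
    by_cases hl : p + 2 ≤ l.length
    · rw [← bd_map, bd_sgnL (by simp; omega), zero_mul]
    · rw [List.drop_eq_nil_of_le (by omega), hc, mul_zero]
  rw [h, zero_add]

theorem changes_drop {A : Type} (P : A → Prop) (p : ℕ) (l : List A) :
    changes P (l.drop p) ≤ changes P l := by
  induction p generalizing l with
  | zero => exact le_rfl
  | succ p ih =>
    cases l with
    | nil => exact le_rfl
    | cons a l =>
      refine (ih l).trans ?_
      cases l with
      | nil => exact Nat.zero_le _
      | cons b l => exact Nat.le_add_left _ _

/-- If the predicate takes both values on the front face, some change happens there and is lost in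
the back face. -/
theorem changes_drop_lt {A : Type} (P : A → Prop) (p : ℕ) (l : List A)
    (h1 : ∃ a ∈ l.take (p + 1), P a) (h2 : ∃ a ∈ l.take (p + 1), ¬ P a) :
    changes P (l.drop p) < changes P l := by
  induction p generalizing l with
  | zero =>
    cases l with
    | nil => simp at h1
    | cons a l => simp at h1 h2; exact absurd h1 h2
  | succ p ih =>
    cases l with
    | nil => simp at h1
    | cons a l =>
      cases l with
      | nil => simp at h1 h2; exact absurd h1 h2
      | cons b l =>
        have h4 : changes P ((b :: l).drop p) ≤ changes P (b :: l) := changes_drop P p _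
        by_cases hab : P a ↔ P b
        · refine (ih (b :: l) ?_ ?_).trans_le (Nat.le_add_left _ _)
          · obtain ⟨x, hx, hx'⟩ := h1
            rw [List.take_succ_cons, List.mem_cons] at hx
            rcases hx with rfl | hx
            · exact ⟨b, by simp, hab.1 hx'⟩
            · exact ⟨x, hx, hx'⟩
          · obtain ⟨x, hx, hx'⟩ := h2
            rw [List.take_succ_cons, List.mem_cons] at hx
            rcases hx with rfl | hx
            · exact ⟨b, by simp, fun h => hx' (hab.2 h)⟩
            · exact ⟨x, hx, hx'⟩
        · have h5 : changes P (a :: b :: l) = 1 + changes P (b :: l) := by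
            simp only [changes]
            simp [hab]
          rw [h5, List.drop_succ_cons]
          omega

theorem precedes_lab (hr : 0 < r) (w : Perm (Fin r)) {j : Fin r} (h : lab hr w ≠ j) :
    Precedes w (lab hr w) j := by
  have h1 : w.symm (lab hr w) = ⟨0, hr⟩ := by simp [lab]
  have h2 : w.symm j ≠ ⟨0, hr⟩ := fun h' => h (by rw [lab, ← h']; simp)
  change w.symm (lab hr w) < w.symm j
  rw [h1, Fin.lt_def]
  exact Nat.pos_of_ne_zero fun h3 => h2 (Fin.ext h3)

/-- Both `i` and `j` occur as first values along the front face, so the pair is ordered both ways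
there. The strict drop is what takes `E_{n+1}` to `E_n`. -/
theorem variations_drop_lt (hr : 0 < r) {l : List (Perm (Fin r))} (h : frontSgn l ≠ 0)
    {i j : Fin r} (hij : i ≠ j) : variations i j (l.drop (r - 1)) < variations i j l := by
  rw [variations_eq_changes, variations_eq_changes]
  rw [frontSgn_eq hr] at h
  have h1 := mem_of_sgnL h
  have h2 : r - 1 + 1 = r := by omega
  refine changes_drop_lt _ _ _ ?_ ?_ <;> rw [h2]
  · obtain ⟨w, hw, e⟩ := List.mem_map.1 (h1 i)
    refine ⟨w, hw, ?_⟩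
    rw [← e]
    exact precedes_lab hr w (by rwa [e])
  · obtain ⟨w, hw, e⟩ := List.mem_map.1 (h1 j)
    refine ⟨w, hw, ?_⟩
    refine (precedes_asymm hij).1 ?_
    rw [← e]
    exact precedes_lab hr w (by rw [e]; exact hij.symm)

end

end KCobar

namespace KCobar

/-! ### The suspension morphisms -/

/-- The sign of the isomorphisms between operadic suspensions. -/
def susp (n r : ℕ) : ℤ := (-1) ^ ((n + 1) * ((r - 1) * (r - 2) / 2))

section

variable {n r : ℕ} {k : ℤ}

open Classical in
/-- The suspension of a function on simplices. -/
noncomputable def suspVal (n : ℕ) (k : ℤ) (c : List (Perm (Fin r)) → ℤ)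
    (l : List (Perm (Fin r))) : ℤ :=
  if Cell (n + 1) k l then susp n r * frontSgn l * c (l.drop (r - 1)) else 0

/-- The suspension morphism on the generators of the cobar constructions. -/
noncomputable def suspApp (n : ℕ) {r : ℕ} (k : ℤ) :
    (D n).obj (pt r) k →+ (D (n + 1)).obj (pt r) k :=
  AddMonoidHom.mk' (fun c => (⟨suspVal n k (value c), fun l hl => by
      by_contra h
      exact hl (if_neg fun h' => h ⟨h', trivial⟩)⟩ : (cellSystem (n + 1)).Cochains (pt r) k))
    (fun c c' => D_ext fun l => by
      change suspVal n k (fun m => value c m + value c' m) l =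
        suspVal n k (value c) l + suspVal n k (value c') l
      unfold suspVal
      split_ifs
      · rw [mul_add]
      · rw [add_zero])

theorem value_suspApp_pos (c : (D n).obj (pt r) k) {l : List (Perm (Fin r))}
    (h : Cell (n + 1) k l) :
    value (suspApp n k c) l = susp n r * frontSgn l * value c (l.drop (r - 1)) := if_pos h

theorem value_suspApp_neg (c : (D n).obj (pt r) k) {l : List (Perm (Fin r))}
    (h : ¬ Cell (n + 1) k l) : value (suspApp n k c) l = 0 := if_neg h

/-- The equivariance of `frontSgn` supplies the additional factor that changes `sgn(w)ⁿ` into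
`sgn(w)ⁿ⁺¹`. -/
theorem suspApp_map (w : Perm (Fin r)) (c : (D n).obj (pt r) k) :
    suspApp n k ((D n).map (β := pt r) w (le_refl _) c) =
      (D (n + 1)).map (β := pt r) w (le_refl _) (suspApp n k c) := by
  refine D_ext fun l => ?_
  rw [value_map]
  by_cases h : Cell (n + 1) k l
  · have hr : 0 < r := by have := h.two_le; omega
    rw [value_suspApp_pos _ h, value_suspApp_pos _ ((Cell.map_iff w).2 h), value_map,
      frontSgn_map hr, ← List.map_drop, pow_succ, Perm.sign_inv]
    linear_combination (-(Perm.sign w : ℤ) ^ n * susp n r * frontSgn l *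
      value c ((l.drop (r - 1)).map (w⁻¹ * ·))) * sign_mul_self w
  · rw [value_suspApp_neg _ h, value_suspApp_neg _ fun h' => h ((Cell.map_iff w).1 h'), mul_zero]

/-- The suspension morphism `σ^*`. -/
noncomputable def suspension (n : ℕ) : SymDiag.Hom (D n) (D (n + 1)) where
  app {r _ k} := suspApp n (r := r) k
  app_map {r _ _} w _ _ x := suspApp_map (r := r) w x

theorem isSuspension (n : ℕ) : IsSuspension n (suspension n) := fun _ _ => rfl

theorem value_nil (c : (D n).obj (pt r) k) : value c [] = 0 := by
  by_contra h
  exact (cell_of_value h).ne_nil rfl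

/-- Consecutive vertices of the front face have distinct labels, so repetitions could only occur in
the back face. -/
theorem isChain_of_drop {A : Type} (p : ℕ) (l : List A) {B : Type} (f : A → B)
    (h : ((l.take (p + 1)).map f).Nodup) (h' : (l.drop p).IsChain (· ≠ ·)) :
    l.IsChain (· ≠ ·) := by
  induction p generalizing l with
  | zero => exact h'
  | succ p ih =>
    cases l with
    | nil => exact List.isChain_nil
    | cons a l =>
      rw [List.take_succ_cons, List.map_cons, List.nodup_cons] at h
      have h1 := ih l h.2 h'
      cases l with
      | nil => exact List.isChain_singleton a
      | cons b l =>
        refine List.isChain_cons_cons.2 ⟨fun hab => h.1 ?_, h1⟩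
        rw [hab]
        simp

/-- A simplex which satisfies the conditions on variations and on degrees lies in the complex if its
suspension does so. -/
theorem cell_of_suspension {l : List (Perm (Fin r))} (hr : 2 ≤ r) (hf : frontSgn l ≠ 0) {k' : ℤ}
    (hd : Cell n k' (l.drop (r - 1))) (hv : ∀ i j, i ≠ j → variations i j l < n + 1)
    (hk : deg (n + 1) l = k) : Cell (n + 1) k l where
  two_le := hr
  ne_nil h := by
    have := length_of_frontSgn (by omega) hf
    rw [h, List.length_nil] at this
    omega
  chain := by
    rw [frontSgn_eq (by omega)] at hf
    have h2 : r - 1 + 1 = r := by omega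
    exact isChain_of_drop (r - 1) l (lab (by omega)) (by rw [h2]; exact nodup_of_sgnL hf) hd.chain
  var_lt := hv
  deg := hk

/-- Each pair loses at least one variation, and the `r - 1` deleted vertices compensate the passage
from `n + 1` to `n` in the degree. -/
theorem Cell.drop {l : List (Perm (Fin r))} (h : Cell (n + 1) k l) (hf : frontSgn l ≠ 0) :
    Cell n k (l.drop (r - 1)) := by
  have hr := h.two_le
  have h1 := length_of_frontSgn (by omega) hf
  refine ⟨hr, fun h2 => ?_, h.chain.drop _, fun i j hij => ?_, ?_⟩
  · have := congrArg List.length h2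
    simp at this
    omega
  · have h2 := variations_drop_lt (by omega) hf hij
    have h3 := h.var_lt i j hij
    omega
  · have h2 := h.deg
    have h3 : ((l.drop (r - 1)).length : ℤ) = l.length - (r - 1) := by
      rw [List.length_drop]; omega
    rw [h3]
    push_cast at h2
    linear_combination h2

theorem suspension_δ (c : (D n).obj (pt r) k) :
    suspApp n (k - 1) ((δ n).d c) = (δ (n + 1)).d (suspApp n k c) := by
  refine D_ext fun l => ?_
  rw [value_δ]
  split_ifs with h
  swap
  · exact value_suspApp_neg _ h
  have hr := h.two_le
  rw [value_suspApp_pos _ h]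
  -- A face with a nonzero contribution is automatically a cell: its front labels are distinct, its
  -- back face is a cell, and it has no more variations than `l`.
  have h1 : bd l (value (suspApp n k c)) =
      bd l (fun m => susp n r * (frontSgn m * value c (m.drop (r - 1)))) := by
    rw [bd_eq_sum, bd_eq_sum]
    refine Finset.sum_congr rfl fun i hi => ?_
    have hi := Finset.mem_range.1 hi
    congr 1
    by_cases h2 : Cell (n + 1) k (l.eraseIdx i)
    · rw [value_suspApp_pos _ h2, mul_assoc]
    · rw [value_suspApp_neg _ h2]
      symm
      by_contra h3
      have h4 := right_ne_zero_of_mul h3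
      have h5 := left_ne_zero_of_mul h4
      have h6 := cell_of_value (right_ne_zero_of_mul h4)
      have h7 := length_of_frontSgn (by omega) h5
      refine h2 (cell_of_suspension hr h5 h6 (fun a b hab => ?_) ?_)
      · have h8 := variations_eraseIdx a b l i hi (fun h9 => by
          rw [h9, List.length_nil] at h7; omega)
        have h9 := h.var_lt a b hab
        omega
      · have h8 := h.deg
        unfold deg
        rw [List.length_eraseIdx_of_lt hi]
        have : ((l.length - 1 : ℕ) : ℤ) = l.length - 1 := by omega
        rw [this]
        linear_combination h8
  rw [h1, bd_mul, bd_frontSgn_mul (by omega) l _ (value_nil c)]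
  by_cases hf : frontSgn l = 0
  · rw [hf]; ring
  · rw [value_δ, if_pos (h.drop hf)]
    have h2 := length_of_frontSgn (by omega) hf
    obtain ⟨q, hq⟩ : ∃ q, l.length = q + (r - 1) := ⟨l.length - (r - 1), by omega⟩
    have h3 : (l.drop (r - 1)).length = q := by rw [List.length_drop]; omega
    have h4 : (-1 : ℤ) ^ (r - 1) * (-1) ^ (r - 1) = 1 := by
      rw [← mul_pow]; norm_num
    rw [h3, hq]
    rw [show q + (r - 1) + 1 = (q + 1) + (r - 1) by omega, pow_add]
    linear_combination (-(susp n r * frontSgn l * (-1) ^ (q + 1) *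
      bd (l.drop (r - 1)) (value c))) * h4

theorem preservesDifferentials_suspension (n : ℕ) :
    PreservesDifferentials (suspension n) (δ n) (δ (n + 1)) :=
  fun {r _ _} x => suspension_δ (r := r) x

/-! ### The suspension morphisms of the diagrams -/

/-- The bound rises by one with `n`, the number of variations rises by at least one, and the last
permutation belongs to the back face. -/
theorem DualLE.of_drop {κ : OWS r} {l : List (Perm (Fin r))} (hr : 0 < r)
    (h : DualLE n κ (l.drop (r - 1))) (hf : frontSgn l ≠ 0) : DualLE (n + 1) κ l := by
  intro i j hij
  have h1 := h i j hij
  have h2 := variations_drop_lt hr hf hij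
  have h3 := length_of_frontSgn hr hf
  have h4 : LastPrecedes (l.drop (r - 1)) i j ↔ LastPrecedes l i j := by
    unfold LastPrecedes
    rw [List.getLast?_drop, if_neg (by omega)]
  rw [h4] at h1
  push_cast
  rcases h1 with h1 | ⟨h1, h5⟩
  · left; omega
  · by_cases h6 : (n : ℤ) + 1 - 1 - κ.wt i j < variations i j l
    · exact Or.inl h6
    · exact Or.inr ⟨by omega, h5⟩

theorem suspApp_mem {κ : completeGraphOperad.obj r} (c : (DK n).obj κ k)
    {l : List (Perm (Fin r))} (h : value (suspApp n k (inclusion n c)) l ≠ 0) :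
    Cell (n + 1) k l ∧ DualLE (n + 1) κ l := by
  have h1 := cell_of_value h
  rw [value_suspApp_pos _ h1] at h
  have h2 : Cell n k (l.drop (r - 1)) ∧ DualLE n κ (l.drop (r - 1)) :=
    (show (cellSystemK n).Cochains κ k from c).2 _ (right_ne_zero_of_mul h)
  exact ⟨h1, h2.2.of_drop (OWS.pos κ) (right_ne_zero_of_mul (left_ne_zero_of_mul h))⟩

/-- The suspension morphism of the diagrams of generators. -/
noncomputable def suspensionK (n : ℕ) : SymDiag.Hom (DK n) (DK (n + 1)) where
  app {_ κ k} := AddMonoidHom.mk' (fun c =>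
      (⟨value (suspApp n k (inclusion n c)), fun _ h => suspApp_mem c h⟩ :
        (cellSystemK (n + 1)).Cochains κ k)) (fun c c' => inclusion_injective κ
      ((congrArg (suspApp n k) (map_add (inclusion n) c c')).trans (map_add (suspApp n k) _ _)))
  app_map {r _ _} w _ _ c := inclusion_injective _ (suspApp_map (r := r) w (inclusion n c))

theorem inclusion_suspensionK {κ : completeGraphOperad.obj r} (c : (DK n).obj κ k) :
    inclusion (n + 1) ((suspensionK n).app c) = (suspension n).app (α := pt r) (inclusion n c) :=
  rfl

theorem preservesDifferentials_suspensionK (n : ℕ) :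
    PreservesDifferentials (suspensionK n) (δK n) (δK (n + 1)) :=
  fun {r _ _} x => inclusion_injective _ (suspension_δ (r := r) (inclusion n x))

theorem ι_mapHom {κ : completeGraphOperad.obj r} (x : (Free (DK n)).obj κ k) :
    (ι (n + 1)).app ((Free.mapHom (suspensionK n)).app x) =
      (Free.mapHom (suspension n)).app (α := pt r) ((ι n).app x) := by
  induction x using Free.induction with
  | gen c => rfl
  | one =>
    rw [(Free.mapHom (suspensionK n)).app_one, (ι (n + 1)).app_one, (ι n).app_one]
    rfl
  | zero κ k =>
    rw [map_zero, map_zero, map_zero]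
    exact (map_zero ((Free.mapHom (suspension n)).app (α := pt _))).symm
  | add x y hx hy =>
    rw [map_add, map_add, hx, hy, map_add]
    exact (map_add ((Free.mapHom (suspension n)).app (α := pt _)) _ _).symm
  | neg x hx =>
    rw [map_neg, map_neg, hx, map_neg]
    exact (map_neg ((Free.mapHom (suspension n)).app (α := pt _)) _).symm
  | map w h x hx =>
    rw [(Free.mapHom (suspensionK n)).app_map, (ι (n + 1)).app_map, (ι n).app_map, hx]
    exact ((Free.mapHom (suspension n)).app_map (α := pt _) (β := pt _) w (le_refl _) _).symm
  | comp g h hk x y hx hy =>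
    rw [(Free.mapHom (suspensionK n)).app_comp, (ι (n + 1)).app_comp, (ι n).app_comp, hx, hy]
    exact ((Free.mapHom (suspension n)).app_comp (α := pt _) (β := pt _) (γ := pt _) g (le_refl _)
      hk _ _).symm

end

end KCobar

namespace KCobar

/-! ### Front faces of shuffle products -/

/-- Sequences labelled in such a way that the labels of the terms of shuffle products are those of a
composite, together with a weight `Z` of the sequences of labels which vanishes unless the labels are
all distinct and form a complete set. -/
structure FrontData (A B C S T : Type) [DecidableEq S] where
  /-- the product -/
  f : A → B → C
  /-- the labels of the first factor -/
  α : A → S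
  /-- the labels of the second factor -/
  β : B → T
  /-- the label where the second factor is plugged in -/
  e : S
  /-- the labels of the product -/
  φ : C → S ⊕ T
  φ_f : ∀ a b, φ (f a b) = if α a = e then Sum.inr (β b) else Sum.inl (α a)
  /-- the weight -/
  Z : List (S ⊕ T) → ℤ
  /-- the number of labels of the first factor -/
  s : ℕ
  /-- the number of labels of the second factor -/
  t : ℕ
  nodup : ∀ M, Z M ≠ 0 → M.Nodup
  left : ∀ M, Z M ≠ 0 → M.countP Sum.isLeft + 1 = s
  right : ∀ M, Z M ≠ 0 → M.countP Sum.isRight = t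
  /-- the function on the back faces -/
  c : List C → ℤ
  c_nil : c [] = 0

namespace FrontData

variable {A B C S T : Type} [DecidableEq S] (F : FrontData A B C S T)

/-- The weight of the shuffle product of two sequences, where the labels start with `P` and are
completed by the labels of the front faces of length `m + 1`. -/
def phase (P : List (S ⊕ T)) (u : List A) (v : List B) (m : ℕ) : ℤ :=
  shEval F.f u v fun w => F.Z (P ++ (w.take (m + 1)).map F.φ) * F.c (w.drop m)

/-- The labels of the product which correspond to a label of the first factor. -/
def sub (V : List T) (a : A) : List (S ⊕ T) :=
  if F.α a = F.e then V.map Sum.inr else [Sum.inl (F.α a)]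

variable {F} {P : List (S ⊕ T)} {a : A} {u : List A} {b : B} {v : List B} {m : ℕ}

theorem sub_pos (h : F.α a = F.e) (V : List T) : F.sub V a = V.map Sum.inr := if_pos h

theorem sub_neg (h : F.α a ≠ F.e) (V : List T) : F.sub V a = [Sum.inl (F.α a)] := if_neg h

theorem φ_pos (h : F.α a = F.e) (b : B) : F.φ (F.f a b) = Sum.inr (F.β b) := by
  rw [F.φ_f, if_pos h]

theorem φ_neg (h : F.α a ≠ F.e) (b : B) : F.φ (F.f a b) = Sum.inl (F.α a) := by
  rw [F.φ_f, if_neg h]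

/-- A repeated label kills the weight. This excludes most lattice paths. -/
theorem Z_eq_zero {x : S ⊕ T} {M : List (S ⊕ T)} (hP : x ∈ P) (hM : x ∈ M) : F.Z (P ++ M) = 0 := by
  by_contra h
  exact (List.nodup_append.1 (F.nodup _ h)).2.2 x hP x hM rfl

theorem phase_zero : F.phase P (a :: u) (b :: v) 0 =
    F.Z (P ++ [F.φ (F.f a b)]) * shEval F.f (a :: u) (b :: v) F.c := by
  rw [← shEval_mul]
  refine shEval_congr fun w hw => ?_
  obtain ⟨w', rfl⟩ := hw.head
  simp

theorem phase_succ : F.phase P (a :: u) (b :: v) (m + 1) =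
    F.phase (P ++ [F.φ (F.f a b)]) u (b :: v) m +
      (-1) ^ u.length * F.phase (P ++ [F.φ (F.f a b)]) (a :: u) v m := by
  unfold phase
  rw [shEval_cons_cons]
  simp only [List.drop_succ_cons, List.drop_nil, F.c_nil, mul_zero, ite_self, zero_add,
    List.take_succ_cons, List.map_cons, List.append_assoc, List.singleton_append]

theorem phase_of_head (h : ∀ M, F.Z (P ++ F.φ (F.f a b) :: M) = 0) :
    F.phase P (a :: u) (b :: v) m = 0 := by
  refine shEval_eq_zero fun w hw => ?_
  obtain ⟨w', rfl⟩ := hw.head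
  rw [List.take_succ_cons, List.map_cons, h, zero_mul]

/-- A label of the first factor other than `e` does not depend on the second factor, so a step along
`v` would repeat it. -/
theorem phase_left (h : F.α a ≠ F.e) : F.phase P (a :: u) (b :: v) (m + 1) =
    F.phase (P ++ [Sum.inl (F.α a)]) u (b :: v) m := by
  rw [phase_succ, φ_neg h]
  convert add_zero _
  refine mul_eq_zero_of_right _ ?_
  cases v with
  | nil => exact shEval_nil_right _ _ _
  | cons b' v =>
    refine phase_of_head fun M => ?_
    rw [φ_neg h]
    exact Z_eq_zero (x := Sum.inl (F.α a)) (by simp) (by simp)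

/-- Once a label of the second factor has been used, only moves along the first factor contribute. -/
theorem phase_of_mem {V : List T} (hP : Sum.inr (F.β b) ∈ P) (hV : F.β b ∈ V) :
    F.phase P u (b :: v) m =
      F.Z (P ++ (u.take (m + 1)).flatMap (F.sub V)) * shEval F.f (u.drop m) (b :: v) F.c := by
  induction m generalizing P u with
  | zero =>
    cases u with
    | nil => simp [phase]
    | cons a u =>
      rw [phase_zero]
      by_cases h : F.α a = F.e
      · rw [φ_pos h, Z_eq_zero hP (by simp), Z_eq_zero hP (by simp [sub_pos h, hV]), zero_mul,
          zero_mul]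
      · simp [φ_neg h, sub_neg h]
  | succ m ih =>
    cases u with
    | nil => simp [phase]
    | cons a u =>
      by_cases h : F.α a = F.e
      -- Meeting the label `e` in `u` would produce `β b` a second time, so both sides vanish.
      · rw [Z_eq_zero hP (by simp [sub_pos h, hV]), zero_mul]
        refine phase_of_head fun M => Z_eq_zero hP ?_
        simp [φ_pos h]
      · rw [phase_left h, ih (List.mem_append_left _ hP)]
        simp [sub_neg h]

/-- If the path leaves `e` before all labels of the second factor have been used, the missing ones
cannot appear any more. -/
theorem Z_eq_zero_of_countP {b : T} (hP : Sum.inr b ∈ P) (h : P.countP Sum.isRight < F.t)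
    (u : List A) : F.Z (P ++ u.flatMap (F.sub [b])) = 0 := by
  by_contra h'
  have h1 := F.right _ h'
  have h2 : (u.flatMap (F.sub [b])).countP Sum.isRight = 0 := by
    refine List.countP_eq_zero.2 fun x hx hx' => ?_
    obtain ⟨a, ha, hxa⟩ := List.mem_flatMap.1 hx
    by_cases hae : F.α a = F.e
    · rw [sub_pos hae] at hxa
      obtain rfl : x = Sum.inr b := by simpa using hxa
      exact h' (Z_eq_zero hP hx)
    · rw [sub_neg hae] at hxa
      obtain rfl : x = Sum.inl (F.α a) := by simpa using hxa
      simp at hx'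
  rw [List.countP_append] at h1
  omega

/-- The moves along the second factor. -/
theorem phase_of_eq {q : ℕ} {V : List T} (ha : F.α a = F.e) (hq : q ≤ m)
    (hP : P.countP Sum.isRight + q + 1 = F.t) (hV : ∀ b ∈ v.take (q + 1), F.β b ∈ V) :
    F.phase P (a :: u) v m = (-1) ^ (q * u.length) *
      (F.Z (P ++ ((v.take (q + 1)).map F.β).map Sum.inr ++ (u.take (m - q)).flatMap (F.sub V)) *
        shEval F.f ((a :: u).drop (m - q)) (v.drop q) F.c) := by
  -- `q + 1` is the number of labels of the second factor still to be used: the path must run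
  -- through that many vertices of `v` before it moves along the first factor.
  induction q generalizing P v m with
  | zero =>
    cases v with
    | nil => simp [phase]
    | cons b v =>
      have hb : F.β b ∈ V := hV b (by simp)
      cases m with
      | zero => simp [phase_zero, φ_pos ha]
      | succ m =>
        rw [phase_succ, φ_pos ha, phase_of_mem (by simp) hb]
        -- All labels of the second factor are now used, so one more step along `v` gives one too
        -- many.
        have h : F.phase (P ++ [Sum.inr (F.β b)]) (a :: u) v m = 0 := by
          cases v with
          | nil => exact shEval_nil_right _ _ _
          | cons b' v =>
            refine phase_of_head fun M => ?_
            by_contra h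
            have h1 := F.right _ h
            simp [List.countP_append, List.countP_cons, φ_pos ha] at h1
            omega
        rw [h]
        simp
  | succ q ih =>
    cases v with
    | nil => simp [phase]
    | cons b v =>
      obtain ⟨m, rfl⟩ : ∃ m', m = m' + 1 := ⟨m - 1, by omega⟩
      -- A step along `u` is premature here and contributes zero, so only the step along `v`
      -- remains, with its sign.
      rw [phase_succ, φ_pos ha, phase_of_mem (V := [F.β b]) (by simp) (by simp),
        Z_eq_zero_of_countP (b := F.β b) (by simp)
          (by simp [List.countP_append]; omega),
        ih (by omega) (by simp [List.countP_append]; omega)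
          (fun b' hb' => hV b' (by simp [hb']))]
      simp only [zero_mul, zero_add, Nat.add_sub_add_right, List.take_succ_cons, List.map_cons,
        List.append_assoc, List.drop_succ_cons, List.cons_append,
        List.nil_append]
      ring

/-- The weights of front faces in shuffle products. -/
theorem phase_eq {m t : ℕ} (ht : F.t = t + 1) (hl : P.countP Sum.isLeft + m + 1 = F.s)
    (hr : P.countP Sum.isRight = 0) :
    F.phase P u v (m + t) = (-1) ^ (t * (u.length + 1 + (u.map F.α).idxOf F.e)) *
      (F.Z (P ++ (u.take (m + 1)).flatMap (F.sub ((v.take (t + 1)).map F.β))) *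
        shEval F.f (u.drop m) (v.drop t) F.c) := by
  -- The path is forced along `u` until it meets `e`, then through `t + 1` vertices of `v`, then
  -- along `u` again. The sign comes from the `t` steps along `v`, each weighted by the number of
  -- vertices of `u` that remain.
  induction m generalizing P u with
  | zero =>
    cases v with
    | nil => simp [phase]
    | cons b v =>
      cases u with
      | nil => simp [phase]
      | cons a u =>
        by_cases ha : F.α a = F.e
        · rw [phase_of_eq (q := t) (V := ((b :: v).take (t + 1)).map F.β) ha (by omega)
            (by omega) (fun b' hb' => List.mem_map_of_mem hb')]
          have h1 : ((a :: u).map F.α).idxOf F.e = 0 := by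
            rw [List.map_cons, ha, List.idxOf_cons_self]
          rw [h1, List.length_cons, show t * (u.length + 1 + 1 + 0) = t * u.length + 2 * t by ring,
            pow_add, pow_mul (-1 : ℤ) 2 t]
          simp [sub_pos ha]
        -- The labels of the first factor other than `e` are already complete, so a further one
        -- kills the weight.
        · have h : ∀ M, F.Z (P ++ Sum.inl (F.α a) :: M) = 0 := fun M => by
            by_contra h
            have h1 := F.left _ h
            rw [List.countP_append, List.countP_cons_of_pos (by rfl)] at h1
            omega
          rw [phase_of_head (by rw [φ_neg ha]; exact h)]
          simp [sub_neg ha, h]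
  | succ m ih =>
    cases v with
    | nil => simp [phase]
    | cons b v =>
      cases u with
      | nil => simp [phase]
      | cons a u =>
        by_cases ha : F.α a = F.e
        · rw [phase_of_eq (q := t) (V := ((b :: v).take (t + 1)).map F.β) ha (by omega)
            (by omega) (fun b' hb' => List.mem_map_of_mem hb')]
          have h1 : ((a :: u).map F.α).idxOf F.e = 0 := by
            rw [List.map_cons, ha, List.idxOf_cons_self]
          rw [h1, List.length_cons, show t * (u.length + 1 + 1 + 0) = t * u.length + 2 * t by ring,
            pow_add, pow_mul (-1 : ℤ) 2 t]
          simp [sub_pos ha]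
        · rw [show m + 1 + t = m + t + 1 by omega, phase_left ha,
            ih (by simp [List.countP_append]; omega) (by simp [List.countP_append, hr])]
          have h1 : ((a :: u).map F.α).idxOf F.e = (u.map F.α).idxOf F.e + 1 := by
            rw [List.map_cons, List.idxOf_cons_ne _ ha]
          rw [h1, List.length_cons, show t * (u.length + 1 + 1 + ((u.map F.α).idxOf F.e + 1)) =
            t * (u.length + 1 + (u.map F.α).idxOf F.e) + 2 * t by ring, pow_add,
            pow_mul (-1 : ℤ) 2 t]
          simp [sub_neg ha]

end FrontData

end KCobar

/-! ### Label sequences of composites of permutations -/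

namespace KCobar

section

variable {s t r : ℕ}

/-- The sequence obtained by the substitution of a sequence for the label `e`. -/
def subst (e : Fin s) (V : List (Fin t)) (a : Fin s) : List (Fin s ⊕ Fin t) :=
  if a = e then V.map Sum.inr else [Sum.inl a]

theorem subst_self (e : Fin s) (V : List (Fin t)) : subst e V e = V.map Sum.inr := if_pos rfl

theorem subst_ne {e a : Fin s} (h : a ≠ e) (V : List (Fin t)) : subst e V a = [Sum.inl a] :=
  if_neg h

theorem mem_flatMap_subst_inl {e : Fin s} {U : List (Fin s)} {V : List (Fin t)} {a : Fin s} :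
    Sum.inl a ∈ U.flatMap (subst e V) ↔ a ≠ e ∧ a ∈ U := by
  rw [List.mem_flatMap]
  constructor
  · rintro ⟨x, hx, h⟩
    by_cases hxe : x = e
    · rw [hxe, subst_self] at h
      simp at h
    · rw [subst_ne hxe] at h
      obtain rfl : a = x := by simpa using h
      exact ⟨hxe, hx⟩
  · rintro ⟨h, ha⟩
    exact ⟨a, ha, by rw [subst_ne h]; simp⟩

theorem mem_flatMap_subst_inr {e : Fin s} {U : List (Fin s)} {V : List (Fin t)} {b : Fin t} :
    Sum.inr b ∈ U.flatMap (subst e V) ↔ e ∈ U ∧ b ∈ V := by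
  rw [List.mem_flatMap]
  constructor
  · rintro ⟨x, hx, h⟩
    by_cases hxe : x = e
    · rw [hxe, subst_self] at h
      exact ⟨hxe ▸ hx, by simpa using h⟩
    · rw [subst_ne hxe] at h
      simp at h
  · rintro ⟨h, hb⟩
    exact ⟨e, h, by rw [subst_self]; simpa using hb⟩

theorem pairVal_precedes_asymm (e : Fin s) (a : Perm (Fin s)) (b : Perm (Fin t))
    (y z : Fin s ⊕ Fin t) (h : pairVal e (Precedes a) (Precedes b) y z)
    (h' : pairVal e (Precedes a) (Precedes b) z y) : False := by
  rcases y with y | y <;> rcases z with z | z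
  all_goals exact lt_asymm h h'

/-- The composition of the permutation operad is given by the substitution of sequences. -/
theorem ofFn_permComp (g : Graft s t r) (a : Perm (Fin s)) (b : Perm (Fin t)) :
    (List.ofFn (permComp g a b)).map g.f = (List.ofFn a).flatMap (subst g.e (List.ofFn b)) := by
  -- Both sequences are sorted for the same asymmetric relation and have the same elements, hence
  -- they coincide.
  set R := pairVal g.e (Precedes a) (Precedes b) with hR
  have h1 : ((List.ofFn (permComp g a b)).map g.f).Pairwise R := by
    rw [List.map_ofFn, List.pairwise_ofFn]
    intro i j hij
    refine (precedes_permComp g a b _ _).1 ?_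
    simpa [Precedes] using hij
  have hp : ∀ {i j : Fin s}, i < j → Precedes a (a i) (a j) := fun h => by simpa [Precedes] using h
  have h2 : ((List.ofFn a).flatMap (subst g.e (List.ofFn b))).Pairwise R := by
    refine List.pairwise_flatMap.2 ⟨fun x _ => ?_, ?_⟩
    · by_cases hx : x = g.e
      · rw [hx, subst_self, List.map_ofFn, List.pairwise_ofFn]
        intro i j hij
        change Precedes b (b i) (b j)
        simpa [Precedes] using hij
      · rw [subst_ne hx]
        exact List.pairwise_singleton _ _
    · rw [List.pairwise_ofFn]
      intro i j hij y hy z hz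
      have h3 := hp hij
      by_cases hi : a i = g.e <;> by_cases hj : a j = g.e
      · exact absurd (a.injective (hi.trans hj.symm)) hij.ne
      · rw [hi, subst_self] at hy
        rw [subst_ne hj] at hz
        obtain ⟨y', -, rfl⟩ := List.mem_map.1 hy
        obtain rfl := List.mem_singleton.1 hz
        rwa [hi] at h3
      · rw [hj, subst_self] at hz
        rw [subst_ne hi] at hy
        obtain ⟨z', -, rfl⟩ := List.mem_map.1 hz
        obtain rfl := List.mem_singleton.1 hy
        rwa [hj] at h3
      · rw [subst_ne hj] at hz
        rw [subst_ne hi] at hy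
        obtain rfl := List.mem_singleton.1 hz
        obtain rfl := List.mem_singleton.1 hy
        exact h3
  have hn : ∀ {L : List (Fin s ⊕ Fin t)}, L.Pairwise R → L.Nodup := fun h =>
    h.imp fun {y z} h h' => by subst h'; exact pairVal_precedes_asymm _ _ _ _ _ h h
  refine List.Perm.eq_of_pairwise
    (fun y z _ _ h h' => (pairVal_precedes_asymm _ _ _ _ _ h h').elim) h1 h2 ?_
  refine (List.perm_ext_iff_of_nodup (hn h1) (hn h2)).2 fun y => ?_
  have h3 : y ∈ (List.ofFn (permComp g a b)).map g.f ↔ ∃ x, g.f x = y := by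
    rw [List.mem_map]
    constructor
    · rintro ⟨x, -, h⟩; exact ⟨x, h⟩
    · rintro ⟨x, h⟩
      exact ⟨x, List.mem_ofFn.2 ⟨(permComp g a b).symm x, by simp⟩, h⟩
  rw [h3, g.range_iff]
  have h4 : ∀ {m : ℕ} (σ : Perm (Fin m)) (x : Fin m), x ∈ List.ofFn σ := fun σ x =>
    List.mem_ofFn.2 ⟨σ.symm x, by simp⟩
  rcases y with y | y
  · rw [mem_flatMap_subst_inl]
    simp [h4]
  · rw [mem_flatMap_subst_inr]
    simp [h4]

theorem exists_ofFn {L : List (Fin r)} (h : L.length ≤ r) (h' : ∀ i, i ∈ L) :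
    ∃ τ : Perm (Fin r), L = List.ofFn τ := by
  have h1 : L.toFinset = Finset.univ := Finset.eq_univ_of_forall fun i => List.mem_toFinset.2 (h' i)
  have h2 : r ≤ L.length := by
    have := L.toFinset_card_le
    rwa [h1, Finset.card_univ, Fintype.card_fin] at this
  have h3 : L.length = r := by omega
  have h4 : L = List.ofFn fun i : Fin r => L.get (i.cast h3.symm) :=
    List.ext_getElem (by rw [List.length_ofFn, h3]) fun i _ _ => by rw [List.getElem_ofFn]; rfl
  have h5 : Function.Surjective fun i : Fin r => L.get (i.cast h3.symm) := fun x => by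
    have := h' x
    rw [h4, List.mem_ofFn] at this
    exact this
  exact ⟨Equiv.ofBijective _ (Finite.surjective_iff_bijective.1 h5), h4⟩

open Classical in
/-- The signature of the sequences of labels of a composite. -/
noncomputable def graftSgn (g : Graft s t r) (M : List (Fin s ⊕ Fin t)) : ℤ :=
  if h : ∃ L : List (Fin r), M = L.map g.f then sgnL h.choose else 0

theorem graftSgn_map (g : Graft s t r) (L : List (Fin r)) : graftSgn g (L.map g.f) = sgnL L := by
  have h : ∃ L' : List (Fin r), L.map g.f = L'.map g.f := ⟨L, rfl⟩
  have h1 : h.choose = L := List.map_injective_iff.2 g.inj h.choose_spec.symm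
  have h2 : graftSgn g (L.map g.f) = sgnL h.choose := dif_pos h
  rw [h2, h1]

theorem exists_of_graftSgn {g : Graft s t r} {M : List (Fin s ⊕ Fin t)} (h : graftSgn g M ≠ 0) :
    ∃ τ : Perm (Fin r), M = (List.ofFn τ).map g.f := by
  have h' : ∃ L : List (Fin r), M = L.map g.f := by
    by_contra h'
    exact h (dif_neg h')
  obtain ⟨L, rfl⟩ := h'
  rw [graftSgn_map] at h
  obtain ⟨τ, rfl⟩ := exists_of_sgnL h
  exact ⟨τ, rfl⟩

theorem countP_ofFn (τ : Perm (Fin r)) (p : Fin r → Bool) :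
    (List.ofFn τ).countP p = (Finset.univ.filter fun i => p i = true).card := by
  rw [List.countP_eq_length_filter, ← List.toFinset_card_of_nodup
    ((List.nodup_ofFn.2 τ.injective).filter _)]
  congr 1
  ext i
  simp only [List.mem_toFinset, List.mem_filter, List.mem_ofFn, Finset.mem_filter, Finset.mem_univ,
    true_and, and_iff_right_iff_imp]
  exact fun _ => ⟨τ.symm i, by simp⟩

theorem countP_right_of_graftSgn {g : Graft s t r} {M : List (Fin s ⊕ Fin t)}
    (h : graftSgn g M ≠ 0) : M.countP Sum.isRight = t := by
  obtain ⟨τ, rfl⟩ := exists_of_graftSgn h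
  rw [List.countP_map, countP_ofFn]
  refine Eq.trans (congrArg Finset.card ?_) g.card_inner
  ext i
  rw [Graft.mem_inner]
  simp [Sum.isRight_iff]

theorem countP_left_of_graftSgn {g : Graft s t r} {M : List (Fin s ⊕ Fin t)}
    (h : graftSgn g M ≠ 0) : M.countP Sum.isLeft + 1 = s := by
  have h1 := countP_right_of_graftSgn h
  have h2 := List.length_eq_countP_add_countP (l := M) Sum.isRight
  have h3 : M.countP Sum.isLeft = M.countP (fun x => decide ¬ Sum.isRight x = true) :=
    List.countP_congr fun x _ => by simp
  obtain ⟨τ, rfl⟩ := exists_of_graftSgn h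
  rw [List.length_map, List.length_ofFn] at h2
  have := g.arity
  omega

/-- The labels of composites of permutations. -/
theorem f_lab (g : Graft s t r) (hs : 0 < s) (ht : 0 < t) (hr : 0 < r) (a : Perm (Fin s))
    (b : Perm (Fin t)) : g.f (lab hr (permComp g a b)) =
      if lab hs a = g.e then Sum.inr (lab ht b) else Sum.inl (lab hs a) := by
  have h1 := ofFn_permComp g a b
  obtain ⟨s, rfl⟩ : ∃ s', s = s' + 1 := ⟨s - 1, by omega⟩
  obtain ⟨t, rfl⟩ : ∃ t', t = t' + 1 := ⟨t - 1, by omega⟩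
  obtain ⟨r, rfl⟩ : ∃ r', r = r' + 1 := ⟨r - 1, by omega⟩
  rw [List.ofFn_succ, List.ofFn_succ, List.ofFn_succ, List.map_cons, List.flatMap_cons] at h1
  change g.f (permComp g a b 0) = if a 0 = g.e then Sum.inr (b 0) else Sum.inl (a 0)
  split_ifs with h
  · rw [h, subst_self, List.map_cons, List.cons_append] at h1
    exact (List.cons.inj h1).1
  · rw [subst_ne h, List.cons_append] at h1
    exact (List.cons.inj h1).1

/-- The labels of the first values of permutations. -/
noncomputable def frontData (g : Graft s t r) (hs : 0 < s) (ht : 0 < t) (hr : 0 < r)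
    (c : List (Perm (Fin r)) → ℤ) (hc : c [] = 0) :
    FrontData (Perm (Fin s)) (Perm (Fin t)) (Perm (Fin r)) (Fin s) (Fin t) where
  f := permComp g
  α := lab hs
  β := lab ht
  e := g.e
  φ w := g.f (lab hr w)
  φ_f := f_lab g hs ht hr
  Z := graftSgn g
  s := s
  t := t
  nodup M h := by
    obtain ⟨τ, rfl⟩ := exists_of_graftSgn h
    exact (List.nodup_ofFn.2 τ.injective).map g.inj
  left _ h := countP_left_of_graftSgn h
  right _ h := countP_right_of_graftSgn h
  c := c
  c_nil := hc

theorem graftSgn_flatMap (g : Graft s t r) (a : Perm (Fin s)) (b : Perm (Fin t)) :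
    graftSgn g ((List.ofFn a).flatMap (subst g.e (List.ofFn b))) = Perm.sign (permComp g a b) := by
  rw [← ofFn_permComp, graftSgn_map, sgnL_ofFn]

/-- If the substituted sequence contains all labels of the composite, `U` and `V` contain all labels
of the factors, and they are short enough to be permutations. The label `e` is seen through an inner
label, hence `0 < t`. -/
theorem graftSgn_flatMap_ne {g : Graft s t r} (ht : 0 < t) {U : List (Fin s)} {V : List (Fin t)}
    (hU : U.length ≤ s) (hV : V.length ≤ t) (h : graftSgn g (U.flatMap (subst g.e V)) ≠ 0) :
    (∃ a : Perm (Fin s), U = List.ofFn a) ∧ ∃ b : Perm (Fin t), V = List.ofFn b := by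
  obtain ⟨τ, hτ⟩ := exists_of_graftSgn h
  have h1 : ∀ y, y ≠ Sum.inl g.e → y ∈ U.flatMap (subst g.e V) := fun y hy => by
    obtain ⟨x, hx⟩ := (g.range_iff y).2 hy
    rw [hτ]
    exact List.mem_map.2 ⟨x, List.mem_ofFn.2 ⟨τ.symm x, by simp⟩, hx⟩
  have h2 : ∀ b : Fin t, g.e ∈ U ∧ b ∈ V := fun b =>
    mem_flatMap_subst_inr.1 (h1 (Sum.inr b) (by simp))
  refine ⟨exists_ofFn hU fun a => ?_, exists_ofFn hV fun b => (h2 b).2⟩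
  by_cases ha : a = g.e
  · rw [ha]
    exact (h2 ⟨0, ht⟩).1
  · exact (mem_flatMap_subst_inl.1 (h1 (Sum.inl a) (by simpa using ha))).2

theorem idxOf_ofFn (a : Perm (Fin s)) (x : Fin s) : (List.ofFn a).idxOf x = a.symm x := by
  have h := (List.nodup_ofFn.2 a.injective).idxOf_getElem (a.symm x : ℕ) (by simp)
  rwa [List.getElem_ofFn, Fin.eta, Equiv.apply_symm_apply] at h

/-- The front faces of shuffle products. -/
theorem shEval_frontSgn (g : Graft s t r) (hs : 0 < s) (ht : 0 < t) (u : List (Perm (Fin s)))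
    (v : List (Perm (Fin t))) (c : List (Perm (Fin r)) → ℤ) (hc : c [] = 0) :
    shEval (permComp g) u v (fun w => frontSgn w * c (w.drop (r - 1))) =
      graftSign g * (((((t : ℤ) - 1) * ((u.length : ℤ) - s)).negOnePow : ℤ)) *
        (frontSgn u * frontSgn v) *
        shEval (permComp g) (u.drop (s - 1)) (v.drop (t - 1)) c := by
  have har := g.arity
  have hr : 0 < r := by omega
  set F := frontData g hs ht hr c hc with hF
  have h1 : shEval (permComp g) u v (fun w => frontSgn w * c (w.drop (r - 1))) =
      F.phase [] u v (s - 1 + (t - 1)) := by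
    have h2 : s - 1 + (t - 1) = r - 1 := by omega
    rw [h2]
    refine shEval_congr fun w _ => ?_
    have h3 : r - 1 + 1 = r := by omega
    rw [frontSgn_eq hr, ← graftSgn_map g, h3, List.map_map, List.nil_append]
    rfl
  have hF1 : F.t = t - 1 + 1 := by change t = _; omega
  have hF2 : ([] : List (Fin s ⊕ Fin t)).countP Sum.isLeft + (s - 1) + 1 = F.s := by
    change _ = s
    simp only [List.countP_nil]
    omega
  rw [h1, FrontData.phase_eq hF1 hF2 List.countP_nil, List.nil_append]
  set U := (u.take s).map (lab hs) with hU
  set V := (v.take t).map (lab ht) with hV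
  have h2 : (u.take (s - 1 + 1)).flatMap (F.sub ((v.take (t - 1 + 1)).map F.β)) =
      U.flatMap (subst g.e V) := by
    rw [hU, List.flatMap_map, show s - 1 + 1 = s by omega, show t - 1 + 1 = t by omega]
    rfl
  rw [h2]
  change _ * (graftSgn g _ * shEval (permComp g) _ _ c) = _
  have hUl : U.length ≤ s := by rw [hU, List.length_map, List.length_take]; omega
  have hVl : V.length ≤ t := by rw [hV, List.length_map, List.length_take]; omega
  rw [frontSgn_eq hs, frontSgn_eq ht, ← hU, ← hV, ← mul_assoc]
  congr 1
  -- If the front labels of `u` or of `v` do not form a permutation, both sides vanish. Otherwise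
  -- the index in `phase_eq` is the position of `e` in `a`, and `sign_permComp` converts the signs.
  by_cases h : (∃ a : Perm (Fin s), U = List.ofFn a) ∧ ∃ b : Perm (Fin t), V = List.ofFn b
  · obtain ⟨⟨a, ha⟩, b, hb⟩ := h
    have h3 : (u.map F.α).idxOf F.e = a.symm g.e := by
      have h4 : u.map F.α = U ++ (u.drop s).map (lab hs) := by
        rw [hU, ← List.map_append, List.take_append_drop]
        rfl
      rw [h4, ← idxOf_ofFn a, ha]
      exact List.idxOf_append_of_mem (List.mem_ofFn.2 ⟨a.symm g.e, a.apply_symm_apply _⟩)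
    rw [h3, ha, hb, graftSgn_flatMap, sgnL_ofFn, sgnL_ofFn, sign_permComp, graftSign,
      ← Int.coe_negOnePow_natCast]
    have key : ((((t - 1) * (u.length + 1 + (a.symm g.e : ℕ)) : ℕ) : ℤ).negOnePow : ℤ) *
        (((((a.symm g.e : ℕ) : ℤ) - (g.e : ℕ)) * ((t : ℤ) - 1)).negOnePow : ℤ) =
        ((((s : ℤ) - 1 - (g.e : ℕ)) * ((t : ℤ) - 1)).negOnePow : ℤ) *
        ((((t : ℤ) - 1) * ((u.length : ℤ) - s)).negOnePow : ℤ) := by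
      rw [← Units.val_mul, ← Units.val_mul, ← Int.negOnePow_add, ← Int.negOnePow_add]
      have h5 : ((t - 1 : ℕ) : ℤ) = t - 1 := by omega
      push_cast
      rw [h5]
      refine negOnePow_congr_zmod ?_
      push_cast
      generalize (s : ZMod 2) = s'
      generalize (t : ZMod 2) = t'
      generalize (u.length : ZMod 2) = u'
      generalize ((a.symm g.e : ℕ) : ZMod 2) = a'
      generalize ((g.e : ℕ) : ZMod 2) = e'
      revert s' t' u' a' e'
      decide
    linear_combination (Perm.sign (permComp g 1 1) * Perm.sign a * Perm.sign b : ℤ) * key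
  · have h3 : graftSgn g (U.flatMap (subst g.e V)) = 0 := by
      by_contra h3
      exact h (graftSgn_flatMap_ne ht hUl hVl h3)
    have h4 : sgnL U * sgnL V = 0 := by
      by_contra h4
      exact h ⟨exists_of_sgnL (left_ne_zero_of_mul h4), exists_of_sgnL (right_ne_zero_of_mul h4)⟩
    rw [h3, h4, mul_zero, mul_zero]

end

end KCobar

namespace KCobar

/-! ### The suspension morphisms and the twisting derivations -/

theorem GrOperad.Hom.app_pcomp {P Q : GrOperad ptOperad} (φ : GrOperad.Hom P Q) {s t r : ℕ}
    (g : Graft s t r) {i j k : ℤ} (p : P.obj (pt s) i) (q : P.obj (pt t) j) :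
    φ.app (P.pcomp g k p q) = Q.pcomp g k (φ.app p) (φ.app q) := by
  by_cases h : i + j = k
  · rw [P.pcomp_pos g h, Q.pcomp_pos g h]
    exact φ.app_comp (α := pt s) (β := pt t) (γ := pt r) g (le_refl _) h p q
  · rw [P.pcomp_neg g h, Q.pcomp_neg g h, map_zero]

/-- Vandermonde's identity for `a + b` choose 2. -/
theorem choose_add (a b : ℕ) :
    (a + b) * (a + b - 1) / 2 = a * (a - 1) / 2 + b * (b - 1) / 2 + a * b := by
  rw [← Finset.sum_range_id, ← Finset.sum_range_id, ← Finset.sum_range_id, Finset.sum_range_add]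
  rw [Finset.sum_add_distrib, Finset.sum_const, Finset.card_range, smul_eq_mul]
  ring

section

variable {n s t r : ℕ} {k : ℤ}

/-- `susp` is not multiplicative under composition. The defect, quadratic in the arities, makes up
for the change of Koszul signs between `n` and `n + 1`. -/
theorem susp_mul (g : Graft s t r) (hs : 0 < s) (ht : 0 < t) :
    susp n r = susp n s * susp n t * (-1) ^ ((n + 1) * ((s - 1) * (t - 1))) := by
  have h := g.arity
  have h1 : r - 1 = (s - 1) + (t - 1) := by omega
  have h2 : ∀ m : ℕ, m - 2 = m - 1 - 1 := fun m => by omega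
  unfold susp
  rw [h2 r, h2 s, h2 t, h1, choose_add, ← pow_add, ← pow_add]
  congr 1
  ring

theorem graftSign_mul_self (g : Graft s t r) : graftSign g * graftSign g = 1 := by
  unfold graftSign
  linear_combination ((((s : ℤ) - 1 - (g.e : ℕ)) * ((t : ℤ) - 1)).negOnePow *
    (((s : ℤ) - 1 - (g.e : ℕ)) * ((t : ℤ) - 1)).negOnePow : ℤ) *
      sign_mul_self (permComp g 1 1) + negOnePow_mul_self (((s : ℤ) - 1 - (g.e : ℕ)) * ((t : ℤ) - 1))

/-- Compatibility of `sgn ∩ -` with composition: `shEval_frontSgn` splits the front face of a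
shuffle into the front faces of the factors, and the remaining signs cancel modulo 2. -/
theorem twistCoeff_suspension (g : Graft s t r) (c : (D n).obj (pt r) k)
    {x : List (Perm (Fin s))} {y : List (Perm (Fin t))}
    (hx : Cell (n + 1) (deg (n + 1) x) x) (hy : Cell (n + 1) (deg (n + 1) y) y)
    (hk : deg (n + 1) x + deg (n + 1) y = k - 1) :
    twistCoeff (n + 1) g x y (value (suspApp n k c)) =
      susp n s * frontSgn x * (susp n t * frontSgn y) *
        twistCoeff n g (x.drop (s - 1)) (y.drop (t - 1)) (value c) := by
  have hs : 0 < s := by have := hx.two_le; omega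
  have ht : 0 < t := by have := hy.two_le; omega
  have h1 : shEval (permComp g) x y (value (suspApp n k c)) = susp n r *
      (graftSign g * ((((t : ℤ) - 1) * ((x.length : ℤ) - s)).negOnePow : ℤ) *
        (frontSgn x * frontSgn y) *
        shEval (permComp g) (x.drop (s - 1)) (y.drop (t - 1)) (value c)) := by
    rw [← shEval_frontSgn g hs ht x y _ (value_nil c), ← shEval_mul]
    refine shEval_congr fun w hw => ?_
    have h2 := hw.cell hx hy
    rw [hk, sub_add_cancel] at h2
    rw [value_suspApp_pos c h2, mul_assoc]
  rw [twistCoeff_eq, twistCoeff_eq, h1]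
  by_cases hfx : frontSgn x = 0
  · rw [hfx]; ring
  by_cases hfy : frontSgn y = 0
  · rw [hfy]; ring
  have hxl := length_of_frontSgn hs hfx
  have hyl := length_of_frontSgn ht hfy
  have e1 : (((x.drop (s - 1)).length : ℕ) : ℤ) = x.length - (s - 1) := by
    rw [List.length_drop]; omega
  have e2 : (((y.drop (t - 1)).length : ℕ) : ℤ) = y.length - (t - 1) := by
    rw [List.length_drop]; omega
  have key : koszul (n + 1) s t x.length y.length * (-1) ^ ((n + 1) * ((s - 1) * (t - 1))) *
      ((((t : ℤ) - 1) * ((x.length : ℤ) - s)).negOnePow : ℤ) =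
      koszul n s t (x.drop (s - 1)).length (y.drop (t - 1)).length := by
    rw [← Int.coe_negOnePow_natCast]
    simp only [koszul_eq, e1, e2]
    simp only [← Units.val_mul, ← Int.negOnePow_add]
    have e3 : ((s - 1 : ℕ) : ℤ) = s - 1 := by omega
    have e4 : ((t - 1 : ℕ) : ℤ) = t - 1 := by omega
    push_cast
    rw [e3, e4]
    refine negOnePow_congr_zmod ?_
    push_cast
    generalize (n : ZMod 2) = n'
    generalize (s : ZMod 2) = s'
    generalize (t : ZMod 2) = t'
    generalize (x.length : ZMod 2) = x'
    generalize (y.length : ZMod 2) = y'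
    revert n' s' t' x' y'
    decide
  rw [susp_mul g hs ht, ← key, pow_succ]
  linear_combination (koszul (n + 1) s t x.length y.length * graftSign g ^ n * susp n s *
    susp n t * (-1) ^ ((n + 1) * ((s - 1) * (t - 1))) *
    ((((t : ℤ) - 1) * ((x.length : ℤ) - s)).negOnePow : ℤ) * (frontSgn x * frontSgn y) *
    shEval (permComp g) (x.drop (s - 1)) (y.drop (t - 1)) (value c)) * graftSign_mul_self g

/-- The degree test may be dropped, because a nonzero value on the right forces the degrees of `x`
and `x'` to match. -/
theorem value_suspApp_dualBasis {x x' : List (Perm (Fin s))}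
    (hx : Cell (n + 1) (deg (n + 1) x') x') :
    value (suspApp n (deg n x) (dualBasis n (deg n x) x)) x' =
      susp n s * frontSgn x' * char n x (x'.drop (s - 1)) := by
  by_cases h : Cell (n + 1) (deg n x) x'
  · exact value_suspApp_pos _ h
  · rw [value_suspApp_neg _ h]
    symm
    by_contra h1
    have hs : 0 < s := by have := hx.two_le; omega
    have h2 := char_length (right_ne_zero_of_mul h1)
    have h3 := length_of_frontSgn hs (right_ne_zero_of_mul (left_ne_zero_of_mul h1))
    rw [List.length_drop] at h2
    refine h ?_
    have h4 : deg n x = deg (n + 1) x' := by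
      unfold deg
      have h5 : (x'.length : ℤ) = x.length + (s - 1) := by omega
      rw [h5]
      push_cast
      ring
    rw [h4]
    exact hx

theorem mapHom_gen {k : ℤ} (c : (D n).obj (pt r) k) :
    (Free.mapHom (suspension n)).app (α := pt r) ((Free.gen (D n)).app c) =
      (Free.gen (D (n + 1))).app (suspApp n k c) := rfl

/-- Both sides are expanded over pairs of simplices `x'`, `y'` of `E_{n+1}`. Duality collapses the
sums over `x` and `y` to the back faces of `x'` and `y'`, where `twistCoeff_suspension` compares the
coefficients. -/
theorem mapHom_twistAt (g : Graft s t r) (c : (D n).obj (pt r) k) {N N' : ℕ}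
    (hN : len n r k ≤ N) (hN' : N + r ≤ N') :
    (Free.mapHom (suspension n)).app (twistAt n N (k - 1) g (value c)) =
      twistAt (n + 1) N' (k - 1) g (value (suspApp n k c)) := by
  have har := g.arity
  have hc : ∀ w, value c w ≠ 0 → Cell n k w := fun w hw => cell_of_value hw
  have hlen : ∀ {x : List (Perm (Fin s))} {y : List (Perm (Fin t))},
      twistCoeff n g x y (value c) ≠ 0 → x.length ≤ N ∧ y.length ≤ N := fun h =>
    twistCoeff_length (fun w' hw' => ((hc w' hw').length_eq.trans_le hN)) h
  -- The suspension lengthens simplices by one less than their arity, hence by at most `r` vertices.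
  have hl : ∀ {m : ℕ} (x : List (Perm (Fin m))), m ≤ r + 1 → x ∈ lists m N →
      len (n + 1) m (deg n x) ≤ N' := fun {m} x hm hx => by
    have := mem_lists.1 hx
    unfold len deg
    push_cast
    have h1 : ((n : ℤ) + 1) * ((m : ℤ) - 1) - ((n : ℤ) * ((m : ℤ) - 1) - x.length) =
      (m : ℤ) - 1 + x.length := by ring
    rw [h1]
    omega
  have e1 : (Free.mapHom (suspension n)).app (twistAt n N (k - 1) g (value c)) =
      ∑ x ∈ lists s N, ∑ y ∈ lists t N, ∑ x' ∈ lists s N', ∑ y' ∈ lists t N',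
        (twistCoeff n g x y (value c) *
          (value (suspApp n (deg n x) (dualBasis n (deg n x) x)) x' *
            value (suspApp n (deg n y) (dualBasis n (deg n y) y)) y')) •
          (Free (D (n + 1))).pcomp g (k - 1) (basis (n + 1) x') (basis (n + 1) y') := by
    rw [twistAt, map_sum, Finset.sum_product]
    refine Finset.sum_congr rfl fun x hx => Finset.sum_congr rfl fun y hy => ?_
    rw [map_zsmul, GrOperad.Hom.app_pcomp, basis, basis, mapHom_gen, mapHom_gen,
      pcomp_gen_left _ (hl x (by omega) hx), Finset.smul_sum]
    refine Finset.sum_congr rfl fun x' _ => ?_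
    rw [pcomp_gen_right _ (hl y (by omega) hy), Finset.smul_sum, Finset.smul_sum]
    refine Finset.sum_congr rfl fun y' _ => ?_
    rw [smul_smul, smul_smul, mul_assoc]
  have e2 : (Free.mapHom (suspension n)).app (twistAt n N (k - 1) g (value c)) =
      ∑ x' ∈ lists s N', ∑ y' ∈ lists t N', (∑ x ∈ lists s N, ∑ y ∈ lists t N,
        twistCoeff n g x y (value c) *
          (value (suspApp n (deg n x) (dualBasis n (deg n x) x)) x' *
            value (suspApp n (deg n y) (dualBasis n (deg n y) y)) y')) •
          (Free (D (n + 1))).pcomp g (k - 1) (basis (n + 1) x') (basis (n + 1) y') := by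
    rw [e1]
    simp only [Finset.sum_smul]
    refine ((Finset.sum_congr rfl fun x _ => Finset.sum_comm).trans Finset.sum_comm).trans
      (Finset.sum_congr rfl fun x' _ => ?_)
    exact (Finset.sum_congr rfl fun x _ => Finset.sum_comm).trans Finset.sum_comm
  rw [e2, twistAt, Finset.sum_product]
  refine Finset.sum_congr rfl fun x' _ => Finset.sum_congr rfl fun y' _ => ?_
  by_cases bx : basis (n + 1) x' = 0
  · rw [bx]; simp only [map_zero, AddMonoidHom.zero_apply, smul_zero]
  by_cases by' : basis (n + 1) y' = 0
  · rw [by']; simp only [map_zero, smul_zero]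
  by_cases hd : deg (n + 1) x' + deg (n + 1) y' = k - 1
  swap
  · rw [GrOperad.pcomp_neg _ _ hd, smul_zero, smul_zero]
  have cx := cell_of_basis bx
  have cy := cell_of_basis by'
  congr 1
  rw [twistCoeff_suspension g c cx cy hd]
  simp only [value_suspApp_dualBasis cx, value_suspApp_dualBasis cy]
  have f1 : ∀ x, ∑ y ∈ lists t N, twistCoeff n g x y (value c) *
      (susp n s * frontSgn x' * char n x (x'.drop (s - 1)) *
        (susp n t * frontSgn y' * char n y (y'.drop (t - 1)))) =
      susp n s * frontSgn x' * (susp n t * frontSgn y') *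
        (twistCoeff n g x (y'.drop (t - 1)) (value c) * char n x (x'.drop (s - 1))) := by
    intro x
    have h1 := sum_mul_value (n := n) (N := N) (fun l => twistCoeff n g x l (value c))
      (fun l hl => ⟨cell_right_of_twistCoeff hc cy.two_le hl, (hlen hl).2⟩) (y'.drop (t - 1))
    rw [← h1, Finset.sum_mul, Finset.mul_sum]
    refine Finset.sum_congr rfl fun y _ => ?_
    rw [char, char]
    ring
  simp only [f1]
  rw [← Finset.mul_sum]
  congr 1
  exact sum_mul_value (n := n) (N := N)
    (fun l => twistCoeff n g l (y'.drop (t - 1)) (value c))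
    (fun l hl => ⟨cell_left_of_twistCoeff hc cx.two_le cy.two_le hl, (hlen hl).1⟩)
    (x'.drop (s - 1))

theorem mapHom_twist (c : (D n).obj (pt r) k) :
    (Free.mapHom (suspension n)).app (twist n c) = twist (n + 1) (suspApp n k c) := by
  have h : len (n + 1) r k ≤ len (n + 1) r k + len n r k + r := by omega
  rw [twist_eq (suspApp n k c) h, twist_eq c (N := len (n + 1) r k + len n r k) (by omega), map_sum]
  exact Finset.sum_congr rfl fun A _ => mapHom_twistAt _ c (by omega) le_rfl

theorem mapHom_cobarHom (c : (D n).obj (pt r) k) :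
    (Free.mapHom (suspension n)).app ((cobarHom n).app c) =
      (cobarHom (n + 1)).app (suspApp n k c) := by
  rw [cobarHom_app, cobarHom_app, map_add, mapHom_twist, mapHom_gen, suspension_δ]

/-- Both sides are derivations along the same operad morphism and agree on generators. -/
theorem mapHom_der {α : ptOperad.obj r} (x : (Free (D n)).obj α k) :
    (Free.mapHom (suspension n)).app ((cobarHom n).der x) =
      (cobarHom (n + 1)).der ((Free.mapHom (suspension n)).app x) := by
  induction x using Free.induction with
  | @gen r α k c => exact mapHom_cobarHom (r := r) c
  | one =>
    rw [Free.DegHom.der_one, map_zero, (Free.mapHom (suspension n)).app_one,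
      Free.DegHom.der_one]
  | zero α k => simp only [map_zero]
  | add x y hx hy => simp only [map_add, hx, hy]
  | neg x hx => simp only [map_neg, hx]
  | map w h x hx =>
    rw [Free.DegHom.der_map, (Free.mapHom (suspension n)).app_map,
      (Free.mapHom (suspension n)).app_map, Free.DegHom.der_map, hx]
  | comp g h hk x y hx hy =>
    rw [Free.DegHom.der_comp, map_add, map_zsmul, (Free.mapHom (suspension n)).app_comp,
      (Free.mapHom (suspension n)).app_comp, (Free.mapHom (suspension n)).app_comp,
      Free.DegHom.der_comp, hx, hy]

theorem preservesDifferentials_mapHom (n : ℕ) :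
    PreservesDifferentials (Free.mapHom (suspension n)).toHom
      (cobarDifferential n).toDifferential (cobarDifferential (n + 1)).toDifferential :=
  fun x => mapHom_der x

/-- Checked after the injective morphism `ι`, where it becomes `mapHom_der`. -/
theorem mapHom_derK {κ : completeGraphOperad.obj r} (x : (Free (DK n)).obj κ k) :
    (Free.mapHom (suspensionK n)).app ((cobarHomK n).der x) =
      (cobarHomK (n + 1)).der ((Free.mapHom (suspensionK n)).app x) := by
  refine ι_injective κ ?_
  rw [ι_mapHom, ι_der, ι_der, ι_mapHom]
  exact mapHom_der (α := pt r) _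

theorem preservesDifferentials_mapHomK (n : ℕ) :
    PreservesDifferentials (Free.mapHom (suspensionK n)).toHom
      (cobarDifferentialK n).toDifferential (cobarDifferentialK (n + 1)).toDifferential :=
  fun x => mapHom_derK x

end

end KCobar

/-- Each cobar construction `B^c(D_n)` arises from a quasi-free `K`-operad, whose colimits over `K_n(r)`,
over `K_m(r)` for `n ≤ m`, and over `K(r) = K_∞(r)` are isomorphic to `B^c(D_n)(r)`; the morphisms
`σ^*` are realized by morphisms of quasi-free `K`-operads which are associated to morphisms of
symmetric `K`-diagrams. -/
theorem mainTheorem7 :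
    ∃ (d : ∀ n : ℕ, (Free (D n)).Differential) (dK : ∀ n : ℕ, (Free (DK n)).Differential),
      (∀ n : ℕ, 1 ≤ n →
        IsCobar n (d n) ∧
        Free.IsQuasiFree (δK n) (dK n) ∧
        (∀ {r : ℕ} {κ : completeGraphOperad.obj r} {k : ℤ} (x : (Free (DK n)).obj κ k),
          (ι n).app ((dK n).d x) = (d n).d (α := pt r) ((ι n).app x)) ∧
        (∀ (m m' : ℕ∞) (_ : (n : ℕ∞) ≤ m) (h : m ≤ m') (r : ℕ) (k : ℤ),
          Function.Bijective
            (colim.transition (Free (DK n)).toSymDiag (layer_mono h r) k)) ∧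
        (∀ (m : ℕ∞) (_ : (n : ℕ∞) ≤ m) (r : ℕ) (k : ℤ),
          Function.Bijective (colim.desc (ι n).toHom (layer m r) k))) ∧
      (∀ n : ℕ, 1 ≤ n →
        ∃ (S : SymDiag.Hom (D n) (D (n + 1))) (SK : SymDiag.Hom (DK n) (DK (n + 1))),
          IsSuspension n S ∧
          PreservesDifferentials S (δ n) (δ (n + 1)) ∧
          PreservesDifferentials SK (δK n) (δK (n + 1)) ∧
          (∀ {r : ℕ} {κ : completeGraphOperad.obj r} {k : ℤ} (c : (DK n).obj κ k),
            inclusion (n + 1) (SK.app c) = S.app (inclusion n c)) ∧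
          PreservesDifferentials (Free.mapHom S).toHom (d n).toDifferential
            (d (n + 1)).toDifferential ∧
          PreservesDifferentials (Free.mapHom SK).toHom (dK n).toDifferential
            (dK (n + 1)).toDifferential ∧
          (∀ {r : ℕ} {κ : completeGraphOperad.obj r} {k : ℤ} (x : (Free (DK n)).obj κ k),
            (ι (n + 1)).app ((Free.mapHom SK).app x) =
              (Free.mapHom S).app (α := pt r) ((ι n).app x))) := by
  refine ⟨cobarDifferential, cobarDifferentialK, fun n _ => ⟨isCobar n, isQuasiFree n,
      fun x => ι_der x, fun m m' hm h r k => colim.transition_bijective (ι n).toHom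
        (layer_mono h r) (desc_bijective hm) (desc_bijective (hm.trans h)),
      fun m hm r k => desc_bijective hm⟩,
    fun n _ => ⟨suspension n, suspensionK n, isSuspension n, preservesDifferentials_suspension n,
      preservesDifferentials_suspensionK n, fun c => inclusion_suspensionK c,
      preservesDifferentials_mapHom n, preservesDifferentials_mapHomK n, fun x => ι_mapHom x⟩⟩
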